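/- **Conventions.** A difference ring $(R,\sigma)$ is a commutative ring $R$ with a ring automorphism $\sigma$; its ring of constants is $\mathrm{const}(R,\sigma)=\{c\in R\mid \sigma(c)=c\}$. It is *computable* (with respect to a surjective coding $\nu:\mathbb N\to R$ of its elements) if equality is decidable and the ring operations and $\sigma$ are (Turing) computable on codes. All algorithms below work on codes of elements. A $\Pi\Sigma$-*ring extension* $(E,\sigma)$ of $(A,\sigma)$ is a difference ring with a tower $A=A_0\le A_1\le\dots\le A_e=E$, $\sigma$ on $E$ extending $\sigma$ on $A$, with $\mathrm{const}(E,\sigma)=\mathrm{const}(A,\sigma)$, such that for each $1\le i\le e$ either $A_i=A_{i-1}[t_i,t_i^{-1}]$ is a Laurent polynomial ring with $\sigma(t_i)/t_i\in A_{i-1}^*$ ($t_i$ is a $\Pi$-monomial), or $A_i=A_{i-1}[t_i]$ is a polynomial ring with $\sigma(t_i)-t_i\in A_{i-1}$ ($t_i$ is a $\Sigma$-monomial). We write $E=A\langle t_1\rangle\dots\langle t_e\rangle$. One *can solve PLDEs* in $(R,\sigma)$ with $K=\mathrm{const}(R,\sigma)$ if there is an algorithm that, given $0\neq(a_0,\dots,a_m)\in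 R^{m+1}$ and $(f_1,\dots,f_d)\in R^d$, computes a finite $K$-basis of $$V=\{(c_1,\dots,c_d,g)\in K^d\times R\mid a_0g+a_1\sigma(g)+\dots+a_m\sigma^m(g)=c_1f_1+\dots+c_df_d\}.$$ For a difference field $(F,\sigma)$, one can *solve the parameterized pseudo-orbit problem* if there is an algorithm that, given $f_1,\dots,f_n\in F^*$, computes a $\mathbb Z$-basis of $\{(z_1,\dots,z_n)\in\mathbb Z^n\mid \exists g\in F^*:\ \sigma(g)/g=f_1^{z_1}\cdots f_n^{z_n}\}$; one can *compute all hypergeometric candidates* if there is an algorithm that, given a nonzero operator $L$ in the ring $F[\sigma]$ of linear difference operators, computes a finite set $S\subset F$ such that for every $r\in F^*$ for which $\sigma-r$ is a right factor of $L$ in $F[\sigma]$ there are $u\in S$ and $v\in F^*$ with $r=u\,\sigma(v)/v$. **Theorem.** Let $(F,\sigma)$ be a computable difference field with constant field $K=\mathrm{const}(F,\sigma)$, and let $(E,\sigma)$ with $E=F\langle t_1\rangle\dots\langle t_e\rangle$ be a $\Pi\Sigma$-ring extension of $(F,\sigma)$ such that $\sigma(t_i)/t_i\in F^*$ for every $\Pi$-monomial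 $t_i$. Suppose that in $(F,\sigma)$ one can solve PLDEs, solve the parameterized pseudo-orbit problem, and compute all hypergeometric candidates. If at least one $t_i$ is a $\Sigma$-monomial, suppose moreover that $F$ has characteristic $0$ and that one can compute all integer roots of any given nonzero polynomial in $K[x]$. Then one can solve PLDEs in $(E,\sigma)$. More precisely, $(E,\sigma)$ has a coding with respect to which it is a computable difference ring and the embedding $F\to E$ is computable, and for every such coding one can solve PLDEs in $(E,\sigma)$. -/

import Mathlib

open scoped LaurentPolynomial

noncomputable section

/-! ### Difference rings, constants, parameterized linear difference equations -/

/-- The ring of constants `{c | σ c = c}` of the difference ring `(R, σ)`. -/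
def constants {R : Type*} [CommRing R] (σ : R ≃+* R) : Subring R where
  carrier := {c | σ c = c}
  mul_mem' := fun {a b} ha hb => by
    simp only [Set.mem_ofPred_eq] at *
    rw [map_mul, ha, hb]
  one_mem' := map_one σ
  add_mem' := fun {a b} ha hb => by
    simp only [Set.mem_ofPred_eq] at *
    rw [map_add, ha, hb]
  zero_mem' := map_zero σ
  neg_mem' := fun {a} ha => by
    simp only [Set.mem_ofPred_eq] at *
    rw [map_neg, ha]

theorem iterate_constants_mul {R : Type*} [CommRing R] (σ : R ≃+* R) (c : constants σ) (x : R)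
    (n : ℕ) : σ^[n] ((c : R) * x) = (c : R) * σ^[n] x := by
  have hc : σ (c : R) = c := c.2
  induction n generalizing x with
  | zero => rfl
  | succ n ih => rw [Function.iterate_succ_apply, Function.iterate_succ_apply, map_mul, hc, ih]

/-- The solution space `V(a, f, R)` of
`a₀ g + a₁ σ(g) + ⋯ + aₘ σᵐ(g) = c₁ f₁ + ⋯ + c_d f_d`, i.e. the set of all
`((c₁, …, c_d), g) ∈ Kᵈ × R` that solve this equation, where `K` is the ring of constants. -/
def pldeSolutions {R : Type*} [CommRing R] (σ : R ≃+* R) {m d : ℕ} (a : Fin (m + 1) → R)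
    (f : Fin d → R) : Submodule (constants σ) ((Fin d → constants σ) × R) where
  carrier := {p | ∑ i, a i * σ^[(i : ℕ)] p.2 = ∑ j, (p.1 j : R) * f j}
  zero_mem' := by
    simp only [Set.mem_ofPred_eq, Prod.snd_zero, Prod.fst_zero, Pi.zero_apply,
      ZeroMemClass.coe_zero, zero_mul, Finset.sum_const_zero]
    exact Finset.sum_eq_zero fun i _ => by rw [iterate_map_zero, mul_zero]
  add_mem' := fun {p q} hp hq => by
    simp only [Set.mem_ofPred_eq, Prod.snd_add, Prod.fst_add, Pi.add_apply, Subring.coe_add,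
      iterate_map_add, mul_add, add_mul, Finset.sum_add_distrib] at *
    rw [hp, hq]
  smul_mem' := fun c p hp => by
    simp only [Set.mem_ofPred_eq, Prod.smul_snd, Prod.smul_fst, Pi.smul_apply, smul_eq_mul,
      Subring.coe_mul] at *
    have h1 : ∀ i : Fin (m + 1),
        a i * σ^[(i : ℕ)] (c • p.2) = (c : R) * (a i * σ^[(i : ℕ)] p.2) := fun i => by
      rw [Subring.smul_def, smul_eq_mul, iterate_constants_mul]
      ring
    simp only [h1, mul_assoc, ← Finset.mul_sum]
    rw [hp]

/-! ### `ΠΣ`-ring extensions -/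

/-- The two sorts of monomials in a `ΠΣ`-ring extension. -/
inductive MonomialKind
  | pi
  | sigma

/-- `B = A[t, t⁻¹]` is a Laurent polynomial ring over `A` with `σ(t)/t ∈ A*`. -/
def IsPiMonomial {E : Type*} [CommRing E] (σ : E ≃+* E) (A B : Subring E) (t : E) : Prop :=
  (∃ φ : A[T;T⁻¹] →+* E, Function.Injective φ ∧ (∀ a : A, φ (LaurentPolynomial.C a) = a) ∧
      φ (LaurentPolynomial.T 1) = t ∧ φ.range = B) ∧
    ∃ α : Aˣ, σ t = ((α : A) : E) * t

/-- `B = A[t]` is a polynomial ring over `A` with `σ(t) - t ∈ A`. -/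
def IsSigmaMonomial {E : Type*} [CommRing E] (σ : E ≃+* E) (A B : Subring E) (t : E) : Prop :=
  (∃ φ : Polynomial A →+* E, Function.Injective φ ∧ (∀ a : A, φ (Polynomial.C a) = a) ∧
      φ Polynomial.X = t ∧ φ.range = B) ∧
    σ t - t ∈ A

/-- A `ΠΣ`-ring extension `(E, σE)`, `E = A⟨t₁⟩⋯⟨tₑ⟩`, of the difference ring `(A, σA)`:
a tower `A = A₀ ≤ A₁ ≤ ⋯ ≤ Aₑ = E` of `Π`- and `Σ`-monomials with `const(E) = const(A)`. -/
structure PiSigmaExtension {A E : Type*} [CommRing A] [CommRing E] [Algebra A E]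
    (σA : A ≃+* A) (σE : E ≃+* E) (e : ℕ) where
  /-- The rings `A₀, …, Aₑ` of the tower. -/
  ring : Fin (e + 1) → Subring E
  /-- The monomials `t₁, …, tₑ`. -/
  t : Fin e → E
  /-- Which of the monomials are `Π`-monomials and which are `Σ`-monomials. -/
  kind : Fin e → MonomialKind
  injective : Function.Injective (algebraMap A E)
  commutes : ∀ x : A, σE (algebraMap A E x) = algebraMap A E (σA x)
  base : ring 0 = (algebraMap A E).range
  top : ring (Fin.last e) = ⊤
  pi_step : ∀ i, kind i = .pi → IsPiMonomial σE (ring i.castSucc) (ring i.succ) (t i)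
  sigma_step : ∀ i, kind i = .sigma → IsSigmaMonomial σE (ring i.castSucc) (ring i.succ) (t i)
  constants_eq : constants σE = (constants σA).map (algebraMap A E)

/-! ### Computable difference rings

Elements of a ring `R` are given to algorithms by natural numbers ("codes"), through a surjection
`ν : ℕ → R`; an element may have several codes. Algorithms are Turing-computable functions. -/

/-- `(R, σ)` is a computable difference ring with respect to the coding `ν`: equality is decidable
and the ring operations and `σ` are computable on codes. (Inverses, where they exist, and `σ⁻¹` are
then computable by search.) -/
structure IsComputableDifferenceRing {R : Type*} [CommRing R] (ν : ℕ → R) (σ : R ≃+* R) :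
    Prop where
  surjective : Function.Surjective ν
  eq : ComputablePred fun p : ℕ × ℕ => ν p.1 = ν p.2
  add : ∃ h : ℕ → ℕ → ℕ, Computable₂ h ∧ ∀ x y, ν (h x y) = ν x + ν y
  neg : ∃ h : ℕ → ℕ, Computable h ∧ ∀ x, ν (h x) = -ν x
  mul : ∃ h : ℕ → ℕ → ℕ, Computable₂ h ∧ ∀ x y, ν (h x y) = ν x * ν y
  aut : ∃ h : ℕ → ℕ, Computable h ∧ ∀ x, ν (h x) = σ (ν x)

/-- `νE` makes `(E, σE)` a computable difference ring in such a way that the embedding of `A`, whose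
elements are coded by `νA`, is computable. -/
structure IsComputableExtension {A E : Type*} [CommRing A] [CommRing E] [Algebra A E]
    (νA : ℕ → A) (νE : ℕ → E) (σE : E ≃+* E) : Prop where
  computable : IsComputableDifferenceRing νE σE
  embedding : ∃ h : ℕ → ℕ, Computable h ∧ ∀ x, νE (h x) = algebraMap A E (νA x)

/-- PLDEs are solvable in `(R, σ)`: there is an algorithm that computes, for any nonzero
`(a₀, …, aₘ)` and any `(f₁, …, f_d)`, a (finite) basis of `V(a, f, R)` over the constants. A basis
is returned as the list of its members `((c₁, …, c_d), g)`. -/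
def CanSolvePLDEs {R : Type*} [CommRing R] (ν : ℕ → R) (σ : R ≃+* R) : Prop :=
  ∃ alg : List ℕ × List ℕ → List (List ℕ × ℕ), Computable alg ∧
    ∀ (m d : ℕ) (a : Fin (m + 1) → ℕ) (f : Fin d → ℕ), (∃ i, ν (a i) ≠ 0) →
      ∃ (r : ℕ) (c : Fin r → Fin d → ℕ) (g : Fin r → ℕ),
        alg (List.ofFn a, List.ofFn f) = List.ofFn (fun k => (List.ofFn (c k), g k)) ∧
        ∃ b : Module.Basis (Fin r) (constants σ)
            (pldeSolutions σ (fun i => ν (a i)) (fun j => ν (f j))),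
          ∀ k, (∀ j, ((b k).1.1 j : R) = ν (c k j)) ∧ (b k).1.2 = ν (g k)

/-- The `ℤ`-module `M(f, F)` of all `(z₁, …, zₙ) ∈ ℤⁿ` such that
`σ(g)/g = f₁^z₁ ⋯ fₙ^zₙ` for some `g ∈ F*`. -/
def pseudoOrbitModule {F : Type*} [Field F] (σ : F ≃+* F) {n : ℕ} (f : Fin n → Fˣ) :
    Submodule ℤ (Fin n → ℤ) :=
  AddSubgroup.toIntSubmodule
    { carrier := {z | ∃ g : Fˣ, σ (g : F) / g = ∏ i, (f i : F) ^ z i}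
      zero_mem' := ⟨1, by simp⟩
      add_mem' := by
        rintro z w ⟨g, hg⟩ ⟨h, hh⟩
        refine ⟨g * h, ?_⟩
        simp only [Pi.add_apply, zpow_add₀ (Units.ne_zero _), Finset.prod_mul_distrib]
        rw [← hg, ← hh, Units.val_mul, map_mul, mul_div_mul_comm]
      neg_mem' := by
        rintro z ⟨g, hg⟩
        refine ⟨g⁻¹, ?_⟩
        simp only [Pi.neg_apply, zpow_neg, Finset.prod_inv_distrib]
        rw [← hg, Units.val_inv_eq_inv_val, map_inv₀, inv_div_inv, inv_div] }

/-- The parameterized pseudo-orbit problem is solvable in `(F, σ)`: there is an algorithm that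
computes, for any nonzero `f₁, …, fₙ`, a `ℤ`-basis of `M(f, F)`. -/
def CanSolvePseudoOrbit {F : Type*} [Field F] (ν : ℕ → F) (σ : F ≃+* F) : Prop :=
  ∃ alg : List ℕ → List (List ℤ), Computable alg ∧
    ∀ (n : ℕ) (c : Fin n → ℕ) (f : Fin n → Fˣ), (∀ i, ν (c i) = f i) →
      ∃ (r : ℕ) (z : Fin r → Fin n → ℤ),
        alg (List.ofFn c) = List.ofFn (fun k => List.ofFn (z k)) ∧
        ∃ b : Module.Basis (Fin r) ℤ (pseudoOrbitModule σ f), ∀ k, (b k : Fin n → ℤ) = z k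

/-- The action of `ℕ` on `F` by powers of `σ`; it turns `SkewPolynomial F` into the ring `F[σ]` of
linear difference operators, where `X` is the operator symbol and `X * a = σ(a) * X`. -/
@[reducible] def differenceAction {F : Type*} [Field F] (σ : F ≃+* F) :
    MulSemiringAction (Multiplicative ℕ) F :=
  MulSemiringAction.compHom F (powersHom (F ≃+* F) σ)

/-- `P` is a right factor of `L` in the ring `F[σ]`. -/
def IsRightFactor {F : Type*} [Field F] (σ : F ≃+* F) (P L : SkewPolynomial F) : Prop :=
  letI := differenceAction σ
  ∃ Q : SkewPolynomial F, L = Q * P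

/-- One can compute all hypergeometric candidates in `(F, σ)`: there is an algorithm that computes,
for any nonzero operator `L = a₀ + a₁ σ + ⋯ + aₘ σᵐ`, a finite set `S` such that for each right
factor `σ - r` of `L` with `r ∈ F*` we have `r = u σ(v)/v` for some `u ∈ S` and `v ∈ F*`. -/
def CanComputeHypergeometricCandidates {F : Type*} [Field F] (ν : ℕ → F) (σ : F ≃+* F) : Prop :=
  ∃ alg : List ℕ → List ℕ, Computable alg ∧
    ∀ (m : ℕ) (a : Fin (m + 1) → ℕ), (∃ i, ν (a i) ≠ 0) →
      ∀ r : F, r ≠ 0 →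
        IsRightFactor σ (SkewPolynomial.X - SkewPolynomial.C r)
          (∑ i : Fin (m + 1), SkewPolynomial.monomial (i : ℕ) (ν (a i))) →
        ∃ u ∈ alg (List.ofFn a), ∃ v : F, v ≠ 0 ∧ r = ν u * (σ v / v)

/-- One can compute all integer roots of any nonzero polynomial `p₀ + p₁ x + ⋯ + pₘ xᵐ` whose
coefficients are constants of `(F, σ)`. -/
def CanComputeIntegerRoots {F : Type*} [Field F] (ν : ℕ → F) (σ : F ≃+* F) : Prop :=
  ∃ alg : List ℕ → List ℤ, Computable alg ∧
    ∀ (m : ℕ) (p : Fin (m + 1) → ℕ), (∀ i, ν (p i) ∈ constants σ) → (∃ i, ν (p i) ≠ 0) →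
      ∀ z : ℤ, z ∈ alg (List.ofFn p) ↔ ∑ i, ν (p i) * (z : F) ^ (i : ℕ) = 0

end

/-!
Wherever the theorem asks for an algorithm, it suffices to give a relation between inputs and
outputs that is semidecidable, sound and total: a search through all candidates then computes an
output (`Semi.exists_choice`). So no algorithm has to be followed step by step. It is enough to say
which certificates show that an output is correct, and to prove, by any noncomputable argument, that
every input has a certified output.

The ring `E` is an integral domain without nonzero proper ideals that are stable under `σ`
(`PiSigmaExtension.sigmaSimple`). Hence an element of its field of fractions that is fixed by `σ` is
a quotient of constants (`PiSigmaExtension.constQuotients`). Under this condition a vector is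
linearly independent over the constants of finitely many others if and only if a functional
`v ↦ ∑ Lᵢ(v_{kᵢ})` with difference operators `Lᵢ` kills the others but not this one
(`exists_functional_or_relation`). Such functionals take the place of Casoratian determinants. They
are the certificates of independence.

As `σ(tᵢ)/tᵢ ∈ F*` for the `Π`-monomials, these can be adjoined to `F` first and the `Σ`-monomials
afterwards (`PiSigmaExtension.piRing`, `PiSigmaExtension.sigmaRing`). Along this tower one does not
look for bases of the solution spaces but for covers, finite lists whose span over the constants
contains all solutions (`CanCover`). Covers pass from a ring `B` to the polynomials in a monomial
over `B` by a comparison of leading coefficients, once the degree of the solutions is bounded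
(`exists_cover_boundedDegree`). Bases are extracted from covers at the very end
(`canSolvePLDEs_of_canCover`). It remains to bound the degrees.

* For `Π`-monomials, a homogeneous solution `g m` with `g ∈ F` and a monomial `m` is hypergeometric
  over `F`. Thus `σ(g m)/(g m)` is `u σ(v)/v` for one of finitely many candidates `u`, and the
  exponents in `m` are read off from a basis of the pseudo-orbit module of `u` and the quotients
  `σ(tᵢ)/tᵢ` (`PiSigmaExtension.piBound_zero`, `PiSigmaExtension.piBound_succ`).
* For a `Σ`-monomial `t` with `σ(t) = t + β`, the highest coefficients of an operator applied to
  `h tⁿ⁻ʲ` are polynomials in `n`, the symbols of `(j, h)`. The `k + 1` highest coefficients of a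
  solution of degree `n` are combinations of elements `h` that can be computed, since each of these
  coefficients solves an equation over `B`. A functional that separates the symbols of some `(0, h)`
  from the others can be chosen so that its value is a nonzero multiple of `κ(n)` with a polynomial
  `κ ≠ 0` over the constants, and the degree `n` of a solution, if large, is an integer root of one
  of these polynomials (`SigmaBound.mem_boundedDegree`). If for a large `k` there were no such
  functional, an operator would lower the degrees of a whole family of polynomials by about `k`
  (`no_symbol_relation`).
  That this is impossible is shown by reduction of order, with estimates for the degrees of
  Casoratians in which it matters that `β` is not of the form `σ(w) - w`
  (`natDegree_add_le_of_combinations`).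

The codings of `E` are built along the tower, one monomial at a time
(`PiSigmaExtension.HasCoding`).
-/

open scoped LaurentPolynomial

noncomputable section

/-! ### Semidecidable predicates and computable functions on coded types -/

/-- A predicate is semidecidable if and only if it is the projection of a computable test: `f a k`
tells whether the search for a witness of `p a` has succeeded after `k` steps. -/
theorem rePred_iff_exists_computable {α : Type*} [Primcodable α] {p : α → Prop} :
    REPred p ↔ ∃ f : α → ℕ → Bool, Computable₂ f ∧ ∀ a, p a ↔ ∃ k, f a k = true := by
  constructor
  · intro hp
    obtain ⟨c, hc⟩ := Nat.Partrec.Code.exists_code.1 hp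
    refine ⟨fun a k => (Nat.Partrec.Code.evaln k c (Encodable.encode a)).isSome, ?_, ?_⟩
    · exact (Primrec.option_isSome.comp (Nat.Partrec.Code.primrec_evaln.comp
        (Primrec.pair (Primrec.pair Primrec.snd (Primrec.const c))
          (Primrec.encode.comp Primrec.fst)))).to_comp
    · intro a
      have h : (∃ x, x ∈ c.eval (Encodable.encode a)) ↔ p a := by
        rw [hc]
        simp [Part.assert, Part.mem_map_iff]
      rw [← h]
      simp only [Option.isSome_iff_exists, Nat.Partrec.Code.evaln_complete]
      constructor
      · rintro ⟨x, k, hk⟩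
        exact ⟨k, x, hk⟩
      · rintro ⟨k, x, hk⟩
        exact ⟨x, k, hk⟩
  · rintro ⟨f, hf, h⟩
    have := (Partrec.rfindOpt (f := fun a k => bif f a k then some () else none)
      (Computable.cond hf (Computable.const _) (Computable.const _))).dom_re
    refine this.of_eq fun a => ?_
    rw [Nat.rfindOpt_dom, h]
    refine exists_congr fun k => ?_
    cases f a k <;> simp

/-- A coded type: its elements are represented by the elements of a `Primcodable` type of codes.
An element may have several codes. -/
class Coded (X : Type*) where
  /-- The type of codes. -/
  Code : Type
  [prim : Primcodable Code]
  /-- The element with a given code. -/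
  val : Code → X
  surj : Function.Surjective val

attribute [reducible, instance] Coded.prim

/-- `f` is computable on codes. -/
@[fun_prop]
def Eff {X Y : Type*} [Coded X] [Coded Y] (f : X → Y) : Prop :=
  ∃ h : Coded.Code X → Coded.Code Y, Computable h ∧ ∀ c, Coded.val (h c) = f (Coded.val c)

/-- `P` is semidecidable on codes. -/
@[fun_prop]
def Semi {X : Type*} [Coded X] (P : X → Prop) : Prop :=
  REPred fun c : Coded.Code X => P (Coded.val c)

section instances

/-- A `Primcodable` type is coded by itself. -/
@[reducible] def Coded.ofPrimcodable (X : Type) [Primcodable X] : Coded X where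
  Code := X
  val := id
  surj := Function.surjective_id

instance : Coded ℕ := Coded.ofPrimcodable ℕ
instance : Coded ℤ := Coded.ofPrimcodable ℤ

instance {X Y : Type*} [Coded X] [Coded Y] : Coded (X × Y) where
  Code := Coded.Code X × Coded.Code Y
  val c := (Coded.val c.1, Coded.val c.2)
  surj p := by
    obtain ⟨a, ha⟩ := Coded.surj p.1
    obtain ⟨b, hb⟩ := Coded.surj p.2
    exact ⟨(a, b), by simp [ha, hb]⟩

instance {X : Type*} [Coded X] : Coded (List X) where
  Code := List (Coded.Code X)
  val c := c.map Coded.val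
  surj l := by
    choose g hg using Coded.surj (X := X)
    exact ⟨l.map g, by simp [Function.comp_def, hg]⟩

end instances

section computability

variable {X Y Z W : Type*} [Coded X] [Coded Y] [Coded Z] [Coded W]

theorem Semi.of_iff {P Q : X → Prop} (hP : Semi P) (h : ∀ x, Q x ↔ P x) : Semi Q :=
  REPred.of_eq hP fun _ => (h _).symm

/-- The step-indexed computable test behind a semidecidable predicate. -/
theorem Semi.exists_test {P : X → Prop} (hP : Semi P) :
    ∃ f : Coded.Code X → ℕ → Bool, Computable₂ f ∧ ∀ c, P (Coded.val c) ↔ ∃ k, f c k = true :=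
  rePred_iff_exists_computable.1 hP

/-! #### Computable functions -/

@[fun_prop]
theorem Eff.id : Eff fun x : X => x := ⟨_, Computable.id, fun _ => rfl⟩

@[fun_prop]
theorem Eff.const (y : Y) : Eff fun _ : X => y := by
  obtain ⟨c, hc⟩ := Coded.surj y
  exact ⟨_, Computable.const c, fun _ => hc⟩

@[fun_prop]
theorem Eff.comp {f : Y → Z} {g : X → Y} (hf : Eff f) (hg : Eff g) : Eff fun x => f (g x) := by
  obtain ⟨h, hh, h1⟩ := hf
  obtain ⟨k, hk, h2⟩ := hg
  exact ⟨fun c => h (k c), hh.comp hk, fun c => by rw [h1, h2]⟩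

@[fun_prop]
theorem Eff.prodMk {f : X → Y} {g : X → Z} (hf : Eff f) (hg : Eff g) :
    Eff fun x => (f x, g x) := by
  obtain ⟨h, hh, h1⟩ := hf
  obtain ⟨k, hk, h2⟩ := hg
  exact ⟨fun c => (h c, k c), hh.pair hk, fun c => Prod.ext (h1 c) (h2 c)⟩

@[fun_prop]
theorem Eff.fst {f : X → Y × Z} (hf : Eff f) : Eff fun x => (f x).1 := by
  obtain ⟨h, hh, h1⟩ := hf
  exact ⟨fun c => (h c).1, Computable.fst.comp hh, fun c => congrArg Prod.fst (h1 c)⟩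

@[fun_prop]
theorem Eff.snd {f : X → Y × Z} (hf : Eff f) : Eff fun x => (f x).2 := by
  obtain ⟨h, hh, h1⟩ := hf
  exact ⟨fun c => (h c).2, Computable.snd.comp hh, fun c => congrArg Prod.snd (h1 c)⟩

/-- Primitive recursion with a parameter. -/
theorem Eff.natRec {n : X → ℕ} {b : X → Y} {s : X → ℕ → Y → Y} (hn : Eff n) (hb : Eff b)
    (hs : Eff fun p : X × ℕ × Y => s p.1 p.2.1 p.2.2) :
    Eff fun x => Nat.rec (motive := fun _ => Y) (b x) (s x) (n x) := by
  obtain ⟨n', hn', h1⟩ := hn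
  obtain ⟨b', hb', h2⟩ := hb
  obtain ⟨s', hs', h3⟩ := hs
  refine ⟨fun c => Nat.rec (b' c) (fun i y => s' (c, (i, y))) (n' c),
    Computable.nat_rec hn' hb' (Computable.to₂ hs'), fun c => ?_⟩
  have h1 : n' c = n (Coded.val c) := h1 c
  beta_reduce
  rw [← h1]
  induction n' c with
  | zero => exact h2 c
  | succ i ih =>
    refine (h3 _).trans ?_
    change s (Coded.val c) i (Coded.val _) = s (Coded.val c) i _
    rw [ih]

@[fun_prop]
theorem Eff.natAdd {f g : X → ℕ} (hf : Eff f) (hg : Eff g) : Eff fun x => f x + g x := by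
  have : Eff fun p : ℕ × ℕ => p.1 + p.2 := ⟨_, Primrec.nat_add.to_comp, fun _ => rfl⟩
  exact this.comp (hf.prodMk hg)

@[fun_prop]
theorem Eff.natSub {f g : X → ℕ} (hf : Eff f) (hg : Eff g) : Eff fun x => f x - g x := by
  have : Eff fun p : ℕ × ℕ => p.1 - p.2 := ⟨_, Primrec.nat_sub.to_comp, fun _ => rfl⟩
  exact this.comp (hf.prodMk hg)

@[fun_prop]
theorem Eff.natMul {f g : X → ℕ} (hf : Eff f) (hg : Eff g) : Eff fun x => f x * g x := by
  have : Eff fun p : ℕ × ℕ => p.1 * p.2 := ⟨_, Primrec.nat_mul.to_comp, fun _ => rfl⟩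
  exact this.comp (hf.prodMk hg)

@[fun_prop]
theorem Eff.intNatAbs {f : X → ℤ} (hf : Eff f) : Eff fun x => (f x).natAbs := by
  have h : Eff Int.natAbs := by
    refine ⟨Int.natAbs, ?_, fun _ => rfl⟩
    have h1 : Primrec fun z : ℤ => (Encodable.encode z + 1) / 2 :=
      Primrec.nat_div.comp (Primrec.succ.comp Primrec.encode) (Primrec.const 2)
    refine h1.to_comp.of_eq fun z => ?_
    have h2 : Encodable.encode z = Equiv.intEquivNat z := rfl
    rw [h2]
    rcases z with n | n
    · have : Equiv.intEquivNat (Int.ofNat n) = 2 * n := rfl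
      rw [this]
      simp
      omega
    · have : Equiv.intEquivNat (Int.negSucc n) = 2 * n + 1 := rfl
      rw [this]
      simp
      omega
  exact h.comp hf

/-! #### Semidecidable predicates -/

@[fun_prop]
theorem Semi.comp {P : Y → Prop} {f : X → Y} (hP : Semi P) (hf : Eff f) :
    Semi fun x => P (f x) := by
  obtain ⟨t, ht, h⟩ := hP.exists_test
  obtain ⟨g, hg, h1⟩ := hf
  refine rePred_iff_exists_computable.2 ⟨fun c k => t (g c) k,
    ht.comp (hg.comp Computable.fst) Computable.snd, fun c => ?_⟩
  beta_reduce
  rw [← h1, h]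

@[fun_prop]
theorem Semi.exists {P : X → Y → Prop} (hP : Semi fun p : X × Y => P p.1 p.2) :
    Semi fun x => ∃ y, P x y := by
  obtain ⟨t, ht, h⟩ := hP.exists_test
  refine rePred_iff_exists_computable.2 ⟨fun c k =>
    ((Encodable.decode (α := Coded.Code Y × ℕ) k).map fun q => t (c, q.1) q.2).getD false, ?_, ?_⟩
  · refine Computable.option_getD (Computable.option_map (Computable.decode.comp Computable.snd)
      (ht.comp ?_ ?_)) (Computable.const false)
    · exact (Computable.fst.comp Computable.fst).pair (Computable.fst.comp Computable.snd)
    · exact Computable.snd.comp Computable.snd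
  · intro c
    constructor
    · rintro ⟨y, hy⟩
      obtain ⟨d, rfl⟩ := Coded.surj y
      obtain ⟨k, hk⟩ := (h (c, d)).1 hy
      exact ⟨Encodable.encode (d, k), by simp [Encodable.encodek, hk]⟩
    · rintro ⟨k, hk⟩
      obtain ⟨⟨d, j⟩, h1, h2⟩ : ∃ q : Coded.Code Y × ℕ, Encodable.decode k = some q ∧
          t (c, q.1) q.2 = true := by
        cases hq : Encodable.decode (α := Coded.Code Y × ℕ) k with
        | none => simp [hq] at hk
        | some q => exact ⟨q, rfl, by simpa [hq] using hk⟩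
      exact ⟨Coded.val d, (h (c, d)).2 ⟨j, h2⟩⟩

@[fun_prop]
theorem Semi.and {P Q : X → Prop} (hP : Semi P) (hQ : Semi Q) : Semi fun x => P x ∧ Q x := by
  obtain ⟨t, ht, h⟩ := hP.exists_test
  obtain ⟨s, hs, h'⟩ := hQ.exists_test
  refine rePred_iff_exists_computable.2 ⟨fun c k => t c k.unpair.1 && s c k.unpair.2, ?_, ?_⟩
  · refine Primrec.and.to_comp.comp (ht.comp Computable.fst ?_) (hs.comp Computable.fst ?_)
    · exact Computable.fst.comp (Computable.unpair.comp Computable.snd)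
    · exact Computable.snd.comp (Computable.unpair.comp Computable.snd)
  · intro c
    beta_reduce
    rw [h, h']
    constructor
    · rintro ⟨⟨k, hk⟩, ⟨l, hl⟩⟩
      exact ⟨Nat.pair k l, by simp [hk, hl]⟩
    · rintro ⟨k, hk⟩
      rw [Bool.and_eq_true] at hk
      exact ⟨⟨_, hk.1⟩, ⟨_, hk.2⟩⟩

@[fun_prop]
theorem Semi.or {P Q : X → Prop} (hP : Semi P) (hQ : Semi Q) : Semi fun x => P x ∨ Q x := by
  obtain ⟨t, ht, h⟩ := hP.exists_test
  obtain ⟨s, hs, h'⟩ := hQ.exists_test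
  refine rePred_iff_exists_computable.2 ⟨fun c k => t c k || s c k, ?_, ?_⟩
  · exact Primrec.or.to_comp.comp (ht.comp Computable.fst Computable.snd)
      (hs.comp Computable.fst Computable.snd)
  · intro c
    simp only [h, h', Bool.or_eq_true, exists_or]

@[fun_prop]
theorem Semi.const (p : Prop) : Semi fun _ : X => p := by
  classical
  refine rePred_iff_exists_computable.2 ⟨fun _ _ => decide p, Computable.const _, fun c => ?_⟩
  simp

/-- Reachability along a relation that is semidecided by `t` can be tested on paths: a path is
given by its vertices, each with the time in which the step to it is confirmed. -/
theorem exists_computable_path {γ β : Type} [Primcodable γ] [Primcodable β]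
    {t : γ × β × β → ℕ → Bool} (ht : Computable₂ t) :
    ∃ run : (γ × β) × List (β × ℕ) → Option β, Computable run ∧ ∀ z a b,
      Relation.ReflTransGen (fun u v => ∃ k, t (z, u, v) k = true) a b ↔
        ∃ l, run ((z, a), l) = some b := by
  -- the `i`-th step of a path moves to its `i`-th vertex, if the given time confirms the step
  let step : γ → List (β × ℕ) → ℕ → Option β → Option β := fun z l i o =>
    o.bind fun b => (l[i]?).bind fun q => bif t (z, b, q.1) q.2 then some q.1 else none
  let run : γ → β → List (β × ℕ) → ℕ → Option β := fun z a l n =>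
    Nat.rec (some a) (step z l) n
  have hstep : Computable fun p : (γ × List (β × ℕ)) × ℕ × Option β =>
      step p.1.1 p.1.2 p.2.1 p.2.2 := by
    have h2 : Computable fun p : (((γ × List (β × ℕ)) × ℕ × Option β) × β) × β × ℕ =>
        bif t (p.1.1.1.1, p.1.2, p.2.1) p.2.2 then some p.2.1 else none := by
      refine Computable.cond (ht.comp (Computable.pair ?_ (Computable.pair ?_ ?_)) ?_)
        (Computable.option_some.comp ?_) (Computable.const _)
      · exact Computable.fst.comp (Computable.fst.comp (Computable.fst.comp Computable.fst))
      · exact Computable.snd.comp Computable.fst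
      · exact Computable.fst.comp Computable.snd
      · exact Computable.snd.comp Computable.snd
      · exact Computable.fst.comp Computable.snd
    have h1 : Computable fun p : ((γ × List (β × ℕ)) × ℕ × Option β) × β =>
        (p.1.1.2[p.1.2.1]?).bind fun q =>
          bif t (p.1.1.1, p.2, q.1) q.2 then some q.1 else none :=
      Computable.option_bind (Computable.list_getElem?.comp
        (Computable.snd.comp (Computable.fst.comp Computable.fst))
        (Computable.fst.comp (Computable.snd.comp Computable.fst))) h2.to₂
    exact Computable.option_bind (Computable.snd.comp Computable.snd) h1.to₂
  have hrun : Computable fun p : (γ × β) × List (β × ℕ) => run p.1.1 p.1.2 p.2 p.2.length := by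
    have h : Computable₂ fun (p : (γ × β) × List (β × ℕ)) (q : ℕ × Option β) =>
        step p.1.1 p.2 q.1 q.2 :=
      (hstep.comp (Computable.pair (Computable.pair (Computable.fst.comp (Computable.fst.comp
        Computable.fst)) (Computable.snd.comp Computable.fst)) Computable.snd)).to₂
    have hl : Computable fun p : (γ × β) × List (β × ℕ) => p.2.length :=
      Computable.list_length.comp Computable.snd
    have h0 : Computable fun p : (γ × β) × List (β × ℕ) => some p.1.2 :=
      Computable.option_some.comp (Computable.snd.comp Computable.fst)
    exact (Computable.nat_rec hl h0 h).of_eq fun p => rfl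
  have hsound : ∀ z a l n b, run z a l n = some b →
      Relation.ReflTransGen (fun u v => ∃ k, t (z, u, v) k = true) a b := by
    intro z a l n
    induction n with
    | zero =>
      intro b hb
      obtain rfl : a = b := by simpa [run] using hb
      exact .refl
    | succ n ih =>
      intro b hb
      obtain ⟨d, hd, hb⟩ := Option.bind_eq_some_iff.1 hb
      obtain ⟨q, hq, hb⟩ := Option.bind_eq_some_iff.1 hb
      cases hc : t (z, d, q.1) q.2 with
      | false => simp [hc] at hb
      | true =>
        obtain rfl : q.1 = b := by simpa [hc] using hb
        exact (ih d hd).tail ⟨_, hc⟩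
  have hpre : ∀ z a l q n, n ≤ l.length → run z a (l ++ [q]) n = run z a l n := by
    intro z a l q n
    induction n with
    | zero => intro _; rfl
    | succ n ih =>
      intro hn
      simp only [run] at ih ⊢
      rw [ih (by omega)]
      simp only [step]
      rw [List.getElem?_append_left (by omega)]
  refine ⟨_, hrun, fun z a b => ⟨fun hy => ?_, fun ⟨l, hl⟩ => hsound z a l _ b hl⟩⟩
  induction hy with
  | refl => exact ⟨[], rfl⟩
  | @tail y w _ hyw ih =>
    obtain ⟨l, hl⟩ := ih
    obtain ⟨k, hk⟩ := hyw
    refine ⟨l ++ [(w, k)], ?_⟩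
    have h1 : run z a (l ++ [(w, k)]) (l.length + 1) =
        (run z a (l ++ [(w, k)]) l.length).bind fun b => ((l ++ [(w, k)])[l.length]?).bind
          fun q => bif t (z, b, q.1) q.2 then some q.1 else none := rfl
    rw [List.length_append, List.length_singleton, h1, hpre _ _ _ _ _ le_rfl, hl]
    simp [hk]

/-- The reachability relation of a semidecidable relation is semidecidable. -/
theorem Semi.reflTransGen {S : Z → Y → Y → Prop} (hS : Semi fun p : Z × Y × Y => S p.1 p.2.1 p.2.2)
    (heq : Semi fun p : Y × Y => p.1 = p.2) {f : X → Z} {u v : X → Y}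
    (hf : Eff f) (hu : Eff u) (hv : Eff v) :
    Semi fun x => Relation.ReflTransGen (S (f x)) (u x) (v x) := by
  suffices h : Semi fun p : Z × Y × Y => Relation.ReflTransGen (S p.1) p.2.1 p.2.2 from
    h.comp (hf.prodMk (hu.prodMk hv))
  obtain ⟨t, ht, h⟩ := hS.exists_test
  obtain ⟨t0, ht0, h0⟩ := heq.exists_test
  obtain ⟨run, hrun, hr⟩ := exists_computable_path ht
  -- An element may have several codes: paths are lifted to codes step by step, and only the final
  -- vertex is compared with the target as an element.
  have key : ∀ z a y, Relation.ReflTransGen (S (Coded.val z)) (Coded.val a) y ↔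
      ∃ b, Relation.ReflTransGen (fun u v => ∃ k, t (z, u, v) k = true) a b ∧
        Coded.val b = y := by
    intro z a y
    constructor
    · intro hy
      induction hy with
      | refl => exact ⟨a, .refl, rfl⟩
      | @tail y w _ hyw ih =>
        obtain ⟨b, hb, rfl⟩ := ih
        obtain ⟨d, rfl⟩ := Coded.surj w
        exact ⟨d, hb.tail ((h (z, b, d)).1 hyw), rfl⟩
    · rintro ⟨b, hb, rfl⟩
      induction hb with
      | refl => exact .refl
      | tail _ huv ih => exact ih.tail ((h (z, _, _)).2 huv)
  refine rePred_iff_exists_computable.2 ⟨fun c k =>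
    ((Encodable.decode (α := List (Coded.Code Y × ℕ) × ℕ) k).bind fun q =>
      (run ((c.1, c.2.1), q.1)).map fun b => t0 (b, c.2.2) q.2).getD false, ?_, ?_⟩
  · refine Computable.option_getD (Computable.option_bind
      (Computable.decode.comp Computable.snd) ?_) (Computable.const false)
    refine Computable.option_map (hrun.comp (Computable.pair (Computable.pair ?_ ?_) ?_))
      (ht0.comp (Computable.pair Computable.snd ?_) ?_)
    · exact Computable.fst.comp (Computable.fst.comp Computable.fst)
    · exact Computable.fst.comp (Computable.snd.comp (Computable.fst.comp Computable.fst))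
    · exact Computable.fst.comp Computable.snd
    · exact Computable.snd.comp (Computable.snd.comp (Computable.fst.comp
        (Computable.fst.comp Computable.fst)))
    · exact Computable.snd.comp (Computable.snd.comp Computable.fst)
  · rintro ⟨z, a, e⟩
    refine (key z a (Coded.val e)).trans ?_
    constructor
    · rintro ⟨b, hab, hb⟩
      obtain ⟨l, hl⟩ := (hr z a b).1 hab
      obtain ⟨k, hk⟩ := (h0 (b, e)).1 hb
      exact ⟨Encodable.encode (l, k), by simp [Encodable.encodek, hl, hk]⟩
    · rintro ⟨k, hk⟩
      cases hq : Encodable.decode (α := List (Coded.Code Y × ℕ) × ℕ) k with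
      | none => simp [hq] at hk
      | some q =>
        cases hb : run ((z, a), q.1) with
        | none => simp [hq, hb] at hk
        | some b =>
          have h1 : t0 (b, e) q.2 = true := by simpa [hq, hb] using hk
          exact ⟨b, (hr z a b).2 ⟨_, hb⟩, (h0 (b, e)).2 ⟨_, h1⟩⟩

/-- A total semidecidable relation has a computable choice function: search through all pairs of a
value and a number of steps. The choice depends on the code of the argument. -/
theorem Semi.exists_choice {P : X → Y → Prop} (hP : Semi fun p : X × Y => P p.1 p.2)
    (htot : ∀ x, ∃ y, P x y) :
    ∃ h : Coded.Code X → Coded.Code Y, Computable h ∧ ∀ c, P (Coded.val c) (Coded.val (h c)) := by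
  obtain ⟨t, ht, h⟩ := hP.exists_test
  let s : Coded.Code X → ℕ → Option (Coded.Code Y) := fun c k =>
    (Encodable.decode (α := Coded.Code Y × ℕ) k).bind fun q =>
      bif t (c, q.1) q.2 then some q.1 else none
  have hs : Computable₂ s := by
    refine Computable.option_bind (Computable.decode.comp Computable.snd) ?_
    refine Computable.cond (ht.comp (Computable.pair ?_ ?_) ?_)
      (Computable.option_some.comp ?_) (Computable.const _)
    · exact Computable.fst.comp Computable.fst
    · exact Computable.fst.comp Computable.snd
    · exact Computable.snd.comp Computable.snd
    · exact Computable.fst.comp Computable.snd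
  have hsP : ∀ c k d, s c k = some d → P (Coded.val c) (Coded.val d) := by
    intro c k d hk
    obtain ⟨q, hq, hd⟩ := Option.bind_eq_some_iff.1 hk
    cases hc : t (c, q.1) q.2 with
    | false => simp [hc] at hd
    | true =>
      obtain rfl : q.1 = d := by simpa [hc] using hd
      exact (h (c, q.1)).2 ⟨_, hc⟩
  have hdom : ∀ c, (Nat.rfindOpt (s c)).Dom := by
    intro c
    rw [Nat.rfindOpt_dom]
    obtain ⟨y, hy⟩ := htot (Coded.val c)
    obtain ⟨d, rfl⟩ := Coded.surj y
    obtain ⟨k, hk⟩ := (h (c, d)).1 hy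
    exact ⟨Encodable.encode (d, k), d, by simp [s, Encodable.encodek, hk]⟩
  refine ⟨fun c => (Nat.rfindOpt (s c)).get (hdom c),
    (Partrec.rfindOpt hs).of_eq_tot fun c => Part.get_mem _, fun c => ?_⟩
  obtain ⟨k, hk⟩ := Nat.rfindOpt_spec (Part.get_mem (hdom c))
  exact hsP c k _ hk

end computability

section structures

variable {X Y Z W : Type*} [Coded X] [Coded Y] [Coded Z] [Coded W]

/-- Equality of elements is decidable on codes. -/
class CodedEq (X : Type*) [Coded X] : Prop where
  eq : Semi fun p : X × X => p.1 = p.2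
  ne : Semi fun p : X × X => p.1 ≠ p.2

@[fun_prop]
theorem Semi.eq [CodedEq Y] {f g : X → Y} (hf : Eff f) (hg : Eff g) : Semi fun x => f x = g x :=
  (CodedEq.eq (X := Y)).comp (hf.prodMk hg)

@[fun_prop]
theorem Semi.ne [CodedEq Y] {f g : X → Y} (hf : Eff f) (hg : Eff g) : Semi fun x => f x ≠ g x :=
  (CodedEq.ne (X := Y)).comp (hf.prodMk hg)

theorem CodedEq.ofPrimcodable (X : Type) [Primcodable X] :
    @CodedEq X (Coded.ofPrimcodable X) := by
  classical
  let _ := Coded.ofPrimcodable X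
  have h : ComputablePred fun p : X × X => p.1 = p.2 :=
    (Primrec.eq (α := X)).computablePred
  exact ⟨h.to_re, h.not.to_re⟩

instance : CodedEq ℕ := CodedEq.ofPrimcodable ℕ

instance [CodedEq X] [CodedEq Y] : CodedEq (X × Y) where
  eq := by
    have : Semi fun p : (X × Y) × (X × Y) => p.1.1 = p.2.1 ∧ p.1.2 = p.2.2 := by fun_prop
    exact this.of_iff fun p => Prod.ext_iff
  ne := by
    have : Semi fun p : (X × Y) × (X × Y) => p.1.1 ≠ p.2.1 ∨ p.1.2 ≠ p.2.2 := by fun_prop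
    exact this.of_iff fun p => by rw [Ne, Prod.ext_iff, not_and_or]

@[fun_prop]
theorem Semi.natLt {f g : X → ℕ} (hf : Eff f) (hg : Eff g) : Semi fun x => f x < g x := by
  have h : Semi fun p : ℕ × ℕ => p.1 < p.2 :=
    (ComputablePred.to_re (Primrec.nat_lt.computablePred))
  exact h.comp (hf.prodMk hg)

@[fun_prop]
theorem Semi.natLe {f g : X → ℕ} (hf : Eff f) (hg : Eff g) : Semi fun x => f x ≤ g x := by
  have h : Semi fun p : ℕ × ℕ => p.1 ≤ p.2 :=
    (ComputablePred.to_re (Primrec.nat_le.computablePred))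
  exact h.comp (hf.prodMk hg)

/-! #### Lists -/

@[fun_prop]
theorem Eff.cons {f : X → Y} {g : X → List Y} (hf : Eff f) (hg : Eff g) :
    Eff fun x => f x :: g x := by
  have h : Eff fun p : Y × List Y => p.1 :: p.2 :=
    ⟨fun p : Coded.Code Y × List (Coded.Code Y) => p.1 :: p.2,
      Computable.list_cons.comp Computable.fst Computable.snd, fun _ => rfl⟩
  exact h.comp (hf.prodMk hg)

@[fun_prop]
theorem Eff.append {f g : X → List Y} (hf : Eff f) (hg : Eff g) :
    Eff fun x => f x ++ g x := by
  have h : Eff fun p : List Y × List Y => p.1 ++ p.2 :=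
    ⟨fun p : List (Coded.Code Y) × List (Coded.Code Y) => p.1 ++ p.2,
      Computable.list_append.comp Computable.fst Computable.snd, fun _ => List.map_append⟩
  exact h.comp (hf.prodMk hg)

@[fun_prop]
theorem Eff.length {f : X → List Y} (hf : Eff f) : Eff fun x => (f x).length := by
  have h : Eff fun l : List Y => l.length :=
    ⟨_, Computable.list_length, fun _ => (List.length_map _).symm⟩
  exact h.comp hf

@[fun_prop]
theorem Eff.getD {f : X → List Y} {n : X → ℕ} {d : X → Y} (hf : Eff f) (hn : Eff n)
    (hd : Eff d) : Eff fun x => (f x).getD (n x) (d x) := by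
  have h : Eff fun p : List Y × ℕ × Y => p.1.getD p.2.1 p.2.2 := by
    refine ⟨fun p : List (Coded.Code Y) × ℕ × Coded.Code Y => (p.1[p.2.1]?).getD p.2.2,
      Computable.option_getD
        (Computable.list_getElem?.comp Computable.fst (Computable.fst.comp Computable.snd))
      (Computable.snd.comp Computable.snd), ?_⟩
    rintro ⟨(l : List (Coded.Code Y)), (n : ℕ), d⟩
    change _ = (l.map Coded.val).getD n (Coded.val d)
    simp only [List.getD_eq_getElem?_getD, List.getElem?_map]
    cases l[n]? <;> rfl
  exact h.comp (hf.prodMk (hn.prodMk hd))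

@[fun_prop]
theorem Eff.iterate {s : X → Y → Y} {n : X → ℕ} {g : X → Y}
    (hs : Eff fun p : X × Y => s p.1 p.2) (hn : Eff n) (hg : Eff g) :
    Eff fun x => (s x)^[n x] (g x) := by
  have h := Eff.natRec (s := fun x _ y => s x y) hn hg (by fun_prop)
  convert h using 2 with x
  induction n x with
  | zero => rfl
  | succ n ih => rw [Function.iterate_succ_apply', ih]

@[fun_prop]
theorem Eff.mapRange {n : X → ℕ} {f : X → ℕ → Y} (hn : Eff n)
    (hf : Eff fun p : X × ℕ => f p.1 p.2) : Eff fun x => (List.range (n x)).map (f x) := by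
  have h := Eff.natRec (b := fun _ => ([] : List Y)) (s := fun x i l => l ++ [f x i]) hn
    (by fun_prop) (by fun_prop)
  convert h using 2 with x
  induction n x with
  | zero => rfl
  | succ n ih => rw [List.range_succ, List.map_append, ih]; rfl

@[fun_prop]
theorem Eff.map {l : X → List Y} {f : X → Y → Z} (hl : Eff l)
    (hf : Eff fun p : X × Y => f p.1 p.2) : Eff fun x => (l x).map (f x) := by
  by_cases hY : Nonempty Y
  · obtain ⟨d⟩ := hY
    have h : Eff fun x => (List.range (l x).length).map fun i => f x ((l x).getD i d) := by
      fun_prop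
    convert h using 2 with x
    refine List.ext_getElem (by simp) fun i h1 h2 => ?_
    simp only [List.length_map] at h1
    simp [List.getD_eq_getElem?_getD, List.getElem?_eq_getElem h1]
  · have h : Eff fun _ : X => ([] : List Z) := by fun_prop
    convert h using 2 with x
    cases hx : l x with
    | nil => rfl
    | cons y _ => exact absurd ⟨y⟩ hY

/-- All members of the list `l` have the property `P`. -/
def AllMem {Y : Type*} (l : List Y) (P : Y → Prop) : Prop := ∀ y ∈ l, P y

/-- All natural numbers below `n` have the property `P`. -/
def AllLt (n : ℕ) (P : ℕ → Prop) : Prop := ∀ i < n, P i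

@[fun_prop]
theorem Semi.allLt {n : X → ℕ} {P : X → ℕ → Prop} (hn : Eff n)
    (hP : Semi fun p : X × ℕ => P p.1 p.2) : Semi fun x => AllLt (n x) (P x) := by
  have h : Semi fun x => Relation.ReflTransGen (fun i j => P x i ∧ j = i + 1) 0 (n x) := by
    exact Semi.reflTransGen (S := fun x i j => P x i ∧ j = i + 1) (f := fun x => x)
      (by fun_prop) (by fun_prop) (by fun_prop) (by fun_prop) hn
  refine h.of_iff fun x => ?_
  unfold AllLt
  generalize n x = n
  constructor
  · intro h
    induction n with
    | zero => exact .refl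
    | succ n ih => exact (ih fun i hi => h i (by omega)).tail ⟨h n (by omega), rfl⟩
  · intro h
    induction h with
    | refl => intro i hi; omega
    | tail _ hs ih =>
      obtain ⟨h1, rfl⟩ := hs
      intro i hi
      rcases Nat.lt_succ_iff_lt_or_eq.1 hi with h | rfl
      exacts [ih i h, h1]

@[fun_prop]
theorem Semi.allMem {l : X → List Y} {P : X → Y → Prop} (hl : Eff l)
    (hP : Semi fun p : X × Y => P p.1 p.2) : Semi fun x => AllMem (l x) (P x) := by
  by_cases hY : Nonempty Y
  · obtain ⟨d⟩ := hY
    have h : Semi fun x => AllLt (l x).length fun i => P x ((l x).getD i d) := by fun_prop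
    refine h.of_iff fun x => ?_
    unfold AllMem AllLt
    rw [List.forall_mem_iff_forall_getElem]
    refine forall₂_congr fun i hi => ?_
    simp [List.getD_eq_getElem?_getD, List.getElem?_eq_getElem hi]
  · refine (Semi.const True).of_iff fun x => iff_of_true ?_ trivial
    exact fun y _ => absurd ⟨y⟩ hY

theorem list_eq_iff_getD {Y : Type*} (d : Y) (l l' : List Y) :
    l = l' ↔ l.length = l'.length ∧ ∀ i < l.length, l.getD i d = l'.getD i d := by
  constructor
  · rintro rfl
    exact ⟨rfl, fun _ _ => rfl⟩
  · rintro ⟨h1, h2⟩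
    refine List.ext_getElem h1 fun i hi hi' => ?_
    simpa [List.getD_eq_getElem?_getD, List.getElem?_eq_getElem, hi, hi'] using h2 i hi

instance [CodedEq X] : CodedEq (List X) where
  eq := by
    by_cases hX : Nonempty X
    · obtain ⟨d⟩ := hX
      have : Semi fun p : List X × List X => p.1.length = p.2.length ∧
        AllLt p.1.length fun i => p.1.getD i d = p.2.getD i d := by fun_prop
      exact this.of_iff fun p => list_eq_iff_getD d _ _
    · refine (Semi.const True).of_iff fun p => iff_of_true ?_ trivial
      rcases p with ⟨_ | ⟨x, _⟩, _ | ⟨y, _⟩⟩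
      · rfl
      · exact absurd ⟨y⟩ hX
      · exact absurd ⟨x⟩ hX
      · exact absurd ⟨x⟩ hX
  ne := by
    by_cases hX : Nonempty X
    · obtain ⟨d⟩ := hX
      have : Semi fun p : List X × List X => p.1.length ≠ p.2.length ∨
        ∃ i, i < p.1.length ∧ p.1.getD i d ≠ p.2.getD i d := by fun_prop
      refine this.of_iff fun p => ?_
      rw [Ne, list_eq_iff_getD d, not_and_or]
      push Not
      rfl
    · refine (Semi.const False).of_iff fun p => iff_of_false ?_ id
      rcases p with ⟨_ | ⟨x, _⟩, _ | ⟨y, _⟩⟩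
      · simp
      · exact absurd ⟨y⟩ hX
      · exact absurd ⟨x⟩ hX
      · exact absurd ⟨x⟩ hX

@[fun_prop]
theorem Semi.mem [CodedEq Y] {f : X → Y} {l : X → List Y} (hf : Eff f) (hl : Eff l) :
    Semi fun x => f x ∈ l x := by
  have h : Semi fun x => ∃ i, i < (l x).length ∧ f x = (l x).getD i (f x) := by fun_prop
  refine h.of_iff fun x => ?_
  rw [List.mem_iff_getElem]
  constructor
  · rintro ⟨i, hi, h⟩
    exact ⟨i, hi, by simp [List.getD_eq_getElem?_getD, List.getElem?_eq_getElem hi, h]⟩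
  · rintro ⟨i, hi, h⟩
    exact ⟨i, hi, by simpa [List.getD_eq_getElem?_getD, List.getElem?_eq_getElem hi] using h.symm⟩

/-! #### Rings -/

/-- The ring operations are computable on codes, and equality is decidable. -/
class CodedRing (R : Type*) [CommRing R] [Coded R] : Prop extends CodedEq R where
  add : Eff fun p : R × R => p.1 + p.2
  neg : Eff fun x : R => -x
  mul : Eff fun p : R × R => p.1 * p.2

section ring

variable {R : Type*} [CommRing R] [Coded R] [CodedRing R]

@[fun_prop]
theorem Eff.add {f g : X → R} (hf : Eff f) (hg : Eff g) : Eff fun x => f x + g x :=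
  (CodedRing.add (R := R)).comp (hf.prodMk hg)

@[fun_prop]
theorem Eff.mul {f g : X → R} (hf : Eff f) (hg : Eff g) : Eff fun x => f x * g x :=
  (CodedRing.mul (R := R)).comp (hf.prodMk hg)

@[fun_prop]
theorem Eff.neg {f : X → R} (hf : Eff f) : Eff fun x => -f x :=
  (CodedRing.neg (R := R)).comp hf

@[fun_prop]
theorem Eff.sub {f g : X → R} (hf : Eff f) (hg : Eff g) : Eff fun x => f x - g x := by
  simp only [sub_eq_add_neg]
  fun_prop

@[fun_prop]
theorem Eff.natCast {f : X → ℕ} (hf : Eff f) : Eff fun x => (f x : R) := by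
  have h := Eff.natRec (b := fun _ => (0 : R)) (s := fun _ _ y => y + 1) hf
    (by fun_prop) (by fun_prop)
  convert h using 2 with x
  induction f x with
  | zero => simp
  | succ n ih => rw [Nat.cast_succ, ih]

@[fun_prop]
theorem Eff.pow {f : X → R} {n : X → ℕ} (hf : Eff f) (hn : Eff n) : Eff fun x => f x ^ n x := by
  have h := Eff.natRec (b := fun _ => (1 : R)) (s := fun x _ y => y * f x) hn
    (by fun_prop) (by fun_prop)
  convert h using 2 with x
  induction n x with
  | zero => simp
  | succ n ih => rw [pow_succ, ih]

@[fun_prop]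
theorem Eff.sumRange {n : X → ℕ} {f : X → ℕ → R} (hn : Eff n)
    (hf : Eff fun p : X × ℕ => f p.1 p.2) : Eff fun x => ∑ i ∈ Finset.range (n x), f x i := by
  have h := Eff.natRec (b := fun _ => (0 : R)) (s := fun x i y => y + f x i) hn
    (by fun_prop) (by fun_prop)
  convert h using 2 with x
  induction n x with
  | zero => simp
  | succ n ih => rw [Finset.sum_range_succ, ih]

@[fun_prop]
theorem Eff.prodRange {n : X → ℕ} {f : X → ℕ → R} (hn : Eff n)
    (hf : Eff fun p : X × ℕ => f p.1 p.2) : Eff fun x => ∏ i ∈ Finset.range (n x), f x i := by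
  have h := Eff.natRec (b := fun _ => (1 : R)) (s := fun x i y => y * f x i) hn
    (by fun_prop) (by fun_prop)
  convert h using 2 with x
  induction n x with
  | zero => simp
  | succ n ih => rw [Finset.prod_range_succ, ih]

end ring

end structures

section coefficients

variable {T U V : Type*} [Coded T] [Coded U] [Coded V]

open Polynomial in
/-- The polynomial with the given list of coefficients, the constant one first. -/
def ofCoeffs {R : Type*} [CommRing R] (l : List R) : R[X] :=
  ∑ i ∈ Finset.range l.length, C (l.getD i 0) * X ^ i

section polynomial

open Polynomial

variable {R : Type*} [CommRing R]

theorem coeff_ofCoeffs (l : List R) (n : ℕ) : (ofCoeffs l).coeff n = l.getD n 0 := by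
  simp only [ofCoeffs, finsetSum_coeff, coeff_C_mul_X_pow]
  by_cases h : n < l.length
  · rw [Finset.sum_eq_single n] <;> simp +contextual [h, eq_comm]
  · rw [Finset.sum_eq_zero]
    · rw [List.getD_eq_default _ _ (by omega)]
    · intro i hi
      rw [Finset.mem_range] at hi
      rw [if_neg (by omega)]

theorem ofCoeffs_surjective : Function.Surjective (ofCoeffs (R := R)) := by
  intro p
  refine ⟨(List.range (p.natDegree + 1)).map p.coeff, ?_⟩
  ext n
  rw [coeff_ofCoeffs]
  by_cases h : n < p.natDegree + 1
  · simp [List.getD_eq_getElem?_getD, h]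
  · rw [List.getD_eq_default _ _ (by simpa using h), coeff_eq_zero_of_natDegree_lt (by omega)]

theorem coeff_map_range_ofCoeffs (f : ℕ → R) (n m : ℕ) :
    (ofCoeffs ((List.range n).map f)).coeff m = if m < n then f m else 0 := by
  rw [coeff_ofCoeffs]
  split_ifs with h
  · simp [List.getD_eq_getElem?_getD, h]
  · rw [List.getD_eq_default _ _ (by simpa using h)]

theorem getD_eq_zero_of_le (l : List R) {i : ℕ} (h : l.length ≤ i) : l.getD i 0 = 0 :=
  List.getD_eq_default _ _ h

variable [Coded R]

/-- Polynomials are coded by lists of codes of their coefficients; trailing zeros are allowed. -/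
instance : Coded R[X] where
  Code := List (Coded.Code R)
  val l := ofCoeffs (l.map Coded.val)
  surj := ofCoeffs_surjective.comp (Coded.surj (X := List R))

@[fun_prop]
theorem Eff.ofCoeffs {f : T → List R} (hf : Eff f) : Eff fun x => ofCoeffs (f x) := by
  obtain ⟨g, hg, h⟩ := hf
  exact ⟨g, hg, fun c => congrArg _root_.ofCoeffs (h c)⟩

theorem Eff.polynomial_ofCoeffs {f : R[X] × U → V}
    (hf : Eff fun q : List R × U => f (_root_.ofCoeffs q.1, q.2)) : Eff f := by
  obtain ⟨g, hg, h⟩ := hf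
  exact ⟨g, hg, h⟩

theorem Semi.polynomial_ofCoeffs {P : R[X] × U → Prop}
    (hf : Semi fun q : List R × U => P (ofCoeffs q.1, q.2)) : Semi P := hf

@[fun_prop]
theorem Eff.coeff {f : T → R[X]} {n : T → ℕ} (hf : Eff f) (hn : Eff n) :
    Eff fun x => (f x).coeff (n x) := by
  have h : Eff fun p : R[X] × ℕ => p.1.coeff p.2 := by
    apply Eff.polynomial_ofCoeffs
    simp only [coeff_ofCoeffs]
    fun_prop
  exact h.comp (hf.prodMk hn)

variable [CodedRing R]

instance : CodedRing R[X] where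
  eq := by
    have h : Semi fun p : List R × List R => AllLt (p.1.length + p.2.length) fun i =>
        p.1.getD i 0 = p.2.getD i 0 := by fun_prop
    refine h.of_iff (X := List R × List R)
      (Q := fun p : List R × List R => ofCoeffs p.1 = ofCoeffs p.2) fun p => ?_
    rw [Polynomial.ext_iff]
    simp only [coeff_ofCoeffs]
    refine ⟨fun h i _ => h i, fun h i => ?_⟩
    by_cases hi : i < p.1.length + p.2.length
    · exact h i hi
    · rw [getD_eq_zero_of_le _ (by omega), getD_eq_zero_of_le _ (by omega)]
  ne := by
    have h : Semi fun p : List R × List R => ∃ i, p.1.getD i 0 ≠ p.2.getD i 0 := by fun_prop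
    refine h.of_iff (X := List R × List R)
      (Q := fun p : List R × List R => ofCoeffs p.1 ≠ ofCoeffs p.2) fun p => ?_
    rw [Ne, Polynomial.ext_iff]
    simp only [coeff_ofCoeffs, not_forall, ne_eq]
  add := by
    have h : Eff fun p : List R × List R => ofCoeffs ((List.range (p.1.length + p.2.length)).map
        fun i => p.1.getD i 0 + p.2.getD i 0) := by fun_prop
    have h2 : Eff fun p : List R × List R => ofCoeffs p.1 + ofCoeffs p.2 := by
      convert h using 2 with p
      ext n
      rw [coeff_map_range_ofCoeffs, coeff_add, coeff_ofCoeffs, coeff_ofCoeffs]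
      split_ifs with hn
      · rfl
      · rw [getD_eq_zero_of_le _ (by omega), getD_eq_zero_of_le _ (by omega), add_zero]
    exact h2
  neg := by
    have h : Eff fun p : List R => ofCoeffs ((List.range p.length).map fun i => -p.getD i 0) := by
      fun_prop
    have h2 : Eff fun p : List R => -ofCoeffs p := by
      convert h using 2 with p
      ext n
      rw [coeff_map_range_ofCoeffs, coeff_neg, coeff_ofCoeffs]
      split_ifs with hn
      · rfl
      · rw [getD_eq_zero_of_le _ (by omega), neg_zero]
    exact h2
  mul := by
    have h : Eff fun p : List R × List R => ofCoeffs ((List.range (p.1.length + p.2.length)).map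
        fun n => ∑ i ∈ Finset.range (n + 1), p.1.getD i 0 * p.2.getD (n - i) 0) := by fun_prop
    have h2 : Eff fun p : List R × List R => ofCoeffs p.1 * ofCoeffs p.2 := by
      convert h using 2 with p
      ext n
      rw [coeff_map_range_ofCoeffs, coeff_mul, Finset.Nat.sum_antidiagonal_eq_sum_range_succ_mk]
      simp only [coeff_ofCoeffs]
      split_ifs with hn
      · rfl
      · refine Finset.sum_eq_zero fun i hi => ?_
        by_cases h1 : p.1.length ≤ i
        · rw [getD_eq_zero_of_le _ h1, zero_mul]
        · rw [Finset.mem_range] at hi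
          rw [getD_eq_zero_of_le p.2 (by omega), mul_zero]
    exact h2

omit [CodedRing R] in
@[fun_prop]
theorem Eff.C {f : T → R} (hf : Eff f) : Eff fun x => Polynomial.C (f x) := by
  have h : Eff fun x => _root_.ofCoeffs [f x] := by fun_prop
  convert h using 2 with x
  simp [_root_.ofCoeffs]

omit [CodedRing R] in
@[fun_prop]
theorem Eff.eval₂ {S : Type*} [CommRing S] [Coded S] [CodedRing S] {φ : R →+* S}
    (hφ : Eff fun r => φ r) {a : T → S} {f : T → R[X]} (ha : Eff a) (hf : Eff f) :
    Eff fun x => (f x).eval₂ φ (a x) := by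
  have h : Eff fun p : R[X] × S => p.1.eval₂ φ p.2 := by
    apply Eff.polynomial_ofCoeffs
    have h : Eff fun p : List R × S =>
        ∑ i ∈ Finset.range p.1.length, φ (p.1.getD i 0) * p.2 ^ i := by
      have h1 : Eff fun p : (List R × S) × ℕ => φ (p.1.1.getD p.2 0) := hφ.comp (by fun_prop)
      fun_prop
    convert h using 2 with p
    simp [_root_.ofCoeffs, eval₂_finsetSum]
  exact h.comp (hf.prodMk ha)

@[fun_prop]
theorem Eff.eval {a : T → R} {f : T → R[X]} (ha : Eff a) (hf : Eff f) :
    Eff fun x => (f x).eval (a x) := by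
  have h : Eff fun x => (f x).eval₂ (RingHom.id R) (a x) :=
    Eff.eval₂ (by simpa using Eff.id) ha hf
  exact h

omit [CodedRing R] in
@[fun_prop]
theorem Eff.polynomialMap {S : Type*} [CommRing S] [Coded S] [CodedRing S] {φ : R →+* S}
    (hφ : Eff fun r => φ r) {f : T → R[X]} (hf : Eff f) :
    Eff fun x => (f x).map φ := by
  have h : Eff fun p : S[X] × R[X] => p.2.eval₂ (Polynomial.C.comp φ) p.1 :=
    Eff.eval₂ (by simpa using Eff.C hφ) (by fun_prop) (by fun_prop)
  have h2 := h.comp ((Eff.const Polynomial.X).prodMk hf)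
  exact h2

omit [CodedRing R] in
/-- A predicate that holds for zero coefficients is tested on the finitely many coefficients of a
code. -/
theorem Semi.forall_coeff {P : T → ℕ → R → Prop} (hP : Semi fun p : T × ℕ × R => P p.1 p.2.1 p.2.2)
    (h0 : ∀ x n, P x n 0) {f : T → R[X]} (hf : Eff f) :
    Semi fun x => ∀ n, P x n ((f x).coeff n) := by
  have h : Semi fun p : R[X] × T => ∀ n, P p.2 n (p.1.coeff n) := by
    apply Semi.polynomial_ofCoeffs
    have h : Semi fun p : List R × T => AllLt p.1.length fun n => P p.2 n (p.1.getD n 0) := by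
      fun_prop
    refine h.of_iff fun p => ?_
    simp only [coeff_ofCoeffs]
    refine ⟨fun h n _ => h n, fun h n => ?_⟩
    by_cases hn : n < p.1.length
    · exact h n hn
    · rw [getD_eq_zero_of_le _ (by omega)]
      exact h0 _ _
  exact h.comp (hf.prodMk (by fun_prop))

@[fun_prop]
theorem Semi.natDegree_le {f : T → R[X]} {n : T → ℕ} (hf : Eff f) (hn : Eff n) :
    Semi fun x => (f x).natDegree ≤ n x := by
  have h : Semi fun x => ∀ i, i ≤ n x ∨ (f x).coeff i = 0 :=
    Semi.forall_coeff (P := fun x i (r : R) => i ≤ n x ∨ r = 0) (by fun_prop)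
      (fun _ _ => Or.inr rfl) hf
  refine h.of_iff fun x => ?_
  rw [natDegree_le_iff_coeff_eq_zero]
  refine forall_congr' fun i => ?_
  rw [or_iff_not_imp_left, not_le]

end polynomial

end coefficients

/-! ### Difference operators and the separation of vectors by operator functionals -/

section operators

variable {R : Type*} [CommRing R]

/-- The value at `g` of the operator `a₀ + a₁ σ + ⋯ + aₘ σᵐ`, given by its list of coefficients. -/
def opApply (σ : R → R) (a : List R) (g : R) : R :=
  ∑ i ∈ Finset.range a.length, a.getD i 0 * σ^[i] g

theorem opApply_cons (σ : R → R) (x : R) (a : List R) (g : R) :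
    opApply σ (x :: a) g = x * g + opApply σ a (σ g) := by
  simp [opApply, Finset.sum_range_succ', add_comm]

theorem opApply_eq_sum {σ : R → R} {a : List R} {n : ℕ} (h : a.length ≤ n) (g : R) :
    opApply σ a g = ∑ i ∈ Finset.range n, a.getD i 0 * σ^[i] g := by
  refine Finset.sum_subset (by simpa using h) fun i _ hi => ?_
  rw [getD_eq_zero_of_le _ (by simpa using hi), zero_mul]

variable (σ : R ≃+* R)

theorem mem_constants {c : R} : c ∈ constants σ ↔ σ c = c := Iff.rfl

/-- The operator `a₀ + a₁ σ + ⋯ + aₘ σᵐ` as a linear map over the constants. -/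
def opLin (a : List R) : R →ₗ[constants σ] R where
  toFun := opApply σ a
  map_add' x y := by simp [opApply, iterate_map_add, mul_add, Finset.sum_add_distrib]
  map_smul' c x := by
    simp only [opApply, Subring.smul_def, smul_eq_mul, iterate_constants_mul, RingHom.id_apply,
      Finset.mul_sum]
    exact Finset.sum_congr rfl fun i _ => by ring

@[simp] theorem opLin_apply (a : List R) (g : R) : opLin σ a g = opApply σ a g := rfl

theorem opApply_map_mul (u : R) (a : List R) (g : R) :
    opApply σ (a.map (u * ·)) g = u * opApply σ a g := by
  simp only [opApply, List.length_map, Finset.mul_sum]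
  refine Finset.sum_congr rfl fun i hi => ?_
  rw [Finset.mem_range] at hi
  simp [List.getD_eq_getElem?_getD, hi, mul_assoc]

theorem opApply_zero_cons_map (a : List R) (g : R) :
    opApply σ (0 :: a.map σ) g = σ (opApply σ a g) := by
  rw [opApply_cons, zero_mul, zero_add]
  simp only [opApply, List.length_map, map_sum, map_mul]
  refine Finset.sum_congr rfl fun i hi => ?_
  rw [Finset.mem_range] at hi
  rw [← Function.iterate_succ_apply, Function.iterate_succ_apply']
  simp [List.getD_eq_getElem?_getD, hi]

/-- The functional `v ↦ ∑ Lᵢ(v_{kᵢ})` on vectors that is given by a list of operators `Lᵢ`, each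
with the index `kᵢ` of the coordinate it is applied to. It is linear over the constants. -/
def functional (φ : List (List R × ℕ)) : (ℕ → R) →ₗ[constants σ] R :=
  (φ.map fun q => opLin σ q.1 ∘ₗ LinearMap.proj q.2).sum

theorem functional_nil : functional σ [] = 0 := rfl

theorem functional_cons (q : List R × ℕ) (φ : List (List R × ℕ)) (v : ℕ → R) :
    functional σ (q :: φ) v = opApply σ q.1 (v q.2) + functional σ φ v := by
  simp [functional]

theorem functional_apply (φ : List (List R × ℕ)) (v : ℕ → R) :
    functional σ φ v = (φ.map fun q => opApply σ q.1 (v q.2)).sum := by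
  induction φ with
  | nil => simp [functional_nil]
  | cons q φ ih => simp [functional_cons, ih]

theorem functional_append (φ ψ : List (List R × ℕ)) (v : ℕ → R) :
    functional σ (φ ++ ψ) v = functional σ φ v + functional σ ψ v := by
  simp [functional_apply]

theorem exists_functional_mul (u : R) (φ : List (List R × ℕ)) :
    ∃ ψ, ∀ v, functional σ ψ v = u * functional σ φ v := by
  refine ⟨φ.map fun q => (q.1.map (u * ·), q.2), fun v => ?_⟩
  induction φ with
  | nil => simp [functional_nil]
  | cons q φ ih => simp only [List.map_cons, functional_cons, ih, opApply_map_mul, mul_add]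

theorem exists_functional_map (φ : List (List R × ℕ)) :
    ∃ ψ, ∀ v, functional σ ψ v = σ (functional σ φ v) := by
  refine ⟨φ.map fun q => (0 :: q.1.map σ, q.2), fun v => ?_⟩
  induction φ with
  | nil => simp [functional_nil]
  | cons q φ ih =>
    simp only [List.map_cons, functional_cons, ih, opApply_zero_cons_map, map_add]

theorem exists_functional_coord (k : ℕ) : ∃ ψ, ∀ v, functional σ ψ v = v k :=
  ⟨[([1], k)], fun v => by simp [functional_apply, opApply]⟩

/-- A quotient of elements of `R` that is fixed by `σ` is a quotient of constants. -/
def ConstQuotients : Prop :=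
  ∀ u v : R, v ≠ 0 → σ u * v = u * σ v →
    ∃ c ∈ constants σ, ∃ d ∈ constants σ, d ≠ 0 ∧ d * u = c * v

/-- The vectors of a list `l` can be separated from a vector `p` by an operator functional, unless
`p` depends on them over the constants. This is the criterion for linear independence over the
constants by Casoratian determinants in a form that needs no determinants. -/
theorem exists_functional_or_relation [IsDomain R] (hσ : ConstQuotients σ) (l : List (ℕ → R)) :
    ∀ p : ℕ → R, (∃ φ, functional σ φ p ≠ 0 ∧ ∀ q ∈ l, functional σ φ q = 0) ∨
      ∃ d : constants σ, d ≠ 0 ∧ d • p ∈ Submodule.span (constants σ) {q | q ∈ l} := by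
  induction l with
  | nil =>
    intro p
    by_cases hp : p = 0
    · exact Or.inr ⟨1, one_ne_zero, by simp [hp]⟩
    · obtain ⟨k, hk⟩ := Function.ne_iff.1 hp
      obtain ⟨φ, hφ⟩ := exists_functional_coord σ k
      exact Or.inl ⟨φ, by simpa [hφ] using hk, by simp⟩
  | cons q l ih =>
    intro p
    have hmono : Submodule.span (constants σ) {q | q ∈ l} ≤
        Submodule.span (constants σ) {x | x ∈ q :: l} :=
      Submodule.span_mono fun x hx => List.mem_cons_of_mem _ hx
    have hkill : ∀ φ, (∀ x ∈ l, functional σ φ x = 0) →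
        ∀ x ∈ Submodule.span (constants σ) {q | q ∈ l}, functional σ φ x = 0 := by
      intro φ hφ x hx
      exact (Submodule.span_le (p := LinearMap.ker (functional σ φ))).2 (fun y hy => hφ y hy) hx
    rcases ih q with ⟨φ, hφq, hφl⟩ | ⟨d, hd, hdq⟩
    · -- `φ` kills `l` but not `q`; a functional `ψ` that kills `l` is corrected by a multiple of
      -- `φ` so that it kills `q`, too.
      by_cases hex : ∃ ψ, (∀ x ∈ l, functional σ ψ x = 0) ∧
          functional σ φ q * functional σ ψ p ≠ functional σ ψ q * functional σ φ p
      · obtain ⟨ψ, hψl, hne⟩ := hex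
        obtain ⟨ψ₁, h1⟩ := exists_functional_mul σ (functional σ φ q) ψ
        obtain ⟨ψ₂, h2⟩ := exists_functional_mul σ (-functional σ ψ q) φ
        refine Or.inl ⟨ψ₁ ++ ψ₂, ?_, ?_⟩
        · rw [functional_append, h1, h2]
          contrapose! hne
          linear_combination hne
        · intro x hx
          rw [functional_append, h1, h2]
          rcases List.mem_cons.1 hx with rfl | hx
          · ring
          · rw [hψl x hx, hφl x hx]
            ring
      · push Not at hex
        -- Otherwise the quotient `φ(p) / φ(q)` is fixed by `σ`, as `σ ∘ φ` kills `l`, too.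
        obtain ⟨ψ, hψ⟩ := exists_functional_map σ φ
        have h1 := hex ψ fun x hx => by rw [hψ, hφl x hx, map_zero]
        rw [hψ, hψ] at h1
        obtain ⟨c, hc, d, hd, hd0, hdc⟩ := hσ (functional σ φ p) (functional σ φ q) hφq
          (by linear_combination h1)
        have h2 := ih ((⟨d, hd⟩ : constants σ) • p - (⟨c, hc⟩ : constants σ) • q)
        rcases h2 with ⟨θ, hθ, hθl⟩ | ⟨d', hd', hrel⟩
        · refine absurd ?_ hθ
          have h3 := hex θ hθl
          rw [map_sub, map_smul, map_smul, Subring.smul_def, Subring.smul_def, smul_eq_mul,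
            smul_eq_mul]
          refine (mul_eq_zero.1 (?_ : functional σ φ q * _ = 0)).resolve_left hφq
          linear_combination d * h3 + functional σ θ q * hdc
        · refine Or.inr ⟨d' * ⟨d, hd⟩, mul_ne_zero hd' fun h => hd0 (congrArg Subtype.val h), ?_⟩
          have h4 : (d' * ⟨d, hd⟩) • p = d' • ((⟨d, hd⟩ : constants σ) • p -
              (⟨c, hc⟩ : constants σ) • q) + (d' * ⟨c, hc⟩) • q := by
            rw [smul_sub, smul_smul, smul_smul, sub_add_cancel]
          rw [h4]
          exact Submodule.add_mem _ (hmono hrel) (Submodule.smul_mem _ _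
            (Submodule.subset_span List.mem_cons_self))
    · rcases ih p with ⟨φ, hφp, hφl⟩ | ⟨d', hd', hdp⟩
      · refine Or.inl ⟨φ, hφp, fun x hx => ?_⟩
        rcases List.mem_cons.1 hx with rfl | hx
        · have h1 := hkill φ hφl _ hdq
          rw [map_smul, Subring.smul_def, smul_eq_mul] at h1
          exact (mul_eq_zero.1 h1).resolve_left fun h => hd (Subtype.ext h)
        · exact hφl x hx
      · exact Or.inr ⟨d', hd', hmono hdp⟩

/-! #### Polynomials with the coefficientwise automorphism -/

open Polynomial

/-- The automorphism of `R[X]` that applies `σ` to the coefficients. -/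
abbrev coeffAut : R[X] ≃+* R[X] := Polynomial.mapEquiv σ

theorem mem_constants_coeffAut {p : R[X]} :
    p ∈ constants (coeffAut σ) ↔ ∀ n, p.coeff n ∈ constants σ := by
  simp [mem_constants, Polynomial.ext_iff]

/-- Long division: a fixed quotient of polynomials has a fixed quotient of leading coefficients. -/
theorem ConstQuotients.polynomial [IsDomain R] (hσ : ConstQuotients σ) :
    ConstQuotients (coeffAut σ) := by
  have key : ∀ n : ℕ, ∀ u v : R[X], u.natDegree + v.natDegree < n → v ≠ 0 →
      coeffAut σ u * v = u * coeffAut σ v → ∃ c ∈ constants (coeffAut σ),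
        ∃ d ∈ constants (coeffAut σ), d ≠ 0 ∧ d * u = c * v := by
    intro n
    induction n with
    | zero => intro u v h; omega
    | succ n ih =>
      -- one step of the division, for `deg v ≤ deg u`
      have step : ∀ u v : R[X], u.natDegree + v.natDegree < n + 1 → u ≠ 0 → v ≠ 0 →
          v.natDegree ≤ u.natDegree → coeffAut σ u * v = u * coeffAut σ v →
          ∃ c ∈ constants (coeffAut σ), ∃ d ∈ constants (coeffAut σ), d ≠ 0 ∧ d * u = c * v := by
        intro u v hn hu hv hle huv
        have hlc := congrArg (fun p => p.coeff (u.natDegree + v.natDegree)) huv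
        have hdeg : ∀ p : R[X], (coeffAut σ p).natDegree = p.natDegree := fun p =>
          natDegree_map_eq_of_injective (f := (σ : R →+* R)) σ.injective p
        have hl : ∀ p : R[X], (coeffAut σ p).coeff p.natDegree = σ p.leadingCoeff := by
          intro p; simp
        have hlead : ∀ p : R[X], (coeffAut σ p).leadingCoeff = σ p.leadingCoeff := fun p => by
          rw [leadingCoeff, hdeg, hl]
        rw [← hdeg u, coeff_mul_degree_add_degree, hdeg u, ← hdeg v, coeff_mul_degree_add_degree,
          hlead, hlead] at hlc
        obtain ⟨c, hc, d, hd, hd0, hdc⟩ := hσ u.leadingCoeff v.leadingCoeff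
          (leadingCoeff_ne_zero.2 hv) hlc
        have hcC : C c ∈ constants (coeffAut σ) := by
          rw [mem_constants] at hc ⊢; simp [hc]
        have hdC : C d ∈ constants (coeffAut σ) := by
          rw [mem_constants] at hd ⊢; simp [hd]
        have hX : (X ^ (u.natDegree - v.natDegree) : R[X]) ∈ constants (coeffAut σ) := by
          rw [mem_constants]; simp
        set u' := C d * u - C c * X ^ (u.natDegree - v.natDegree) * v with hu'
        have huv' : coeffAut σ u' * v = u' * coeffAut σ v := by
          rw [mem_constants] at hcC hdC hX
          rw [hu', map_sub, map_mul, map_mul, map_mul, hcC, hdC, hX]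
          linear_combination C d * huv
        by_cases hz : u' = 0
        · exact ⟨_, mul_mem hcC hX, _, hdC, C_ne_zero.2 hd0, sub_eq_zero.1 hz⟩
        have hlt : u'.natDegree < u.natDegree := by
          have h1 : u'.natDegree ≤ u.natDegree := by
            refine (natDegree_sub_le _ _).trans (max_le ?_ ?_)
            · exact natDegree_C_mul_le _ _
            · refine natDegree_mul_le.trans ?_
              have := natDegree_C_mul_X_pow_le c (u.natDegree - v.natDegree)
              omega
          refine lt_of_le_of_ne h1 fun h => hz ?_
          rw [← leadingCoeff_eq_zero, leadingCoeff, h, hu', coeff_sub, coeff_C_mul]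
          have h2 : u.natDegree = v.natDegree + (u.natDegree - v.natDegree) := by omega
          have h3 : (C c * X ^ (u.natDegree - v.natDegree) * v).coeff u.natDegree =
              c * v.leadingCoeff := by
            rw [mul_assoc, coeff_C_mul, mul_comm (X ^ _)]
            nth_rewrite 2 [h2]
            rw [coeff_mul_X_pow]
            rfl
          rw [h3]
          exact sub_eq_zero.2 hdc
        obtain ⟨c', hc', d', hd', hd0', hdc'⟩ := ih u' v (by omega) hv huv'
        refine ⟨c' + d' * (C c * X ^ (u.natDegree - v.natDegree)),
          add_mem hc' (mul_mem hd' (mul_mem hcC hX)), d' * C d, mul_mem hd' hdC,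
          mul_ne_zero hd0' (C_ne_zero.2 hd0), ?_⟩
        rw [hu'] at hdc'
        linear_combination hdc'
      intro u v hn hv huv
      by_cases hu : u = 0
      · exact ⟨0, zero_mem _, 1, one_mem _, one_ne_zero, by simp [hu]⟩
      rcases le_total v.natDegree u.natDegree with hle | hle
      · exact step u v hn hu hv hle huv
      · obtain ⟨c, hc, d, hd, hd0, hdc⟩ := step v u (by omega) hv hu hle
          (by linear_combination -huv)
        refine ⟨d, hd, c, hc, ?_, hdc.symm⟩
        rintro rfl
        rw [zero_mul] at hdc
        exact mul_ne_zero hd0 hv hdc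
  intro u v hv huv
  exact key _ u v (Nat.lt_succ_self _) hv huv

end operators

/-! ### Polynomials in one monomial -/

section monomial

open Polynomial

variable {E : Type*} [CommRing E]

/-- The polynomials over `E` whose coefficients lie in the subring `A`. -/
def polySub (A : Subring E) : Subring E[X] := (Polynomial.mapRingHom A.subtype).range

theorem mem_polySub {A : Subring E} {p : E[X]} : p ∈ polySub A ↔ ∀ n, p.coeff n ∈ A := by
  rw [polySub, Polynomial.mem_map_range]
  simp

theorem polySub_mono {A B : Subring E} (h : A ≤ B) : polySub A ≤ polySub B := fun _ hp =>
  mem_polySub.2 fun n => h (mem_polySub.1 hp n)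

theorem C_mem_polySub {A : Subring E} {a : E} (ha : a ∈ A) : C a ∈ polySub A :=
  mem_polySub.2 fun n => by
    rw [coeff_C]
    split_ifs
    exacts [ha, zero_mem _]

theorem X_mem_polySub {A : Subring E} : (X : E[X]) ∈ polySub A :=
  mem_polySub.2 fun n => by
    rw [coeff_X]
    split_ifs
    exacts [one_mem _, zero_mem _]

/-- `t` is transcendental over the subring `A`. -/
def TransOver (A : Subring E) (t : E) : Prop := ∀ p ∈ polySub A, p.eval t = 0 → p = 0

theorem TransOver.mono {A B : Subring E} {t : E} (hB : TransOver B t) (h : A ≤ B) :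
    TransOver A t := fun p hp => hB p (polySub_mono h hp)

theorem TransOver.eq {A : Subring E} {t : E} (h : TransOver A t) {p q : E[X]}
    (hp : p ∈ polySub A) (hq : q ∈ polySub A) (hpq : p.eval t = q.eval t) : p = q :=
  sub_eq_zero.1 (h _ (sub_mem hp hq) (by rw [eval_sub, hpq, sub_self]))

/-- The ring `A[t]`. -/
def polyAdjoin (A : Subring E) (t : E) : Subring E := (polySub A).map (evalRingHom t)

theorem mem_polyAdjoin {A : Subring E} {t x : E} :
    x ∈ polyAdjoin A t ↔ ∃ p ∈ polySub A, p.eval t = x := Iff.rfl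

theorem self_mem_polyAdjoin (A : Subring E) (t : E) : t ∈ polyAdjoin A t :=
  ⟨X, X_mem_polySub, by simp⟩

/-- The ring `A[t, t⁻¹]`, for a unit `t` of `E`. -/
def laurentAdjoin (A : Subring E) (t : E) : Subring E where
  carrier := {x | ∃ N : ℕ, x * t ^ N ∈ polyAdjoin A t}
  mul_mem' := by
    rintro x y ⟨N, hx⟩ ⟨M, hy⟩
    refine ⟨N + M, ?_⟩
    have h := mul_mem hx hy
    rwa [mul_mul_mul_comm, ← pow_add] at h
  one_mem' := ⟨0, by simp⟩
  add_mem' := by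
    rintro x y ⟨N, hx⟩ ⟨M, hy⟩
    have ht : ∀ n : ℕ, t ^ n ∈ polyAdjoin A t := fun n =>
      pow_mem (self_mem_polyAdjoin A t) n
    refine ⟨N + M, ?_⟩
    have h := add_mem (mul_mem hx (ht M)) (mul_mem hy (ht N))
    have h2 : (x + y) * t ^ (N + M) = x * t ^ N * t ^ M + y * t ^ M * t ^ N := by ring
    rwa [h2]
  zero_mem' := ⟨0, by simp⟩
  neg_mem' := by
    rintro x ⟨N, hx⟩
    exact ⟨N, by rw [neg_mul]; exact neg_mem hx⟩

theorem mem_laurentAdjoin {A : Subring E} {t x : E} :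
    x ∈ laurentAdjoin A t ↔ ∃ N : ℕ, ∃ p ∈ polySub A, p.eval t = x * t ^ N := Iff.rfl

theorem le_polyAdjoin (A : Subring E) (t : E) : A ≤ polyAdjoin A t := fun a ha =>
  ⟨C a, C_mem_polySub ha, by simp⟩

theorem polyAdjoin_le_laurentAdjoin (A : Subring E) (t : E) :
    polyAdjoin A t ≤ laurentAdjoin A t := fun x hx => ⟨0, by simpa using hx⟩

theorem polyAdjoin_le {A B : Subring E} {t : E} (h : A ≤ B) (ht : t ∈ B) :
    polyAdjoin A t ≤ B := by
  rintro x ⟨p, hp, rfl⟩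
  change p.eval t ∈ B
  rw [eval_eq_sum_range]
  exact sum_mem fun i _ => mul_mem (h (mem_polySub.1 hp i)) (pow_mem ht i)

theorem laurentAdjoin_le {A B : Subring E} {t u : E} (h : A ≤ B) (ht : t ∈ B) (hu : u ∈ B)
    (htu : t * u = 1) : laurentAdjoin A t ≤ B := by
  rintro x ⟨N, hx⟩
  have h1 := mul_mem (polyAdjoin_le h ht hx) (pow_mem hu N)
  rwa [mul_assoc, ← mul_pow, htu, one_pow, mul_one] at h1

/-- The extension of `σ` to `E[X]` with `X ↦ α X + β`. -/
def shiftHom (σ : E ≃+* E) (α β : E) : E[X] →+* E[X] :=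
  eval₂RingHom (C.comp (σ : E →+* E)) (C α * X + C β)

variable (σ : E ≃+* E) (α β : E)

@[simp] theorem shiftHom_C (a : E) : shiftHom σ α β (C a) = C (σ a) := by
  simp [shiftHom]

@[simp] theorem shiftHom_X : shiftHom σ α β X = C α * X + C β := by
  simp [shiftHom]

theorem shiftHom_eq_sum (p : E[X]) : shiftHom σ α β p =
    ∑ i ∈ Finset.range (p.natDegree + 1), C (σ (p.coeff i)) * (C α * X + C β) ^ i := by
  conv_lhs => rw [p.as_sum_range_C_mul_X_pow]
  simp [map_sum]

theorem eval_shiftHom {σ : E ≃+* E} {α β t : E} (ht : σ t = α * t + β) (p : E[X]) :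
    (shiftHom σ α β p).eval t = σ (p.eval t) := by
  rw [shiftHom_eq_sum, eval_finsetSum, eval_eq_sum_range, map_sum]
  refine Finset.sum_congr rfl fun i _ => ?_
  simp [ht]

theorem shiftHom_mem_polySub {σ : E ≃+* E} {α β : E} {A : Subring E} (hσ : ∀ x ∈ A, σ x ∈ A)
    (hα : α ∈ A) (hβ : β ∈ A) {p : E[X]} (hp : p ∈ polySub A) : shiftHom σ α β p ∈ polySub A := by
  rw [shiftHom_eq_sum]
  exact sum_mem fun i _ => mul_mem (C_mem_polySub (hσ _ (mem_polySub.1 hp i)))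
    (pow_mem (add_mem (mul_mem (C_mem_polySub hα) X_mem_polySub) (C_mem_polySub hβ)) i)

theorem natDegree_shiftHom_le (p : E[X]) : (shiftHom σ α β p).natDegree ≤ p.natDegree := by
  rw [shiftHom_eq_sum]
  refine natDegree_sum_le_of_forall_le _ _ fun i hi => ?_
  rw [Finset.mem_range] at hi
  refine (natDegree_C_mul_le _ _).trans ((natDegree_pow_le).trans ?_)
  have := natDegree_linear_le (a := α) (b := β)
  nlinarith

theorem coeff_shiftHom_of_le {p : E[X]} {n : ℕ} (hn : p.natDegree ≤ n) :
    (shiftHom σ α β p).coeff n = α ^ n * σ (p.coeff n) := by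
  have key : ∀ i, ((C α * X + C β) ^ i : E[X]).coeff i = α ^ i := fun i => by
    have := coeff_pow_of_natDegree_le (p := C α * X + C β) (m := i) (n := 1)
      (natDegree_linear_le)
    simpa using this
  have hlow : ∀ i, ((C α * X + C β) ^ i : E[X]).natDegree ≤ i := fun i => by
    refine natDegree_pow_le.trans ?_
    have := natDegree_linear_le (a := α) (b := β)
    nlinarith
  rw [shiftHom_eq_sum, finsetSum_coeff]
  rcases hn.eq_or_lt with rfl | hn
  · rw [Finset.sum_range_succ, Finset.sum_eq_zero, zero_add, coeff_C_mul, key, mul_comm]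
    intro i hi
    rw [Finset.mem_range] at hi
    rw [coeff_C_mul, coeff_eq_zero_of_natDegree_lt ((hlow i).trans_lt hi), mul_zero]
  · rw [coeff_eq_zero_of_natDegree_lt hn, map_zero, mul_zero]
    refine Finset.sum_eq_zero fun i hi => ?_
    rw [Finset.mem_range] at hi
    rw [coeff_C_mul, coeff_eq_zero_of_natDegree_lt ((hlow i).trans_lt (by omega)), mul_zero]

theorem coeff_zero_shiftHom (p : E[X]) : (shiftHom σ α 0 p).coeff 0 = σ (p.coeff 0) := by
  have h := congrArg (fun f : E[X] →+* E => f p)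
    (show (constantCoeff.comp (shiftHom σ α 0) : E[X] →+* E) = (σ : E →+* E).comp constantCoeff by
      ext <;> simp)
  simpa using h

/-- `σ`-simplicity: no nonzero proper additive subgroup of the subring `A` is both an ideal of `A`
and stable under `σ`. -/
def SigmaSimple (σ : E ≃+* E) (A : Subring E) : Prop :=
  ∀ I : AddSubgroup E, (∀ x ∈ I, x ∈ A) → (∀ a ∈ A, ∀ x ∈ I, a * x ∈ I) → (∀ x ∈ I, σ x ∈ I) →
    (∃ x ∈ I, x ≠ 0) → (1 : E) ∈ I

/-- The inductive step for simplicity. Among the polynomials `q` of degree at most `d` with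
`q(t) ∈ I` there is one with `k`-th coefficient `1`, as those coefficients form an ideal. By the
minimality of `d` it is fixed by `σ`, hence a constant. -/
theorem one_mem_of_minimal {σ : E ≃+* E} {A : Subring E} {t α β : E} (hA : SigmaSimple σ A)
    (htr : TransOver A t) (hσA : ∀ x ∈ A, σ x ∈ A) (hα : α ∈ A) (hβ : β ∈ A)
    (hσt : σ t = α * t + β) (hconst : ∀ c ∈ constants σ, c ≠ 0 → ∃ c' ∈ A, c' * c = 1)
    {I : AddSubgroup E} (hI : ∀ a ∈ A, ∀ x ∈ I, a * x ∈ I) (hσI : ∀ x ∈ I, σ x ∈ I)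
    {d k : ℕ} (hk : ∀ q : E[X], q.natDegree ≤ d → (shiftHom σ α β q).coeff k = σ (q.coeff k))
    (hmin : ∀ r ∈ polySub A, r.natDegree ≤ d → r.coeff k = 0 → r.eval t ∈ I → r = 0)
    {p : E[X]} (hp : p ∈ polySub A) (hpd : p.natDegree ≤ d) (hpk : p.coeff k ≠ 0)
    (hpI : p.eval t ∈ I) : (1 : E) ∈ I := by
  -- the ideal of the `k`-th coefficients
  let J : AddSubgroup E :=
    { carrier := {a | ∃ q ∈ polySub A, q.natDegree ≤ d ∧ q.coeff k = a ∧ q.eval t ∈ I}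
      zero_mem' := ⟨0, zero_mem _, by simp, by simp, by simp [zero_mem]⟩
      add_mem' := by
        rintro a b ⟨q, hq, hqd, rfl, hqI⟩ ⟨r, hr, hrd, rfl, hrI⟩
        exact ⟨q + r, add_mem hq hr, (natDegree_add_le _ _).trans (max_le hqd hrd), by simp,
          by rw [eval_add]; exact add_mem hqI hrI⟩
      neg_mem' := by
        rintro a ⟨q, hq, hqd, rfl, hqI⟩
        exact ⟨-q, neg_mem hq, by rwa [natDegree_neg], by simp,
          by rw [eval_neg]; exact neg_mem hqI⟩ }
  obtain ⟨q, hq, hqd, hq1, hqI⟩ : (1 : E) ∈ J := by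
    refine hA J ?_ ?_ ?_ ⟨_, ⟨p, hp, hpd, rfl, hpI⟩, hpk⟩
    · rintro x ⟨q, hq, -, rfl, -⟩
      exact mem_polySub.1 hq k
    · rintro a ha x ⟨q, hq, hqd, rfl, hqI⟩
      exact ⟨C a * q, mul_mem (C_mem_polySub ha) hq, (natDegree_C_mul_le _ _).trans hqd, by simp,
        by rw [eval_mul, eval_C]; exact hI a ha _ hqI⟩
    · rintro x ⟨q, hq, hqd, rfl, hqI⟩
      exact ⟨shiftHom σ α β q, shiftHom_mem_polySub hσA hα hβ hq,
        (natDegree_shiftHom_le σ α β q).trans hqd, hk q hqd,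
        by rw [eval_shiftHom hσt]; exact hσI _ hqI⟩
  -- `σ(q) - q` has `k`-th coefficient zero
  have h0 : shiftHom σ α β q - q = 0 := by
    refine hmin _ (sub_mem (shiftHom_mem_polySub hσA hα hβ hq) hq) ?_ ?_ ?_
    · exact (natDegree_sub_le _ _).trans (max_le ((natDegree_shiftHom_le σ α β q).trans hqd) hqd)
    · rw [coeff_sub, hk q hqd, hq1, map_one, sub_self]
    · rw [eval_sub, eval_shiftHom hσt]
      exact sub_mem (hσI _ hqI) hqI
  have hc : q.eval t ∈ constants σ := by
    rw [mem_constants, ← eval_shiftHom hσt, sub_eq_zero.1 h0]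
  have hne : q.eval t ≠ 0 := fun h => by
    have := htr q hq h
    rw [this, coeff_zero] at hq1
    exact hpk (by rw [← mul_one (p.coeff k), ← hq1, mul_zero])
  obtain ⟨c', hc', hcc⟩ := hconst _ hc hne
  rw [← hcc]
  exact hI c' hc' _ hqI

/-- Adjoining a `Σ`-monomial preserves `σ`-simplicity: for `q` of the minimal degree `d` with
`q(t) ∈ I`, the shift preserves the coefficient of degree `k = d`. -/
theorem SigmaSimple.polyAdjoin {σ : E ≃+* E} {A : Subring E} {t β : E} (hA : SigmaSimple σ A)
    (htr : TransOver A t) (hσA : ∀ x ∈ A, σ x ∈ A) (hβ : β ∈ A) (hσt : σ t = t + β)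
    (hconst : ∀ c ∈ constants σ, c ≠ 0 → ∃ c' ∈ A, c' * c = 1) :
    SigmaSimple σ (polyAdjoin A t) := by
  intro I hIB hI hσI hne
  have hex : ∃ n, ∃ p ∈ polySub A, p ≠ 0 ∧ p.eval t ∈ I ∧ p.natDegree = n := by
    obtain ⟨x, hx, hx0⟩ := hne
    obtain ⟨p, hp, rfl⟩ := hIB x hx
    refine ⟨_, p, hp, ?_, hx, rfl⟩
    rintro rfl
    simp at hx0
  classical
  obtain ⟨p, hp, hp0, hpI, hpd⟩ := Nat.find_spec hex
  refine one_mem_of_minimal (d := Nat.find hex) (k := Nat.find hex) hA htr hσA (one_mem _) hβ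
    (by rw [hσt, one_mul]) hconst (fun a ha => hI a (le_polyAdjoin A t ha)) hσI ?_ ?_ hp hpd.le ?_
    hpI
  · intro q hq
    rw [coeff_shiftHom_of_le _ _ _ hq, one_pow, one_mul]
  · intro r hr hrd hrk hrI
    by_contra hr0
    refine Nat.find_min hex (lt_of_le_of_ne hrd fun h => hr0 ?_) ⟨r, hr, hr0, hrI, rfl⟩
    rw [← h] at hrk
    exact leadingCoeff_eq_zero.1 hrk
  · rw [← hpd]
    exact leadingCoeff_ne_zero.2 hp0

/-- Adjoining a `Π`-monomial preserves `σ`-simplicity. Here the constant coefficient `k = 0` is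
used: it cannot vanish in minimal degree, since `t` is a unit. -/
theorem SigmaSimple.laurentAdjoin {σ : E ≃+* E} {A : Subring E} {t u α : E}
    (hA : SigmaSimple σ A) (htr : TransOver A t) (hσA : ∀ x ∈ A, σ x ∈ A) (hα : α ∈ A)
    (hσt : σ t = α * t) (htu : t * u = 1)
    (hconst : ∀ c ∈ constants σ, c ≠ 0 → ∃ c' ∈ A, c' * c = 1) :
    SigmaSimple σ (laurentAdjoin A t) := by
  intro I hIB hI hσI hne
  have htB : t ∈ _root_.laurentAdjoin A t :=
    polyAdjoin_le_laurentAdjoin A t (self_mem_polyAdjoin A t)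
  have huB : u ∈ _root_.laurentAdjoin A t := ⟨1, by rw [pow_one, mul_comm, htu]; exact one_mem _⟩
  have hex : ∃ n, ∃ p ∈ polySub A, p ≠ 0 ∧ p.eval t ∈ I ∧ p.natDegree = n := by
    obtain ⟨x, hx, hx0⟩ := hne
    obtain ⟨N, p, hp, hpx⟩ := hIB x hx
    replace hpx : p.eval t = x * t ^ N := hpx
    refine ⟨_, p, hp, ?_, ?_, rfl⟩
    · rintro rfl
      apply hx0
      rw [eval_zero] at hpx
      calc x = x * t ^ N * u ^ N := by rw [mul_assoc, ← mul_pow, htu, one_pow, mul_one]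
        _ = 0 := by rw [← hpx, zero_mul]
    · rw [hpx, mul_comm]
      exact hI _ (pow_mem htB N) _ hx
  classical
  have hmin : ∀ r ∈ polySub A, r.natDegree ≤ Nat.find hex → r.coeff 0 = 0 → r.eval t ∈ I →
      r = 0 := by
    intro r hr hrd hr0 hrI
    by_contra hne0
    have hX : r = X * r.divX := by
      conv_lhs => rw [← divX_mul_X_add r, hr0, C_0, add_zero, mul_comm]
    have hd0 : r.divX ≠ 0 := fun h => hne0 (by rw [hX, h, mul_zero])
    refine Nat.find_min hex (m := r.divX.natDegree) ?_
      ⟨r.divX, mem_polySub.2 fun n => ?_, hd0, ?_, rfl⟩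
    · rw [natDegree_divX_eq_natDegree_tsub_one]
      have : r.natDegree ≠ 0 := fun h => by
        rw [eq_C_of_natDegree_eq_zero h, hr0, C_0] at hne0
        exact hne0 rfl
      omega
    · rw [coeff_divX]
      exact mem_polySub.1 hr _
    · have h1 : r.divX.eval t = u * r.eval t := by
        conv_rhs => rw [hX, eval_mul, eval_X, ← mul_assoc, mul_comm u, htu, one_mul]
      rw [h1]
      exact hI u huB _ hrI
  obtain ⟨p, hp, hp0, hpI, hpd⟩ := Nat.find_spec hex
  refine one_mem_of_minimal (d := Nat.find hex) (k := 0) hA htr hσA hα (zero_mem _)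
    (by rw [hσt, add_zero]) hconst
    (fun a ha => hI a (polyAdjoin_le_laurentAdjoin A t (le_polyAdjoin A t ha))) hσI
    (fun q _ => coeff_zero_shiftHom σ α q) hmin hp hpd.le ?_ hpI
  exact fun h => hp0 (hmin p hp hpd.le h hpI)

end monomial

/-! ### The structure of a `ΠΣ`-ring extension -/

section tower

open Polynomial

section steps

variable {E : Type*} [CommRing E] {σ : E ≃+* E} {A B : Subring E} {t : E}

theorem eval_map_subtype {φ : A[X] →+* E} (hC : ∀ a : A, φ (C a) = a) (hX : φ X = t) (p : A[X]) :
    (p.map A.subtype).eval t = φ p := by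
  rw [eval_map, ← coe_eval₂RingHom]
  congr 1
  ext <;> simp [hC, hX]

theorem transOver_of_injective {φ : A[X] →+* E} (hφ : Function.Injective φ)
    (hC : ∀ a : A, φ (C a) = a) (hX : φ X = t) : TransOver A t := by
  rintro _ ⟨p, rfl⟩ hp
  rw [coe_mapRingHom, eval_map_subtype hC hX] at hp
  rw [coe_mapRingHom, (map_eq_zero_iff φ hφ).1 hp, Polynomial.map_zero]

theorem IsSigmaMonomial.transOver (h : IsSigmaMonomial σ A B t) : TransOver A t := by
  obtain ⟨⟨φ, hφ, hC, hX, -⟩, -⟩ := h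
  exact transOver_of_injective hφ hC hX

theorem IsSigmaMonomial.eq_polyAdjoin (h : IsSigmaMonomial σ A B t) : B = polyAdjoin A t := by
  obtain ⟨⟨φ, hφ, hC, hX, rfl⟩, -⟩ := h
  ext x
  rw [mem_polyAdjoin]
  constructor
  · rintro ⟨p, rfl⟩
    exact ⟨_, ⟨p, rfl⟩, eval_map_subtype hC hX p⟩
  · rintro ⟨_, ⟨p, rfl⟩, rfl⟩
    exact ⟨p, (eval_map_subtype hC hX p).symm⟩

theorem IsSigmaMonomial.isDomain [IsDomain A] (h : IsSigmaMonomial σ A B t) : IsDomain B := by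
  obtain ⟨⟨φ, hφ, -, -, rfl⟩, -⟩ := h
  exact (RingEquiv.ofBijective φ.rangeRestrict
    ⟨fun x y hxy => hφ (congrArg Subtype.val hxy),
      φ.rangeRestrict_surjective⟩).symm.toMulEquiv.isDomain

theorem toLaurent_spec {φ : A[T;T⁻¹] →+* E} (hC : ∀ a : A, φ (LaurentPolynomial.C a) = a)
    (hT : φ (LaurentPolynomial.T 1) = t) :
    (∀ a : A, (φ.comp toLaurent) (C a) = a) ∧ (φ.comp toLaurent) X = t := by
  refine ⟨fun a => ?_, ?_⟩
  · rw [RingHom.comp_apply, toLaurent_C, hC]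
  · rw [RingHom.comp_apply, toLaurent_X, hT]

theorem IsPiMonomial.transOver (h : IsPiMonomial σ A B t) : TransOver A t := by
  obtain ⟨⟨φ, hφ, hC, hT, -⟩, -⟩ := h
  obtain ⟨h1, h2⟩ := toLaurent_spec hC hT
  exact transOver_of_injective (hφ.comp toLaurent_injective) h1 h2

theorem IsPiMonomial.exists_inv (h : IsPiMonomial σ A B t) : ∃ u ∈ B, t * u = 1 := by
  obtain ⟨⟨φ, hφ, hC, hT, rfl⟩, -⟩ := h
  refine ⟨φ (LaurentPolynomial.T (-1)), ⟨_, rfl⟩, ?_⟩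
  rw [← hT, ← map_mul, ← LaurentPolynomial.T_add]
  simp

theorem IsPiMonomial.eq_laurentAdjoin (h : IsPiMonomial σ A B t) : B = laurentAdjoin A t := by
  obtain ⟨u, huB, hu⟩ := h.exists_inv
  obtain ⟨⟨φ, hφ, hC, hT, rfl⟩, -⟩ := h
  obtain ⟨h1, h2⟩ := toLaurent_spec hC hT
  refine le_antisymm ?_ (laurentAdjoin_le ?_ ⟨_, hT⟩ huB hu)
  · rintro _ ⟨f, rfl⟩
    obtain ⟨N, p, hp⟩ := LaurentPolynomial.exists_T_pow f
    refine ⟨N, _, ⟨p, rfl⟩, ?_⟩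
    refine (eval_map_subtype h1 h2 p).trans ?_
    rw [RingHom.comp_apply, hp, map_mul, ← hT, ← map_pow, LaurentPolynomial.T_pow]
    simp
  · intro a ha
    exact ⟨_, hC ⟨a, ha⟩⟩

theorem IsPiMonomial.isDomain [IsDomain A] (h : IsPiMonomial σ A B t) : IsDomain B := by
  obtain ⟨⟨φ, hφ, -, -, rfl⟩, -⟩ := h
  exact (RingEquiv.ofBijective φ.rangeRestrict
    ⟨fun x y hxy => hφ (congrArg Subtype.val hxy),
      φ.rangeRestrict_surjective⟩).symm.toMulEquiv.isDomain

theorem polyAdjoin_stable {α β : E} (hA : ∀ x ∈ A, σ x ∈ A) (hα : α ∈ A) (hβ : β ∈ A)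
    (ht : σ t = α * t + β) : ∀ x ∈ polyAdjoin A t, σ x ∈ polyAdjoin A t := by
  rintro _ ⟨p, hp, rfl⟩
  exact ⟨_, shiftHom_mem_polySub hA hα hβ hp, eval_shiftHom ht p⟩

theorem laurentAdjoin_stable {α α' : E} (hA : ∀ x ∈ A, σ x ∈ A) (hα : α ∈ A) (hα' : α' ∈ A)
    (hαα : α' * α = 1) (ht : σ t = α * t) : ∀ x ∈ laurentAdjoin A t, σ x ∈ laurentAdjoin A t := by
  rintro x ⟨N, hx⟩
  refine ⟨N, ?_⟩
  have h1 := mul_mem (pow_mem (le_polyAdjoin A t hα') N) (polyAdjoin_stable (β := 0) hA hα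
    (zero_mem _) (by rw [ht, add_zero]) _ hx)
  rw [map_mul, map_pow, ht, mul_pow] at h1
  have h2 : α' ^ N * (σ x * (α ^ N * t ^ N)) = (α' * α) ^ N * (σ x * t ^ N) := by
    rw [mul_pow]; ring
  rwa [h2, hαα, one_pow, one_mul] at h1

/-- Transcendence of `t` over `A` survives the adjunction of an element `s` and its inverse if `s`
is transcendental over a ring that contains both `A` and `t`. -/
theorem TransOver.laurentAdjoin [IsDomain E] {s : E} (ht : TransOver A t) (hAB : A ≤ B)
    (htB : t ∈ B) (hs : TransOver B s) (hs0 : s ≠ 0) : TransOver (laurentAdjoin A s) t := by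
  intro p hp hpt
  -- a power of `s` clears the denominators of all coefficients
  obtain ⟨M, hM⟩ : ∃ M, ∀ n, p.coeff n * s ^ M ∈ polyAdjoin A s := by
    choose N hN using mem_polySub.1 hp
    refine ⟨∑ i ∈ Finset.range (p.natDegree + 1), N i, fun n => ?_⟩
    by_cases hn : n ∈ Finset.range (p.natDegree + 1)
    · rw [← Finset.add_sum_erase _ _ hn, pow_add, ← mul_assoc]
      exact mul_mem (hN n) (pow_mem (self_mem_polyAdjoin A s) _)
    · rw [coeff_eq_zero_of_natDegree_lt (by simpa [Nat.lt_succ_iff] using hn), zero_mul]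
      exact zero_mem _
  choose q hq hqs using hM
  replace hqs : ∀ n, (q n).eval s = p.coeff n * s ^ M := hqs
  let D := p.natDegree + 1
  -- exchange the roles of `s` and `t`
  let G : E[X] := ∑ n ∈ Finset.range D, C (t ^ n) * q n
  have hG : G = 0 := by
    refine hs G (sum_mem fun n _ => mul_mem (C_mem_polySub (pow_mem htB n))
      (polySub_mono hAB (hq n))) ?_
    have h1 : G.eval s = (∑ n ∈ Finset.range D, p.coeff n * t ^ n) * s ^ M := by
      simp only [G, eval_finsetSum, eval_mul, eval_C, hqs, Finset.sum_mul]
      exact Finset.sum_congr rfl fun n _ => by ring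
    rw [h1, ← eval_eq_sum_range, hpt, zero_mul]
  have hq0 : ∀ n < D, q n = 0 := by
    intro n hn
    ext z
    have h2 : (∑ i ∈ Finset.range D, C ((q i).coeff z) * X ^ i : E[X]) = 0 := by
      refine ht _ (sum_mem fun i _ => mul_mem (C_mem_polySub (mem_polySub.1 (hq i) z))
        (pow_mem X_mem_polySub i)) ?_
      have h3 := congrArg (fun r => coeff r z) hG
      simp only [G, finsetSum_coeff, coeff_C_mul, coeff_zero] at h3
      simp only [eval_finsetSum, eval_mul, eval_C, eval_pow, eval_X]
      rw [← h3]
      exact Finset.sum_congr rfl fun i _ => mul_comm _ _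
    have h4 := congrArg (fun r => coeff r n) h2
    simpa [finsetSum_coeff, coeff_C_mul, coeff_X_pow, hn] using h4
  ext n
  by_cases hn : n < D
  · have h5 := hqs n
    rw [hq0 n hn, eval_zero] at h5
    simpa [hs0] using h5.symm
  · rw [coeff_zero, coeff_eq_zero_of_natDegree_lt (by omega)]

end steps

namespace PiSigmaExtension

variable {F E : Type*} [Field F] [CommRing E] [Algebra F E] {σF : F ≃+* F} {σE : E ≃+* E} {e : ℕ}
  (T : PiSigmaExtension σF σE e)

include T in
theorem constants_subset {c : E} (hc : c ∈ constants σE) :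
    ∃ a ∈ constants σF, algebraMap F E a = c := by
  rw [T.constants_eq] at hc
  exact hc

include T in
theorem const_mem_range {c : E} (hc : c ∈ constants σE) : c ∈ (algebraMap F E).range := by
  obtain ⟨a, -, rfl⟩ := T.constants_subset hc
  exact ⟨a, rfl⟩

include T in
theorem exists_const_inv {c : E} (hc : c ∈ constants σE) (h0 : c ≠ 0) :
    ∃ c' ∈ constants σE, c' ∈ (algebraMap F E).range ∧ c' * c = 1 := by
  obtain ⟨a, ha, rfl⟩ := T.constants_subset hc
  have ha0 : a ≠ 0 := by rintro rfl; simp at h0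
  refine ⟨algebraMap F E a⁻¹, ?_, ⟨_, rfl⟩, ?_⟩
  · rw [mem_constants] at ha ⊢
    rw [T.commutes, map_inv₀, ha]
  · rw [← map_mul, inv_mul_cancel₀ ha0, map_one]

theorem range_le_ring (i : Fin (e + 1)) : (algebraMap F E).range ≤ T.ring i := by
  induction i using Fin.induction with
  | zero => rw [T.base]
  | succ i ih =>
    rcases hk : T.kind i with _ | _
    · rw [(T.pi_step i hk).eq_laurentAdjoin]
      exact (ih.trans (le_polyAdjoin _ _)).trans (polyAdjoin_le_laurentAdjoin _ _)
    · rw [(T.sigma_step i hk).eq_polyAdjoin]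
      exact ih.trans (le_polyAdjoin _ _)

/-- The rings of the tower are domains, as the extended ground ring is a field. -/
theorem isDomain_ring (i : Fin (e + 1)) : IsDomain (T.ring i) := by
  induction i using Fin.induction with
  | zero =>
    rw [T.base]
    exact (RingEquiv.ofBijective (algebraMap F E).rangeRestrict
      ⟨fun x y hxy => T.injective (congrArg Subtype.val hxy),
        (algebraMap F E).rangeRestrict_surjective⟩).symm.toMulEquiv.isDomain
  | succ i ih =>
    rcases hk : T.kind i with _ | _
    · exact (T.pi_step i hk).isDomain
    · exact (T.sigma_step i hk).isDomain

include T in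
theorem isDomain : IsDomain E := by
  have h := T.isDomain_ring (Fin.last e)
  rw [T.top] at h
  exact (Subring.topEquiv (R := E)).symm.toMulEquiv.isDomain

theorem ring_stable (i : Fin (e + 1)) : ∀ x ∈ T.ring i, σE x ∈ T.ring i := by
  induction i using Fin.induction with
  | zero =>
    rw [T.base]
    rintro _ ⟨a, rfl⟩
    exact ⟨σF a, (T.commutes a).symm⟩
  | succ i ih =>
    rcases hk : T.kind i with _ | _
    · obtain ⟨α, hα⟩ := (T.pi_step i hk).2
      rw [(T.pi_step i hk).eq_laurentAdjoin]
      refine laurentAdjoin_stable (α := ((α : T.ring i.castSucc) : E))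
        (α' := ((α⁻¹ : (T.ring i.castSucc)ˣ) : T.ring i.castSucc)) ih (Subtype.mem _)
        (Subtype.mem _) ?_ hα
      rw [← Subring.coe_mul, Units.inv_mul, Subring.coe_one]
    · rw [(T.sigma_step i hk).eq_polyAdjoin]
      exact polyAdjoin_stable (α := 1) (β := σE (T.t i) - T.t i) ih (one_mem _)
        (T.sigma_step i hk).2 (by ring)

theorem sigmaSimple_ring (i : Fin (e + 1)) : SigmaSimple σE (T.ring i) := by
  have hconst : ∀ j, ∀ c ∈ constants σE, c ≠ 0 → ∃ c' ∈ T.ring j, c' * c = 1 := by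
    intro j c hc h0
    obtain ⟨c', -, h1, h2⟩ := T.exists_const_inv hc h0
    exact ⟨c', T.range_le_ring j h1, h2⟩
  induction i using Fin.induction with
  | zero =>
    rw [T.base]
    rintro I hI hmul - ⟨x, hx, hx0⟩
    obtain ⟨a, rfl⟩ := hI x hx
    have ha0 : a ≠ 0 := by rintro rfl; simp at hx0
    have := hmul (algebraMap F E a⁻¹) ⟨_, rfl⟩ _ hx
    rwa [← map_mul, inv_mul_cancel₀ ha0, map_one] at this
  | succ i ih =>
    rcases hk : T.kind i with _ | _
    · have h := T.pi_step i hk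
      obtain ⟨α, hα⟩ := h.2
      obtain ⟨u, -, hu⟩ := h.exists_inv
      rw [h.eq_laurentAdjoin]
      exact ih.laurentAdjoin h.transOver (T.ring_stable _) (Subtype.mem _) hα hu (hconst _)
    · have h := T.sigma_step i hk
      rw [h.eq_polyAdjoin]
      exact ih.polyAdjoin h.transOver (T.ring_stable _) h.2 (by ring) (hconst _)

include T in
/-- `E` is a simple difference ring. -/
theorem sigmaSimple : SigmaSimple σE (⊤ : Subring E) := by
  rw [← T.top]
  exact T.sigmaSimple_ring _

include T in
/-- An element `w = u / v` of the field of fractions of `E` with `σ(w) - w ∈ E` lies in `E`, as its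
denominators form a nonzero ideal that is stable under `σ`. -/
theorem exists_eq_mul_of_map_sub {u v β : E} (hv : v ≠ 0)
    (h : σE u * v - u * σE v = β * (v * σE v)) : ∃ x, u = x * v ∧ σE x - x = β := by
  have := T.isDomain
  have hσv : σE v ≠ 0 := by simpa using hv
  -- the denominators of `u / v`
  let I : AddSubgroup E :=
    { carrier := {b | ∃ x, b * u = x * v}
      zero_mem' := ⟨0, by simp⟩
      add_mem' := by
        rintro a b ⟨x, hx⟩ ⟨y, hy⟩
        exact ⟨x + y, by rw [add_mul, add_mul, hx, hy]⟩
      neg_mem' := by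
        rintro a ⟨x, hx⟩
        exact ⟨-x, by rw [neg_mul, neg_mul, hx]⟩ }
  obtain ⟨x, hx⟩ : (1 : E) ∈ I := by
    refine T.sigmaSimple I (fun _ _ => trivial) ?_ ?_ ⟨v, ⟨u, mul_comm _ _⟩, hv⟩
    · rintro a - b ⟨x, hx⟩
      exact ⟨a * x, by rw [mul_assoc, hx, mul_assoc]⟩
    · rintro b ⟨x, hx⟩
      refine ⟨σE x - σE b * β, mul_right_cancel₀ hσv ?_⟩
      have h1 := congrArg σE hx
      rw [map_mul, map_mul] at h1
      linear_combination v * h1 - σE b * h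
  rw [one_mul] at hx
  refine ⟨x, hx, mul_right_cancel₀ (mul_ne_zero hv hσv) ?_⟩
  have h1 := congrArg σE hx
  rw [map_mul] at h1
  linear_combination h - v * h1 + σE v * hx

include T in
/-- The quotients of elements of `E` that are fixed by `σ` are constants of `E`. -/
theorem constQuotients : ConstQuotients σE := by
  intro u v hv h
  obtain ⟨x, hx, h1⟩ := T.exists_eq_mul_of_map_sub (β := 0) hv (by rw [h]; ring)
  refine ⟨x, sub_eq_zero.1 h1, 1, one_mem _, ?_, by rw [one_mul, hx]⟩
  have := T.isDomain
  exact one_ne_zero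

include T in
/-- For a `Σ`-monomial `t` over `A`, the element `σ(t) - t` is not of the form `σ(w) - w` with `w`
in the field of fractions of `A`. -/
theorem not_telescoping {A : Subring E} (hA : (algebraMap F E).range ≤ A) {t β u v : E}
    (ht : TransOver A t) (hσt : σE t = t + β) (hu : u ∈ A) (hv : v ∈ A) (hv0 : v ≠ 0) :
    σE u * v - u * σE v ≠ β * (v * σE v) := by
  intro h
  obtain ⟨x, hx, hxβ⟩ := T.exists_eq_mul_of_map_sub hv0 h
  -- otherwise `t - x` is a constant, and `v x = u` is an equation of degree `1` for `t` over `A`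
  have hc : t - x ∈ constants σE := by
    rw [mem_constants, map_sub, hσt]
    linear_combination -hxβ
  have h0 := ht (C v * X - C (v * (t - x) + u)) (sub_mem (mul_mem (C_mem_polySub hv) X_mem_polySub)
    (C_mem_polySub (add_mem (mul_mem hv (hA (T.const_mem_range hc))) hu))) (by simp [hx]; ring)
  have h1 := congrArg (fun p => coeff p 1) h0
  simp at h1
  exact hv0 h1

end PiSigmaExtension

end tower

/-! ### The tower with its `Π`-monomials moved to the bottom -/

namespace PiSigmaExtension

open Polynomial

variable {F E : Type*} [Field F] [CommRing E] [Algebra F E] {σF : F ≃+* F} {σE : E ≃+* E} {e : ℕ}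
  (T : PiSigmaExtension σF σE e)

open Classical in
/-- `A[tₖ, tₖ⁻¹]` if `tₖ` is a `Π`-monomial, and `A` otherwise. -/
def adjoinPi (k : ℕ) (A : Subring E) : Subring E :=
  if h : ∃ _ : k < e, T.kind ⟨k, ‹_›⟩ = .pi then laurentAdjoin A (T.t ⟨k, h.1⟩) else A

open Classical in
/-- `A[tₖ]` if `tₖ` is a `Σ`-monomial, and `A` otherwise. -/
def adjoinSigma (k : ℕ) (A : Subring E) : Subring E :=
  if h : ∃ _ : k < e, T.kind ⟨k, ‹_›⟩ = .sigma then polyAdjoin A (T.t ⟨k, h.1⟩) else A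

/-- The ring generated over `F` by the `Π`-monomials among `t₀, …, tₖ₋₁` and their inverses. -/
def piRing : ℕ → Subring E
  | 0 => (algebraMap F E).range
  | k + 1 => T.adjoinPi k (piRing k)

/-- The ring generated over `F` by all `Π`-monomials, their inverses, and the `Σ`-monomials among
`t₀, …, tₖ₋₁`. -/
def sigmaRing : ℕ → Subring E
  | 0 => T.piRing e
  | k + 1 => T.adjoinSigma k (sigmaRing k)

/-- The ring generated over the `k`-th ring of the tower by the `Π`-monomials among
`tₖ, …, tₗ₋₁` and their inverses. It contains the first `k` rings of the reordered tower, and serves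
to show that `tₖ` is transcendental over them. -/
def mixedRing (k : Fin e) : ℕ → Subring E
  | 0 => T.ring k.castSucc
  | l + 1 => if (k : ℕ) ≤ l then T.adjoinPi l (mixedRing k l) else T.ring k.castSucc

theorem adjoinPi_of_pi {i : Fin e} (h : T.kind i = .pi) (A : Subring E) :
    T.adjoinPi i A = laurentAdjoin A (T.t i) := dif_pos (⟨i.2, h⟩ : ∃ _ : (i : ℕ) < e, _)

theorem adjoinPi_of_not {k : ℕ} (h : ¬ ∃ hk : k < e, T.kind ⟨k, hk⟩ = .pi) (A : Subring E) :
    T.adjoinPi k A = A := dif_neg h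

theorem adjoinSigma_of_sigma {i : Fin e} (h : T.kind i = .sigma) (A : Subring E) :
    T.adjoinSigma i A = polyAdjoin A (T.t i) := dif_pos (⟨i.2, h⟩ : ∃ _ : (i : ℕ) < e, _)

theorem adjoinSigma_of_not {k : ℕ} (h : ¬ ∃ hk : k < e, T.kind ⟨k, hk⟩ = .sigma) (A : Subring E) :
    T.adjoinSigma k A = A := dif_neg h

theorem adjoinPi_mono (k : ℕ) {A B : Subring E} (h : A ≤ B) :
    T.adjoinPi k A ≤ T.adjoinPi k B := by
  unfold adjoinPi
  split_ifs
  · rintro x ⟨N, p, hp, hx⟩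
    exact ⟨N, p, polySub_mono h hp, hx⟩
  · exact h

theorem le_adjoinPi (k : ℕ) (A : Subring E) : A ≤ T.adjoinPi k A := by
  unfold adjoinPi
  split_ifs
  · exact (le_polyAdjoin _ _).trans (polyAdjoin_le_laurentAdjoin _ _)
  · exact le_rfl

theorem le_adjoinSigma (k : ℕ) (A : Subring E) : A ≤ T.adjoinSigma k A := by
  unfold adjoinSigma
  split_ifs
  · exact le_polyAdjoin _ _
  · exact le_rfl

theorem range_le_piRing (k : ℕ) : (algebraMap F E).range ≤ T.piRing k := by
  induction k with
  | zero => exact le_rfl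
  | succ k ih => exact ih.trans (T.le_adjoinPi k _)

theorem piRing_mono : Monotone T.piRing := monotone_nat_of_le_succ fun k => T.le_adjoinPi k _

theorem sigmaRing_mono : Monotone T.sigmaRing :=
  monotone_nat_of_le_succ fun k => T.le_adjoinSigma k _

theorem range_le_sigmaRing (k : ℕ) : (algebraMap F E).range ≤ T.sigmaRing k :=
  (T.range_le_piRing e).trans (T.sigmaRing_mono (Nat.zero_le k))

theorem ring_succ_of_pi {i : Fin e} (h : T.kind i = .pi) :
    T.ring i.succ = laurentAdjoin (T.ring i.castSucc) (T.t i) := (T.pi_step i h).eq_laurentAdjoin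

theorem ring_succ_of_sigma {i : Fin e} (h : T.kind i = .sigma) :
    T.ring i.succ = polyAdjoin (T.ring i.castSucc) (T.t i) := (T.sigma_step i h).eq_polyAdjoin

theorem ring_castSucc_le_succ (i : Fin e) : T.ring i.castSucc ≤ T.ring i.succ := by
  rcases h : T.kind i with _ | _
  · rw [T.ring_succ_of_pi h]
    exact (le_polyAdjoin _ _).trans (polyAdjoin_le_laurentAdjoin _ _)
  · rw [T.ring_succ_of_sigma h]
    exact le_polyAdjoin _ _

theorem ring_mono : Monotone T.ring := Fin.monotone_iff_le_succ.2 T.ring_castSucc_le_succ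

theorem t_mem_ring (i : Fin e) : T.t i ∈ T.ring i.succ := by
  rcases h : T.kind i with _ | _
  · rw [T.ring_succ_of_pi h]
    exact polyAdjoin_le_laurentAdjoin _ _ (self_mem_polyAdjoin _ _)
  · rw [T.ring_succ_of_sigma h]
    exact self_mem_polyAdjoin _ _

theorem transOver_ring (i : Fin e) : TransOver (T.ring i.castSucc) (T.t i) := by
  rcases h : T.kind i with _ | _
  · exact (T.pi_step i h).transOver
  · exact (T.sigma_step i h).transOver

theorem piRing_le_ring (i : Fin (e + 1)) : T.piRing i ≤ T.ring i := by
  induction i using Fin.induction with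
  | zero => exact T.base.ge
  | succ i ih =>
    rw [Fin.val_succ]
    change T.adjoinPi i (T.piRing i) ≤ _
    rcases h : T.kind i with _ | _
    · rw [T.ring_succ_of_pi h, ← T.adjoinPi_of_pi h]
      exact T.adjoinPi_mono _ ih
    · rw [T.adjoinPi_of_not (by simp [h])]
      exact ih.trans (T.ring_castSucc_le_succ i)

theorem transOver_piRing (i : Fin e) : TransOver (T.piRing i) (T.t i) :=
  (T.transOver_ring i).mono (T.piRing_le_ring i.castSucc)

theorem t_mem_piRing {i : Fin e} (h : T.kind i = .pi) : T.t i ∈ T.piRing (i + 1) := by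
  change _ ∈ T.adjoinPi i _
  rw [T.adjoinPi_of_pi h]
  exact polyAdjoin_le_laurentAdjoin _ _ (self_mem_polyAdjoin _ _)

theorem inv_mem_piRing {i : Fin e} (h : T.kind i = .pi) {u : E} (hu : T.t i * u = 1) :
    u ∈ T.piRing (i + 1) := by
  change _ ∈ T.adjoinPi i _
  rw [T.adjoinPi_of_pi h]
  exact ⟨1, by rw [pow_one, mul_comm, hu]; exact one_mem _⟩

theorem ring_le_sigmaRing (i : Fin (e + 1)) : T.ring i ≤ T.sigmaRing i := by
  induction i using Fin.induction with
  | zero => exact T.base.le.trans (T.range_le_piRing e)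
  | succ i ih =>
    rw [Fin.val_succ]
    rcases h : T.kind i with _ | _
    · obtain ⟨u, -, hu⟩ := (T.pi_step i h).exists_inv
      have hle : T.piRing (i + 1) ≤ T.sigmaRing (i + 1) :=
        (T.piRing_mono i.2).trans (T.sigmaRing_mono (Nat.zero_le _))
      rw [T.ring_succ_of_pi h]
      exact laurentAdjoin_le (ih.trans (T.sigmaRing_mono (Nat.le_succ _)))
        (hle (T.t_mem_piRing h)) (hle (T.inv_mem_piRing h hu)) hu
    · change _ ≤ T.adjoinSigma i _
      rw [T.ring_succ_of_sigma h, T.adjoinSigma_of_sigma h]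
      exact polyAdjoin_le (ih.trans (le_polyAdjoin _ _)) (self_mem_polyAdjoin _ _)

theorem sigmaRing_top : T.sigmaRing e = ⊤ := by
  rw [eq_top_iff, ← T.top]
  exact T.ring_le_sigmaRing (Fin.last e)

theorem mixedRing_of_le (k : Fin e) {l : ℕ} (h : l ≤ k) : T.mixedRing k l = T.ring k.castSucc := by
  cases l with
  | zero => rfl
  | succ l => exact if_neg (by omega)

theorem mixedRing_succ (k : Fin e) {l : ℕ} (h : k ≤ l) :
    T.mixedRing k (l + 1) = T.adjoinPi l (T.mixedRing k l) := if_pos h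

theorem ring_le_mixedRing (k : Fin e) (l : ℕ) : T.ring k.castSucc ≤ T.mixedRing k l := by
  induction l with
  | zero => exact le_rfl
  | succ l ih =>
    by_cases h : (k : ℕ) ≤ l
    · rw [T.mixedRing_succ k h]
      exact ih.trans (T.le_adjoinPi l _)
    · exact (T.mixedRing_of_le k (by omega)).ge

theorem mixedRing_le_ring (k : Fin e) {l : ℕ} (hk : k ≤ l) (hl : l < e + 1) :
    T.mixedRing k l ≤ T.ring ⟨l, hl⟩ := by
  induction l, hk using Nat.le_induction with
  | base => exact (T.mixedRing_of_le k le_rfl).le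
  | succ l hkl ih =>
    rw [T.mixedRing_succ k hkl]
    have hle : l < e := by omega
    by_cases h : T.kind ⟨l, hle⟩ = .pi
    · refine (T.adjoinPi_mono l (ih (by omega))).trans ?_
      rw [show T.adjoinPi l _ = _ from T.adjoinPi_of_pi h _]
      exact (T.ring_succ_of_pi h).ge
    · rw [T.adjoinPi_of_not (by simp [h])]
      exact (ih (by omega)).trans (T.ring_castSucc_le_succ ⟨l, hle⟩)

theorem piRing_le_mixedRing (k : Fin e) (l : ℕ) : T.piRing l ≤ T.mixedRing k l := by
  induction l with
  | zero => exact (T.range_le_ring _)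
  | succ l ih =>
    by_cases h : (k : ℕ) ≤ l
    · rw [T.mixedRing_succ k h]
      exact T.adjoinPi_mono l ih
    · rw [T.mixedRing_of_le k (by omega)]
      refine (T.piRing_le_ring ⟨l + 1, by omega⟩).trans (T.ring_mono ?_)
      rw [Fin.le_def]
      simp only [Fin.val_castSucc]
      omega

theorem sigmaRing_le_mixedRing (k : Fin e) {j : ℕ} (hj : j ≤ k) :
    T.sigmaRing j ≤ T.mixedRing k e := by
  induction j with
  | zero => exact T.piRing_le_mixedRing k e
  | succ j ih =>
    change T.adjoinSigma j _ ≤ _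
    have hje : j < e := by omega
    by_cases h : T.kind ⟨j, hje⟩ = .sigma
    · rw [show T.adjoinSigma j _ = _ from T.adjoinSigma_of_sigma h _]
      refine polyAdjoin_le (ih (by omega)) (T.ring_le_mixedRing k e (T.ring_mono ?_
        (T.t_mem_ring ⟨j, hje⟩)))
      rw [Fin.le_def]
      simp only [Fin.val_castSucc, Fin.val_succ]
      omega
    · rw [T.adjoinSigma_of_not (by simp [h])]
      exact ih (by omega)

/-- A `Σ`-monomial stays transcendental when later `Π`-monomials are adjoined below it. -/
theorem transOver_mixedRing {k : Fin e} (hk : T.kind k = .sigma) {l : ℕ} (hkl : k ≤ l)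
    (hl : l ≤ e) : TransOver (T.mixedRing k l) (T.t k) := by
  have := T.isDomain
  induction l, hkl using Nat.le_induction with
  | base =>
    rw [T.mixedRing_of_le k le_rfl]
    exact T.transOver_ring k
  | succ l hkl ih =>
    have hle : l < e := by omega
    rw [T.mixedRing_succ k hkl]
    by_cases h : T.kind ⟨l, hle⟩ = .pi
    · have hne : (k : ℕ) ≠ l := by
        rintro rfl
        rw [hk] at h
        cases h
      rw [show T.adjoinPi l _ = _ from T.adjoinPi_of_pi h _]
      obtain ⟨u, -, hu⟩ := (T.pi_step _ h).exists_inv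
      refine (ih (by omega)).laurentAdjoin (T.mixedRing_le_ring k hkl (by omega))
        (T.ring_mono ?_ (T.t_mem_ring k)) (T.transOver_ring ⟨l, hle⟩)
        (left_ne_zero_of_mul_eq_one hu)
      rw [Fin.le_def]
      simp only [Fin.val_succ]
      omega
    · rw [T.adjoinPi_of_not (by simp [h])]
      exact ih (by omega)

theorem transOver_sigmaRing {k : Fin e} (hk : T.kind k = .sigma) :
    TransOver (T.sigmaRing k) (T.t k) :=
  (T.transOver_mixedRing hk k.2.le le_rfl).mono (T.sigmaRing_le_mixedRing k le_rfl)

/-- As `σ(tᵢ)/tᵢ` lies in `F`, the `Π`-monomials generate difference rings without the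
`Σ`-monomials. -/
theorem piRing_stable (hPi : ∀ i, T.kind i = MonomialKind.pi →
      ∃ α : F, α ≠ 0 ∧ σE (T.t i) = algebraMap F E α * T.t i) (k : ℕ) :
    ∀ x ∈ T.piRing k, σE x ∈ T.piRing k := by
  induction k with
  | zero =>
    rintro _ ⟨a, rfl⟩
    exact ⟨σF a, (T.commutes a).symm⟩
  | succ k ih =>
    change ∀ x ∈ T.adjoinPi k _, σE x ∈ T.adjoinPi k _
    by_cases h : ∃ hk : k < e, T.kind ⟨k, hk⟩ = .pi
    · obtain ⟨hk, h⟩ := h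
      rw [show T.adjoinPi k _ = _ from T.adjoinPi_of_pi h _]
      obtain ⟨α, hα, hαt⟩ := hPi _ h
      refine laurentAdjoin_stable (α' := algebraMap F E α⁻¹) ih (T.range_le_piRing k ⟨α, rfl⟩)
        (T.range_le_piRing k ⟨_, rfl⟩) ?_ hαt
      rw [← map_mul, inv_mul_cancel₀ hα, map_one]
    · rwa [T.adjoinPi_of_not h]

theorem sigma_sub_mem {k : Fin e} (h : T.kind k = .sigma) :
    σE (T.t k) - T.t k ∈ T.sigmaRing k :=
  T.ring_le_sigmaRing k.castSucc (T.sigma_step k h).2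

theorem sigmaRing_stable (hPi : ∀ i, T.kind i = MonomialKind.pi →
      ∃ α : F, α ≠ 0 ∧ σE (T.t i) = algebraMap F E α * T.t i) (k : ℕ) :
    ∀ x ∈ T.sigmaRing k, σE x ∈ T.sigmaRing k := by
  induction k with
  | zero => exact T.piRing_stable hPi e
  | succ k ih =>
    change ∀ x ∈ T.adjoinSigma k _, σE x ∈ T.adjoinSigma k _
    by_cases h : ∃ hk : k < e, T.kind ⟨k, hk⟩ = .sigma
    · obtain ⟨hk, h⟩ := h
      rw [show T.adjoinSigma k _ = _ from T.adjoinSigma_of_sigma h _]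
      exact polyAdjoin_stable (α := 1) (β := σE (T.t ⟨k, hk⟩) - T.t ⟨k, hk⟩) ih (one_mem _)
        (T.sigma_sub_mem h) (by ring)
    · rwa [T.adjoinSigma_of_not h]

open Classical in
/-- The unit `tᵢ` of `E` for a `Π`-monomial `tᵢ`; for a `Σ`-monomial, the unit `1`. -/
def piUnit (i : Fin e) : Eˣ :=
  if h : T.kind i = .pi then
    Units.mkOfMulEqOne _ _ (Classical.choose_spec (T.pi_step i h).exists_inv).2 else 1

theorem piUnit_of_pi {i : Fin e} (h : T.kind i = .pi) : (T.piUnit i : E) = T.t i := by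
  rw [piUnit, dif_pos h]
  rfl

theorem piUnit_of_sigma {i : Fin e} (h : T.kind i = .sigma) : T.piUnit i = 1 :=
  dif_neg (by simp [h])

/-- The monomial `∏ tᵢ ^ zᵢ` in the `Π`-monomials. -/
def piMonomial (z : Fin e → ℤ) : Eˣ := ∏ i, T.piUnit i ^ z i

theorem piMonomial_add (z w : Fin e → ℤ) :
    T.piMonomial (z + w) = T.piMonomial z * T.piMonomial w := by
  simp [piMonomial, zpow_add, Finset.prod_mul_distrib]

theorem piMonomial_single (i : Fin e) (n : ℤ) :
    T.piMonomial (Pi.single i n) = T.piUnit i ^ n := by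
  rw [piMonomial, Finset.prod_eq_single i]
  · simp
  · intro j _ hj
    simp [Pi.single_eq_of_ne hj]
  · simp

theorem piMonomial_mem {z : Fin e → ℤ} {k : ℕ} (hz : ∀ i : Fin e, k ≤ i → z i = 0) :
    (T.piMonomial z : E) ∈ T.piRing k := by
  rw [piMonomial, Units.coe_prod]
  refine prod_mem fun i _ => ?_
  by_cases hi : k ≤ i
  · simp [hz i hi, one_mem]
  rcases h : T.kind i with _ | _
  · have hle : T.piRing (i + 1) ≤ T.piRing k := T.piRing_mono (by omega)
    rcases z i with n | n
    · rw [Int.ofNat_eq_natCast, zpow_natCast, Units.val_pow_eq_pow_val, T.piUnit_of_pi h]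
      exact pow_mem (hle (T.t_mem_piRing h)) n
    · rw [zpow_negSucc, ← inv_pow, Units.val_pow_eq_pow_val]
      refine pow_mem (hle (T.inv_mem_piRing h ?_)) _
      rw [← T.piUnit_of_pi h, Units.mul_inv]
  · simp [T.piUnit_of_sigma h, one_mem]

/-- The `Π`-monomials are multiplicatively independent modulo `F*`. -/
theorem eq_zero_of_piMonomial_mem {z : Fin e → ℤ}
    (hmem : (T.piMonomial z : E) ∈ (algebraMap F E).range) :
    ∀ i, T.kind i = .pi → z i = 0 := by
  have := T.isDomain
  have key : ∀ n ≤ e, ∀ i : Fin e, n ≤ i → T.kind i = .pi → z i = 0 := by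
    intro n hn
    induction hm : e - n generalizing n with
    | zero => intro i hi; omega
    | succ m ih =>
      have hgt := ih (n + 1) (by omega) (by omega)
      intro i hi hpi
      rcases hi.eq_or_lt with rfl | hlt
      swap
      · exact hgt i hlt hpi
      by_contra hne
      -- the remaining monomial has `tᵢ` as its last factor, over which it would be algebraic
      let w' : Fin e → ℤ := fun j => if (j : ℕ) < i then z j else 0
      have hzw : T.piMonomial z = T.piMonomial w' * T.piUnit i ^ z i := by
        rw [← T.piMonomial_single, ← T.piMonomial_add, piMonomial, piMonomial]
        refine Finset.prod_congr rfl fun j _ => ?_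
        rcases hkj : T.kind j with _ | _
        · congr 1
          rw [Pi.add_apply]
          rcases lt_trichotomy j i with h | rfl | h
          · simp [w', h, Pi.single_eq_of_ne h.ne]
          · simp [w']
          · simp [w', Pi.single_eq_of_ne h.ne', hgt j (by rw [Fin.lt_def] at h; omega) hkj]
        · simp [T.piUnit_of_sigma hkj]
      have hw' : (T.piMonomial w' : E) ∈ T.piRing i := T.piMonomial_mem fun j hj => by
        simp only [w']
        rw [if_neg (by omega)]
      have htr := T.transOver_piRing i
      have hmem' := T.range_le_piRing i hmem
      rcases hzi : z i with n | n
      · have hn : n ≠ 0 := by rintro rfl; exact hne (by rw [hzi]; rfl)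
        have h0 := htr (C (T.piMonomial w' : E) * X ^ n - C (T.piMonomial z : E))
          (sub_mem (mul_mem (C_mem_polySub hw') (pow_mem X_mem_polySub n))
            (C_mem_polySub hmem')) (by
            rw [hzw, hzi, Int.ofNat_eq_natCast, zpow_natCast]
            simp [T.piUnit_of_pi hpi])
        have h1 := congrArg (fun p => coeff p n) h0
        simp [coeff_C, hn] at h1
      · have h0 := htr (C (T.piMonomial z : E) * X ^ (n + 1) - C (T.piMonomial w' : E))
          (sub_mem (mul_mem (C_mem_polySub hmem') (pow_mem X_mem_polySub _))
            (C_mem_polySub hw')) (by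
            rw [hzw, hzi, zpow_negSucc]
            simp only [← T.piUnit_of_pi hpi, ← inv_pow, Units.val_mul, Units.val_pow_eq_pow_val,
              eval_sub, eval_mul, eval_C, eval_pow, eval_X]
            rw [mul_assoc, ← mul_pow, Units.inv_mul, one_pow, mul_one, sub_self])
        have h1 := congrArg (fun p => coeff p (n + 1)) h0
        simp at h1
  exact fun i => key 0 (Nat.zero_le e) i (Nat.zero_le _)

end PiSigmaExtension

/-! ### Covers of the solutions of parameterized equations -/

section span

variable {R : Type*} [CommRing R] (σ : R ≃+* R)

/-- The span of the members of a list over the constants. -/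
def listSpan (l : List R) : Submodule (constants σ) R := Submodule.span (constants σ) {x | x ∈ l}

variable {σ}

theorem mem_listSpan_of_mem {l : List R} {x : R} (h : x ∈ l) : x ∈ listSpan σ l :=
  Submodule.subset_span h

theorem listSpan_le {l : List R} {M : Submodule (constants σ) R} :
    listSpan σ l ≤ M ↔ ∀ x ∈ l, x ∈ M := Submodule.span_le

theorem listSpan_mono {l l' : List R} (h : ∀ x ∈ l, x ∈ l') : listSpan σ l ≤ listSpan σ l' :=
  Submodule.span_mono h

theorem const_mul_mem {M : Submodule (constants σ) R} {c x : R} (hc : c ∈ constants σ)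
    (hx : x ∈ M) : c * x ∈ M := M.smul_mem ⟨c, hc⟩ hx

theorem mem_listSpan {l : List R} {x : R} : x ∈ listSpan σ l ↔
    ∃ c : List R, (∀ y ∈ c, y ∈ constants σ) ∧
      x = ∑ i ∈ Finset.range l.length, c.getD i 0 * l.getD i 0 := by
  constructor
  · intro h
    induction l generalizing x with
    | nil =>
      refine ⟨[], by simp, ?_⟩
      have : listSpan σ ([] : List R) = ⊥ := by simp [listSpan]
      rw [this, Submodule.mem_bot] at h
      simpa using h
    | cons a l ih =>
      have h1 : listSpan σ (a :: l) = Submodule.span _ {a} ⊔ listSpan σ l := by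
        rw [listSpan, listSpan, ← Submodule.span_union]
        congr 1
        ext y
        simp
      rw [h1, Submodule.mem_sup] at h
      obtain ⟨y, hy, z, hz, rfl⟩ := h
      obtain ⟨c, rfl⟩ := Submodule.mem_span_singleton.1 hy
      obtain ⟨d, hd, rfl⟩ := ih hz
      refine ⟨(c : R) :: d, ?_, ?_⟩
      · rintro y (_ | ⟨_, hy⟩)
        exacts [c.2, hd y hy]
      · rw [List.length_cons, Finset.sum_range_succ']
        simp [Subring.smul_def, add_comm]
  · rintro ⟨c, hc, rfl⟩
    refine Submodule.sum_mem _ fun i hi => ?_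
    rw [Finset.mem_range] at hi
    refine const_mul_mem ?_ (mem_listSpan_of_mem ?_)
    · by_cases h : i < c.length
      · rw [List.getD_eq_getElem _ _ h]
        exact hc _ (List.getElem_mem h)
      · rw [getD_eq_zero_of_le _ (by omega)]
        exact zero_mem _
    · rw [List.getD_eq_getElem _ _ hi]
      exact List.getElem_mem hi

theorem map_mem_listSpan (f : R →ₗ[constants σ] R) {l : List R} {x : R} (hx : x ∈ listSpan σ l) :
    f x ∈ listSpan σ (l.map f) := by
  have h : listSpan σ l ≤ (listSpan σ (l.map f)).comap f :=
    listSpan_le.2 fun y hy => mem_listSpan_of_mem (List.mem_map_of_mem hy)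
  exact h hx

theorem mul_mem_listSpan {l : List R} {x : R} (u : R) (hx : x ∈ listSpan σ l) :
    x * u ∈ listSpan σ (l.map (· * u)) := by
  have h : listSpan σ l ≤ (listSpan σ (l.map (· * u))).comap
      (LinearMap.mulRight (constants σ) u) :=
    listSpan_le.2 fun y hy => mem_listSpan_of_mem (List.mem_map_of_mem (f := (· * u)) hy)
  exact h hx

@[fun_prop]
theorem Semi.mem_listSpan {X : Type*} [Coded X] [Coded R] [CodedRing R]
    (hσ : Eff fun x : R => σ x) {f : X → R} {l : X → List R} (hf : Eff f) (hl : Eff l) :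
    Semi fun x => f x ∈ listSpan σ (l x) := by
  have h : Semi fun x => ∃ c : List R, AllMem c (fun y => σ y = y) ∧
    f x = ∑ i ∈ Finset.range (l x).length, c.getD i 0 * (l x).getD i 0 := by fun_prop
  exact h.of_iff fun x => _root_.mem_listSpan

/-- Every `g ∈ S` that the operator `a` maps into the span of `f` lies in the span of `G`. -/
def Covers (σ : R ≃+* R) (S : Set R) (a f G : List R) : Prop :=
  ∀ g ∈ S, opApply σ a g ∈ listSpan σ f → g ∈ listSpan σ G

/-- Covers of the solutions in `B` can be found by a search that certifies its result: there is a
semidecidable relation that only holds between equations and covers of their solutions, and that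
holds for at least one cover of each equation. -/
def CanCover [Coded R] (σ : R ≃+* R) (B : Subring R) : Prop :=
  ∃ P : List R → List R → List R → Prop,
    (Semi fun x : List R × List R × List R => P x.1 x.2.1 x.2.2) ∧
    (∀ a f G, P a f G → (∀ g ∈ G, g ∈ B) ∧ Covers σ B a f G) ∧
    ∀ a f, (∀ x ∈ a, x ∈ B) → (∃ x ∈ a, x ≠ 0) → (∀ x ∈ f, x ∈ B) → ∃ G, P a f G

end span

/-! ### Polynomial solutions of bounded degree -/

section bounded

open Polynomial

variable {E : Type*} [CommRing E]

theorem iterate_mul_comp {S : Type*} [CommRing S] (σ : S →+* S) (c x : S) (i : ℕ) :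
    (fun y => c * σ y)^[i] x = (∏ j ∈ Finset.range i, σ^[j] c) * σ^[i] x := by
  induction i with
  | zero => simp
  | succ i ih =>
    rw [Function.iterate_succ_apply', ih, map_mul, map_prod, ← Function.iterate_succ_apply' σ i x,
      Finset.prod_range_succ' (n := i), ← mul_assoc]
    simp only [← Function.iterate_succ_apply' σ, Function.iterate_zero, id]
    ring

/-- The operator `a` in which `σ` is replaced by `c σ`. -/
def twist (σ : E ≃+* E) (c : E) (a : List E) : List E :=
  (List.range a.length).map fun i => a.getD i 0 * ∏ j ∈ Finset.range i, σ^[j] c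

theorem opApply_twist (σ : E ≃+* E) (c : E) (a : List E) (x : E) :
    opApply σ (twist σ c a) x = opApply (fun y => c * σ y) a x := by
  have h : (twist σ c a).length = a.length := by simp [twist]
  rw [opApply, opApply, h]
  refine Finset.sum_congr rfl fun i hi => ?_
  rw [Finset.mem_range] at hi
  have h1 := iterate_mul_comp (σ : E →+* E) c x i
  simp only [RingEquiv.coe_toRingHom] at h1
  rw [h1, twist]
  simp [List.getD_eq_getElem?_getD, hi, mul_assoc]

/-- Solutions of the form `x θ`, with `σ(θ) = c θ`, are found by replacing `σ` with `c σ`. -/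
theorem opApply_mul_of_map_eq {σ : E ≃+* E} {c θ : E} (hθ : σ θ = c * θ) (a : List E) (x : E) :
    opApply σ a (x * θ) = opApply (fun y => c * σ y) a x * θ := by
  rw [opApply, opApply, Finset.sum_mul]
  refine Finset.sum_congr rfl fun i hi => ?_
  clear hi
  rw [mul_assoc]
  congr 1
  induction i generalizing x with
  | zero => rfl
  | succ i ih =>
    rw [Function.iterate_succ_apply, Function.iterate_succ_apply, map_mul, hθ, ← ih]
    congr 1
    ring

/-- An operator with polynomial coefficients, acting on polynomials by `X ↦ α X + β` and an
additional factor `c`. -/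
def polyOp (σ : E ≃+* E) (α β c : E) (A : List E[X]) (p : E[X]) : E[X] :=
  opApply (fun x => C c * shiftHom σ α β x) A p

variable {σ : E ≃+* E} {α β c t : E}

theorem eval_polyOp (ht : σ t = α * t + β) (A : List E[X]) (p : E[X]) :
    (polyOp σ α β c A p).eval t = opApply (fun y => c * σ y) (A.map (eval t)) (p.eval t) := by
  rw [polyOp, opApply, opApply, eval_finsetSum, List.length_map]
  refine Finset.sum_congr rfl fun i hi => ?_
  rw [Finset.mem_range] at hi
  rw [eval_mul]
  congr 1
  · simp [List.getD_eq_getElem?_getD, hi]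
  · clear hi
    induction i generalizing p with
    | zero => rfl
    | succ i ih =>
      rw [Function.iterate_succ_apply, Function.iterate_succ_apply, ih]
      simp [eval_shiftHom ht]

theorem natDegree_iterate_le {n : ℕ} {p : E[X]} (hp : p.natDegree ≤ n) (i : ℕ) :
    ((fun x => C c * shiftHom σ α β x)^[i] p).natDegree ≤ n := by
  induction i with
  | zero => exact hp
  | succ i ih =>
    rw [Function.iterate_succ_apply']
    exact (natDegree_C_mul_le _ _).trans ((natDegree_shiftHom_le σ α β _).trans ih)

/-- The leading coefficient of `polyOp σ α β c A p`, for polynomials `A` of degree at most `D` and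
`p` of degree at most `n`. -/
theorem coeff_polyOp {D n : ℕ} {A : List E[X]} (hA : ∀ q ∈ A, q.natDegree ≤ D) {p : E[X]}
    (hp : p.natDegree ≤ n) : (polyOp σ α β c A p).coeff (D + n) =
      opApply (fun y => c * α ^ n * σ y) (A.map (coeff · D)) (p.coeff n) := by
  rw [polyOp, opApply, opApply, finsetSum_coeff, List.length_map]
  refine Finset.sum_congr rfl fun i hi => ?_
  rw [Finset.mem_range] at hi
  have h1 : (A.getD i 0).natDegree ≤ D := by
    rw [List.getD_eq_getElem _ _ hi]
    exact hA _ (List.getElem_mem hi)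
  rw [coeff_mul_add_eq_of_natDegree_le h1 (natDegree_iterate_le hp i)]
  congr 1
  · simp [List.getD_eq_getElem?_getD, hi]
  · clear hi h1
    induction i with
    | zero => rfl
    | succ i ih =>
      rw [Function.iterate_succ_apply', Function.iterate_succ_apply', coeff_C_mul,
        coeff_shiftHom_of_le _ _ _ (natDegree_iterate_le hp i), ih]
      ring

theorem natDegree_polyOp_le {D n : ℕ} {A : List E[X]} (hA : ∀ q ∈ A, q.natDegree ≤ D) {p : E[X]}
    (hp : p.natDegree ≤ n) : (polyOp σ α β c A p).natDegree ≤ D + n := by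
  rw [polyOp, opApply]
  refine natDegree_sum_le_of_forall_le _ _ fun i hi => ?_
  rw [Finset.mem_range] at hi
  have h1 : (A.getD i 0).natDegree ≤ D := by
    rw [List.getD_eq_getElem _ _ hi]
    exact hA _ (List.getElem_mem hi)
  exact natDegree_mul_le.trans (add_le_add h1 (natDegree_iterate_le hp i))

variable {B : Subring E}

theorem iterate_mem_polySub (hB : ∀ x ∈ B, σ x ∈ B) (hα : α ∈ B) (hβ : β ∈ B) (hc : c ∈ B)
    {p : E[X]} (hp : p ∈ polySub B) (i : ℕ) :
    (fun x => C c * shiftHom σ α β x)^[i] p ∈ polySub B := by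
  induction i with
  | zero => exact hp
  | succ i ih =>
    rw [Function.iterate_succ_apply']
    exact mul_mem (C_mem_polySub hc) (shiftHom_mem_polySub hB hα hβ ih)

theorem getD_mem {S : Type*} [CommRing S] {M : Subring S} {l : List S} (h : ∀ x ∈ l, x ∈ M)
    (i : ℕ) : l.getD i 0 ∈ M := by
  by_cases hi : i < l.length
  · rw [List.getD_eq_getElem _ _ hi]
    exact h _ (List.getElem_mem hi)
  · rw [getD_eq_zero_of_le _ (by omega)]
    exact zero_mem _

theorem polyOp_mem (hB : ∀ x ∈ B, σ x ∈ B) (hα : α ∈ B) (hβ : β ∈ B) (hc : c ∈ B)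
    {A : List E[X]} (hA : ∀ q ∈ A, q ∈ polySub B) {p : E[X]} (hp : p ∈ polySub B) :
    polyOp σ α β c A p ∈ polySub B := by
  rw [polyOp, opApply]
  exact sum_mem fun i _ => mul_mem (getD_mem hA i) (iterate_mem_polySub hB hα hβ hc hp i)

theorem twist_mem (hB : ∀ x ∈ B, σ x ∈ B) (hc : c ∈ B) {a : List E} (ha : ∀ x ∈ a, x ∈ B) :
    ∀ x ∈ twist σ c a, x ∈ B := by
  intro x hx
  obtain ⟨i, -, rfl⟩ := List.mem_map.1 hx
  refine mul_mem (getD_mem ha i) (prod_mem fun j hj => ?_)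
  clear hx hj
  induction j with
  | zero => exact hc
  | succ j ih =>
    rw [Function.iterate_succ_apply']
    exact hB _ ih

theorem iterate_ne_zero {σ : E ≃+* E} {x : E} (hx : x ≠ 0) (j : ℕ) : σ^[j] x ≠ 0 := by
  induction j with
  | zero => exact hx
  | succ j ih =>
    rw [Function.iterate_succ_apply']
    exact (map_ne_zero_iff σ σ.injective).2 ih

theorem exists_twist_ne_zero [IsDomain E] (hc : c ≠ 0) {a : List E} (ha : ∃ x ∈ a, x ≠ 0) :
    ∃ x ∈ twist σ c a, x ≠ 0 := by
  obtain ⟨x, hx, hx0⟩ := ha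
  obtain ⟨i, hi, rfl⟩ := List.mem_iff_getElem.1 hx
  refine ⟨_, List.mem_map.2 ⟨i, List.mem_range.2 hi, rfl⟩, mul_ne_zero ?_ ?_⟩
  · rwa [List.getD_eq_getElem _ _ hi]
  · exact Finset.prod_ne_zero_iff.2 fun j _ => iterate_ne_zero hc j

/-- The values at `t` of the polynomials over `B` of degree less than `N`. -/
def boundedDegree (B : Subring E) (t : E) (N : ℕ) : Set E :=
  {x | ∃ p ∈ polySub B, (∀ i, N ≤ i → p.coeff i = 0) ∧ p.eval t = x}

/-- The polynomials in the list `A` have their coefficients in `B`, and `l` is the list of their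
values at `t`. -/
def Lifts (B : Subring E) (t : E) (A : List E[X]) (l : List E) : Prop :=
  (∀ q ∈ A, q ∈ polySub B) ∧ A.map (eval t) = l

theorem exists_lifts {l : List E} (h : ∀ x ∈ l, x ∈ polyAdjoin B t) : ∃ A, Lifts B t A l := by
  induction l with
  | nil => exact ⟨[], by simp [Lifts]⟩
  | cons x l ih =>
    obtain ⟨p, hp, hpx⟩ := h x List.mem_cons_self
    obtain ⟨A, hA, rfl⟩ := ih fun y hy => h y (List.mem_cons_of_mem _ hy)
    refine ⟨p :: A, ?_, ?_⟩
    · rintro q (_ | ⟨_, hq⟩)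
      exacts [hp, hA q hq]
    · rw [List.map_cons]
      exact congrArg (· :: _) hpx

/-- A bound `D` for the degrees in `A` that is attained. -/
theorem exists_degree {A : List E[X]} (hA : ∃ q ∈ A, q ≠ 0) :
    ∃ D, (∀ q ∈ A, q.natDegree ≤ D) ∧ ∃ x ∈ A.map (coeff · D), x ≠ 0 := by
  have key : ∀ A : List E[X], (∀ q ∈ A, q = 0) ∨
      ∃ D, (∀ q ∈ A, q.natDegree ≤ D) ∧ ∃ q ∈ A, q.coeff D ≠ 0 := by
    intro A
    induction A with
    | nil => exact Or.inl (by simp)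
    | cons p A ih =>
      by_cases hp : p = 0
      · subst hp
        rcases ih with h | ⟨D, h1, q, hq, hqD⟩
        · exact Or.inl (by simpa using h)
        · exact Or.inr ⟨D, by simpa using h1, q, List.mem_cons_of_mem _ hq, hqD⟩
      · refine Or.inr ?_
        rcases ih with h | ⟨D, h1, q, hq, hqD⟩
        · refine ⟨p.natDegree, ?_, p, List.mem_cons_self, leadingCoeff_ne_zero.2 hp⟩
          rintro q (_ | ⟨_, hq⟩)
          · exact le_rfl
          · simp [h q hq]
        · rcases le_or_gt p.natDegree D with hle | hlt
          · refine ⟨D, ?_, q, List.mem_cons_of_mem _ hq, hqD⟩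
            rintro q (_ | ⟨_, hq⟩)
            exacts [hle, h1 q hq]
          · refine ⟨p.natDegree, ?_, p, List.mem_cons_self, leadingCoeff_ne_zero.2 hp⟩
            rintro q (_ | ⟨_, hq⟩)
            exacts [le_rfl, (h1 q hq).trans hlt.le]
  rcases key A with h | ⟨D, h1, q, hq, hqD⟩
  · obtain ⟨q, hq, hq0⟩ := hA
    exact absurd (h q hq) hq0
  · exact ⟨D, h1, _, List.mem_map_of_mem hq, hqD⟩

/-- If `q(t)` is a combination of the values at `t` of the polynomials `A` over the constants, then
the coefficients of `q` are the same combinations of those of `A`. -/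
theorem coeff_mem_listSpan (htr : TransOver B t) (hK : ∀ x ∈ constants σ, x ∈ B) {f : List E}
    {A : List E[X]} (hA : Lifts B t A f) {q : E[X]} (hq : q ∈ polySub B)
    (h : q.eval t ∈ listSpan σ f) (n : ℕ) : q.coeff n ∈ listSpan σ (A.map (coeff · n)) := by
  obtain ⟨hAB, rfl⟩ := hA
  obtain ⟨c, hc, hsum⟩ := mem_listSpan.1 h
  have hq2 : q = ∑ i ∈ Finset.range A.length, C (c.getD i 0) * A.getD i 0 := by
    refine htr.eq hq (sum_mem fun i _ => mul_mem (C_mem_polySub ?_) (getD_mem hAB i)) ?_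
    · exact getD_mem (fun x hx => hK x (hc x hx)) i
    · rw [hsum, eval_finsetSum, List.length_map]
      refine Finset.sum_congr rfl fun i hi => ?_
      rw [Finset.mem_range] at hi
      simp [List.getD_eq_getElem?_getD, hi]
  refine mem_listSpan.2 ⟨c, hc, ?_⟩
  rw [hq2, finsetSum_coeff, List.length_map]
  refine Finset.sum_congr rfl fun i hi => ?_
  rw [Finset.mem_range] at hi
  simp [List.getD_eq_getElem?_getD, hi]

end bounded

section boundedcover

open Polynomial

variable {E : Type*} [CommRing E] [Coded E] [CodedRing E] {σ : E ≃+* E} {B : Subring E}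
  {α β c t : E} {T : Type*} [Coded T]

@[fun_prop]
theorem Eff.opApply (hσ : Eff fun x : E => σ x) {a : T → List E} {g : T → E} (ha : Eff a)
    (hg : Eff g) : Eff fun x => opApply σ (a x) (g x) := by
  unfold _root_.opApply
  fun_prop

@[fun_prop]
theorem Eff.twist (hσ : Eff fun x : E => σ x) {a : T → List E} {c : T → E} (hc : Eff c)
    (ha : Eff a) : Eff fun x => twist σ (c x) (a x) := by
  unfold _root_.twist
  fun_prop

omit [CodedRing E] in
@[fun_prop]
theorem Semi.mem_polySub (hB : Semi fun x : E => x ∈ B) {p : T → E[X]} (hp : Eff p) :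
    Semi fun x => p x ∈ polySub B := by
  refine (Semi.forall_coeff (P := fun _ _ r => r ∈ B) (by fun_prop) (fun _ _ => zero_mem B)
    hp).of_iff fun x => _root_.mem_polySub

@[fun_prop]
theorem Semi.lifts (hB : Semi fun x : E => x ∈ B) {A : T → List E[X]} {l : T → List E}
    (hA : Eff A) (hl : Eff l) : Semi fun x => Lifts B t (A x) (l x) := by
  have h : Semi fun x => AllMem (A x) (fun q => q ∈ polySub B) ∧
    (A x).map (fun q => eval t q) = l x := by fun_prop
  exact h.of_iff fun x => Iff.rfl

/-- One step in the computation of a cover of the solutions of degree at most `n`: the coefficients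
of degree `n` are covered by the given relation `P` for the subring of coefficients. The lists `f`
and `G` are extended accordingly, and the solutions of degree less than `n` remain. -/
def TopStep (σ : E ≃+* E) (B : Subring E) (α t : E) (P : List E → List E → List E → Prop)
    (z : List E × List E[X] × ℕ) (y y' : ℕ × List E × List E) : Prop :=
  ∃ A : List E[X], ∃ C : List E, Lifts B t A y.2.1 ∧
    P (twist σ (α ^ y'.1) (z.2.1.map fun q => q.coeff z.2.2))
      (A.map fun q => q.coeff (z.2.2 + y'.1)) C ∧
    y.1 = y'.1 + 1 ∧ y'.2.1 = y.2.1 ++ C.map (fun c => opApply σ z.1 (c * t ^ y'.1)) ∧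
    y'.2.2 = y.2.2 ++ C.map fun c => c * t ^ y'.1

/-- If covers can be found in `B`, then they can be found for the solutions in `B[t]` of any given
degree. -/
theorem exists_cover_boundedDegree [IsDomain E] (hσ : Eff fun x : E => σ x)
    (htr : TransOver B t) (hB : ∀ x ∈ B, σ x ∈ B) (hα : α ∈ B) (hα0 : α ≠ 0) (hβ : β ∈ B)
    (ht : σ t = α * t + β) (hK : ∀ x ∈ constants σ, x ∈ B) (hmem : Semi fun x : E => x ∈ B)
    (hcov : CanCover σ B) :
    ∃ Q : List E → List E → ℕ → List E → Prop,
      (Semi fun x : List E × List E × ℕ × List E => Q x.1 x.2.1 x.2.2.1 x.2.2.2) ∧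
      (∀ a f N G, Q a f N G →
        (∀ g ∈ G, g ∈ polyAdjoin B t) ∧ Covers σ (boundedDegree B t N) a f G) ∧
      ∀ a f N, (∀ x ∈ a, x ∈ polyAdjoin B t) → (∃ x ∈ a, x ≠ 0) →
        (∀ x ∈ f, x ∈ polyAdjoin B t) → ∃ G, Q a f N G := by
  obtain ⟨P, hP, hsound, htotal⟩ := hcov
  refine ⟨fun a f N G => ∃ A : List E[X], ∃ D : ℕ, ∃ f', Lifts B t A a ∧
    AllMem A (fun q => q.natDegree ≤ D) ∧
    Relation.ReflTransGen (TopStep σ B α t P (a, A, D)) (N, f, []) (0, f', G), ?_, ?_, ?_⟩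
  · have hP' : ∀ {X : Type _} [Coded X] {u v w : X → List E}, Eff u → Eff v → Eff w →
        Semi fun x => P (u x) (v x) (w x) := fun hu hv hw =>
      hP.comp (hu.prodMk (hv.prodMk hw))
    have hS : Semi fun p : (List E × List E[X] × ℕ) × (ℕ × List E × List E) ×
        (ℕ × List E × List E) => TopStep σ B α t P p.1 p.2.1 p.2.2 := by
      unfold TopStep
      refine Semi.exists (Semi.exists ?_)
      refine Semi.and (by fun_prop) (Semi.and (hP' ?_ ?_ ?_) ?_) <;> fun_prop
    refine Semi.exists (Semi.exists (Semi.exists ?_))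
    refine Semi.and (by fun_prop) (Semi.and (by fun_prop) ?_)
    exact Semi.reflTransGen (S := TopStep σ B α t P)
      (f := fun p : (((List E × List E × ℕ × List E) × List E[X]) × ℕ) × List E =>
        (p.1.1.1.1, p.1.1.2, p.1.2)) hS (by fun_prop) (by fun_prop) (by fun_prop) (by fun_prop)
  · rintro a f N G ⟨A, D, f', hA, hD, hchain⟩
    -- Induction on the chain from its end: a solution minus its term of degree `y₁.1` is a solution
    -- of lower degree for the right hand sides extended by the images of the candidate terms.
    have key : ∀ y y' : ℕ × List E × List E,
        Relation.ReflTransGen (TopStep σ B α t P (a, A, D)) y y' → y'.1 = 0 →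
        (∀ g ∈ y.2.2, g ∈ y'.2.2) ∧
        ((∀ g ∈ y.2.2, g ∈ polyAdjoin B t) → ∀ g ∈ y'.2.2, g ∈ polyAdjoin B t) ∧
        Covers σ (boundedDegree B t y.1) a y.2.1 y'.2.2 := by
      intro y y' h hy'
      induction h using Relation.ReflTransGen.head_induction_on with
      | refl =>
        refine ⟨fun _ h => h, fun h => h, ?_⟩
        rintro _ ⟨p, -, hp, rfl⟩ -
        have : p = 0 := by
          ext i
          exact hp i (by omega)
        simp [this]
      | head hstep _ ih =>
        rename_i y₀ y₁ _
        obtain ⟨Fp, C', hF, hPC, hn, hf, hG⟩ := hstep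
        obtain ⟨ih1, ih2, ih3⟩ := ih
        dsimp only at hPC hn hf hG
        obtain ⟨hCB, hcovC⟩ := hsound _ _ _ hPC
        have hin : ∀ g ∈ y₀.2.2, g ∈ y₁.2.2 := fun g hg => by
          rw [hG]; exact List.mem_append_left _ hg
        refine ⟨fun g hg => ih1 g (hin g hg), fun h => ih2 ?_, ?_⟩
        · intro g hg
          rw [hG, List.mem_append] at hg
          rcases hg with hg | hg
          · exact h g hg
          · obtain ⟨c, hc, rfl⟩ := List.mem_map.1 hg
            exact mul_mem (le_polyAdjoin _ _ (hCB c hc)) (pow_mem (self_mem_polyAdjoin B t) _)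
        · rintro _ ⟨p, hp, hpn, rfl⟩ hpf
          have hdeg : p.natDegree ≤ y₁.1 := natDegree_le_iff_coeff_eq_zero.2 fun i hi =>
            hpn i (by omega)
          have h1 : (polyOp σ α β 1 A p).eval t = opApply σ a (p.eval t) := by
            rw [eval_polyOp ht, hA.2]
            simp
          -- the leading coefficient satisfies an equation over `B`
          have h2 := coeff_mem_listSpan htr hK hF (polyOp_mem hB hα hβ (one_mem _) hA.1 hp)
            (by rwa [h1]) (D + y₁.1)
          rw [coeff_polyOp (α := α) (β := β) hD hdeg, one_mul, ← opApply_twist] at h2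
          have h3 := hcovC _ (mem_polySub.1 hp y₁.1) h2
          have h4 : p.eval t = (p - C (p.coeff y₁.1) * X ^ y₁.1).eval t +
              p.coeff y₁.1 * t ^ y₁.1 := by simp
          have h5 := mul_mem_listSpan (t ^ y₁.1) h3
          have h6 : p.coeff y₁.1 * t ^ y₁.1 ∈ listSpan σ y₁.2.2 := by
            rw [hG]
            exact listSpan_mono (fun x hx => List.mem_append_right _ hx) h5
          rw [h4]
          refine Submodule.add_mem _ (ih3 _ ⟨_, ?_, ?_, rfl⟩ ?_) (listSpan_mono ih1 h6)
          · exact sub_mem hp (mul_mem (C_mem_polySub (mem_polySub.1 hp _))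
              (pow_mem X_mem_polySub _))
          · intro i hi
            rw [coeff_sub, coeff_C_mul_X_pow]
            split_ifs with hi'
            · rw [hi', sub_self]
            · rw [sub_zero]
              exact hpn i (by omega)
          · have h7 : opApply σ a ((p - C (p.coeff y₁.1) * X ^ y₁.1).eval t) =
                opApply σ a (p.eval t) - opApply σ a (p.coeff y₁.1 * t ^ y₁.1) := by
              rw [← opLin_apply, ← opLin_apply, ← opLin_apply, ← map_sub]
              simp
            rw [h7, hf]
            refine Submodule.sub_mem _ (listSpan_mono (fun x hx => List.mem_append_left _ hx) hpf)
              (listSpan_mono (fun x hx => List.mem_append_right _ hx) ?_)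
            have h8 := map_mem_listSpan (opLin σ a) h5
            rwa [List.map_map] at h8
    obtain ⟨-, h2, h3⟩ := key _ _ hchain rfl
    exact ⟨h2 (by simp), h3⟩
  · intro a f N ha ha0 hf
    obtain ⟨A, hA⟩ := exists_lifts ha
    have hA0 : ∃ q ∈ A, q ≠ 0 := by
      obtain ⟨x, hx, hx0⟩ := ha0
      rw [← hA.2] at hx
      obtain ⟨q, hq, rfl⟩ := List.mem_map.1 hx
      refine ⟨q, hq, ?_⟩
      rintro rfl
      simp at hx0
    obtain ⟨D, hD, hD0⟩ := exists_degree hA0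
    have key : ∀ N f G₀, (∀ x ∈ f, x ∈ polyAdjoin B t) → ∃ f' G,
        Relation.ReflTransGen (TopStep σ B α t P (a, A, D)) (N, f, G₀) (0, f', G) := by
      intro N
      induction N with
      | zero => exact fun f G₀ _ => ⟨f, G₀, .refl⟩
      | succ N ih =>
        intro f G₀ hf
        obtain ⟨Fp, hF⟩ := exists_lifts hf
        have h1 : ∀ x ∈ A.map (fun q => q.coeff D), x ∈ B := by
          intro x hx
          obtain ⟨q, hq, rfl⟩ := List.mem_map.1 hx
          exact mem_polySub.1 (hA.1 q hq) _
        have h2 : ∀ x ∈ Fp.map (fun q => q.coeff (D + N)), x ∈ B := by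
          intro x hx
          obtain ⟨q, hq, rfl⟩ := List.mem_map.1 hx
          exact mem_polySub.1 (hF.1 q hq) _
        obtain ⟨C', hC⟩ := htotal (twist σ (α ^ N) (A.map fun q => q.coeff D))
          (Fp.map fun q => q.coeff (D + N)) (twist_mem hB (pow_mem hα _) h1)
          (exists_twist_ne_zero (pow_ne_zero _ hα0) hD0) h2
        obtain ⟨f', G, h⟩ := ih (f ++ C'.map fun c => opApply σ a (c * t ^ N))
          (G₀ ++ C'.map fun c => c * t ^ N) (by
            intro x hx
            rcases List.mem_append.1 hx with hx | hx
            · exact hf x hx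
            · obtain ⟨c, hc, rfl⟩ := List.mem_map.1 hx
              have hcB := (hsound _ _ _ hC).1 c hc
              refine ⟨polyOp σ α β 1 A (C c * X ^ N), polyOp_mem hB hα hβ (one_mem _) hA.1
                (mul_mem (C_mem_polySub hcB) (pow_mem X_mem_polySub _)), ?_⟩
              change eval t _ = _
              rw [eval_polyOp ht, hA.2]
              simp)
        exact ⟨f', G, .head ⟨Fp, C', hF, hC, rfl, rfl, rfl⟩ h⟩
    obtain ⟨f', G, h⟩ := key N f [] hf
    exact ⟨G, A, D, f', hA, hD, h⟩

/-- Covers can be found in `B[t]` if they can be found in `B` and the degrees of the solutions can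
be bounded. -/
theorem CanCover.polyAdjoin [IsDomain E] (hσ : Eff fun x : E => σ x)
    (htr : TransOver B t) (hB : ∀ x ∈ B, σ x ∈ B) (hα : α ∈ B) (hα0 : α ≠ 0) (hβ : β ∈ B)
    (ht : σ t = α * t + β) (hK : ∀ x ∈ constants σ, x ∈ B) (hmem : Semi fun x : E => x ∈ B)
    (hcov : CanCover σ B)
    (hdeg : ∃ P : List E → List E → ℕ → Prop,
      (Semi fun x : List E × List E × ℕ => P x.1 x.2.1 x.2.2) ∧
      (∀ a f N, P a f N → ∀ g ∈ _root_.polyAdjoin B t, opApply σ a g ∈ listSpan σ f →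
        g ∈ boundedDegree B t N) ∧
      ∀ a f, (∀ x ∈ a, x ∈ _root_.polyAdjoin B t) → (∃ x ∈ a, x ≠ 0) →
        (∀ x ∈ f, x ∈ _root_.polyAdjoin B t) → ∃ N, P a f N) :
    CanCover σ (_root_.polyAdjoin B t) := by
  obtain ⟨P, hP, hPs, hPt⟩ := hdeg
  obtain ⟨Q, hQ, hQs, hQt⟩ :=
    exists_cover_boundedDegree hσ htr hB hα hα0 hβ ht hK hmem hcov
  refine ⟨fun a f G => ∃ N, P a f N ∧ Q a f N G, ?_, ?_, ?_⟩
  · refine Semi.exists (Semi.and ?_ ?_)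
    · exact hP.comp (f := fun p : (List E × List E × List E) × ℕ => (p.1.1, p.1.2.1, p.2))
        (by fun_prop)
    · exact hQ.comp (f := fun p : (List E × List E × List E) × ℕ =>
        (p.1.1, p.1.2.1, p.2, p.1.2.2)) (by fun_prop)
  · rintro a f G ⟨N, h1, h2⟩
    exact ⟨(hQs _ _ _ _ h2).1, fun g hg hgf => (hQs _ _ _ _ h2).2 g (hPs a f N h1 g hg hgf) hgf⟩
  · intro a f ha ha0 hf
    obtain ⟨N, hN⟩ := hPt a f ha ha0 hf
    obtain ⟨G, hG⟩ := hQt a f N ha ha0 hf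
    exact ⟨G, N, hN, hG⟩

end boundedcover

/-! ### Right factors and solutions with a unit quotient `σ(g)/g` -/

section rightfactor

variable {F : Type*} [Field F] (σ : F ≃+* F)

/-- If `σ(g) = r g` formally solves `a₀ g + ⋯ + aₘ σᵐ(g) = 0`, then `σ - r` is a right factor of the
operator. -/
theorem isRightFactor_of_sum_eq_zero {m : ℕ} (a : Fin (m + 1) → F) (r : F)
    (h : ∑ i : Fin (m + 1), a i * ∏ j ∈ Finset.range i, σ^[j] r = 0) :
    IsRightFactor σ (SkewPolynomial.X - SkewPolynomial.C r)
      (∑ i : Fin (m + 1), SkewPolynomial.monomial (i : ℕ) (a i)) := by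
  let _ := differenceAction σ
  have hφ : ⇑(SkewPolynomial.φ : F →+* F) = σ := by
    funext x
    change ((σ ^ 1 : F ≃+* F)) x = σ x
    rw [pow_one]
  -- division with remainder of `c σⁱ` by `σ - r` on the right
  have key : ∀ (i : ℕ) (c : F), ∃ Q : SkewPolynomial F,
      SkewPolynomial.monomial i c - SkewPolynomial.C (c * ∏ j ∈ Finset.range i, σ^[j] r) =
        Q * (SkewPolynomial.X - SkewPolynomial.C r) := by
    intro i
    induction i with
    | zero => exact fun c => ⟨0, by simp⟩
    | succ i ih =>
      intro c
      obtain ⟨Q, hQ⟩ := ih (c * σ^[i] r)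
      refine ⟨SkewPolynomial.monomial i c + Q, ?_⟩
      rw [add_mul, ← hQ, mul_sub, SkewPolynomial.monomial_mul_X, SkewPolynomial.monomial_mul_C, hφ,
        Finset.prod_range_succ, mul_assoc, mul_comm (σ^[i] r)]
      abel
  choose Q hQ using key
  refine ⟨∑ i : Fin (m + 1), Q i (a i), ?_⟩
  have h2 : ∑ i : Fin (m + 1), SkewPolynomial.C (a i * ∏ j ∈ Finset.range i, σ^[j] r) =
      (0 : SkewPolynomial F) := by
    rw [← map_sum, h, map_zero]
  rw [Finset.sum_mul, ← sub_zero (∑ i : Fin (m + 1), SkewPolynomial.monomial (i : ℕ) (a i)), ← h2,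
    ← Finset.sum_sub_distrib]
  exact Finset.sum_congr rfl fun i _ => hQ i (a i)

end rightfactor

/-! ### Codings of difference rings -/

section coding

variable {R : Type*}

/-- The coding of the elements of a type by natural numbers through a given surjection. -/
@[reducible] def Coded.ofSurjective (ν : ℕ → R) (h : Function.Surjective ν) : Coded R where
  Code := ℕ
  val := ν
  surj := h

variable [CommRing R] {ν : ℕ → R} {σ : R ≃+* R}

theorem IsComputableDifferenceRing.codedRing (h : IsComputableDifferenceRing ν σ) :
    @CodedRing R _ (Coded.ofSurjective ν h.surjective) := by
  let _ := Coded.ofSurjective ν h.surjective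
  obtain ⟨add, hadd, hadd'⟩ := h.add
  obtain ⟨mul, hmul, hmul'⟩ := h.mul
  obtain ⟨neg, hneg, hneg'⟩ := h.neg
  exact
    { eq := h.eq.to_re
      ne := h.eq.not.to_re
      add := ⟨fun c : ℕ × ℕ => add c.1 c.2, hadd.comp Computable.fst Computable.snd,
        fun c => hadd' c.1 c.2⟩
      neg := ⟨neg, hneg, hneg'⟩
      mul := ⟨fun c : ℕ × ℕ => mul c.1 c.2, hmul.comp Computable.fst Computable.snd,
        fun c => hmul' c.1 c.2⟩ }

theorem IsComputableDifferenceRing.eff_aut (h : IsComputableDifferenceRing ν σ) :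
    @Eff R R (Coded.ofSurjective ν h.surjective) (Coded.ofSurjective ν h.surjective)
      (fun x => σ x) := by
  obtain ⟨s, hs, hs'⟩ := h.aut
  exact ⟨s, hs, hs'⟩

end coding

section ofFn

variable {R : Type*} [CommRing R]

theorem opApply_ofFn (σ : R → R) {n : ℕ} (a : Fin n → R) (g : R) :
    opApply σ (List.ofFn a) g = ∑ i, a i * σ^[(i : ℕ)] g := by
  rw [opApply, List.length_ofFn, Finset.sum_range]
  exact Finset.sum_congr rfl fun i _ => by simp [List.getD_eq_getElem?_getD]

theorem mem_listSpan_ofFn {σ : R ≃+* R} {n : ℕ} {f : Fin n → R} {x : R} :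
    x ∈ listSpan σ (List.ofFn f) ↔ ∃ c : Fin n → constants σ, ∑ i, (c i : R) * f i = x := by
  have h : {y | y ∈ List.ofFn f} = Set.range f := by
    ext y
    simp [List.mem_ofFn]
  rw [listSpan, h, Submodule.mem_span_range_iff_exists_fun]
  rfl

end ofFn

/-! ### The ground field -/

namespace PiSigmaExtension

variable {F E : Type*} [Field F] [CommRing E] [Algebra F E] {σF : F ≃+* F} {σE : E ≃+* E} {e : ℕ}
  (T : PiSigmaExtension σF σE e)

/-- The element of `E` that is given by the code of an element of `F`. -/
def codeMap (E : Type*) [CommRing E] [Algebra F E] (ν : ℕ → F) (n : ℕ) : E := algebraMap F E (ν n)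

include T in
theorem iterate_algebraMap (x : F) (n : ℕ) :
    σE^[n] (algebraMap F E x) = algebraMap F E (σF^[n] x) := by
  induction n with
  | zero => rfl
  | succ n ih => rw [Function.iterate_succ_apply', ih, T.commutes, Function.iterate_succ_apply']

theorem semi_mem_range [Coded E] [CodedRing E] {νF : ℕ → F} (hν : Function.Surjective νF)
    (hemb : Eff fun n : ℕ => codeMap E νF n) :
    Semi fun x : E => x ∈ (algebraMap F E).range := by
  have h : Semi fun x : E => ∃ n, codeMap E νF n = x := by fun_prop
  refine h.of_iff fun x => ?_
  constructor
  · rintro ⟨y, rfl⟩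
    obtain ⟨n, rfl⟩ := hν y
    exact ⟨n, rfl⟩
  · rintro ⟨n, rfl⟩
    exact ⟨_, rfl⟩

/-- Every list of elements of the ground field has a list of codes. -/
theorem exists_codes {νF : ℕ → F} (hν : Function.Surjective νF) {l : List E}
    (h : ∀ x ∈ l, x ∈ (algebraMap F E).range) :
    ∃ c : List ℕ, c.map (codeMap E νF) = l := by
  induction l with
  | nil => exact ⟨[], rfl⟩
  | cons x l ih =>
    obtain ⟨y, rfl⟩ := h x List.mem_cons_self
    obtain ⟨n, rfl⟩ := hν y
    obtain ⟨c, rfl⟩ := ih fun z hz => h z (List.mem_cons_of_mem _ hz)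
    exact ⟨n :: c, rfl⟩

theorem exists_ofFn_codes {c : List ℕ} {P : ℕ → Prop} (h : ∃ n ∈ c, P n) :
    ∃ (m : ℕ) (a : Fin (m + 1) → ℕ), c = List.ofFn a ∧ ∃ i, P (a i) := by
  obtain ⟨n, hn, hP⟩ := h
  obtain ⟨k, a, rfl⟩ : ∃ (k : ℕ) (a : Fin k → ℕ), c = List.ofFn a :=
    ⟨_, c.get, (List.ofFn_get c).symm⟩
  obtain ⟨i, rfl⟩ := (List.mem_ofFn' _ _).1 hn
  cases k with
  | zero => exact i.elim0
  | succ m => exact ⟨m, a, rfl, i, hP⟩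

include T in
/-- Over the ground field, the last components of the computed bases are covers. -/
theorem canCover_range [Coded E] [CodedRing E] {νF : ℕ → F} (hν : Function.Surjective νF)
    (hemb : Eff fun n : ℕ => codeMap E νF n) (hPLDE : CanSolvePLDEs νF σF) :
    CanCover σE (algebraMap F E).range := by
  have hne : Semi fun ca : List ℕ => ∃ n, n ∈ ca ∧ codeMap E νF n ≠ 0 := by fun_prop
  obtain ⟨alg, halg, hspec⟩ := hPLDE
  have halg' : Eff fun p : List ℕ × List ℕ => alg p := by
    refine ⟨alg, halg, fun c => ?_⟩
    change List.map (fun q : List ℕ × ℕ => (q.1.map id, q.2)) (alg c) =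
      alg (c.1.map id, c.2.map id)
    simp
  refine ⟨fun a f G => ∃ ca cf : List ℕ, ca.map (codeMap E νF) = a ∧
    cf.map (codeMap E νF) = f ∧ (∃ n, n ∈ ca ∧ codeMap E νF n ≠ 0) ∧
    ((alg (ca, cf)).map fun q => q.2).map (codeMap E νF) = G, ?_, ?_, ?_⟩
  · have hmap : Eff fun l : List ℕ => l.map (codeMap E νF) :=
      Eff.map Eff.id (hemb.comp (Eff.snd Eff.id))
    have hg : Eff fun p : List ℕ × List ℕ => ((alg p).map fun q => q.2).map (codeMap E νF) :=
      hmap.comp (halg'.map (by fun_prop))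
    refine Semi.exists (Semi.exists (Semi.and ?_ (Semi.and ?_ (Semi.and ?_ ?_))))
    · exact Semi.eq (hmap.comp (by fun_prop)) (by fun_prop)
    · exact Semi.eq (hmap.comp (by fun_prop)) (by fun_prop)
    · exact hne.comp (by fun_prop)
    · exact Semi.eq (hg.comp (by fun_prop)) (by fun_prop)
  · rintro _ _ _ ⟨ca, cf, rfl, rfl, hne, rfl⟩
    refine ⟨fun g hg => ?_, ?_⟩
    · obtain ⟨n, -, rfl⟩ := List.mem_map.1 hg
      exact ⟨_, rfl⟩
    rintro _ ⟨x, rfl⟩ hx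
    obtain ⟨m, a, rfl, hi⟩ := exists_ofFn_codes hne
    obtain ⟨d, f, rfl⟩ : ∃ (k : ℕ) (f : Fin k → ℕ), cf = List.ofFn f :=
      ⟨_, cf.get, (List.ofFn_get cf).symm⟩
    obtain ⟨r, c, g, hout, b, hb⟩ := hspec m d a f (by
      obtain ⟨i, hi⟩ := hi
      exact ⟨i, fun h => hi (by rw [codeMap, h, map_zero])⟩)
    rw [hout]
    simp only [List.map_ofFn, Function.comp_def, codeMap]
    simp only [List.map_ofFn, opApply_ofFn, Function.comp_def, codeMap] at hx
    obtain ⟨k, hk⟩ := mem_listSpan_ofFn.1 hx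
    choose k' hk' hkk using fun i => T.constants_subset (k i).2
    have hmem : ((fun i => ⟨k' i, hk' i⟩, x) : (Fin d → constants σF) × F) ∈
        pldeSolutions σF (fun i => νF (a i)) (fun j => νF (f j)) := by
      change ∑ i, νF (a i) * σF^[(i : ℕ)] x = ∑ j, k' j * νF (f j)
      apply T.injective
      simp only [map_sum, map_mul, hkk, hk]
      exact (Finset.sum_congr rfl fun i _ => by rw [T.iterate_algebraMap]).symm
    have hrep := congrArg
      (fun v : ↥(pldeSolutions σF (fun i => νF (a i)) (fun j => νF (f j))) => v.1.2)
      (b.sum_repr ⟨_, hmem⟩)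
    simp only [Submodule.coe_sum, Submodule.coe_smul, Prod.snd_sum, Prod.smul_snd] at hrep
    refine mem_listSpan_ofFn.2 ⟨fun i => ⟨algebraMap F E (b.repr ⟨_, hmem⟩ i), ?_⟩, ?_⟩
    · rw [mem_constants, T.commutes, (b.repr ⟨_, hmem⟩ i).2]
    · refine Eq.trans ?_ (congrArg (algebraMap F E) hrep)
      rw [map_sum]
      exact Finset.sum_congr rfl fun i _ => by
        rw [← (hb i).2, Subring.smul_def, smul_eq_mul, map_mul]
  · rintro a f ha ⟨x, hx, hx0⟩ hf
    obtain ⟨ca, rfl⟩ := exists_codes hν ha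
    obtain ⟨cf, rfl⟩ := exists_codes hν hf
    obtain ⟨n, hn, rfl⟩ := List.mem_map.1 hx
    exact ⟨_, ca, cf, rfl, rfl, ⟨n, hn, hx0⟩, rfl⟩

end PiSigmaExtension

/-! ### Bounds for the exponents of `Π`-monomials -/

theorem exists_bound_forall_mem {X : Type*} {P : X → ℕ → Prop}
    (hmono : ∀ x N M, N ≤ M → P x N → P x M) {l : List X} (h : ∀ x ∈ l, ∃ N, P x N) :
    ∃ N, ∀ x ∈ l, P x N := by
  induction l with
  | nil => exact ⟨0, by simp⟩
  | cons x l ih =>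
    obtain ⟨N, hN⟩ := h x List.mem_cons_self
    obtain ⟨M, hM⟩ := ih fun y hy => h y (List.mem_cons_of_mem _ hy)
    refine ⟨max N M, ?_⟩
    rintro y (_ | ⟨_, hy⟩)
    exacts [hmono _ _ _ (le_max_left _ _) hN, hmono _ _ _ (le_max_right _ _) (hM y hy)]

/-- A module of integer vectors that are determined by their first coordinate has at most one basis
vector; if it contains a vector with first coordinate `-1`, then this vector is a basis up to
sign. -/
theorem exists_natAbs_eq_of_basis {n r : ℕ} {M : Submodule ℤ (Fin (n + 1) → ℤ)}
    (hM : ∀ w ∈ M, w 0 = 0 → w = 0) (b : Module.Basis (Fin r) ℤ M) {z : Fin (n + 1) → ℤ}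
    (hz : z ∈ M) (hz0 : z 0 = -1) :
    ∃ l, ∀ i, (z i).natAbs = ((b l : Fin (n + 1) → ℤ) i).natAbs := by
  have hne : Nonempty (Fin r) := by
    by_contra hr
    rw [not_nonempty_iff] at hr
    have h := b.ext_elem (x := ⟨z, hz⟩) (y := 0) fun i => hr.elim i
    rw [← Subtype.coe_inj] at h
    simp only [ZeroMemClass.coe_zero] at h
    rw [h] at hz0
    simp at hz0
  obtain ⟨l⟩ := hne
  have h1 : (b l : Fin (n + 1) → ℤ) = -((b l : Fin (n + 1) → ℤ) 0) • z := by
    have h := hM (((b l : Fin (n + 1) → ℤ) 0) • z + (b l : Fin (n + 1) → ℤ))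
      (add_mem (M.smul_mem _ hz) (b l).2) (by simp [hz0])
    rw [neg_smul]
    exact eq_neg_of_add_eq_zero_right h
  have h2 : b l = -((b l : Fin (n + 1) → ℤ) 0) • (⟨z, hz⟩ : M) := Subtype.ext h1
  have h3 := congrArg (fun v => b.repr v l) h2
  simp only [map_smul, Finsupp.smul_apply, Module.Basis.repr_self, Finsupp.single_eq_same,
    smul_eq_mul] at h3
  have h4 : (-((b l : Fin (n + 1) → ℤ) 0)).natAbs = 1 :=
    Int.isUnit_iff_natAbs_eq.1 (IsUnit.of_mul_eq_one _ h3.symm)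
  refine ⟨l, fun i => ?_⟩
  have h5 := congrArg Int.natAbs (congrFun h1 i)
  rw [h5, Pi.smul_apply, smul_eq_mul, Int.natAbs_mul, h4, one_mul]

namespace PiSigmaExtension

variable {F E : Type*} [Field F] [CommRing E] [Algebra F E] {σF : F ≃+* F} {σE : E ≃+* E} {e : ℕ}
  (T : PiSigmaExtension σF σE e)

/-- There is a semidecidable relation between operators over the `k`-th `Π`-ring and bounds for the
exponents of the monomials `tₖ, tₖ₊₁, …` in their solutions of the form `g · ∏ tᵢ ^ zᵢ`, where `g`
is a nonzero element of that ring. -/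
def PiBound [Coded E] (k : ℕ) : Prop :=
  ∃ P : List E → ℕ → Prop, (Semi fun x : List E × ℕ => P x.1 x.2) ∧
    (∀ a N, P a N → ∀ g ∈ T.piRing k, g ≠ 0 → ∀ z : Fin e → ℤ,
      opApply σE a (g * T.piMonomial z) = 0 →
        ∀ i : Fin e, k ≤ i → T.kind i = .pi → (z i).natAbs ≤ N) ∧
    ∀ a, (∀ x ∈ a, x ∈ T.piRing k) → (∃ x ∈ a, x ≠ 0) → ∃ N, P a N

/-- The quotient `σ(m)/m` of a monomial `m = ∏ tᵢ ^ zᵢ` is the product `∏ αᵢ ^ zᵢ` in `F`. -/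
theorem exists_map_piMonomial (hPi : ∀ i, T.kind i = MonomialKind.pi →
      ∃ α : F, α ≠ 0 ∧ σE (T.t i) = algebraMap F E α * T.t i) :
    ∃ α : Fin e → Fˣ, (∀ i, T.kind i = .sigma → α i = 1) ∧
      (∀ i, T.kind i = .pi → σE (T.t i) = algebraMap F E (α i) * T.t i) ∧
      ∀ z, σE (T.piMonomial z) = algebraMap F E ↑(∏ i, α i ^ z i) * (T.piMonomial z : E) := by
  have h : ∀ i, ∃ α : Fˣ, (T.kind i = .sigma → α = 1) ∧
      (T.kind i = .pi → σE (T.t i) = algebraMap F E α * T.t i) ∧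
      Units.map (σE : E →* E) (T.piUnit i) =
        Units.map (algebraMap F E : F →* E) α * T.piUnit i := by
    intro i
    rcases hk : T.kind i with _ | _
    · obtain ⟨α, hα, h⟩ := hPi i hk
      refine ⟨Units.mk0 α hα, by simp, fun _ => h, Units.ext ?_⟩
      simpa [T.piUnit_of_pi hk] using h
    · exact ⟨1, by simp, by simp, by simp [T.piUnit_of_sigma hk]⟩
  choose α h1 h2 h3 using h
  refine ⟨α, h1, h2, fun z => ?_⟩
  have h4 : Units.map (σE : E →* E) (T.piMonomial z) =
      Units.map (algebraMap F E : F →* E) (∏ i, α i ^ z i) * T.piMonomial z := by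
    simp only [piMonomial, map_prod, map_zpow, h3, mul_zpow, Finset.prod_mul_distrib]
  exact congrArg Units.val h4

/-- The relation of `piBound_zero` is semidecidable: `x.2` bounds all entries of the bases of the
pseudo-orbit modules of `(u, L)`, where `u` runs through the hypergeometric candidates. -/
theorem semi_exponentBound [Coded E] [CodedRing E] {νF : ℕ → F}
    (hemb : Eff fun n : ℕ => codeMap E νF n) {algH : List ℕ → List ℕ} (hH : Computable algH)
    {algO : List ℕ → List (List ℤ)} (hO : Computable algO) (L : List ℕ) :
    Semi fun x : List E × ℕ => ∃ ca : List ℕ, ca.map (codeMap E νF) = x.1 ∧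
      (∃ n, n ∈ ca ∧ codeMap E νF n ≠ 0) ∧
      AllMem (algH ca) fun u => AllMem (algO (u :: L)) fun row =>
        AllMem row fun y => y.natAbs ≤ x.2 := by
  have hmap : Eff fun l : List ℕ => l.map (codeMap E νF) :=
    Eff.map Eff.id (hemb.comp (Eff.snd Eff.id))
  have hne : Semi fun ca : List ℕ => ∃ n, n ∈ ca ∧ codeMap E νF n ≠ 0 := by fun_prop
  have h1 : Semi fun x : List ℕ × ℕ => AllMem (algH x.1) fun u => AllMem (algO (u :: L)) fun row =>
      AllMem row fun y => y.natAbs ≤ x.2 := by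
    have hH' : Eff fun x => algH x :=
      ⟨algH, hH, fun c => by change (algH c).map id = algH (c.map id); simp⟩
    have hO' : Eff fun x => algO x := ⟨algO, hO, fun c => by
      change (algO c).map (List.map id) = algO (c.map id); simp⟩
    have hL : Eff fun u : ℕ => u :: L := by fun_prop
    have hO2 : Eff fun u : ℕ => algO (u :: L) := hO'.comp hL
    have h2 : Semi fun x : List (List ℤ) × ℕ => AllMem x.1 fun row =>
      AllMem row fun y => y.natAbs ≤ x.2 := by fun_prop
    have h3 : Semi fun x : ℕ × ℕ => AllMem (algO (x.1 :: L)) fun row =>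
      AllMem row fun y => y.natAbs ≤ x.2 :=
      h2.comp (f := fun x : ℕ × ℕ => (algO (x.1 :: L), x.2))
        ((hO2.comp (Eff.fst Eff.id)).prodMk (Eff.snd Eff.id))
    exact Semi.allMem (hH'.comp (Eff.fst Eff.id)) (h3.comp
      (f := fun p : (List ℕ × ℕ) × ℕ => (p.2, p.1.2)) (by fun_prop))
  exact Semi.exists (Semi.and (Semi.eq (hmap.comp (by fun_prop)) (by fun_prop))
      (Semi.and (hne.comp (by fun_prop)) (h1.comp
        (f := fun p : (List E × ℕ) × List ℕ => (p.2, p.1.2)) (by fun_prop))))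

/-- The exponents are bounded over the ground field. If `g · m` is a solution, where `m = ∏ tᵢ ^ zᵢ`
and `σ(tᵢ) = αᵢ tᵢ`, then `σ - r` with `r = σ(g m) / (g m) ∈ F` is a right factor of the operator,
and `r = u σ(v)/v` for a candidate `u`. So `(-1, z)` lies in the pseudo-orbit module of `(u, α)`.
The vectors of this module are determined by their first coordinate, as the `Π`-monomials are
independent modulo `F*`; hence `(-1, z)` agrees with a vector of any basis up to sign. -/
theorem piBound_zero [Coded E] [CodedRing E] (hPi : ∀ i, T.kind i = MonomialKind.pi →
      ∃ α : F, α ≠ 0 ∧ σE (T.t i) = algebraMap F E α * T.t i)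
    {νF : ℕ → F} (hν : Function.Surjective νF)
    (hemb : Eff fun n : ℕ => codeMap E νF n) (hOrbit : CanSolvePseudoOrbit νF σF)
    (hHyp : CanComputeHypergeometricCandidates νF σF) : T.PiBound 0 := by
  classical
  have hdom := T.isDomain
  obtain ⟨α, hα1, -, hα⟩ := T.exists_map_piMonomial hPi
  obtain ⟨algH, hH, hHs⟩ := hHyp
  obtain ⟨algO, hO, hOs⟩ := hOrbit
  let n := Fintype.card {i // T.kind i = .pi}
  let ε : Fin n ≃ {i // T.kind i = .pi} := (Fintype.equivFin _).symm
  choose cα hcα using fun j => hν (α (ε j).1)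
  have hprod : ∀ z : Fin e → ℤ, ∏ i, α i ^ z i = ∏ j, α (ε j).1 ^ z (ε j).1 := by
    intro z
    rw [ε.prod_comp fun i : {i // T.kind i = .pi} => α i.1 ^ z i.1,
      ← Fintype.prod_subtype_mul_prod_subtype (fun i => T.kind i = .pi),
      Finset.prod_eq_one (f := fun i : {i // ¬ T.kind i = .pi} => _), mul_one]
    rintro ⟨i, hi⟩ -
    rcases hk : T.kind i with _ | _
    · exact absurd hk hi
    · rw [hα1 i hk, one_zpow]
  -- the vectors of the pseudo-orbit module are determined by the exponent of the candidate
  have hinj : ∀ u : Fˣ, ∀ w ∈ pseudoOrbitModule σF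
      (Fin.cons u fun j => α (ε j).1 : Fin (n + 1) → Fˣ), w 0 = 0 → w = 0 := by
    rintro u w ⟨g, hg⟩ hw0
    let z : Fin e → ℤ := fun i => if h : T.kind i = .pi then w (ε.symm ⟨i, h⟩).succ else 0
    have hz : ∀ j, z (ε j).1 = w j.succ := fun j => by
      simp only [z]
      rw [dif_pos (ε j).2]
      simp
    have hg' : σF g = ↑(∏ i, α i ^ z i) * (g : F) := by
      rw [div_eq_iff g.ne_zero, Fin.prod_univ_succ, hw0, zpow_zero, one_mul] at hg
      rw [hg, hprod]
      simp [hz]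
    have hconst : (T.piMonomial z : E) * algebraMap F E ↑g⁻¹ ∈ constants σE := by
      rw [mem_constants, map_mul, hα, T.commutes, Units.val_inv_eq_inv_val, map_inv₀, hg',
        mul_right_comm, ← map_mul, mul_inv, mul_inv_cancel_left₀ (Units.ne_zero _), mul_comm]
    obtain ⟨y, hy⟩ := T.const_mem_range hconst
    have hmem : (T.piMonomial z : E) ∈ (algebraMap F E).range := by
      refine ⟨y * g, ?_⟩
      rw [map_mul, hy, mul_assoc, ← map_mul, Units.inv_mul, map_one, mul_one]
    have hz0 := T.eq_zero_of_piMonomial_mem hmem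
    funext i
    refine Fin.cases hw0 (fun j => ?_) i
    rw [← hz, hz0 _ (ε j).2]
    rfl
  refine ⟨fun a N => ∃ ca : List ℕ, ca.map (codeMap E νF) = a ∧
    (∃ n, n ∈ ca ∧ codeMap E νF n ≠ 0) ∧
    AllMem (algH ca) fun u => AllMem (algO (u :: List.ofFn cα)) fun row =>
      AllMem row fun y => y.natAbs ≤ N, ?_, ?_, ?_⟩
  · exact semi_exponentBound hemb hH hO _
  · rintro _ N ⟨ca, rfl, hne, hN⟩ _ ⟨g, rfl⟩ hg0 z hz i - hi
    obtain ⟨m, a, rfl, i₀, hi₀⟩ := exists_ofFn_codes hne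
    have hg : g ≠ 0 := by rintro rfl; simp at hg0
    -- the monomial satisfies a first-order equation, whose operator is a right factor
    let c : Fˣ := ∏ i, α i ^ z i
    let r : F := c * σF g / g
    have hr0 : r ≠ 0 := div_ne_zero (mul_ne_zero c.ne_zero (by simpa using hg)) hg
    rw [opApply_mul_of_map_eq (hα z)] at hz
    have hz1 := (mul_eq_zero.1 hz).resolve_right (Units.ne_zero _)
    have hz2 : ∑ i : Fin (m + 1), νF (a i) * ∏ j ∈ Finset.range i, σF^[j] r = 0 := by
      have h1 : ∀ k : ℕ, (fun y => algebraMap F E ↑c * σE y)^[k] (algebraMap F E g) =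
          algebraMap F E ((∏ j ∈ Finset.range k, σF^[j] r) * g) := by
        intro k
        induction k with
        | zero => simp
        | succ k ih =>
          rw [Function.iterate_succ_apply', ih, T.commutes, ← map_mul, Finset.prod_range_succ',
            map_mul σF, map_prod σF]
          simp only [← Function.iterate_succ_apply' σF, Function.iterate_zero, id]
          congr 1
          rw [show σF g = ↑c⁻¹ * (r * g) by
            rw [div_mul_cancel₀ _ hg, ← mul_assoc, Units.inv_mul, one_mul]]
          have := c.mul_inv
          linear_combination ((∏ j ∈ Finset.range k, σF^[j + 1] r) * (r * g)) * this
      rw [List.map_ofFn, opApply_ofFn] at hz1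
      have h2 : algebraMap F E ((∑ i : Fin (m + 1), νF (a i) *
          ∏ j ∈ Finset.range i, σF^[j] r) * g) = 0 := by
        rw [← hz1, Finset.sum_mul, map_sum]
        refine Finset.sum_congr rfl fun i _ => ?_
        rw [h1, mul_assoc, map_mul]
        rfl
      rw [map_eq_zero_iff _ T.injective] at h2
      exact (mul_eq_zero.1 h2).resolve_right hg
    obtain ⟨u, hu, v, hv, hruv⟩ := hHs m a ⟨i₀, fun h => hi₀ (by rw [codeMap, h, map_zero])⟩ r hr0
      (isRightFactor_of_sum_eq_zero σF (fun i => νF (a i)) r hz2)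
    have hu0 : νF u ≠ 0 := by
      intro h
      rw [h, zero_mul] at hruv
      exact hr0 hruv
    obtain ⟨k, w, hout, b, hb⟩ := hOs (n + 1) (Fin.cons u cα)
      (Fin.cons (Units.mk0 _ hu0) fun j => α (ε j).1)
      (fun i => Fin.cases rfl (fun j => hcα j) i)
    have hmem : (Fin.cons (-1) (fun j => z (ε j).1) : Fin (n + 1) → ℤ) ∈ pseudoOrbitModule σF
        (Fin.cons (Units.mk0 _ hu0) fun j => α (ε j).1 : Fin (n + 1) → Fˣ) := by
      refine ⟨Units.mk0 (v / g) (div_ne_zero hv hg), ?_⟩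
      have h1 : (c : F) = ∏ j, (α (ε j).1 : F) ^ z (ε j).1 := by
        simp only [c]
        rw [hprod]
        simp
      have hσg : σF g ≠ 0 := by simpa using hg
      rw [Fin.prod_univ_succ]
      simp only [Fin.cons_zero, Fin.cons_succ, ← h1, Units.val_mk0, zpow_neg_one, map_div₀]
      have h2 : (c : F) * σF g / g = νF u * (σF v / v) := hruv
      field_simp at h2 ⊢
      linear_combination -h2
    obtain ⟨l, hl⟩ := exists_natAbs_eq_of_basis (hinj _) b hmem rfl
    have h3 := hl (ε.symm ⟨i, hi⟩).succ
    rw [Fin.cons_succ] at h3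
    simp only [Equiv.apply_symm_apply] at h3
    rw [h3, hb]
    refine hN u hu (List.ofFn (w l)) ?_ _ ((List.mem_ofFn' _ _).2 ⟨_, rfl⟩)
    have h4 : u :: List.ofFn cα = List.ofFn (Fin.cons u cα : Fin (n + 1) → ℕ) := by
      rw [List.ofFn_succ]
      simp
    rw [h4, hout]
    exact (List.mem_ofFn' _ _).2 ⟨l, rfl⟩
  · rintro a ha ⟨x, hx, hx0⟩
    obtain ⟨ca, rfl⟩ := exists_codes hν ha
    obtain ⟨n', hn', rfl⟩ := List.mem_map.1 hx
    obtain ⟨N, hN⟩ : ∃ N, ∀ u ∈ algH ca, ∀ row ∈ algO (u :: List.ofFn cα), ∀ y ∈ row,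
        y.natAbs ≤ N := by
      refine exists_bound_forall_mem (fun u N M h h1 row hr y hy => (h1 row hr y hy).trans h)
        fun u _ => ?_
      refine exists_bound_forall_mem (fun row N M h h1 y hy => (h1 y hy).trans h) fun row _ => ?_
      exact exists_bound_forall_mem (fun y N M h h1 => h1.trans h) fun y _ => ⟨_, le_rfl⟩
    exact ⟨N, ca, rfl, ⟨n', hn', hx0⟩, hN⟩

end PiSigmaExtension

/-! ### Equations over a Laurent polynomial ring -/

section laurent

open Polynomial

section

variable {E : Type*} [CommRing E] {σ : E ≃+* E} {B : Subring E} {α α' : E}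

theorem opApply_map_mul_right (σ : E ≃+* E) (u : E) (a : List E) (g : E) :
    opApply σ (a.map (· * u)) g = opApply σ a g * u := by
  rw [mul_comm, ← opApply_map_mul]
  simp only [mul_comm]

theorem polyAdjoin_pow_mem {t x : E} {N M : ℕ} (h : N ≤ M) (hx : x * t ^ N ∈ polyAdjoin B t) :
    x * t ^ M ∈ polyAdjoin B t := by
  have h1 := mul_mem hx (pow_mem (self_mem_polyAdjoin B t) (M - N))
  rwa [mul_assoc, ← pow_add, Nat.add_sub_cancel' h] at h1

theorem exists_common_denominator {t : E} {l : List E} (h : ∀ x ∈ l, x ∈ laurentAdjoin B t) :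
    ∃ N, ∀ x ∈ l, x * t ^ N ∈ polyAdjoin B t :=
  exists_bound_forall_mem (P := fun x N => x * t ^ N ∈ polyAdjoin B t)
    (fun _ _ _ h hx => polyAdjoin_pow_mem h hx) h

theorem exists_common_lifts {t : E} {l l' : List E} (h : ∀ x ∈ l, x ∈ laurentAdjoin B t)
    (h' : ∀ x ∈ l', x ∈ laurentAdjoin B t) :
    ∃ N, (∀ x ∈ l.map (· * t ^ N), x ∈ polyAdjoin B t) ∧
      ∀ x ∈ l'.map (· * t ^ N), x ∈ polyAdjoin B t := by
  obtain ⟨N, hN⟩ := exists_common_denominator h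
  obtain ⟨M, hM⟩ := exists_common_denominator h'
  refine ⟨max N M, fun x hx => ?_, fun x hx => ?_⟩
  · obtain ⟨y, hy, rfl⟩ := List.mem_map.1 hx
    exact polyAdjoin_pow_mem (le_max_left _ _) (hN y hy)
  · obtain ⟨y, hy, rfl⟩ := List.mem_map.1 hx
    exact polyAdjoin_pow_mem (le_max_right _ _) (hM y hy)

theorem opApply_eval_mul {t θ c : E} (ht : σ t = α * t) (hθ : σ θ = c * θ) (A : List E[X])
    (p : E[X]) : opApply σ (A.map (eval t)) (p.eval t * θ) =
      (polyOp σ α 0 c A p).eval t * θ := by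
  rw [opApply_mul_of_map_eq hθ, eval_polyOp (by rw [ht, add_zero])]

theorem opApply_coeff_mul {t θ c : E} (ht : σ t = α * t) (hθ : σ θ = c * θ) {A : List E[X]}
    {D n : ℕ} (hA : ∀ q ∈ A, q.natDegree ≤ D) {p : E[X]} (hp : p.natDegree ≤ n) :
    opApply σ (A.map (coeff · D)) (p.coeff n * (t ^ n * θ)) =
      (polyOp σ α 0 c A p).coeff (D + n) * (t ^ n * θ) := by
  rw [opApply_mul_of_map_eq (c := c * α ^ n) (by rw [map_mul, map_pow, ht, hθ]; ring),
    coeff_polyOp hA hp]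

theorem exists_lifts_degree {t : E} {l : List E} {A : List E[X]} (hA : Lifts B t A l)
    (h : ∃ x ∈ l, x ≠ 0) :
    ∃ D, (∀ q ∈ A, q.natDegree ≤ D) ∧ ∃ x ∈ A.map (coeff · D), x ≠ 0 := by
  refine exists_degree ?_
  obtain ⟨x, hx, hx0⟩ := h
  rw [← hA.2] at hx
  obtain ⟨q, hq, rfl⟩ := List.mem_map.1 hx
  refine ⟨q, hq, ?_⟩
  rintro rfl
  simp at hx0

theorem exists_natDegree_le (A : List E[X]) : ∃ D, ∀ q ∈ A, q.natDegree ≤ D :=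
  exists_bound_forall_mem (fun _ _ _ h hx => hx.trans h) fun _ _ => ⟨_, le_rfl⟩

theorem exists_mul_ne_zero [IsDomain E] {u : E} (hu : u ≠ 0) {l : List E} (h : ∃ x ∈ l, x ≠ 0) :
    ∃ x ∈ l.map (· * u), x ≠ 0 := by
  obtain ⟨x, hx, hx0⟩ := h
  exact ⟨_, List.mem_map_of_mem hx, mul_ne_zero hx0 hu⟩

theorem coeff_mem_of_lifts {t : E} {l : List E} {A : List E[X]} (hA : Lifts B t A l) (D : ℕ) :
    ∀ x ∈ A.map (coeff · D), x ∈ B := by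
  intro x hx
  obtain ⟨q, hq, rfl⟩ := List.mem_map.1 hx
  exact mem_polySub.1 (hA.1 q hq) _

theorem eval_inv_mul_pow (t : Eˣ) (p : E[X]) :
    p.eval ((t⁻¹ : Eˣ) : E) * (t : E) ^ p.natDegree = p.reverse.eval (t : E) := by
  let _ : Invertible ((t⁻¹ : Eˣ) : E) := t⁻¹.invertible
  have h := eval₂_reverse_mul_pow (RingHom.id E) ((t⁻¹ : Eˣ) : E) p
  have h1 : ⅟((t⁻¹ : Eˣ) : E) = t := by
    rw [invOf_units, inv_inv]
  rw [h1] at h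
  rw [eval, ← h, mul_assoc, ← mul_pow, Units.inv_mul, one_pow, mul_one]
  rfl

theorem reverse_mem_polySub {p : E[X]} (hp : p ∈ polySub B) : p.reverse ∈ polySub B :=
  mem_polySub.2 fun n => by
    rw [coeff_reverse]
    exact mem_polySub.1 hp _

theorem TransOver.inv {t : Eˣ} (h : TransOver B (t : E)) : TransOver B ((t⁻¹ : Eˣ) : E) := by
  intro p hp hpt
  have h1 := h _ (reverse_mem_polySub hp) (by rw [← eval_inv_mul_pow, hpt, zero_mul])
  exact (reverse_eq_zero).1 h1

theorem laurentAdjoin_inv_le (t : Eˣ) :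
    laurentAdjoin B (t : E) ≤ laurentAdjoin B ((t⁻¹ : Eˣ) : E) := by
  refine laurentAdjoin_le ((le_polyAdjoin _ _).trans (polyAdjoin_le_laurentAdjoin _ _))
    ⟨1, ?_⟩ (u := ((t⁻¹ : Eˣ) : E)) ?_ (by simp)
  · rw [pow_one, Units.mul_inv]
    exact one_mem _
  · exact polyAdjoin_le_laurentAdjoin _ _ (self_mem_polyAdjoin _ _)

end

variable {E : Type*} [CommRing E] [Coded E] [CodedRing E] {σ : E ≃+* E} {B : Subring E}
  {α α' : E}

theorem semi_mem_laurentAdjoin (t : E) (hB : Semi fun x : E => x ∈ B) :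
    Semi fun x : E => x ∈ laurentAdjoin B t := by
  have h : Semi fun x : E => ∃ N : ℕ, ∃ p : E[X], p ∈ polySub B ∧ eval t p = x * t ^ N := by
    fun_prop
  exact h.of_iff fun x => mem_laurentAdjoin

theorem semi_mem_polyAdjoin (t : E) (hB : Semi fun x : E => x ∈ B) :
    Semi fun x : E => x ∈ polyAdjoin B t := by
  have h : Semi fun x : E => ∃ p : E[X], p ∈ polySub B ∧ eval t p = x := by fun_prop
  exact h.of_iff fun x => mem_polyAdjoin

/-- There is a semidecidable relation between operators over `B` and bounds for the exponents of the
unit `t` in their solutions of the form `x tⁿ`, where `x ∈ B` is nonzero. The bound is two-sided, so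
that it controls degrees and, with `t⁻¹` in place of `t`, pole orders. -/
def UnitBound (σ : E ≃+* E) (B : Subring E) (t : Eˣ) : Prop :=
  ∃ P : List E → ℕ → Prop, (Semi fun x : List E × ℕ => P x.1 x.2) ∧
    (∀ a N, P a N → ∀ x ∈ B, x ≠ 0 → ∀ n : ℤ, opApply σ a (x * ↑(t ^ n)) = 0 → n.natAbs ≤ N) ∧
    ∀ a, (∀ x ∈ a, x ∈ B) → (∃ x ∈ a, x ≠ 0) → ∃ N, P a N

omit [CodedRing E] in
theorem UnitBound.inv {t : Eˣ} (h : UnitBound σ B t) : UnitBound σ B t⁻¹ := by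
  obtain ⟨P, hP, hs, ht⟩ := h
  refine ⟨P, hP, fun a N hN x hx hx0 n hn => ?_, ht⟩
  rw [← Int.natAbs_neg]
  exact hs a N hN x hx hx0 (-n) (by rwa [zpow_neg, ← inv_zpow])

/-- The number `N` bounds the degrees in `t` of the right hand sides `f` relative to those of `a`,
and the exponents of `t` in the solutions for the leading coefficients of `a`. -/
def DegreeBound (B : Subring E) (t : E) (P : List E → ℕ → Prop) (a f : List E) (N : ℕ) : Prop :=
  ∃ A Fp : List E[X], ∃ M D N₁ : ℕ, Lifts B t A (a.map fun x => x * t ^ M) ∧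
    Lifts B t Fp (f.map fun x => x * t ^ M) ∧ AllMem A (fun q => q.natDegree ≤ D) ∧
    AllMem Fp (fun q => q.natDegree ≤ N) ∧ P (A.map fun q => q.coeff D) N₁ ∧ N₁ ≤ N

theorem semi_degreeBound {t : E} {P : List E → ℕ → Prop} (hmem : Semi fun x : E => x ∈ B)
    (hP : Semi fun x : List E × ℕ => P x.1 x.2) :
    Semi fun x : List E × List E × ℕ => DegreeBound B t P x.1 x.2.1 x.2.2 := by
  have hP' : Semi fun x : (List E[X] × ℕ) × ℕ => P (x.1.1.map fun q => q.coeff x.1.2) x.2 :=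
    hP.comp (f := fun x : (List E[X] × ℕ) × ℕ => (x.1.1.map fun q => q.coeff x.1.2, x.2))
      (by fun_prop)
  have h1 : Semi fun x : (List E × ℕ) × List E[X] => Lifts B t x.2 (x.1.1.map fun y =>
    y * t ^ x.1.2) := by fun_prop
  have h2 : Semi fun x : List E[X] × ℕ => AllMem x.1 (fun q => q.natDegree ≤ x.2) := by fun_prop
  refine Semi.exists (Semi.exists (Semi.exists (Semi.exists (Semi.exists (Semi.and ?_ (Semi.and ?_
    (Semi.and ?_ (Semi.and ?_ (Semi.and ?_ ?_)))))))))
  · exact h1.comp (f := fun x : (((((List E × List E × ℕ) × List E[X]) × List E[X]) × ℕ) × ℕ) × ℕ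
      => ((x.1.1.1.1.1.1, x.1.1.2), x.1.1.1.1.2)) (by fun_prop)
  · exact h1.comp (f := fun x : (((((List E × List E × ℕ) × List E[X]) × List E[X]) × ℕ) × ℕ) × ℕ
      => ((x.1.1.1.1.1.2.1, x.1.1.2), x.1.1.1.2)) (by fun_prop)
  · exact h2.comp (f := fun x : (((((List E × List E × ℕ) × List E[X]) × List E[X]) × ℕ) × ℕ) × ℕ
      => (x.1.1.1.1.2, x.1.2)) (by fun_prop)
  · exact h2.comp (f := fun x : (((((List E × List E × ℕ) × List E[X]) × List E[X]) × ℕ) × ℕ) × ℕ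
      => (x.1.1.1.2, x.1.1.1.1.1.2.2)) (by fun_prop)
  · exact hP'.comp (f := fun x : (((((List E × List E × ℕ) × List E[X]) × List E[X]) × ℕ) × ℕ) × ℕ
      => ((x.1.1.1.1.2, x.1.2), x.2)) (by fun_prop)
  · exact Semi.natLe (by fun_prop) (by fun_prop)

/-- The degrees in `t` of the solutions in `B[t, t⁻¹]` are bounded: above the degree of the right
hand side, the leading coefficient of a solution is a solution for the leading coefficients. -/
theorem UnitBound.exists_degree_bound [IsDomain E] {t : Eˣ} (hbd : UnitBound σ B t)
    (htr : TransOver B (t : E)) (hB : ∀ x ∈ B, σ x ∈ B) (hα : α ∈ B)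
    (hα' : α' ∈ B) (hαα : α' * α = 1) (ht : σ t = α * t) (hK : ∀ x ∈ constants σ, x ∈ B)
    (hmem : Semi fun x : E => x ∈ B) :
    ∃ Q : List E → List E → ℕ → Prop,
      (Semi fun x : List E × List E × ℕ => Q x.1 x.2.1 x.2.2) ∧
      (∀ a f N, Q a f N → ∀ g ∈ laurentAdjoin B (t : E), opApply σ a g ∈ listSpan σ f →
        ∃ M, ∃ p ∈ polySub B, p.eval (t : E) = g * (t : E) ^ M ∧ p.natDegree ≤ M + N) ∧
      ∀ a f, (∀ x ∈ a, x ∈ laurentAdjoin B (t : E)) → (∃ x ∈ a, x ≠ 0) →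
        (∀ x ∈ f, x ∈ laurentAdjoin B (t : E)) → ∃ N₀, ∀ N, N₀ ≤ N → Q a f N := by
  obtain ⟨P, hP, hPs, hPt⟩ := hbd
  refine ⟨DegreeBound B t P, semi_degreeBound hmem hP, ?_, ?_⟩
  · rintro a f N ⟨A, Fp, M₁, D, N₁, hA, hF, hD, hDF, hPN, hN⟩ g hg hgf
    obtain ⟨M, p, hp, hpg⟩ := mem_laurentAdjoin.1 hg
    refine ⟨M, p, hp, hpg, ?_⟩
    by_contra! hlt
    have hp0 : p ≠ 0 := by rintro rfl; simp at hlt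
    have htM : ∀ k, (t : E) ^ k ≠ 0 := fun k => pow_ne_zero _ t.ne_zero
    -- the power of `t⁻¹` by which `p(t)` is to be multiplied
    obtain ⟨θ, hθ⟩ : ∃ θ : Eˣ, θ = (t ^ M)⁻¹ := ⟨_, rfl⟩
    have hθM : (t : E) ^ M * θ = 1 := by
      rw [hθ, ← Units.val_pow_eq_pow_val, Units.mul_inv]
    have hσθ : σ θ = α' ^ M * θ := by
      refine mul_left_cancel₀ (mul_ne_zero (pow_ne_zero M (right_ne_zero_of_mul_eq_one hαα))
        (htM M)) ?_
      have h1 : α ^ M * (t : E) ^ M * σ θ = 1 := by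
        rw [← mul_pow, ← ht, ← map_pow, ← map_mul, hθM, map_one]
      have h2 : α' ^ M * α ^ M = 1 := by rw [← mul_pow, hαα, one_pow]
      rw [h1]
      linear_combination (-(t : E) ^ M * θ) * h2 - hθM
    have hgθ : g = p.eval (t : E) * θ := by rw [hpg, mul_assoc, hθM, mul_one]
    have h1 := opApply_eval_mul ht hσθ A p
    rw [← hgθ, hA.2, opApply_map_mul_right] at h1
    have h2 : (polyOp σ α 0 (α' ^ M) A p).eval (t : E) ∈
        listSpan σ ((f.map (· * (t : E) ^ M₁)).map (· * (t : E) ^ M)) := by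
      have h3 := mul_mem_listSpan ((t : E) ^ M) (mul_mem_listSpan ((t : E) ^ M₁) hgf)
      rw [h1, mul_assoc, mul_comm (θ : E), hθM, mul_one] at h3
      exact h3
    have hFX : Lifts B (t : E) (Fp.map (· * X ^ M)) ((f.map (· * (t : E) ^ M₁)).map
        (· * (t : E) ^ M)) := by
      refine ⟨fun q hq => ?_, ?_⟩
      · obtain ⟨q, hq', rfl⟩ := List.mem_map.1 hq
        exact mul_mem (hF.1 q hq') (pow_mem X_mem_polySub M)
      · rw [← hF.2, List.map_map, List.map_map]
        congr 1
        funext q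
        simp
    have h3 := coeff_mem_listSpan htr hK hFX (polyOp_mem hB hα (zero_mem _) (pow_mem hα' M)
      hA.1 hp) h2 (D + p.natDegree)
    have h4 : ∀ x ∈ (Fp.map (· * X ^ M)).map (coeff · (D + p.natDegree)), x ∈
        (⊥ : Submodule (constants σ) E) := by
      intro x hx
      obtain ⟨q, hq, rfl⟩ := List.mem_map.1 hx
      obtain ⟨q, hq', rfl⟩ := List.mem_map.1 hq
      refine (Submodule.mem_bot _).2 (coeff_eq_zero_of_natDegree_lt ?_)
      refine (natDegree_mul_le.trans (add_le_add (hDF q hq') (natDegree_X_pow_le _))).trans_lt ?_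
      omega
    -- the right hand side has no term in the leading degree
    have h5 := (Submodule.mem_bot _).1 (listSpan_le.2 h4 h3)
    have h6 := opApply_coeff_mul ht hσθ hD (p := p) le_rfl
    rw [h5, zero_mul] at h6
    have h7 := hPs _ _ hPN (p.coeff p.natDegree) (mem_polySub.1 hp _) (leadingCoeff_ne_zero.2 hp0)
      ((p.natDegree : ℤ) - M) (by
        rw [← h6]
        congr 2
        rw [hθ, zpow_sub, zpow_natCast, zpow_natCast]
        simp)
    omega
  · intro a f ha ha0 hf
    obtain ⟨M, h1, h2⟩ := exists_common_lifts ha hf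
    obtain ⟨A, hA⟩ := exists_lifts h1
    obtain ⟨Fp, hF⟩ := exists_lifts h2
    obtain ⟨D, hD, hD0⟩ := exists_lifts_degree hA
      (exists_mul_ne_zero (pow_ne_zero M t.ne_zero) ha0)
    obtain ⟨N, hN⟩ := exists_natDegree_le Fp
    obtain ⟨N₁, hN₁⟩ := hPt _ (coeff_mem_of_lifts hA D) hD0
    exact ⟨max N N₁, fun n hn => ⟨A, Fp, M, D, N₁, hA, hF, hD,
      fun q hq => (hN q hq).trans ((le_max_left _ _).trans hn), hN₁, (le_max_right _ _).trans hn⟩⟩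

/-- Covers can be found in `B[t, t⁻¹]` if they can be found in `B` and the exponents of `t` can be
bounded: multiplication by `tᴺ` turns the solutions into polynomials of degree at most `2 N`. -/
theorem CanCover.laurentAdjoin [IsDomain E] (hσ : Eff fun x : E => σ x) {t : Eˣ}
    (hcov : CanCover σ B)
    (hbd : UnitBound σ B t) (htr : TransOver B (t : E)) (hB : ∀ x ∈ B, σ x ∈ B) (hα : α ∈ B)
    (hα' : α' ∈ B) (hαα : α' * α = 1) (ht : σ t = α * t) (hK : ∀ x ∈ constants σ, x ∈ B)
    (hmem : Semi fun x : E => x ∈ B) : CanCover σ (_root_.laurentAdjoin B (t : E)) := by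
  have hα0 : α ≠ 0 := right_ne_zero_of_mul_eq_one hαα
  obtain ⟨u, hu⟩ : ∃ u : E, u = ((t⁻¹ : Eˣ) : E) := ⟨_, rfl⟩
  have htu : (t : E) * u = 1 := by rw [hu, Units.mul_inv]
  have hσu : σ ((t⁻¹ : Eˣ) : E) = α' * ((t⁻¹ : Eˣ) : E) := by
    rw [← hu]
    refine mul_left_cancel₀ (mul_ne_zero hα0 t.ne_zero) ?_
    have h1 : α * (t : E) * σ u = 1 := by rw [← ht, ← map_mul, htu, map_one]
    rw [h1]
    linear_combination (-(t : E) * u) * hαα - htu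
  obtain ⟨Q, hQ, hQs, hQt⟩ := exists_cover_boundedDegree (β := 0) hσ htr hB hα hα0 (zero_mem _)
    (by rw [ht, add_zero]) hK hmem hcov
  obtain ⟨U, hU, hUs, hUt⟩ := hbd.exists_degree_bound htr hB hα hα' hαα ht hK hmem
  obtain ⟨L, hL, hLs, hLt⟩ := hbd.inv.exists_degree_bound htr.inv hB hα' hα
    (by rw [mul_comm, hαα]) hσu hK hmem
  -- the operator `a` conjugated by `tᴺ` and multiplied by `tᴹ`
  let conj : List E → ℕ → ℕ → List E := fun a N M =>
    (twist σ (α' ^ N) a).map fun x => x * (t : E) ^ M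
  have hconj : ∀ a N M g, opApply σ (conj a N M) (g * (t : E) ^ N) * u ^ N =
      opApply σ a g * (t : E) ^ M := by
    intro a N M g
    have h1 : g = (g * (t : E) ^ N) * u ^ N := by rw [mul_assoc, ← mul_pow, htu, one_pow, mul_one]
    have h2 : σ (u ^ N) = α' ^ N * u ^ N := by rw [map_pow, hu, hσu, mul_pow]
    conv_rhs => rw [h1, opApply_mul_of_map_eq h2]
    rw [opApply_map_mul_right, opApply_twist]
    ring
  refine ⟨fun a f G => ∃ N M : ℕ, ∃ G' : List E, (U a f N ∧ L a f N) ∧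
    Q (conj a N M) (f.map fun x => x * (t : E) ^ (N + M)) (2 * N + 1) G' ∧
    G = G'.map fun x => x * u ^ N, ?_, ?_, ?_⟩
  · refine Semi.exists (Semi.exists (Semi.exists (Semi.and (Semi.and ?_ ?_) (Semi.and ?_ ?_))))
    · exact hU.comp (f := fun x : (((List E × List E × List E) × ℕ) × ℕ) × List E =>
        (x.1.1.1.1, x.1.1.1.2.1, x.1.1.2)) (by fun_prop)
    · exact hL.comp (f := fun x : (((List E × List E × List E) × ℕ) × ℕ) × List E =>
        (x.1.1.1.1, x.1.1.1.2.1, x.1.1.2)) (by fun_prop)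
    · exact hQ.comp (f := fun x : (((List E × List E × List E) × ℕ) × ℕ) × List E =>
        (conj x.1.1.1.1 x.1.1.2 x.1.2, x.1.1.1.2.1.map fun y => y * (t : E) ^ (x.1.1.2 + x.1.2),
          2 * x.1.1.2 + 1, x.2)) (by fun_prop)
    · fun_prop
  · rintro a f _ ⟨N, M, G, ⟨h1, h2⟩, h3, rfl⟩
    obtain ⟨hG, hcovG⟩ := hQs _ _ _ _ h3
    have huB : u ∈ _root_.laurentAdjoin B (t : E) :=
      ⟨1, by rw [pow_one, mul_comm, htu]; exact one_mem _⟩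
    refine ⟨fun g hg => ?_, fun g hg hgf => ?_⟩
    · obtain ⟨x, hx, rfl⟩ := List.mem_map.1 hg
      exact mul_mem (polyAdjoin_le_laurentAdjoin _ _ (hG x hx)) (pow_mem huB N)
    obtain ⟨M₁, p, hp, hpg, hpd⟩ := hUs a f N h1 g hg hgf
    obtain ⟨M₂, q, hq, hqg, hqd⟩ := hLs a f N h2 g (laurentAdjoin_inv_le t hg) hgf
    rw [← hu] at hqg
    -- `q` bounds the order of the pole, and `p` the degree
    obtain ⟨r, hr, hrg⟩ : ∃ r ∈ polySub B, r.eval (t : E) = g * (t : E) ^ N := by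
      refine ⟨q.reverse * X ^ (M₂ + N - q.natDegree),
        mul_mem (reverse_mem_polySub hq) (pow_mem X_mem_polySub _), ?_⟩
      have h4 := eval_inv_mul_pow t q
      rw [← hu, hqg] at h4
      rw [eval_mul, ← h4, eval_pow, eval_X, mul_assoc, ← pow_add, Nat.add_sub_cancel' hqd,
        mul_assoc, pow_add, ← mul_assoc (u ^ M₂), ← mul_pow, mul_comm u, htu, one_pow, one_mul]
    have hrp : r * X ^ M₁ = p * X ^ N := by
      refine htr.eq (mul_mem hr (pow_mem X_mem_polySub _)) (mul_mem hp (pow_mem X_mem_polySub _)) ?_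
      simp only [eval_mul, eval_pow, eval_X, hrg, hpg]
      ring
    have hmem' : g * (t : E) ^ N ∈ boundedDegree B (t : E) (2 * N + 1) := by
      refine ⟨r, hr, fun i hi => ?_, hrg⟩
      have h5 := congrArg (fun s => coeff s (i + M₁)) hrp
      simp only [coeff_mul_X_pow] at h5
      rw [h5, coeff_eq_zero_of_natDegree_lt]
      refine natDegree_mul_le.trans_lt ?_
      rw [natDegree_X_pow]
      omega
    have h6 := hcovG _ hmem' (by
      have h7 := congrArg (fun y => y * (t : E) ^ N) (hconj a N M g)
      rw [mul_assoc, ← mul_pow, mul_comm u, htu, one_pow, mul_one, mul_assoc, ← pow_add,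
        add_comm M] at h7
      rw [h7]
      exact mul_mem_listSpan _ hgf)
    have h8 := mul_mem_listSpan (u ^ N) h6
    rwa [mul_assoc, ← mul_pow, htu, one_pow, mul_one] at h8
  · intro a f ha ha0 hf
    obtain ⟨N₁, h1⟩ := hUt a f ha ha0 hf
    obtain ⟨N₂, h2⟩ := hLt a f (fun x hx => laurentAdjoin_inv_le t (ha x hx)) ha0
      fun x hx => laurentAdjoin_inv_le t (hf x hx)
    let N := max N₁ N₂
    have htw : ∀ x ∈ twist σ (α' ^ N) a, x ∈ _root_.laurentAdjoin B (t : E) := by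
      have hle := (le_polyAdjoin B (t : E)).trans (polyAdjoin_le_laurentAdjoin _ _)
      exact twist_mem (laurentAdjoin_stable hB hα hα' hαα ht) (pow_mem (hle hα') N) ha
    obtain ⟨M, h3, h4⟩ := exists_common_lifts htw hf
    have h5 : ∀ x ∈ f.map fun x => x * (t : E) ^ (N + M), x ∈ _root_.polyAdjoin B (t : E) := by
      intro x hx
      obtain ⟨y, hy, rfl⟩ := List.mem_map.1 hx
      exact polyAdjoin_pow_mem (Nat.le_add_left M N) (h4 _ (List.mem_map_of_mem hy))
    obtain ⟨G, hG⟩ := hQt _ _ (2 * N + 1) h3 (exists_mul_ne_zero (pow_ne_zero M t.ne_zero)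
      (exists_twist_ne_zero (pow_ne_zero N (left_ne_zero_of_mul_eq_one hαα)) ha0)) h5
    exact ⟨_, N, M, G, ⟨h1 N (le_max_left _ _), h2 N (le_max_right _ _)⟩, hG, rfl⟩

end laurent

/-! ### Equations over the `Π`-rings -/

namespace PiSigmaExtension

open Polynomial

variable {F E : Type*} [Field F] [CommRing E] [Algebra F E] {σF : F ≃+* F} {σE : E ≃+* E} {e : ℕ}
  (T : PiSigmaExtension σF σE e) [Coded E] [CodedRing E]

theorem semi_mem_piRing {νF : ℕ → F} (hν : Function.Surjective νF)
    (hemb : Eff fun n : ℕ => codeMap E νF n) (k : ℕ) : Semi fun x : E => x ∈ T.piRing k := by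
  induction k with
  | zero => exact semi_mem_range hν hemb
  | succ k ih =>
    change Semi fun x : E => x ∈ T.adjoinPi k _
    by_cases h : ∃ hk : k < e, T.kind ⟨k, hk⟩ = .pi
    · obtain ⟨hk, h⟩ := h
      rw [show T.adjoinPi k _ = _ from T.adjoinPi_of_pi h _]
      exact semi_mem_laurentAdjoin _ ih
    · rwa [T.adjoinPi_of_not h]

/-- The exponents are bounded over the next `Π`-ring: the coefficient of a solution `g` at the
highest power of `tₖ` solves the equation of the leading coefficients, and the exponents of the
later monomials are unchanged. -/
theorem piBound_succ (hPi : ∀ i, T.kind i = MonomialKind.pi →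
      ∃ α : F, α ≠ 0 ∧ σE (T.t i) = algebraMap F E α * T.t i) {k : ℕ}
    (hmem : Semi fun x : E => x ∈ T.piRing k) (h : T.PiBound k) : T.PiBound (k + 1) := by
  have hdom := T.isDomain
  obtain ⟨α, -, hαt, hα⟩ := T.exists_map_piMonomial hPi
  obtain ⟨P, hP, hPs, hPt⟩ := h
  by_cases hk : ∃ hk : k < e, T.kind ⟨k, hk⟩ = .pi
  swap
  · refine ⟨P, hP, fun a N hN g hg hg0 z hz i hi => hPs a N hN g ?_ hg0 z hz i (by omega), ?_⟩
    · rwa [piRing, T.adjoinPi_of_not hk] at hg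
    · rwa [piRing, T.adjoinPi_of_not hk]
  obtain ⟨hke, hk⟩ := hk
  obtain ⟨κ, rfl⟩ : ∃ κ : Fin e, (κ : ℕ) = k := ⟨⟨k, hke⟩, rfl⟩
  obtain ⟨t, ht⟩ : ∃ t : E, t = T.t κ := ⟨_, rfl⟩
  have htu : (T.piUnit κ : E) = t := by rw [T.piUnit_of_pi hk, ht]
  have hring : T.piRing (κ + 1) = laurentAdjoin (T.piRing κ) t := by
    rw [piRing, T.adjoinPi_of_pi hk, ht]
  rw [PiBound, hring]
  have htr : TransOver (T.piRing κ) t := ht ▸ T.transOver_piRing κ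
  have hσt : σE t = algebraMap F E (α κ) * t := ht ▸ hαt κ hk
  have hB := T.piRing_stable hPi κ
  have hF := T.range_le_piRing κ
  refine ⟨fun a N => ∃ A : List E[X], ∃ M D : ℕ,
    Lifts (T.piRing κ) t A (a.map fun x => x * t ^ M) ∧ AllMem A (fun q => q.natDegree ≤ D) ∧
    P (A.map fun q => q.coeff D) N, ?_, ?_, ?_⟩
  · have hP' : Semi fun x : (List E[X] × ℕ) × ℕ => P (x.1.1.map fun q => q.coeff x.1.2) x.2 :=
      hP.comp (f := fun x : (List E[X] × ℕ) × ℕ => (x.1.1.map fun q => q.coeff x.1.2, x.2))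
        (by fun_prop)
    refine Semi.exists (Semi.exists (Semi.exists (Semi.and ?_ (Semi.and ?_ ?_))))
    · exact Semi.lifts hmem (by fun_prop) (by fun_prop)
    · exact Semi.allMem (by fun_prop) (Semi.natDegree_le (by fun_prop) (by fun_prop))
    · exact hP'.comp (f := fun x : (((List E × ℕ) × List E[X]) × ℕ) × ℕ =>
        ((x.1.1.2, x.2), x.1.1.1.2)) (by fun_prop)
  · rintro a N ⟨A, M₁, D, hA, hD, hPN⟩ g hg hg0 z hz i hi hpi
    obtain ⟨M, p, hp, hpg⟩ := mem_laurentAdjoin.1 hg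
    have ht0 : t ≠ 0 := htu ▸ (T.piUnit κ).ne_zero
    have hp0 : p ≠ 0 := by
      rintro rfl
      rw [eval_zero] at hpg
      exact mul_ne_zero hg0 (pow_ne_zero M ht0) hpg.symm
    -- `g` is `p(t) t⁻ᴹ`; the power of `t` is moved into the monomial
    let w : Fin e → ℤ := z + Pi.single κ (-(M : ℤ))
    have htM : t ^ M * (T.piMonomial w : E) = T.piMonomial z := by
      rw [← htu, ← Units.val_pow_eq_pow_val, ← Units.val_mul, T.piMonomial_add,
        T.piMonomial_single, zpow_neg, zpow_natCast, mul_comm, inv_mul_cancel_right]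
    have h1 := opApply_eval_mul hσt (hα w) A p
    rw [hpg, mul_assoc, htM, hA.2, opApply_map_mul_right, hz, zero_mul] at h1
    have h2 := (mul_eq_zero.1 h1.symm).resolve_right (Units.ne_zero _)
    have h3 := htr _ (polyOp_mem hB (hF ⟨_, rfl⟩) (zero_mem _) (hF ⟨_, rfl⟩) hA.1 hp) h2
    have h4 := opApply_coeff_mul hσt (hα w) hD (p := p) le_rfl
    rw [h3, coeff_zero, zero_mul] at h4
    have h5 := hPs _ _ hPN (p.coeff p.natDegree) (mem_polySub.1 hp _) (leadingCoeff_ne_zero.2 hp0)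
      (Pi.single κ (p.natDegree : ℤ) + w) (by
        rw [← h4, T.piMonomial_add, T.piMonomial_single, zpow_natCast, Units.val_mul,
          Units.val_pow_eq_pow_val, htu]) i (by omega) hpi
    have hne : i ≠ κ := by
      rintro rfl
      omega
    simpa [w, Pi.single_eq_of_ne hne] using h5
  · intro a ha ha0
    obtain ⟨M, h1, -⟩ := exists_common_lifts ha (l' := []) (by simp)
    obtain ⟨A, hA⟩ := exists_lifts h1
    obtain ⟨D, hD, hD0⟩ := exists_lifts_degree hA
      (exists_mul_ne_zero (pow_ne_zero M (htu ▸ (T.piUnit κ).ne_zero)) ha0)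
    obtain ⟨N, hN⟩ := hPt _ (coeff_mem_of_lifts hA D) hD0
    exact ⟨N, A, M, D, hA, hD, hN⟩

/-- Covers can be found in the rings generated by `Π`-monomials. -/
theorem canCover_piRing (hPi : ∀ i, T.kind i = MonomialKind.pi →
      ∃ α : F, α ≠ 0 ∧ σE (T.t i) = algebraMap F E α * T.t i)
    (hσ : Eff fun x : E => σE x) {νF : ℕ → F} (hν : Function.Surjective νF)
    (hemb : Eff fun n : ℕ => codeMap E νF n) (hPLDE : CanSolvePLDEs νF σF)
    (hOrbit : CanSolvePseudoOrbit νF σF)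
    (hHyp : CanComputeHypergeometricCandidates νF σF) (k : ℕ) :
    CanCover σE (T.piRing k) := by
  have hdom := T.isDomain
  have hmem := T.semi_mem_piRing hν hemb
  have hbd : ∀ k, T.PiBound k := fun k => by
    induction k with
    | zero => exact T.piBound_zero hPi hν hemb hOrbit hHyp
    | succ k ih => exact T.piBound_succ hPi (hmem k) ih
  induction k with
  | zero => exact T.canCover_range hν hemb hPLDE
  | succ k ih =>
    by_cases hk : ∃ hk : k < e, T.kind ⟨k, hk⟩ = .pi
    swap
    · rwa [piRing, T.adjoinPi_of_not hk]
    obtain ⟨hke, hk⟩ := hk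
    obtain ⟨κ, rfl⟩ : ∃ κ : Fin e, (κ : ℕ) = k := ⟨⟨k, hke⟩, rfl⟩
    rw [piRing, T.adjoinPi_of_pi hk, ← T.piUnit_of_pi hk]
    obtain ⟨α, hα0, hα⟩ := hPi κ hk
    have hF := T.range_le_piRing κ
    refine ih.laurentAdjoin hσ ?_ ?_ (T.piRing_stable hPi κ) (hF ⟨α, rfl⟩) (hF ⟨α⁻¹, rfl⟩) ?_ ?_
      (fun x hx => hF (T.const_mem_range hx)) (hmem κ)
    · obtain ⟨P, hP, hPs, hPt⟩ := hbd κ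
      refine ⟨P, hP, fun a N hN x hx hx0 n hn => ?_, hPt⟩
      have h1 := hPs a N hN x hx hx0 (Pi.single κ n) (by rwa [T.piMonomial_single]) κ le_rfl hk
      simpa using h1
    · rw [T.piUnit_of_pi hk]
      exact T.transOver_piRing κ
    · rw [← map_mul, inv_mul_cancel₀ hα0, map_one]
    · rw [T.piUnit_of_pi hk, hα]

end PiSigmaExtension

/-! ### Degrees of Casoratians -/

section sigmadegree

open Polynomial

variable {E : Type*} [CommRing E] {σ : E ≃+* E} {B : Subring E} {β : E}

theorem coeff_mul_second {p q : E[X]} {n m : ℕ} (hp : p.natDegree ≤ n + 1)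
    (hq : q.natDegree ≤ m + 1) : (p * q).coeff (n + m + 1) =
      p.coeff (n + 1) * q.coeff m + p.coeff n * q.coeff (m + 1) := by
  obtain ⟨p', hp', h⟩ : ∃ p' : E[X], p'.natDegree ≤ n ∧
      p = C (p.coeff (n + 1)) * X ^ (n + 1) + p' := by
    refine ⟨p - C (p.coeff (n + 1)) * X ^ (n + 1), ?_, by ring⟩
    refine natDegree_le_iff_coeff_eq_zero.2 fun i hi => ?_
    rw [coeff_sub, coeff_C_mul_X_pow]
    split_ifs with h
    · rw [h, sub_self]
    · rw [sub_zero]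
      exact coeff_eq_zero_of_natDegree_lt (by omega)
  have h1 : p.coeff n = p'.coeff n := by
    rw [h, coeff_add, coeff_C_mul_X_pow, if_neg (by omega), zero_add]
  have h2 : (C (p.coeff (n + 1)) * X ^ (n + 1) * q).coeff (n + m + 1) =
      p.coeff (n + 1) * q.coeff m := by
    rw [mul_assoc, coeff_C_mul, mul_comm (X ^ _), show n + m + 1 = m + (n + 1) by omega,
      coeff_mul_X_pow]
  have h3 : (p' * q).coeff (n + m + 1) = p'.coeff n * q.coeff (m + 1) :=
    coeff_mul_add_eq_of_natDegree_le hp' hq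
  rw [h1, ← h2, ← h3, ← coeff_add, ← add_mul, ← h]

theorem coeff_shiftHom_second {p : E[X]} {n : ℕ} (hp : p.natDegree ≤ n + 1) :
    (shiftHom σ 1 β p).coeff n = σ (p.coeff n) + (n + 1) * (β * σ (p.coeff (n + 1))) := by
  obtain ⟨p', hp', h⟩ : ∃ p' : E[X], p'.natDegree ≤ n ∧
      p = C (p.coeff (n + 1)) * X ^ (n + 1) + p' := by
    refine ⟨p - C (p.coeff (n + 1)) * X ^ (n + 1), ?_, by ring⟩
    refine natDegree_le_iff_coeff_eq_zero.2 fun i hi => ?_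
    rw [coeff_sub, coeff_C_mul_X_pow]
    split_ifs with h
    · rw [h, sub_self]
    · rw [sub_zero]
      exact coeff_eq_zero_of_natDegree_lt (by omega)
  have h1 : p.coeff n = p'.coeff n := by
    rw [h, coeff_add, coeff_C_mul_X_pow, if_neg (by omega), zero_add]
  rw [h1]
  generalize p.coeff (n + 1) = a at h
  rw [h, map_add, coeff_add, coeff_shiftHom_of_le _ _ _ hp', map_mul, map_pow, shiftHom_C,
    shiftHom_X, C_1, one_mul, coeff_C_mul, coeff_X_add_C_pow]
  simp
  ring

/-- The Casoratian of `p` and `q` for the automorphism that extends `σ` by `X ↦ X + β`. -/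
def casoratian (σ : E ≃+* E) (β : E) (p q : E[X]) : E[X] :=
  shiftHom σ 1 β p * q - p * shiftHom σ 1 β q

theorem casoratian_sub_C_mul {c : E} (hc : c ∈ constants σ) (p q : E[X]) :
    casoratian σ β (p - C c * q) q = casoratian σ β p q := by
  rw [mem_constants] at hc
  simp only [casoratian, map_sub, map_mul, shiftHom_C, hc]
  ring

theorem natDegree_casoratian_le (p q : E[X]) :
    (casoratian σ β p q).natDegree ≤ p.natDegree + q.natDegree := by
  refine (natDegree_sub_le _ _).trans (max_le ?_ ?_)
  · exact natDegree_mul_le.trans (add_le_add (natDegree_shiftHom_le _ _ _ _) le_rfl)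
  · exact natDegree_mul_le.trans (add_le_add le_rfl (natDegree_shiftHom_le _ _ _ _))

variable [IsDomain E]

/-- The degree of the Casoratian of polynomials of different degrees drops by at most one. If the
leading coefficients cancel, then `p` and `q` have the same leading coefficient up to a constant,
and the cancellation of the second coefficients would express `β` as `σ(w) - w`. -/
theorem le_natDegree_casoratian [CharZero E] (hσ : ConstQuotients σ)
    (hinv : ∀ c ∈ constants σ, c ≠ 0 → ∃ c' ∈ constants σ, c' * c = 1)
    (hβ : ∀ u ∈ B, ∀ v ∈ B, v ≠ 0 → σ u * v - u * σ v ≠ β * (v * σ v))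
    (hK : ∀ x ∈ constants σ, x ∈ B) {p q : E[X]} (hp : p ∈ polySub B) (hq : q ∈ polySub B)
    (hp0 : p ≠ 0) (hq0 : q ≠ 0) (hne : p.natDegree ≠ q.natDegree) :
    casoratian σ β p q ≠ 0 ∧ p.natDegree + q.natDegree ≤ (casoratian σ β p q).natDegree + 1 := by
  set n := p.natDegree
  set m := q.natDegree
  have htop : (casoratian σ β p q).coeff (n + m) =
      σ (p.coeff n) * q.coeff m - p.coeff n * σ (q.coeff m) := by
    rw [casoratian, coeff_sub,
      coeff_mul_add_eq_of_natDegree_le (natDegree_shiftHom_le _ _ _ _) le_rfl,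
      coeff_mul_add_eq_of_natDegree_le le_rfl (natDegree_shiftHom_le _ _ _ _),
      coeff_shiftHom_of_le _ _ _ le_rfl, coeff_shiftHom_of_le _ _ _ le_rfl]
    simp [n, m]
  by_cases h0 : σ (p.coeff n) * q.coeff m - p.coeff n * σ (q.coeff m) = 0
  swap
  · rw [← htop] at h0
    have := le_natDegree_of_ne_zero h0
    exact ⟨fun h => h0 (by rw [h, coeff_zero]), by omega⟩
  have hqm : q.coeff m ≠ 0 := leadingCoeff_ne_zero.2 hq0
  have hpn : p.coeff n ≠ 0 := leadingCoeff_ne_zero.2 hp0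
  obtain ⟨c₁, hc₁, d₁, hd₁, hd₁0, hdc⟩ := hσ _ _ hqm (sub_eq_zero.1 h0)
  obtain ⟨d', hd', hdd⟩ := hinv d₁ hd₁ hd₁0
  obtain ⟨c, hc, hcq⟩ : ∃ c ∈ constants σ, p.coeff n = c * q.coeff m :=
    ⟨d' * c₁, mul_mem hd' hc₁, by linear_combination d' * hdc - (p.coeff n) * hdd⟩
  have hc0 : c ≠ 0 := by
    rintro rfl
    rw [zero_mul] at hcq
    exact hpn hcq
  -- the coefficient below the leading ones, taken from `X p` and `X q` as `n` or `m` may be zero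
  have hsub : ∀ {r : E[X]} {k : ℕ}, r.natDegree ≤ k → (X * shiftHom σ 1 β r).coeff k =
      σ ((X * r).coeff k) + k * (β * σ (r.coeff k)) := by
    intro r k hr
    cases k with
    | zero => simp
    | succ k =>
      rw [coeff_X_mul, coeff_X_mul, coeff_shiftHom_second hr]
      push_cast
      ring
  have hdeg : ∀ {r : E[X]} {k : ℕ}, r.natDegree ≤ k → (X * r).natDegree ≤ k + 1 := by
    intro r k hr
    refine natDegree_mul_le.trans ?_
    rw [natDegree_X]
    omega
  have hs : ∀ r : E[X], (shiftHom σ 1 β r).natDegree ≤ r.natDegree :=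
    fun r => natDegree_shiftHom_le _ _ _ r
  have hsc : ∀ r : E[X], (shiftHom σ 1 β r).coeff r.natDegree = σ (r.coeff r.natDegree) :=
    fun r => by rw [coeff_shiftHom_of_le _ _ _ le_rfl, one_pow, one_mul]
  set y := (X * p).coeff n - c * (X * q).coeff m with hy
  have hsecond : (X * (X * casoratian σ β p q)).coeff (n + m + 1) =
      (σ y * q.coeff m - y * σ (q.coeff m)) +
        ((n : E) - m) * c * (β * (q.coeff m * σ (q.coeff m))) := by
    have h1 : X * (X * casoratian σ β p q) =
        (X * shiftHom σ 1 β p) * (X * q) - (X * p) * (X * shiftHom σ 1 β q) := by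
      rw [casoratian]; ring
    rw [h1, coeff_sub, coeff_mul_second (hdeg (hs p)) (hdeg le_rfl),
      coeff_mul_second (hdeg le_rfl) (hdeg (hs q)), hsub le_rfl, hsub le_rfl]
    simp only [coeff_X_mul]
    rw [hsc, hsc]
    have hcσ : σ c = c := hc
    change _ = _
    rw [hy, map_sub, map_mul, hcσ]
    change σ (p.coeff n) * (X * q).coeff m + (σ ((X * p).coeff n) + n * (β * σ (p.coeff n))) *
      q.coeff m - (p.coeff n * (σ ((X * q).coeff m) + m * (β * σ (q.coeff m))) +
        (X * p).coeff n * σ (q.coeff m)) = _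
    rw [hcq, map_mul, hcσ]
    ring
  have hne0 : (X * (X * casoratian σ β p q)).coeff (n + m + 1) ≠ 0 := by
    rw [hsecond]
    intro h
    have hnm : ((m : E) - n) * c ∈ constants σ := by
      refine mul_mem (sub_mem ?_ ?_) hc <;> rw [mem_constants, map_natCast]
    have hnm0 : ((m : E) - n) * c ≠ 0 :=
      mul_ne_zero (sub_ne_zero.2 fun h => hne (by exact_mod_cast h.symm)) hc0
    obtain ⟨z, hz, hzz⟩ := hinv _ hnm hnm0
    have hyB : y ∈ B := by
      refine sub_mem ?_ (mul_mem (hK c hc) ?_)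
      · exact mem_polySub.1 (mul_mem X_mem_polySub hp) _
      · exact mem_polySub.1 (mul_mem X_mem_polySub hq) _
    refine hβ (z * y) (mul_mem (hK z hz) hyB) (q.coeff m) (mem_polySub.1 hq _) hqm ?_
    have hzσ : σ z = z := hz
    rw [map_mul, hzσ]
    linear_combination z * h + (β * (q.coeff m * σ (q.coeff m))) * hzz
  have h2 := le_natDegree_of_ne_zero hne0
  have hne1 : casoratian σ β p q ≠ 0 := fun h => hne0 (by simp [h])
  refine ⟨hne1, ?_⟩
  rw [natDegree_X_mul (mul_ne_zero X_ne_zero hne1), natDegree_X_mul hne1] at h2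
  omega

/-- A lower bound for the degree of the Casoratian without an assumption on the degrees: if `p` and
`q` have the same degree and the leading coefficients cancel in the Casoratian, then a constant
multiple of `q`, which does not affect it, is subtracted from `p` in order to lower the degree. -/
theorem exists_le_natDegree_casoratian [CharZero E] (hσ : ConstQuotients σ)
    (hinv : ∀ c ∈ constants σ, c ≠ 0 → ∃ c' ∈ constants σ, c' * c = 1)
    (hβ : ∀ u ∈ B, ∀ v ∈ B, v ≠ 0 → σ u * v - u * σ v ≠ β * (v * σ v))
    (hK : ∀ x ∈ constants σ, x ∈ B) {p q : E[X]} (hp : p ∈ polySub B) (hq : q ∈ polySub B)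
    (hq0 : q ≠ 0) (hne : ∀ c ∈ constants σ, p - C c * q ≠ 0) :
    casoratian σ β p q ≠ 0 ∧ ∃ c ∈ constants σ,
      (p - C c * q).natDegree + q.natDegree ≤ (casoratian σ β p q).natDegree + 1 := by
  by_cases hd : p.natDegree = q.natDegree
  swap
  · obtain ⟨h1, h2⟩ := le_natDegree_casoratian hσ hinv hβ hK hp hq
      (by simpa using hne 0 (zero_mem _)) hq0 hd
    exact ⟨h1, 0, zero_mem _, by simpa using h2⟩
  by_cases h0 : σ p.leadingCoeff * q.leadingCoeff = p.leadingCoeff * σ q.leadingCoeff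
  · obtain ⟨c₁, hc₁, d₁, hd₁, hd₁0, hdc⟩ := hσ _ _ (leadingCoeff_ne_zero.2 hq0) h0
    obtain ⟨d', hd', hdd⟩ := hinv d₁ hd₁ hd₁0
    have hc : d' * c₁ ∈ constants σ := mul_mem hd' hc₁
    have hcq : p.leadingCoeff = d' * c₁ * q.leadingCoeff := by
      linear_combination d' * hdc - p.leadingCoeff * hdd
    have hne' := hne _ hc
    have hlt : (p - C (d' * c₁) * q).natDegree ≠ q.natDegree := by
      intro h
      refine hne' (leadingCoeff_eq_zero.1 ?_)
      rw [leadingCoeff, h, coeff_sub, coeff_C_mul, ← hd, sub_eq_zero, hd]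
      rw [leadingCoeff, leadingCoeff, hd] at hcq
      exact hcq
    obtain ⟨h1, h2⟩ := le_natDegree_casoratian hσ hinv hβ hK
      (sub_mem hp (mul_mem (C_mem_polySub (hK _ hc)) hq)) hq hne' hq0 hlt
    rw [casoratian_sub_C_mul hc] at h1 h2
    exact ⟨h1, _, hc, h2⟩
  · have htop : (casoratian σ β p q).coeff (p.natDegree + q.natDegree) =
        σ p.leadingCoeff * q.leadingCoeff - p.leadingCoeff * σ q.leadingCoeff := by
      rw [casoratian, coeff_sub,
        coeff_mul_add_eq_of_natDegree_le (natDegree_shiftHom_le _ _ _ _) le_rfl,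
        coeff_mul_add_eq_of_natDegree_le le_rfl (natDegree_shiftHom_le _ _ _ _),
        coeff_shiftHom_of_le _ _ _ le_rfl, coeff_shiftHom_of_le _ _ _ le_rfl]
      simp
    have h1 : (casoratian σ β p q).coeff (p.natDegree + q.natDegree) ≠ 0 := by
      rw [htop]
      exact sub_ne_zero.2 h0
    have h2 := le_natDegree_of_ne_zero h1
    refine ⟨fun h => h1 (by rw [h, coeff_zero]), 0, zero_mem _, ?_⟩
    simp only [map_zero, zero_mul, sub_zero]
    omega

end sigmadegree

/-! ### Degrees under a difference operator, by reduction of order -/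

section operatordegree

open Polynomial

variable {E : Type*} [CommRing E] {σ : E ≃+* E} {B : Subring E} {β : E}

theorem natDegree_shiftHom [IsDomain E] (p : E[X]) :
    (shiftHom σ 1 β p).natDegree = p.natDegree := by
  refine le_antisymm (natDegree_shiftHom_le _ _ _ p) ?_
  by_cases hp : p = 0
  · simp [hp]
  refine le_natDegree_of_ne_zero ?_
  rw [coeff_shiftHom_of_le _ _ _ le_rfl, one_pow, one_mul]
  simpa using hp

theorem natDegree_iterate_shiftHom [IsDomain E] (n : ℕ) (p : E[X]) :
    ((shiftHom σ 1 β)^[n] p).natDegree = p.natDegree := by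
  induction n with
  | zero => rfl
  | succ n ih => rw [Function.iterate_succ_apply', natDegree_shiftHom, ih]

theorem iterate_shiftHom_mem (hB : ∀ x ∈ B, σ x ∈ B) (hβB : β ∈ B) {p : E[X]}
    (hp : p ∈ polySub B) (n : ℕ) : (shiftHom σ 1 β)^[n] p ∈ polySub B := by
  induction n with
  | zero => exact hp
  | succ n ih =>
    rw [Function.iterate_succ_apply']
    exact shiftHom_mem_polySub hB (one_mem _) hβB ih

/-- Reduction of order. If `L` is an operator of order `m + 1` and `S` is the shift, then
`L(y) η - y L(η)` is, up to the factor `η S(η) ⋯ Sᵐ(η)`, an operator of order `m` at the Casoratian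
of `y` and `η`. -/
theorem exists_reduction_of_order (hB : ∀ x ∈ B, σ x ∈ B) (hβB : β ∈ B) {η : E[X]}
    (hη : η ∈ polySub B) (m : ℕ) : ∀ a : ℕ → E[X], (∀ i, a i ∈ polySub B) →
      ∃ b : ℕ → E[X], (∀ i, b i ∈ polySub B) ∧
        b m = a (m + 1) * (∏ l ∈ Finset.range m, (shiftHom σ 1 β)^[l] η) * η ∧
        ∀ y, (∏ l ∈ Finset.range (m + 1), (shiftHom σ 1 β)^[l] η) *
          ∑ j ∈ Finset.range (m + 2), a j *
            ((shiftHom σ 1 β)^[j] y * η - y * (shiftHom σ 1 β)^[j] η) =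
          ∑ l ∈ Finset.range (m + 1), b l * (shiftHom σ 1 β)^[l] (casoratian σ β y η) := by
  induction m with
  | zero =>
    intro a ha
    refine ⟨fun _ => a 1 * η, fun _ => mul_mem (ha 1) hη, by simp, fun y => ?_⟩
    simp [Finset.sum_range_succ, casoratian]
    ring
  | succ m ih =>
    intro a ha
    -- By `Sᵐ⁺²(y) Sᵐ⁺¹(η) = Sᵐ⁺¹(y) Sᵐ⁺²(η) + Sᵐ⁺¹(z)` for the Casoratian `z` of `y` and `η`, the
    -- operator times `Sᵐ⁺¹(η)` becomes an operator of order `m + 1` plus a term in `Sᵐ⁺¹(z)`.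
    obtain ⟨b, hb, -, hby⟩ := ih
      (fun j => if j < m + 1 then (shiftHom σ 1 β)^[m + 1] η * a j else
        (shiftHom σ 1 β)^[m + 1] η * a j + a (j + 1) * (shiftHom σ 1 β)^[m + 2] η) fun i => by
          have h1 := iterate_shiftHom_mem hB hβB hη (m + 1)
          have h2 := iterate_shiftHom_mem hB hβB hη (m + 2)
          split_ifs
          · exact mul_mem h1 (ha _)
          · exact add_mem (mul_mem h1 (ha _)) (mul_mem (ha _) h2)
    have hQ : (∏ l ∈ Finset.range (m + 1), (shiftHom σ 1 β)^[l] η) ∈ polySub B :=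
      prod_mem fun l _ => iterate_shiftHom_mem hB hβB hη l
    refine ⟨fun l => if l < m + 1 then b l else
      a (m + 2) * (∏ l ∈ Finset.range (m + 1), (shiftHom σ 1 β)^[l] η) * η, fun i => ?_, ?_,
      fun y => ?_⟩
    · dsimp only
      split_ifs
      · exact hb i
      · exact mul_mem (mul_mem (ha _) hQ) hη
    · simp
    · have h1 : ∀ g : ℕ → E[X], ∀ u : E[X], ∑ l ∈ Finset.range (m + 2),
          (if l < m + 1 then b l else u) * g l =
          (∑ l ∈ Finset.range (m + 1), b l * g l) + u * g (m + 1) := by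
        intro g u
        rw [Finset.sum_range_succ, if_neg (lt_irrefl _)]
        exact congrArg (· + _) (Finset.sum_congr rfl fun l hl => by
          rw [if_pos (Finset.mem_range.1 hl)])
      have h2 : ∀ g : ℕ → E[X], ∀ u v : E[X], ∑ l ∈ Finset.range (m + 2),
          (if l < m + 1 then u * a l else u * a l + a (l + 1) * v) * g l =
          u * (∑ l ∈ Finset.range (m + 2), a l * g l) + a (m + 2) * v * g (m + 1) := by
        intro g u v
        rw [Finset.sum_range_succ, if_neg (lt_irrefl _), Finset.sum_range_succ (fun l => a l * g l),
          mul_add, Finset.mul_sum]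
        rw [Finset.sum_congr rfl fun l hl => by rw [if_pos (Finset.mem_range.1 hl), mul_assoc]]
        ring
      rw [h1, ← hby y, h2]
      rw [Finset.prod_range_succ _ (m + 1), Finset.sum_range_succ _ (m + 2)]
      have hz : (shiftHom σ 1 β)^[m + 1] (casoratian σ β y η) =
          (shiftHom σ 1 β)^[m + 2] y * (shiftHom σ 1 β)^[m + 1] η -
            (shiftHom σ 1 β)^[m + 1] y * (shiftHom σ 1 β)^[m + 2] η := by
        rw [casoratian, iterate_map_sub, iterate_map_mul, iterate_map_mul,
          ← Function.iterate_succ_apply, ← Function.iterate_succ_apply]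
      rw [hz]
      ring

/-- An operator cannot lower the degrees by much on all of a large space. If `L` has order `m` and
leading coefficient `a m`, and all nonzero combinations of `y 0, …, y m` over the constants have
degrees in an interval of length `δ`, then some `L (y i)` has degree at least `deg (a m)` plus the
lower end of this interval, up to an error that depends on `m` and `δ` only. The proof is by
reduction of order. -/
theorem natDegree_add_le_of_combinations [IsDomain E] [CharZero E] (hσ : ConstQuotients σ)
    (hinv : ∀ c ∈ constants σ, c ≠ 0 → ∃ c' ∈ constants σ, c' * c = 1)
    (hβ : ∀ u ∈ B, ∀ v ∈ B, v ≠ 0 → σ u * v - u * σ v ≠ β * (v * σ v))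
    (hK : ∀ x ∈ constants σ, x ∈ B) (hB : ∀ x ∈ B, σ x ∈ B) (hβB : β ∈ B) (m : ℕ) :
    ∀ (a y : ℕ → E[X]) (lo hi δ N : ℕ), (∀ i, a i ∈ polySub B) → (∀ i, y i ∈ polySub B) →
      a m ≠ 0 → hi ≤ lo + δ →
      (∀ c : ℕ → E, (∀ i, c i ∈ constants σ) → (∃ i ≤ m, c i ≠ 0) →
        ∑ i ∈ Finset.range (m + 1), C (c i) * y i ≠ 0 ∧
        lo ≤ (∑ i ∈ Finset.range (m + 1), C (c i) * y i).natDegree ∧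
        (∑ i ∈ Finset.range (m + 1), C (c i) * y i).natDegree ≤ hi) →
      (∀ i ≤ m, (∑ j ∈ Finset.range (m + 1), a j * (shiftHom σ 1 β)^[j] (y i)).natDegree ≤ N) →
      (a m).natDegree + lo ≤ N + m * (δ + m) := by
  induction m with
  | zero =>
    intro a y lo hi δ N ha hy ham hδ hc hN
    obtain ⟨h1, h2, -⟩ := hc (fun _ => 1) (fun _ => one_mem _) ⟨0, le_rfl, one_ne_zero⟩
    have h3 := hN 0 le_rfl
    simp only [zero_add, Finset.range_one, Finset.sum_singleton, map_one, one_mul,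
      Function.iterate_zero, id] at h1 h2 h3
    rw [natDegree_mul ham h1] at h3
    omega
  | succ m ih =>
    intro a y lo hi δ N ha hy ham hδ hc hN
    have hsingle : ∀ i ≤ m + 1, y i ≠ 0 ∧ lo ≤ (y i).natDegree ∧ (y i).natDegree ≤ hi := by
      intro i hi
      have := hc (fun j => if j = i then 1 else 0) (fun j => by
        split_ifs; exacts [one_mem _, zero_mem _]) ⟨i, hi, by simp⟩
      simpa [apply_ite C, ite_mul, Nat.lt_succ_of_le hi] using this
    obtain ⟨hη, hηlo, hηhi⟩ := hsingle 0 (Nat.zero_le _)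
    obtain ⟨b, hb, hbm, hby⟩ := exists_reduction_of_order hB hβB (hy 0) m a ha
    have hS : ∀ l, (shiftHom σ 1 β)^[l] (y 0) ≠ 0 := by
      intro l
      have hinj : Function.Injective (shiftHom σ 1 β) := by
        rw [injective_iff_map_eq_zero]
        intro p hp
        by_contra h
        have h1 : (shiftHom σ 1 β p).coeff p.natDegree = σ (p.coeff p.natDegree) := by
          rw [coeff_shiftHom_of_le _ _ _ le_rfl, one_pow, one_mul]
        rw [hp, coeff_zero, eq_comm, map_eq_zero_iff _ σ.injective, coeff_natDegree,
          leadingCoeff_eq_zero] at h1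
        exact h h1
      intro h
      exact hη (hinj.iterate l (by rw [h, iterate_map_zero]))
    have hQ0 : ∀ n, ∏ l ∈ Finset.range n, (shiftHom σ 1 β)^[l] (y 0) ≠ 0 :=
      fun n => Finset.prod_ne_zero_iff.2 fun l _ => hS l
    have hQ : ∀ n, (∏ l ∈ Finset.range n, (shiftHom σ 1 β)^[l] (y 0)).natDegree =
        n * (y 0).natDegree := by
      intro n
      rw [natDegree_prod _ _ fun l _ => hS l]
      simp [natDegree_iterate_shiftHom]
    have hbm0 : b m ≠ 0 := by
      rw [hbm]
      exact mul_ne_zero (mul_ne_zero ham (hQ0 m)) hη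
    have hbdeg : (b m).natDegree =
        (a (m + 1)).natDegree + m * (y 0).natDegree + (y 0).natDegree := by
      rw [hbm, natDegree_mul (mul_ne_zero ham (hQ0 m)) hη, natDegree_mul ham (hQ0 m), hQ]
    have hz : ∀ i, casoratian σ β (y (i + 1)) (y 0) ∈ polySub B := fun i =>
      sub_mem (mul_mem (shiftHom_mem_polySub hB (one_mem _) hβB (hy _)) (hy 0))
        (mul_mem (hy _) (shiftHom_mem_polySub hB (one_mem _) hβB (hy 0)))
    -- The Casoratians of `y 0` with the others satisfy the hypotheses for the reduced operator:
    -- their combinations have degrees from `lo + deg (y 0) - 1` up to `hi + deg (y 0)`.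
    have key := ih b (fun i => casoratian σ β (y (i + 1)) (y 0)) (lo + (y 0).natDegree - 1)
      (hi + (y 0).natDegree) (δ + 1) ((m + 1) * (y 0).natDegree + (N + hi)) hb hz hbm0 (by omega)
      ?_ ?_
    · rw [hbdeg] at key
      have h1 : (m + 1) * (y 0).natDegree = m * (y 0).natDegree + (y 0).natDegree := by ring
      have h2 : (m + 1) * (δ + (m + 1)) = m * (δ + 1 + m) + (δ + 1 + m) := by ring
      rw [h1] at key
      rw [h2]
      omega
    · intro c hcc hcne
      have hsum : ∑ i ∈ Finset.range (m + 1), C (c i) * casoratian σ β (y (i + 1)) (y 0) =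
          casoratian σ β (∑ i ∈ Finset.range (m + 1), C (c i) * y (i + 1)) (y 0) := by
        simp only [casoratian, map_sum, map_mul, shiftHom_C, Finset.sum_mul]
        rw [← Finset.sum_sub_distrib]
        refine Finset.sum_congr rfl fun i _ => ?_
        rw [(mem_constants σ).1 (hcc i)]
        ring
      have hcomb : ∀ d ∈ constants σ,
          (∑ i ∈ Finset.range (m + 1), C (c i) * y (i + 1)) - C d * y 0 ≠ 0 ∧
          lo ≤ ((∑ i ∈ Finset.range (m + 1), C (c i) * y (i + 1)) - C d * y 0).natDegree ∧
          ((∑ i ∈ Finset.range (m + 1), C (c i) * y (i + 1)) - C d * y 0).natDegree ≤ hi := by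
        intro d hd
        have := hc (fun i => Nat.casesOn i (-d) c) (fun i => by
          cases i
          · exact neg_mem hd
          · exact hcc _) (by
            obtain ⟨i, hi, hne⟩ := hcne
            exact ⟨i + 1, by omega, hne⟩)
        rw [Finset.sum_range_succ'] at this
        simpa [sub_eq_add_neg] using this
      have hpm : (∑ i ∈ Finset.range (m + 1), C (c i) * y (i + 1)) ∈ polySub B :=
        sum_mem fun i _ => mul_mem (C_mem_polySub (hK _ (hcc i))) (hy _)
      obtain ⟨h1, d, hd, h2⟩ := exists_le_natDegree_casoratian hσ hinv hβ hK hpm (hy 0) hη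
        fun d hd => (hcomb d hd).1
      rw [hsum]
      refine ⟨h1, ?_, (natDegree_casoratian_le _ _).trans ?_⟩
      · have := (hcomb d hd).2.1
        omega
      · have := (hcomb 0 (zero_mem _)).2.2
        simp only [map_zero, zero_mul, sub_zero] at this
        omega
    · intro i hi'
      rw [← hby]
      refine natDegree_mul_le.trans ?_
      rw [hQ]
      refine Nat.add_le_add_left ?_ _
      have h1 : ∑ j ∈ Finset.range (m + 2), a j * ((shiftHom σ 1 β)^[j] (y (i + 1)) * y 0 -
          y (i + 1) * (shiftHom σ 1 β)^[j] (y 0)) =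
          (∑ j ∈ Finset.range (m + 2), a j * (shiftHom σ 1 β)^[j] (y (i + 1))) * y 0 -
          y (i + 1) * ∑ j ∈ Finset.range (m + 2), a j * (shiftHom σ 1 β)^[j] (y 0) := by
        rw [Finset.sum_mul, Finset.mul_sum, ← Finset.sum_sub_distrib]
        exact Finset.sum_congr rfl fun j _ => by ring
      rw [h1]
      refine (natDegree_sub_le _ _).trans (max_le ?_ ?_)
      · exact natDegree_mul_le.trans (add_le_add (hN _ (by omega)) hηhi)
      · have h2 := (hsingle (i + 1) (by omega)).2.2
        have h3 := hN 0 (Nat.zero_le _)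
        exact natDegree_mul_le.trans (by rw [add_comm N]; exact add_le_add h2 h3)

end operatordegree

/-! ### Symbols: the highest coefficients of an operator applied to `h tⁿ⁻ʲ`, for variable `n` -/

section symbols

open Polynomial

variable {E : Type*} [CommRing E] {σ : E ≃+* E} {B : Subring E} {β : E}

/-- The coefficients of `symbol`, considered as an operator. The first product is `k! / l!`, and the
value of the second one at `n` is `l!` times the binomial coefficient of `n - j` and `l`. -/
def symbolCoeff (σ : E ≃+* E) (β : E) (A : List E[X]) (D k i j ρ : ℕ) : E[X] :=
  ∑ l ∈ Finset.range (k + 1), C ((∏ x ∈ Finset.range (k - l), ((k - x : ℕ) : E)) *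
    (A.getD ρ 0 * X ^ i).coeff (D + j + l) * (∑ x ∈ Finset.range ρ, σ^[x] β) ^ l) *
    ∏ x ∈ Finset.range l, (X - C ((j + x : ℕ) : E))

/-- The polynomial whose value at `n` is, up to the factor `k!`, the coefficient of degree
`D + n - i` of the operator `A` applied to `h tⁿ⁻ʲ`, where `D` bounds the degree of `A` and `i ≤ k`;
see `eval_symbol`. The factor keeps the symbol free of denominators. -/
def symbol (σ : E ≃+* E) (β : E) (A : List E[X]) (D k i : ℕ) (y : ℕ × E) : E[X] :=
  opApply (coeffAut σ) ((List.range A.length).map (symbolCoeff σ β A D k i y.1)) (C y.2)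

theorem iterate_shift_C_mul_X_pow (h : E) (m ρ : ℕ) :
    (fun x => C 1 * shiftHom σ 1 β x)^[ρ] (C h * X ^ m) =
      C (σ^[ρ] h) * (X + C (∑ x ∈ Finset.range ρ, σ^[x] β)) ^ m := by
  induction ρ with
  | zero => simp
  | succ ρ ih =>
    rw [Function.iterate_succ_apply', ih, Finset.sum_range_succ', Function.iterate_succ_apply']
    simp only [Function.iterate_succ_apply']
    simp only [map_mul, map_pow, map_add, shiftHom_C, shiftHom_X, map_one, one_mul, map_sum,
      Function.iterate_zero, id]
    congr 2
    ring

theorem factorial_mul_choose_eq {k l m n j : ℕ} (hl : l ≤ k) (hn : n = m + j) :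
    (k.factorial : E) * m.choose l = (∏ x ∈ Finset.range (k - l), ((k - x : ℕ) : E)) *
      ∏ x ∈ Finset.range l, ((n : E) - ((j + x : ℕ) : E)) := by
  have h1 : ∏ x ∈ Finset.range (k - l), ((k - x : ℕ) : E) = (k.descFactorial (k - l) : E) := by
    rw [Nat.descFactorial_eq_prod_range, Nat.cast_prod]
  have h2 : ∏ x ∈ Finset.range l, ((n : E) - ((j + x : ℕ) : E)) = (m.descFactorial l : E) := by
    rw [← descPochhammer_eval_eq_descFactorial, descPochhammer_eval_eq_prod_range]
    refine Finset.prod_congr rfl fun x _ => ?_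
    rw [hn]
    push_cast
    ring
  rw [h1, h2, Nat.descFactorial_eq_factorial_mul_choose m, ← Nat.factorial_mul_descFactorial
    (Nat.sub_le k l), Nat.sub_sub_self hl]
  push_cast
  ring

theorem eval_symbolCoeff {A : List E[X]} {D k i j m n : ℕ} (ρ : ℕ) (hA : ∀ q ∈ A, q.natDegree ≤ D)
    (hik : i ≤ k) (hin : i ≤ n) (hn : n = m + j) : (symbolCoeff σ β A D k i j ρ).eval (n : E) =
      k.factorial *
        (A.getD ρ 0 * (X + C (∑ x ∈ Finset.range ρ, σ^[x] β)) ^ m).coeff (D + n - i) := by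
  have hq : (A.getD ρ 0).natDegree ≤ D := by
    by_cases hi : ρ < A.length
    · rw [List.getD_eq_getElem _ _ hi]
      exact hA _ (List.getElem_mem hi)
    · rw [getD_eq_zero_of_le _ (by omega)]
      simp
  rw [symbolCoeff]
  generalize A.getD ρ 0 = q at *
  generalize ∑ x ∈ Finset.range ρ, σ^[x] β = b
  have h0 : ∀ l, k < l → (q * X ^ i).coeff (D + j + l) = 0 := fun l hl => by
    refine coeff_eq_zero_of_natDegree_lt (natDegree_mul_le.trans_lt ?_)
    have := natDegree_X_pow_le (R := E) i
    omega
  have h1 : (q * (X + C b) ^ m).coeff (D + n - i) = ∑ l ∈ Finset.range (m + 1),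
      (m.choose l : E) * (q * X ^ i).coeff (D + j + l) * b ^ l := by
    have h2 : (q * (X + C b) ^ m).coeff (D + n - i) =
        (q * X ^ i * (X + C b) ^ m).coeff (D + n) := by
      rw [mul_right_comm, ← coeff_mul_X_pow (q * (X + C b) ^ m) i, Nat.sub_add_cancel (by omega)]
    rw [h2, add_comm X, add_pow, Finset.mul_sum, finsetSum_coeff]
    refine Finset.sum_congr rfl fun l hl => ?_
    rw [Finset.mem_range] at hl
    have h3 : q * X ^ i * (C b ^ l * X ^ (m - l) * (m.choose l : E[X])) =
        C ((m.choose l : E) * b ^ l) * (q * X ^ i * X ^ (m - l)) := by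
      rw [C_mul, C_pow, map_natCast]
      ring
    rw [h3, coeff_C_mul, show D + n = (D + j + l) + (m - l) by omega, coeff_mul_X_pow]
    ring
  have h2 : ∑ l ∈ Finset.range (m + 1), (m.choose l : E) * (q * X ^ i).coeff (D + j + l) * b ^ l =
      ∑ l ∈ Finset.range (k + 1), (m.choose l : E) * (q * X ^ i).coeff (D + j + l) * b ^ l := by
    trans ∑ l ∈ Finset.range (m + k + 1), (m.choose l : E) * (q * X ^ i).coeff (D + j + l) * b ^ l
    · refine Finset.sum_subset (by simp) fun l _ hl => ?_
      rw [Finset.mem_range] at hl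
      rw [Nat.choose_eq_zero_of_lt (by omega)]
      simp
    · refine (Finset.sum_subset (by simp) fun l _ hl => ?_).symm
      rw [Finset.mem_range] at hl
      rw [h0 l (by omega)]
      simp
  rw [h1, h2, eval_finsetSum, Finset.mul_sum]
  refine Finset.sum_congr rfl fun l hl => ?_
  rw [eval_mul, eval_C, eval_prod]
  simp only [eval_sub, eval_X, eval_C]
  linear_combination (-(q * X ^ i).coeff (D + j + l) * b ^ l) * factorial_mul_choose_eq (E := E)
    (Nat.lt_succ_iff.1 (Finset.mem_range.1 hl)) hn

theorem eval_coeffAut (n : ℕ) (p : E[X]) : (coeffAut σ p).eval (n : E) = σ (p.eval (n : E)) := by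
  have h := (hom_eval₂ p (RingHom.id E) (σ : E →+* E) (n : E)).symm
  rw [map_natCast, RingHom.comp_id] at h
  rw [Polynomial.mapEquiv_apply, eval_map]
  exact h

theorem eval_opApply_coeffAut (n : ℕ) (a : List E[X]) (p : E[X]) :
    (opApply (coeffAut σ) a p).eval (n : E) =
      opApply σ (a.map (eval (n : E))) (p.eval (n : E)) := by
  rw [opApply, opApply, eval_finsetSum, List.length_map]
  refine Finset.sum_congr rfl fun i hi => ?_
  rw [Finset.mem_range] at hi
  rw [eval_mul]
  congr 1
  · simp [List.getD_eq_getElem?_getD, hi]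
  · clear hi
    induction i with
    | zero => rfl
    | succ i ih =>
      rw [Function.iterate_succ_apply', Function.iterate_succ_apply', eval_coeffAut, ih]

/-- The defining property of the symbols, for exponents `n` that are not too small. -/
theorem eval_symbol {A : List E[X]} {D k i n : ℕ} {y : ℕ × E} (hA : ∀ q ∈ A, q.natDegree ≤ D)
    (hik : i ≤ k) (hin : i ≤ n) (hyn : y.1 ≤ n) : (symbol σ β A D k i y).eval (n : E) =
      k.factorial * (polyOp σ 1 β 1 A (C y.2 * X ^ (n - y.1))).coeff (D + n - i) := by
  rw [symbol, eval_opApply_coeffAut, eval_C, polyOp, opApply, opApply, finsetSum_coeff,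
    Finset.mul_sum]
  simp only [List.length_map, List.length_range]
  refine Finset.sum_congr rfl fun ρ hρ => ?_
  rw [Finset.mem_range] at hρ
  rw [iterate_shift_C_mul_X_pow, mul_left_comm (A.getD ρ 0), coeff_C_mul]
  have h1 := eval_symbolCoeff (σ := σ) (β := β) ρ hA hik hin (j := y.1) (m := n - y.1) (by omega)
  have h2 : (List.map (eval (n : E)) (List.map (symbolCoeff σ β A D k i y.1)
      (List.range A.length))).getD ρ 0 = (symbolCoeff σ β A D k i y.1 ρ).eval (n : E) := by
    simp [List.getD_eq_getElem?_getD, hρ]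
  rw [h2, h1]
  ring

theorem symbol_mem (hB : ∀ x ∈ B, σ x ∈ B) (hβ : β ∈ B) {A : List E[X]}
    (hA : ∀ q ∈ A, q ∈ polySub B) (D k i : ℕ) {y : ℕ × E} (hy : y.2 ∈ B) :
    symbol σ β A D k i y ∈ polySub B := by
  have hit : ∀ x, x ∈ B → ∀ ρ, σ^[ρ] x ∈ B := by
    intro x hx ρ
    induction ρ with
    | zero => exact hx
    | succ ρ ih =>
      rw [Function.iterate_succ_apply']
      exact hB _ ih
  have hc : ∀ ρ, symbolCoeff σ β A D k i y.1 ρ ∈ polySub B := by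
    intro ρ
    refine sum_mem fun l _ => mul_mem (C_mem_polySub (mul_mem (mul_mem ?_ ?_) (pow_mem ?_ _)))
      (prod_mem fun x _ => sub_mem X_mem_polySub (C_mem_polySub (natCast_mem _ _)))
    · exact prod_mem fun x _ => natCast_mem _ _
    · exact mem_polySub.1 (mul_mem (getD_mem hA ρ) (pow_mem X_mem_polySub _)) _
    · exact sum_mem fun x _ => hit _ hβ x
  rw [symbol, opApply]
  refine sum_mem fun ρ hρ => mul_mem (getD_mem ?_ ρ) ?_
  · intro q hq
    obtain ⟨ρ', -, rfl⟩ := List.mem_map.1 hq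
    exact hc ρ'
  · have : (coeffAut σ)^[ρ] (C y.2) = C (σ^[ρ] y.2) := by
      clear hρ
      induction ρ with
      | zero => rfl
      | succ ρ ih => rw [Function.iterate_succ_apply', Function.iterate_succ_apply', ih]; simp
    rw [this]
    exact C_mem_polySub (hit _ hy ρ)

section eff

variable [Coded E] [CodedRing E] {T : Type*} [Coded T]

@[fun_prop]
theorem Eff.coeffAut (hσ : Eff fun x : E => σ x) {f : T → E[X]} (hf : Eff f) :
    Eff fun x => coeffAut σ (f x) := by
  have h : Eff fun x => (f x).map (σ : E →+* E) := Eff.polynomialMap hσ hf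
  exact h

@[fun_prop]
theorem Eff.symbolCoeff (hσ : Eff fun x : E => σ x) {A : T → List E[X]} {D k i j ρ : T → ℕ}
    (hA : Eff A) (hD : Eff D) (hk : Eff k) (hi : Eff i) (hj : Eff j) (hρ : Eff ρ) :
    Eff fun x => symbolCoeff σ β (A x) (D x) (k x) (i x) (j x) (ρ x) := by
  unfold _root_.symbolCoeff
  fun_prop

theorem Eff.opApply_coeffAut (hσ : Eff fun x : E => σ x) {a : T → List E[X]} {g : T → E[X]}
    (ha : Eff a) (hg : Eff g) : Eff fun x => _root_.opApply (_root_.coeffAut σ) (a x) (g x) :=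
  Eff.opApply (Eff.coeffAut hσ Eff.id) ha hg

@[fun_prop]
theorem Eff.symbol (hσ : Eff fun x : E => σ x) {A : T → List E[X]} {D k i : T → ℕ} {y : T → ℕ × E}
    (hA : Eff A) (hD : Eff D) (hk : Eff k) (hi : Eff i) (hy : Eff y) :
    Eff fun x => symbol σ β (A x) (D x) (k x) (i x) (y x) := by
  unfold _root_.symbol
  exact Eff.opApply_coeffAut hσ (by fun_prop) (by fun_prop)

theorem Eff.listSum {f : T → List E} (hf : Eff f) : Eff fun x => (f x).sum := by
  have h : Eff fun x => ∑ i ∈ Finset.range (f x).length, (f x).getD i 0 := by fun_prop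
  convert h using 2 with x
  induction f x with
  | nil => simp
  | cons a l ih => simp [Finset.sum_range_succ', ih, add_comm]

theorem Eff.functional {σ : E ≃+* E} (hσ : Eff fun x : E => σ x) {φ : T → List (List E × ℕ)}
    {v : T → ℕ → E} (hφ : Eff φ) (hv : Eff fun p : T × ℕ => v p.1 p.2) :
    Eff fun x => functional σ (φ x) (v x) := by
  have h : Eff fun x => ((φ x).map fun q => _root_.opApply σ q.1 (v x q.2)).sum :=
    Eff.listSum (Eff.map hφ (by fun_prop))
  convert h using 2 with x
  exact functional_apply σ (φ x) (v x)

end eff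

end symbols

/-! ### Certificates for degree bounds at a `Σ`-monomial -/

section sigmabound

open Polynomial

variable {E : Type*} [CommRing E] {σ : E ≃+* E} {B : Subring E} {β t : E}

theorem polyOp_eq_sum {A : List E[X]} {n : ℕ} (hn : A.length ≤ n) (p : E[X]) :
    polyOp σ 1 β 1 A p = ∑ i ∈ Finset.range n, A.getD i 0 * (shiftHom σ 1 β)^[i] p := by
  have h : (fun x => C 1 * shiftHom σ 1 β x) = shiftHom σ 1 β := by
    funext x
    rw [C_1, one_mul]
  rw [polyOp, h, opApply_eq_sum hn]

theorem polyOp_add (A : List E[X]) (p q : E[X]) :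
    polyOp σ 1 β 1 A (p + q) = polyOp σ 1 β 1 A p + polyOp σ 1 β 1 A q := by
  simp only [polyOp_eq_sum le_rfl, iterate_map_add, mul_add, Finset.sum_add_distrib]

theorem polyOp_C_mul (A : List E[X]) {c : E} (hc : c ∈ constants σ) (p : E[X]) :
    polyOp σ 1 β 1 A (C c * p) = C c * polyOp σ 1 β 1 A p := by
  have h : ∀ i, (shiftHom σ 1 β)^[i] (C c) = C c := fun i =>
    Function.iterate_fixed (by rw [shiftHom_C, (mem_constants σ).1 hc]) i
  simp only [polyOp_eq_sum le_rfl, iterate_map_mul, h, Finset.mul_sum]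
  exact Finset.sum_congr rfl fun i _ => by ring

theorem polyOp_zero (A : List E[X]) : polyOp σ 1 β 1 A 0 = 0 := by
  simp [polyOp_eq_sum le_rfl, iterate_map_zero]

theorem polyOp_sum {ι : Type*} (A : List E[X]) (s : Finset ι) (p : ι → E[X]) :
    polyOp σ 1 β 1 A (∑ j ∈ s, p j) = ∑ j ∈ s, polyOp σ 1 β 1 A (p j) := by
  classical
  induction s using Finset.induction_on with
  | empty => simp [polyOp_zero]
  | insert j s hj ih => rw [Finset.sum_insert hj, Finset.sum_insert hj, polyOp_add, ih]

/-- The highest `J` coefficients of a polynomial split off. -/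
theorem exists_truncation (p : E[X]) {n : ℕ} (hp : p.natDegree ≤ n) (J : ℕ) (hJ : J ≤ n) :
    ∃ r : E[X], p = (∑ j ∈ Finset.range J, C (p.coeff (n - j)) * X ^ (n - j)) + r ∧
      r.natDegree ≤ n - J ∧ ∀ m ≤ n - J, r.coeff m = p.coeff m := by
  induction J with
  | zero => exact ⟨p, by simp, hp, fun _ _ => rfl⟩
  | succ J ih =>
    obtain ⟨r, hr, hdeg, hc⟩ := ih (by omega)
    refine ⟨r - C (p.coeff (n - J)) * X ^ (n - J), ?_, ?_, fun m hm => ?_⟩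
    · rw [Finset.sum_range_succ]
      linear_combination hr
    · refine natDegree_le_iff_coeff_eq_zero.2 fun m hm => ?_
      rw [coeff_sub, coeff_C_mul_X_pow]
      split_ifs with h
      · rw [h, hc _ le_rfl, sub_self]
      · rw [coeff_eq_zero_of_natDegree_lt (by omega), sub_zero]
    · rw [coeff_sub, coeff_C_mul_X_pow, if_neg (by omega), sub_zero, hc _ (by omega)]

/-- The vector of the symbols of the monomial `h tⁿ⁻ʲ`, where `y = (j, h)`, for the coefficients of
degrees `D + n - i`, `i ≤ k`. It is continued beyond `k` by repetition of the last coordinate. -/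
def symbolVec (σ : E ≃+* E) (β : E) (A : List E[X]) (D k : ℕ) (y : ℕ × E) (i : ℕ) : E[X] :=
  symbol σ β A D k (i - (i - k)) y

/-- A certificate for the following: the elements `h` with `(J, h)` in `Y` span all possible
coefficients of degree `n - J` of a solution of degree `n`, whatever `n` is, if this is so for the
higher coefficients. The list `Z` spans the coefficients of the symbols of the elements of `Y` of
lower levels. The coefficient of degree `n - J` is mapped by the leading operator into the values of
these symbols, hence into the span of `Z`; so it lies in the span of the cover `G`, from which `C`
is selected. -/
def LevelCover (σ : E ≃+* E) (β : E) (P : List E → List E → List E → Prop) (A : List E[X])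
    (D k : ℕ) (Y : List (ℕ × E)) (J : ℕ) : Prop :=
  ∃ Z G C : List E, AllMem Y (fun y => J ≤ y.1 ∨
      ∀ m, (symbol σ β A D k J y).coeff m ∈ listSpan σ Z) ∧
    P (A.map fun q => (k.factorial : E) * q.coeff D) Z G ∧ AllMem G (fun g => g ∈ listSpan σ C) ∧
    AllMem C fun c => (J, c) ∈ Y

/-- An operator functional separates the symbols of `y` from the symbols of the other members of
`Y`. Its value at the symbols of `y` is `b κ`, and by `Q` the polynomial `κ` can vanish at integers
below `N` only. -/
def SymbolSeparated (σ : E ≃+* E) (β : E) (Q : E[X] → ℕ → Prop) (A : List E[X]) (D k : ℕ)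
    (Y : List (ℕ × E)) (y : ℕ × E) (N : ℕ) : Prop :=
  ∃ (φ : List (List E[X] × ℕ)) (κ : E[X]) (b : E) (N' : ℕ),
    AllMem Y (fun y' => (y'.1 = y.1 ∧ y'.2 = y.2) ∨
      functional (coeffAut σ) φ (symbolVec σ β A D k y') = 0) ∧
    (functional (coeffAut σ) φ (symbolVec σ β A D k y) = C b * κ ∧ b ≠ 0) ∧ Q κ N' ∧ N' < N

/-- A certificate for `N` being a bound for the degrees in `t` of the solutions in `B[t]`. It
consists of polynomials for the given elements of `B[t]`, of a list `Y` with elements that span,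
level by level, the `k + 1` highest coefficients of any solution, and of functionals that separate
the symbols of each element of level `0` from those of the others. As `DF + k < N`, the right hand
sides do not contribute to the `k + 1` highest coefficients in degrees `n ≥ N`. -/
def SigmaBound (σ : E ≃+* E) (β : E) (P : List E → List E → List E → Prop) (Q : E[X] → ℕ → Prop)
    (B : Subring E) (t : E) (a f : List E) (N : ℕ) : Prop :=
  ∃ (A Fp : List E[X]) (Y : List (ℕ × E)) (D k DF : ℕ),
    (Lifts B t A a ∧ Lifts B t Fp f) ∧
    (AllMem A (fun q => q.natDegree ≤ D) ∧ AllMem Fp (fun q => q.natDegree ≤ DF)) ∧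
    AllLt (k + 1) (fun J => LevelCover σ β P A D k Y J) ∧
    AllMem Y (fun y => y.1 ≤ k ∧ (y.1 ≠ 0 ∨ SymbolSeparated σ β Q A D k Y y N)) ∧ DF + k < N

/-- At a fixed integer `n`, the symbols are given by an operator. -/
theorem eval_symbol_eq (A : List E[X]) (D k i n j : ℕ) : ∃ a : List E, ∀ h,
    (symbol σ β A D k i (j, h)).eval (n : E) = opLin σ a h :=
  ⟨((List.range A.length).map (symbolCoeff σ β A D k i j)).map (eval (n : E)), fun h => by
    rw [symbol, eval_opApply_coeffAut, eval_C, opLin_apply]⟩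

theorem eval_mem_listSpan {Z : List E} {p : E[X]} (hp : ∀ m, p.coeff m ∈ listSpan σ Z) (n : ℕ) :
    p.eval (n : E) ∈ listSpan σ Z := by
  rw [eval_eq_sum_range]
  refine sum_mem fun m _ => ?_
  rw [mul_comm]
  exact const_mul_mem (by rw [mem_constants, map_pow, map_natCast]) (hp m)

theorem eval_functional_eq_zero (φ : List (List E[X] × ℕ)) {v : ℕ → E[X]} {n : ℕ}
    (hv : ∀ i, (v i).eval (n : E) = 0) : (functional (coeffAut σ) φ v).eval (n : E) = 0 := by
  induction φ with
  | nil => simp [functional_nil]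
  | cons q φ ih =>
    rw [functional_cons, eval_add, ih, eval_opApply_coeffAut, hv, add_zero]
    exact map_zero (opLin σ _)

/-- The possible coefficients are covered level by level. -/
theorem coeff_mem_of_levelCover {P : List E → List E → List E → Prop}
    (hP : ∀ a f G, P a f G → Covers σ B a f G) {A : List E[X]} {D k n : ℕ} {Y : List (ℕ × E)}
    (hA : ∀ q ∈ A, q.natDegree ≤ D) (hY : ∀ J ≤ k, LevelCover σ β P A D k Y J) {p : E[X]}
    (hp : p ∈ polySub B) (hpn : p.natDegree ≤ n) (hkn : k ≤ n)
    (hL : ∀ i ≤ k, (polyOp σ 1 β 1 A p).coeff (D + n - i) = 0) (J : ℕ) (hJ : J ≤ k) :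
    p.coeff (n - J) ∈ Submodule.span (constants σ) {h | (J, h) ∈ Y} := by
  induction J using Nat.strong_induction_on with
  | _ J ih =>
    obtain ⟨Z, G, C', hZ, hPG, hG, hC⟩ := hY J hJ
    -- the coefficient of degree `D + n - J` of the image of `p`, times `k!`
    have hsum : ∑ j ∈ Finset.range J, (symbol σ β A D k J (j, p.coeff (n - j))).eval (n : E) +
        opApply σ (A.map fun q => (k.factorial : E) * q.coeff D) (p.coeff (n - J)) = 0 := by
      obtain ⟨r, hr, hdeg, hc⟩ := exists_truncation p hpn J (by omega)
      have h1 := hL J hJ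
      rw [hr, polyOp_add, polyOp_sum, coeff_add, finsetSum_coeff,
        show D + n - J = D + (n - J) by omega, coeff_polyOp hA hdeg, hc _ le_rfl] at h1
      have h2 : opApply σ (A.map fun q => (k.factorial : E) * q.coeff D) (p.coeff (n - J)) =
          k.factorial * opApply (fun y => 1 * 1 ^ (n - J) * σ y) (A.map (coeff · D))
            (p.coeff (n - J)) := by
        rw [show (fun y => 1 * 1 ^ (n - J) * σ y) = σ by funext y; simp, ← opApply_map_mul,
          List.map_map]
        rfl
      rw [h2, ← mul_zero (k.factorial : E), ← h1, mul_add, Finset.mul_sum]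
      refine congrArg (· + _) (Finset.sum_congr rfl fun j hj => ?_)
      rw [Finset.mem_range] at hj
      rw [eval_symbol hA hJ (by omega) (by dsimp only; omega),
        show D + n - J = D + (n - J) by omega]
    have hmem : ∀ j ∈ Finset.range J,
        (symbol σ β A D k J (j, p.coeff (n - j))).eval (n : E) ∈ listSpan σ Z := by
      intro j hj
      rw [Finset.mem_range] at hj
      obtain ⟨a, ha⟩ := eval_symbol_eq (σ := σ) (β := β) A D k J n j
      rw [ha]
      refine (Submodule.span_le (p := (listSpan σ Z).comap (opLin σ a))).2 ?_
        (ih j hj (by omega))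
      intro h hh
      rw [SetLike.mem_coe, Submodule.mem_comap, ← ha]
      exact eval_mem_listSpan ((hZ _ hh).resolve_left (by simpa using hj)) n
    have hop : opApply σ (A.map fun q => (k.factorial : E) * q.coeff D) (p.coeff (n - J)) ∈
        listSpan σ Z := by
      rw [eq_neg_of_add_eq_zero_right hsum]
      exact neg_mem (sum_mem hmem)
    have h3 := hP _ _ _ hPG _ (mem_polySub.1 hp _) hop
    refine (listSpan_le.2 fun g hg => ?_) h3
    refine (listSpan_le.2 fun c hc => ?_) (hG g hg)
    exact Submodule.subset_span (hC c hc)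

theorem exists_weights {R M ι : Type*} [CommRing R] [AddCommGroup M] [Module R M] {s : Finset ι}
    {v : ι → M} {x : M} (hx : x ∈ Submodule.span R (v '' s)) :
    ∃ w : ι → R, ∑ i ∈ s, w i • v i = x := by
  classical
  obtain ⟨w, rfl⟩ := (Submodule.mem_span_image_finset_iff_exists_fun R).1 hx
  refine ⟨fun i => if h : i ∈ s then w ⟨i, h⟩ else 0, ?_⟩
  rw [← Finset.sum_coe_sort]
  exact Finset.sum_congr rfl fun i _ => by simp

/-- The certificates are sound. The `k + 1` highest coefficients of a solution of degree `n ≥ N`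
would be a combination of the members of `Y`, with a nonzero weight at some `y` of level `0`, and
the evaluations at `n` of the symbols would satisfy the same relation. The functional for `y` is
compatible with evaluation at `n`, so that its value at the symbols of `y` vanishes at `n`. -/
theorem SigmaBound.mem_boundedDegree [IsDomain E] {P : List E → List E → List E → Prop}
    {Q : E[X] → ℕ → Prop} (htr : TransOver B t) (hB : ∀ x ∈ B, σ x ∈ B) (hβ : β ∈ B)
    (ht : σ t = t + β) (hK : ∀ x ∈ constants σ, x ∈ B)
    (hP : ∀ a f G, P a f G → Covers σ B a f G)
    (hQ : ∀ κ N, Q κ N → ∀ n : ℕ, κ.eval (n : E) = 0 → n ≤ N) {a f : List E} {N : ℕ}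
    (h : SigmaBound σ β P Q B t a f N) {g : E} (hg : g ∈ polyAdjoin B t)
    (hgf : opApply σ a g ∈ listSpan σ f) : g ∈ boundedDegree B t N := by
  classical
  obtain ⟨A, Fp, Y, D, k, DF, ⟨hAl, hFl⟩, ⟨hA, hF⟩, hlev, hsep, hN⟩ := h
  obtain ⟨p, hp, rfl⟩ := mem_polyAdjoin.1 hg
  by_contra hlt
  obtain ⟨n, hn⟩ : ∃ n, p.natDegree = n := ⟨_, rfl⟩
  have hnN : N ≤ n := by
    by_contra! h
    exact hlt ⟨p, hp, fun i hi => coeff_eq_zero_of_natDegree_lt (by omega), rfl⟩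
  have hp0 : p ≠ 0 := by
    rintro rfl
    exact hlt ⟨0, hp, by simp, rfl⟩
  have hLt : (polyOp σ 1 β 1 A p).eval t = opApply σ a (p.eval t) := by
    rw [eval_polyOp (by rw [ht, one_mul]), hAl.2]
    simp only [one_mul]
  have hL : ∀ i ≤ k, (polyOp σ 1 β 1 A p).coeff (D + n - i) = 0 := by
    intro i hi
    have h1 := coeff_mem_listSpan htr hK hFl (polyOp_mem hB (one_mem _) hβ (one_mem _) hAl.1 hp)
      (by rw [hLt]; exact hgf) (D + n - i)
    have h2 : listSpan σ (Fp.map (coeff · (D + n - i))) ≤ ⊥ := by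
      refine listSpan_le.2 fun x hx => ?_
      obtain ⟨q, hq, rfl⟩ := List.mem_map.1 hx
      have := hF q hq
      exact coeff_eq_zero_of_natDegree_lt (by omega)
    exact h2 h1
  have hcov := coeff_mem_of_levelCover (n := n) hP hA (fun J hJ => hlev J (by omega)) hp hn.le
    (by omega) hL
  -- the highest coefficients of `p`, as a combination of the members of `Y`
  have hu : (∑ j ∈ Finset.range (k + 1), Pi.single j (p.coeff (n - j)) : ℕ → E) ∈
      Submodule.span (constants σ) ((fun y : ℕ × E => (Pi.single y.1 y.2 : ℕ → E)) ''
        (Y.toFinset : Set (ℕ × E))) := by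
    refine sum_mem fun j hj => ?_
    rw [Finset.mem_range] at hj
    have h1 : Submodule.span (constants σ) {h | (j, h) ∈ Y} ≤
        (Submodule.span (constants σ) ((fun y : ℕ × E => (Pi.single y.1 y.2 : ℕ → E)) ''
          (Y.toFinset : Set (ℕ × E)))).comap (LinearMap.single (constants σ) (fun _ => E) j) := by
      refine Submodule.span_le.2 fun h hh => Submodule.subset_span ⟨(j, h), by simpa using hh, rfl⟩
    exact h1 (hcov j (by omega))
  obtain ⟨w, hw⟩ := exists_weights hu
  have hcoord : ∀ j ≤ k, ∑ y ∈ Y.toFinset, (w y : E) * (if j = y.1 then y.2 else 0) =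
      p.coeff (n - j) := by
    intro j hj
    have h1 := congrFun hw j
    simp only [Finset.sum_apply, Pi.smul_apply, Pi.single_apply, Subring.smul_def, smul_eq_mul,
      Finset.sum_ite_eq, Finset.mem_range] at h1
    rw [h1, if_pos (by omega)]
  -- the combination of symbol vectors with the same weights vanishes at `n`
  have hzero : ∀ i ≤ k, ∑ y ∈ Y.toFinset, (w y : E) * (symbol σ β A D k i y).eval (n : E) = 0 := by
    intro i hi
    have h1 : ∑ j ∈ Finset.range (k + 1), (symbol σ β A D k i (j, p.coeff (n - j))).eval (n : E) =
        0 := by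
      obtain ⟨r, hr, hdeg, -⟩ := exists_truncation p hn.le (k + 1) (by omega)
      have h1 := hL i hi
      rw [hr, polyOp_add, polyOp_sum, coeff_add, finsetSum_coeff,
        coeff_eq_zero_of_natDegree_lt ((natDegree_polyOp_le hA hdeg).trans_lt (by omega)),
        add_zero] at h1
      rw [← mul_zero (k.factorial : E), ← h1, Finset.mul_sum]
      refine Finset.sum_congr rfl fun j hj => ?_
      rw [Finset.mem_range] at hj
      rw [eval_symbol hA hi (by omega) (by dsimp only; omega)]
    rw [← h1]
    choose a ha using fun j => eval_symbol_eq (σ := σ) (β := β) A D k i n j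
    have h2 : ∀ j ∈ Finset.range (k + 1), (symbol σ β A D k i (j, p.coeff (n - j))).eval (n : E) =
        ∑ y ∈ Y.toFinset, if j = y.1 then (w y : E) * opLin σ (a j) y.2 else 0 := by
      intro j hj
      rw [ha, ← hcoord j (by simpa [Nat.lt_succ_iff] using hj), map_sum]
      refine Finset.sum_congr rfl fun y _ => ?_
      split_ifs
      · have := map_smul (opLin σ (a j)) (w y) y.2
        rwa [Subring.smul_def, Subring.smul_def, smul_eq_mul, smul_eq_mul] at this
      · rw [mul_zero, map_zero]
    rw [Finset.sum_congr rfl h2, Finset.sum_comm]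
    refine Finset.sum_congr rfl fun y hy => ?_
    rw [Finset.sum_ite_eq', if_pos (Finset.mem_range.2 (Nat.lt_succ_of_le
      (hsep y (List.mem_toFinset.1 hy)).1)), ← ha]
  -- the leading coefficient needs a nonzero weight of level `0`
  have hlead : p.coeff (n - 0) ≠ 0 := by
    rw [Nat.sub_zero, ← hn]
    exact leadingCoeff_ne_zero.2 hp0
  obtain ⟨y, hy, hy0, hwy⟩ : ∃ y ∈ Y, y.1 = 0 ∧ w y ≠ 0 := by
    by_contra! h
    rw [← hcoord 0 (Nat.zero_le _)] at hlead
    refine hlead (Finset.sum_eq_zero fun y hy => ?_)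
    split_ifs with h0
    · rw [h y (List.mem_toFinset.1 hy) h0.symm, ZeroMemClass.coe_zero, zero_mul]
    · rw [mul_zero]
  obtain ⟨φ, κ, b, N', hφ, ⟨hφy, hb⟩, hκ, hN'⟩ := (hsep y hy).2.resolve_left fun h => h hy0
  have hcw : ∀ y, C (w y : E) ∈ constants (coeffAut σ) := fun y => by
    rw [mem_constants, Polynomial.mapEquiv_apply, map_C]
    exact congrArg C (w y).2
  have hev := eval_functional_eq_zero (σ := σ) φ (n := n)
    (v := ∑ y ∈ Y.toFinset, (⟨_, hcw y⟩ : constants (coeffAut σ)) • symbolVec σ β A D k y) (by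
      intro i
      simp only [Finset.sum_apply, Pi.smul_apply, Subring.smul_def, smul_eq_mul, eval_finsetSum,
        eval_mul, eval_C]
      exact hzero _ (by omega))
  rw [map_sum, Finset.sum_eq_single_of_mem y (List.mem_toFinset.2 hy), map_smul, hφy,
    Subring.smul_def, smul_eq_mul, eval_mul, eval_mul, eval_C, eval_C] at hev
  · have hwy' : (w y : E) ≠ 0 := fun h => hwy (Subtype.ext h)
    have := hQ κ N' hκ n (by simpa [hb, hwy'] using hev)
    omega
  · intro y' hy' hne
    rw [map_smul, (hφ y' (List.mem_toFinset.1 hy')).resolve_left fun h => hne (Prod.ext h.1 h.2),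
      smul_zero]

end sigmabound

/-! ### Degree bounds at a `Σ`-monomial: the certificates can be recognized -/

section sigmatotal

open Polynomial

variable {E : Type*} [CommRing E] {σ : E ≃+* E} {B : Subring E} {β t : E}

section semi

variable [Coded E] [CodedRing E]

theorem Eff.natCast_factorial {T : Type*} [Coded T] {k : T → ℕ} (hk : Eff k) :
    Eff fun x => ((k x).factorial : E) := by
  have h : Eff fun x => ∏ i ∈ Finset.range (k x), ((i + 1 : ℕ) : E) := by fun_prop
  convert h using 2 with x
  rw [← Nat.cast_prod, Finset.prod_range_add_one_eq_factorial]

theorem semi_coeff_symbol_mem (hσ : Eff fun x : E => σ x) :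
    Semi fun x : ((List E[X] × ℕ × ℕ) × ℕ × (ℕ × E)) × List E =>
      ∀ m, (symbol σ β x.1.1.1 x.1.1.2.1 x.1.1.2.2 x.1.2.1 x.1.2.2).coeff m ∈ listSpan σ x.2 := by
  have h : Eff fun x : ((List E[X] × ℕ × ℕ) × ℕ × (ℕ × E)) × List E =>
      symbol σ β x.1.1.1 x.1.1.2.1 x.1.1.2.2 x.1.2.1 x.1.2.2 :=
    Eff.symbol hσ (by fun_prop) (by fun_prop) (by fun_prop) (by fun_prop) (by fun_prop)
  have h2 : Semi fun p : (((List E[X] × ℕ × ℕ) × ℕ × (ℕ × E)) × List E) × ℕ × E =>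
      p.2.2 ∈ listSpan σ p.1.2 := Semi.mem_listSpan hσ (by fun_prop) (by fun_prop)
  exact Semi.forall_coeff (P := fun (x : ((List E[X] × ℕ × ℕ) × ℕ × (ℕ × E)) × List E) _ r =>
    r ∈ listSpan σ x.2) h2 (fun _ _ => zero_mem _) h

theorem semi_levelCover (hσ : Eff fun x : E => σ x) {P : List E → List E → List E → Prop}
    (hP : Semi fun x : List E × List E × List E => P x.1 x.2.1 x.2.2) :
    Semi fun x : (List E[X] × ℕ × ℕ) × List (ℕ × E) × ℕ =>
      LevelCover σ β P x.1.1 x.1.2.1 x.1.2.2 x.2.1 x.2.2 := by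
  have h1 : Semi fun x : (((((List E[X] × ℕ × ℕ) × List (ℕ × E) × ℕ) × List E) × List E) ×
      List E) × (ℕ × E) => ∀ m, (symbol σ β x.1.1.1.1.1.1 x.1.1.1.1.1.2.1 x.1.1.1.1.1.2.2
        x.1.1.1.1.2.2 x.2).coeff m ∈ listSpan σ x.1.1.1.2 :=
    (semi_coeff_symbol_mem hσ).comp (f := fun x : (((((List E[X] × ℕ × ℕ) × List (ℕ × E) × ℕ) ×
      List E) × List E) × List E) × (ℕ × E) =>
        ((x.1.1.1.1.1, x.1.1.1.1.2.2, x.2), x.1.1.1.2)) (by fun_prop)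
  have h2 : Eff fun x : List E[X] × ℕ × ℕ =>
      x.1.map fun q => (x.2.2.factorial : E) * q.coeff x.2.1 :=
    Eff.map (by fun_prop) (Eff.mul (Eff.natCast_factorial (by fun_prop)) (by fun_prop))
  have h3 : Semi fun x : (List E[X] × ℕ × ℕ) × List E × List E =>
      P (x.1.1.map fun q => (x.1.2.2.factorial : E) * q.coeff x.1.2.1) x.2.1 x.2.2 :=
    hP.comp (f := fun x : (List E[X] × ℕ × ℕ) × List E × List E =>
      (x.1.1.map fun q => (x.1.2.2.factorial : E) * q.coeff x.1.2.1, x.2.1, x.2.2))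
      ((h2.comp (Eff.fst Eff.id)).prodMk (by fun_prop))
  refine Semi.exists (Semi.exists (Semi.exists (Semi.and (Semi.allMem (by fun_prop)
    (Semi.or (Semi.natLe (by fun_prop) (by fun_prop)) h1)) (Semi.and ?_ (Semi.and
    (Semi.allMem (by fun_prop) (Semi.mem_listSpan hσ (by fun_prop) (by fun_prop)))
    (Semi.allMem (by fun_prop) (Semi.mem (by fun_prop) (by fun_prop))))))))
  exact h3.comp (f := fun x : ((((List E[X] × ℕ × ℕ) × List (ℕ × E) × ℕ) × List E) × List E) ×
      List E => (x.1.1.1.1, x.1.1.2, x.1.2)) (by fun_prop)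

theorem eff_functional_symbolVec (hσ : Eff fun x : E => σ x) :
    Eff fun x : ((List E[X] × ℕ × ℕ) × (ℕ × E)) × List (List E[X] × ℕ) =>
      functional (coeffAut σ) x.2 (symbolVec σ β x.1.1.1 x.1.1.2.1 x.1.1.2.2 x.1.2) := by
  have h : Eff fun p : (((List E[X] × ℕ × ℕ) × (ℕ × E)) × List (List E[X] × ℕ)) × ℕ =>
      symbol σ β p.1.1.1.1 p.1.1.1.2.1 p.1.1.1.2.2 (p.2 - (p.2 - p.1.1.1.2.2)) p.1.1.2 :=
    Eff.symbol hσ (by fun_prop) (by fun_prop) (by fun_prop) (by fun_prop) (by fun_prop)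
  exact Eff.functional (Eff.coeffAut hσ Eff.id) (by fun_prop) h

theorem semi_symbolSeparated (hσ : Eff fun x : E => σ x) {Q : E[X] → ℕ → Prop}
    (hQ : Semi fun x : E[X] × ℕ => Q x.1 x.2) :
    Semi fun x : (List E[X] × ℕ × ℕ) × List (ℕ × E) × (ℕ × E) × ℕ =>
      SymbolSeparated σ β Q x.1.1 x.1.2.1 x.1.2.2 x.2.1 x.2.2.1 x.2.2.2 := by
  have h1 : Semi fun x : ((((((List E[X] × ℕ × ℕ) × List (ℕ × E) × (ℕ × E) × ℕ) ×
      List (List E[X] × ℕ)) × E[X]) × E) × ℕ) × (ℕ × E) =>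
      functional (coeffAut σ) x.1.1.1.1.2 (symbolVec σ β x.1.1.1.1.1.1.1 x.1.1.1.1.1.1.2.1
        x.1.1.1.1.1.1.2.2 x.2) = 0 :=
    Semi.eq ((eff_functional_symbolVec hσ).comp (g := fun x : ((((((List E[X] × ℕ × ℕ) ×
      List (ℕ × E) × (ℕ × E) × ℕ) × List (List E[X] × ℕ)) × E[X]) × E) × ℕ) × (ℕ × E) =>
        ((x.1.1.1.1.1.1, x.2), x.1.1.1.1.2)) (by fun_prop)) (Eff.const _)
  have h2 : Semi fun x : (((((List E[X] × ℕ × ℕ) × List (ℕ × E) × (ℕ × E) × ℕ) ×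
      List (List E[X] × ℕ)) × E[X]) × E) × ℕ =>
      functional (coeffAut σ) x.1.1.1.2 (symbolVec σ β x.1.1.1.1.1.1 x.1.1.1.1.1.2.1
        x.1.1.1.1.1.2.2 x.1.1.1.1.2.2.1) = C x.1.2 * x.1.1.2 :=
    Semi.eq ((eff_functional_symbolVec hσ).comp (g := fun x : (((((List E[X] × ℕ × ℕ) ×
      List (ℕ × E) × (ℕ × E) × ℕ) × List (List E[X] × ℕ)) × E[X]) × E) × ℕ =>
        ((x.1.1.1.1.1, x.1.1.1.1.2.2.1), x.1.1.1.2)) (by fun_prop)) (by fun_prop)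
  have h3 : Semi fun x : (((((List E[X] × ℕ × ℕ) × List (ℕ × E) × (ℕ × E) × ℕ) ×
      List (List E[X] × ℕ)) × E[X]) × E) × ℕ => Q x.1.1.2 x.2 :=
    hQ.comp (f := fun x : (((((List E[X] × ℕ × ℕ) × List (ℕ × E) × (ℕ × E) × ℕ) ×
      List (List E[X] × ℕ)) × E[X]) × E) × ℕ => (x.1.1.2, x.2)) (by fun_prop)
  exact Semi.exists (Semi.exists (Semi.exists (Semi.exists (Semi.and (Semi.allMem (by fun_prop)
    (Semi.or (by fun_prop) h1)) (Semi.and (Semi.and h2 (by fun_prop)) (Semi.and h3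
    (Semi.natLt (by fun_prop) (by fun_prop))))))))

theorem semi_sigmaBound (hσ : Eff fun x : E => σ x) (hmem : Semi fun x : E => x ∈ B)
    {P : List E → List E → List E → Prop}
    (hP : Semi fun x : List E × List E × List E => P x.1 x.2.1 x.2.2) {Q : E[X] → ℕ → Prop}
    (hQ : Semi fun x : E[X] × ℕ => Q x.1 x.2) :
    Semi fun x : List E × List E × ℕ => SigmaBound σ β P Q B t x.1 x.2.1 x.2.2 := by
  have h1 : Semi fun x : List E[X] × List E => Lifts B t x.1 x.2 := by fun_prop
  have h2 : Semi fun x : List E[X] × ℕ => AllMem x.1 (fun q => q.natDegree ≤ x.2) := by fun_prop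
  have h3 : Semi fun x : (List E[X] × ℕ × ℕ) × List (ℕ × E) =>
      AllLt (x.1.2.2 + 1) (fun J => LevelCover σ β P x.1.1 x.1.2.1 x.1.2.2 x.2 J) :=
    Semi.allLt (by fun_prop) ((semi_levelCover hσ hP).comp
      (f := fun p : ((List E[X] × ℕ × ℕ) × List (ℕ × E)) × ℕ => (p.1.1, p.1.2, p.2))
      (by fun_prop))
  have h4 : Semi fun x : ((List E[X] × ℕ × ℕ) × List (ℕ × E)) × ℕ =>
      AllMem x.1.2 (fun y => y.1 ≤ x.1.1.2.2 ∧ (y.1 ≠ 0 ∨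
        SymbolSeparated σ β Q x.1.1.1 x.1.1.2.1 x.1.1.2.2 x.1.2 y x.2)) := by
    refine Semi.allMem (by fun_prop) (Semi.and (Semi.natLe (by fun_prop) (by fun_prop))
      (Semi.or (by fun_prop) ?_))
    exact (semi_symbolSeparated hσ hQ).comp
      (f := fun p : (((List E[X] × ℕ × ℕ) × List (ℕ × E)) × ℕ) × (ℕ × E) =>
        (p.1.1.1, p.1.1.2, p.2, p.1.2)) (by fun_prop)
  refine Semi.exists (Semi.exists (Semi.exists (Semi.exists (Semi.exists (Semi.exists (Semi.and
    (Semi.and ?_ ?_) (Semi.and (Semi.and ?_ ?_) (Semi.and ?_ (Semi.and ?_ ?_)))))))))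
  · exact h1.comp (f := fun x : ((((((List E × List E × ℕ) × List E[X]) × List E[X]) ×
      List (ℕ × E)) × ℕ) × ℕ) × ℕ => (x.1.1.1.1.1.2, x.1.1.1.1.1.1.1)) (by fun_prop)
  · exact h1.comp (f := fun x : ((((((List E × List E × ℕ) × List E[X]) × List E[X]) ×
      List (ℕ × E)) × ℕ) × ℕ) × ℕ => (x.1.1.1.1.2, x.1.1.1.1.1.1.2.1)) (by fun_prop)
  · exact h2.comp (f := fun x : ((((((List E × List E × ℕ) × List E[X]) × List E[X]) ×
      List (ℕ × E)) × ℕ) × ℕ) × ℕ => (x.1.1.1.1.1.2, x.1.1.2)) (by fun_prop)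
  · exact h2.comp (f := fun x : ((((((List E × List E × ℕ) × List E[X]) × List E[X]) ×
      List (ℕ × E)) × ℕ) × ℕ) × ℕ => (x.1.1.1.1.2, x.2)) (by fun_prop)
  · exact h3.comp (f := fun x : ((((((List E × List E × ℕ) × List E[X]) × List E[X]) ×
      List (ℕ × E)) × ℕ) × ℕ) × ℕ => ((x.1.1.1.1.1.2, x.1.1.2, x.1.2), x.1.1.1.2)) (by fun_prop)
  · exact h4.comp (f := fun x : ((((((List E × List E × ℕ) × List E[X]) × List E[X]) ×
      List (ℕ × E)) × ℕ) × ℕ) × ℕ => (((x.1.1.1.1.1.2, x.1.1.2, x.1.2), x.1.1.1.2),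
        x.1.1.1.1.1.1.2.2)) (by fun_prop)
  · exact Semi.natLt (by fun_prop) (by fun_prop)

end semi

end sigmatotal

/-! ### Degree bounds at a `Σ`-monomial: the certificates exist -/

section sigmatotal

open Polynomial

variable {E : Type*} [CommRing E] {σ : E ≃+* E} {B : Subring E} {β t : E}

theorem isField_constants [Nontrivial E]
    (hinv : ∀ c ∈ constants σ, c ≠ 0 → ∃ c' ∈ constants σ, c' * c = 1) :
    IsField (constants σ) :=
  ⟨⟨0, 1, zero_ne_one⟩, mul_comm, fun {a} ha => by
    obtain ⟨c, hc, h⟩ := hinv a a.2 fun h => ha (Subtype.ext h)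
    exact ⟨⟨c, hc⟩, Subtype.ext ((mul_comm _ _).trans h)⟩⟩

/-- A finite family has a linearly independent subfamily with the same span, as the constants form
a field. -/
theorem exists_independent_sublist [IsDomain E]
    (hinv : ∀ c ∈ constants σ, c ≠ 0 → ∃ c' ∈ constants σ, c' * c = 1) (G : List E) :
    ∃ C : List E, (∀ c ∈ C, c ∈ G) ∧ (∀ g ∈ G, g ∈ listSpan σ C) ∧
      LinearIndepOn (constants σ) id {c | c ∈ C} := by
  classical
  let _ : Field (constants σ) := (isField_constants hinv).toField
  obtain ⟨b, hb, hspan, hind⟩ := exists_linearIndependent (constants σ) {g | g ∈ G}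
  have hfin : b.Finite := (List.finite_toSet G).subset hb
  have hset : {c | c ∈ hfin.toFinset.toList} = b := by
    ext c
    simp
  refine ⟨hfin.toFinset.toList, fun c hc => hb (hset ▸ hc : c ∈ b), fun g hg => ?_, ?_⟩
  · have : g ∈ Submodule.span (constants σ) b := by
      rw [hspan]
      exact Submodule.subset_span hg
    rw [← hset] at this
    exact this
  · rw [hset]
    exact hind

/-- A nonzero ideal of `E[X]` that is closed under the coefficientwise automorphism contains, up to
a factor from `E`, a nonzero polynomial with constant coefficients: a member of minimal degree has
this property. -/
theorem exists_C_mul_mem [IsDomain E] (hσ : ConstQuotients σ)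
    (hinv : ∀ c ∈ constants σ, c ≠ 0 → ∃ c' ∈ constants σ, c' * c = 1) {I : Ideal E[X]}
    (hI : ∀ p ∈ I, coeffAut σ p ∈ I) (n : ℕ) : ∀ d ∈ I, d ≠ 0 → d.natDegree ≤ n →
      ∃ (b : E) (κ : E[X]), b ≠ 0 ∧ κ ≠ 0 ∧ (∀ i, κ.coeff i ∈ constants σ) ∧ C b * κ ∈ I := by
  induction n using Nat.strong_induction_on with
  | _ n ih =>
    intro d hd hd0 hdn
    obtain ⟨u, hu⟩ : ∃ u, u = d.leadingCoeff := ⟨_, rfl⟩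
    have hu0 : u ≠ 0 := hu ▸ leadingCoeff_ne_zero.2 hd0
    have hdeg : (coeffAut σ d).natDegree = d.natDegree :=
      natDegree_map_eq_of_injective (f := (σ : E →+* E)) σ.injective d
    -- `d'` has a smaller degree; if it is zero, then the coefficients of `d` over `u` are constants
    obtain ⟨d', hd'⟩ : ∃ d', d' = C u * coeffAut σ d - C (σ u) * d := ⟨_, rfl⟩
    have hmem : d' ∈ I := by
      rw [hd']
      exact sub_mem (I.mul_mem_left _ (hI d hd)) (I.mul_mem_left _ hd)
    have hcoeff : ∀ i, d'.coeff i = u * σ (d.coeff i) - σ u * d.coeff i := fun i => by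
      rw [hd', coeff_sub, coeff_C_mul, coeff_C_mul]
      simp
    by_cases h0 : d' = 0
    · have hk : ∀ i, ∃ k ∈ constants σ, d.coeff i = k * u := by
        intro i
        have h1 := hcoeff i
        rw [h0, coeff_zero] at h1
        obtain ⟨c, hc, e, he, he0, hec⟩ := hσ (d.coeff i) u hu0 (by linear_combination -h1)
        obtain ⟨e', he', hee⟩ := hinv e he he0
        exact ⟨e' * c, mul_mem he' hc, by linear_combination e' * hec - d.coeff i * hee⟩
      choose k hk hkd using hk
      obtain ⟨κ, hκ⟩ : ∃ κ : E[X], κ = ∑ i ∈ Finset.range (d.natDegree + 1), C (k i) * X ^ i :=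
        ⟨_, rfl⟩
      have hdκ : C u * κ = d := by
        rw [hκ, Finset.mul_sum]
        conv_rhs => rw [d.as_sum_range_C_mul_X_pow]
        refine Finset.sum_congr rfl fun i _ => ?_
        rw [hkd i, C_mul]
        ring
      refine ⟨u, κ, hu0, ?_, fun i => ?_, by rwa [hdκ]⟩
      · rintro rfl
        rw [mul_zero] at hdκ
        exact hd0 hdκ.symm
      · rw [hκ, finsetSum_coeff]
        refine sum_mem fun j _ => ?_
        rw [coeff_C_mul_X_pow]
        split_ifs
        exacts [hk j, zero_mem _]
    · have hlt : d'.natDegree < d.natDegree := by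
        have h1 : d'.natDegree ≤ d.natDegree := by
          rw [hd']
          exact (natDegree_sub_le _ _).trans (max_le ((natDegree_C_mul_le _ _).trans hdeg.le)
            (natDegree_C_mul_le _ _))
        refine lt_of_le_of_ne h1 fun h => h0 (leadingCoeff_eq_zero.1 ?_)
        rw [leadingCoeff, h, hcoeff, hu, leadingCoeff]
        ring
      exact ih d'.natDegree (by omega) d' hmem h0 le_rfl

/-- Polynomials of the consecutive degrees `n₀, …, n₀ + m` are independent, and their nonzero
combinations have degrees in that interval. -/
theorem natDegree_combination [IsDomain E] {y : ℕ → E[X]} {n₀ : ℕ}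
    (hy : ∀ i, y i ≠ 0 ∧ (y i).natDegree = n₀ + i) (c : ℕ → E) (m : ℕ) (hc : ∃ i ≤ m, c i ≠ 0) :
    ∑ i ∈ Finset.range (m + 1), C (c i) * y i ≠ 0 ∧
      n₀ ≤ (∑ i ∈ Finset.range (m + 1), C (c i) * y i).natDegree ∧
      (∑ i ∈ Finset.range (m + 1), C (c i) * y i).natDegree ≤ n₀ + m := by
  have hub : ∀ m, (∑ i ∈ Finset.range (m + 1), C (c i) * y i).natDegree ≤ n₀ + m := fun m =>
    natDegree_sum_le_of_forall_le _ _ fun i hi => (natDegree_C_mul_le _ _).trans (by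
      rw [(hy i).2]
      have := Finset.mem_range.1 hi
      omega)
  refine ⟨?_, ?_, hub m⟩
  all_goals
    induction m with
    | zero =>
      obtain ⟨i, hi, hci⟩ := hc
      obtain rfl : i = 0 := by omega
      simp [natDegree_C_mul hci, (hy 0).2, hci, (hy 0).1]
    | succ m ih =>
      by_cases hm : c (m + 1) = 0
      · obtain ⟨i, hi, hci⟩ := hc
        have h1 : i ≠ m + 1 := by rintro rfl; exact hci hm
        rw [Finset.sum_range_succ, hm, C_0, zero_mul, add_zero]
        exact ih ⟨i, by omega, hci⟩
      · have h1 : (∑ i ∈ Finset.range (m + 1 + 1), C (c i) * y i).natDegree = n₀ + (m + 1) := by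
          rw [Finset.sum_range_succ, natDegree_add_eq_right_of_natDegree_lt]
          · rw [natDegree_C_mul hm, (hy _).2]
          · rw [natDegree_C_mul hm, (hy _).2]
            have := hub m
            omega
        first
        | omega
        | intro h
          rw [h, natDegree_zero] at h1
          omega

theorem exists_forall_eval_ne_zero [IsDomain E] [CharZero E] {p : E[X]} (hp : p ≠ 0) :
    ∃ N : ℕ, ∀ n ≥ N, p.eval (n : E) ≠ 0 := by
  classical
  have h : Set.Finite {n : ℕ | p.eval (n : E) = 0} := by
    refine Set.Finite.subset (Set.Finite.preimage (f := ((↑) : ℕ → E))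
      Nat.cast_injective.injOn p.roots.toFinset.finite_toSet) fun n hn => ?_
    simpa [hp] using hn
  obtain ⟨N, hN⟩ := h.bddAbove
  refine ⟨N + 1, fun n hn h0 => ?_⟩
  have := hN h0
  omega

/-- The order `m` of a nonzero operator. -/
theorem exists_last_ne_zero {A : List E[X]} (hA : ∃ q ∈ A, q ≠ 0) : ∃ m < A.length,
    A.getD m 0 ≠ 0 ∧ ∀ p : E[X], polyOp σ 1 β 1 A p =
      ∑ i ∈ Finset.range (m + 1), A.getD i 0 * (shiftHom σ 1 β)^[i] p := by
  classical
  obtain ⟨q, hq, hq0⟩ := hA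
  obtain ⟨i, hi, rfl⟩ := List.mem_iff_getElem.1 hq
  have hne : ((Finset.range A.length).filter fun j => ¬ A.getD j 0 = 0).Nonempty :=
    ⟨i, by simp [hi, hq0]⟩
  have hmem := Finset.max'_mem _ hne
  rw [Finset.mem_filter, Finset.mem_range] at hmem
  refine ⟨_, hmem.1, hmem.2, fun p => ?_⟩
  rw [polyOp_eq_sum le_rfl]
  symm
  refine Finset.sum_subset (fun j hj => ?_) fun j hj hj' => ?_
  · rw [Finset.mem_range] at hj ⊢
    omega
  · have h0 : A.getD j 0 = 0 := by
      by_contra h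
      have := Finset.le_max' ((Finset.range A.length).filter fun j => ¬ A.getD j 0 = 0) j
        (Finset.mem_filter.2 ⟨hj, h⟩)
      rw [Finset.mem_range] at hj'
      omega
    rw [h0, zero_mul]

/-- For large `k` there is no relation between the symbol vectors with polynomials with constant
coefficients as weights, if the elements of level `0` are independent. Such a relation would yield
for each large `n` a polynomial of degree `n` whose image has a degree less than `D + n - k`, in
contradiction to `natDegree_add_le_of_combinations`. -/
theorem no_symbol_relation [IsDomain E] [CharZero E] (hσ : ConstQuotients σ)
    (hinv : ∀ c ∈ constants σ, c ≠ 0 → ∃ c' ∈ constants σ, c' * c = 1)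
    (hβ : ∀ u ∈ B, ∀ v ∈ B, v ≠ 0 → σ u * v - u * σ v ≠ β * (v * σ v))
    (hK : ∀ x ∈ constants σ, x ∈ B) (hB : ∀ x ∈ B, σ x ∈ B) (hβB : β ∈ B)
    {A : List E[X]} (hAB : ∀ q ∈ A, q ∈ polySub B) (hA0 : ∃ q ∈ A, q ≠ 0) {D k : ℕ}
    (hA : ∀ q ∈ A, q.natDegree ≤ D) (hk : D + A.length + 2 * (A.length * A.length) ≤ k)
    {Y : Finset (ℕ × E)} (hY : ∀ y ∈ Y, y.1 ≤ k ∧ y.2 ∈ B)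
    (hind : LinearIndepOn (constants σ) Prod.snd {y | y ∈ Y ∧ y.1 = 0}) {W : ℕ × E → E[X]}
    (hW : ∀ y i, (W y).coeff i ∈ constants σ)
    (hrel : ∀ i ≤ k, ∑ y ∈ Y, W y * symbol σ β A D k i y = 0) {y₀ : ℕ × E} (hy₀ : y₀ ∈ Y)
    (hy₀' : y₀.1 = 0) : W y₀ = 0 := by
  classical
  by_contra hW0
  obtain ⟨N, hN⟩ := exists_forall_eval_ne_zero hW0
  have hWn : ∀ y (n : ℕ), (W y).eval (n : E) ∈ constants σ := by
    intro y n
    rw [eval_eq_sum_range]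
    exact sum_mem fun i _ => mul_mem (hW y i) (by rw [mem_constants, map_pow, map_natCast])
  -- the polynomial of degree `n` with the weights evaluated at `n`
  obtain ⟨g, hg⟩ : ∃ g : ℕ → E[X], ∀ n, g n =
      ∑ y ∈ Y, C ((W y).eval (n : E) * y.2) * X ^ (n - y.1) := ⟨_, fun _ => rfl⟩
  have hgB : ∀ n, g n ∈ polySub B := fun n => by
    rw [hg]
    exact sum_mem fun y hy => mul_mem (C_mem_polySub (mul_mem (hK _ (hWn y n)) (hY y hy).2))
      (pow_mem X_mem_polySub _)
  have hgdeg : ∀ n, (g n).natDegree ≤ n := fun n => by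
    rw [hg]
    exact natDegree_sum_le_of_forall_le _ _ fun y _ =>
      (natDegree_C_mul_X_pow_le _ _).trans (Nat.sub_le _ _)
  have hglead : ∀ n, N ≤ n → 0 < n → (g n).coeff n ≠ 0 := by
    intro n hn hn0 h0
    rw [hg, finsetSum_coeff] at h0
    have h1 : ∑ y ∈ Y.filter (fun y => y.1 = 0), (⟨_, hWn y n⟩ : constants σ) • y.2 = 0 := by
      rw [← h0, Finset.sum_filter]
      refine Finset.sum_congr rfl fun y _ => ?_
      rw [coeff_C_mul_X_pow]
      by_cases hy : y.1 = 0
      · rw [if_pos hy, if_pos (by omega)]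
        rfl
      · rw [if_neg hy, if_neg (by omega)]
    have hset : {y | y ∈ Y ∧ y.1 = 0} =
        ((Y.filter (fun y => y.1 = 0) : Finset (ℕ × E)) : Set (ℕ × E)) := by
      ext y
      simp
    rw [hset] at hind
    have h2 := linearIndepOn_finset_iff.1 hind _ h1 y₀ (Finset.mem_filter.2 ⟨hy₀, hy₀'⟩)
    exact hN n hn (congrArg Subtype.val h2)
  -- by the relation, the `k + 1` highest coefficients of its image vanish
  have hgL : ∀ n, k < n → (polyOp σ 1 β 1 A (g n)).natDegree ≤ D + n - k - 1 := by
    intro n hn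
    refine natDegree_le_iff_coeff_eq_zero.2 fun m hm => ?_
    by_cases hmD : D + n < m
    · exact coeff_eq_zero_of_natDegree_lt ((natDegree_polyOp_le hA (hgdeg n)).trans_lt hmD)
    obtain ⟨i, hi, rfl⟩ : ∃ i ≤ k, m = D + n - i := ⟨D + n - m, by omega, by omega⟩
    have h1 := congrArg (eval (n : E)) (hrel i hi)
    rw [eval_finsetSum, eval_zero] at h1
    have hfac : (k.factorial : E) ≠ 0 := Nat.cast_ne_zero.2 k.factorial_ne_zero
    refine (mul_eq_zero.1 (?_ : (k.factorial : E) * _ = 0)).resolve_left hfac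
    rw [← h1, hg, polyOp_sum, finsetSum_coeff, Finset.mul_sum]
    refine Finset.sum_congr rfl fun y hy => ?_
    rw [eval_mul, eval_symbol hA hi (by omega) (by have := (hY y hy).1; omega), C_mul, mul_assoc,
      polyOp_C_mul A (hWn y n), coeff_C_mul]
    ring
  -- a contradiction for the operator of order `m`, at `m + 1` consecutive degrees
  obtain ⟨m, hm, hm0, hmA⟩ := exists_last_ne_zero (σ := σ) (β := β) hA0
  obtain ⟨n₀, hn₀⟩ : ∃ n₀, n₀ = N + k + 1 := ⟨_, rfl⟩
  have hy : ∀ i, g (n₀ + i) ≠ 0 ∧ (g (n₀ + i)).natDegree = n₀ + i := by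
    intro i
    have h1 := hglead (n₀ + i) (by omega) (by omega)
    exact ⟨fun h => h1 (by rw [h, coeff_zero]),
      le_antisymm (hgdeg _) (le_natDegree_of_ne_zero h1)⟩
  have key := natDegree_add_le_of_combinations hσ hinv hβ hK hB hβB m (fun j => A.getD j 0)
    (fun i => g (n₀ + i)) n₀ (n₀ + m) m (D + n₀ + m - k - 1) (fun j => getD_mem hAB j)
    (fun i => hgB _) hm0 le_rfl (fun c _ hc => natDegree_combination hy c m hc) fun i hi => by
      rw [← hmA]
      exact (hgL _ (by omega)).trans (by omega)
  have h1 : m * m ≤ A.length * A.length := Nat.mul_le_mul hm.le hm.le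
  have h2 : m * (m + m) = 2 * (m * m) := by ring
  omega

end sigmatotal

section sigmatotal

open Polynomial

variable {E : Type*} [CommRing E] {σ : E ≃+* E} {B : Subring E} {β t : E}

theorem LevelCover.append {P : List E → List E → List E → Prop} {A : List E[X]} {D k J J' : ℕ}
    {Y Y' : List (ℕ × E)} (h : LevelCover σ β P A D k Y J) (hY' : ∀ y ∈ Y', y.1 = J')
    (hJ : J ≤ J') :
    LevelCover σ β P A D k (Y ++ Y') J := by
  obtain ⟨Z, G, C, hZ, hP, hG, hC⟩ := h
  refine ⟨Z, G, C, fun y hy => ?_, hP, hG, fun c hc => List.mem_append_left _ (hC c hc)⟩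
  rcases List.mem_append.1 hy with hy | hy
  · exact hZ y hy
  · exact Or.inl (hJ.trans (hY' y hy).ge)

/-- The candidates for the next coefficient, given those for the higher ones. -/
theorem exists_next_level [IsDomain E]
    (hinv : ∀ c ∈ constants σ, c ≠ 0 → ∃ c' ∈ constants σ, c' * c = 1)
    (hB : ∀ x ∈ B, σ x ∈ B) (hβB : β ∈ B) {P : List E → List E → List E → Prop}
    (hP : ∀ a f G, P a f G → (∀ g ∈ G, g ∈ B) ∧ Covers σ B a f G)
    (hPt : ∀ a f, (∀ x ∈ a, x ∈ B) → (∃ x ∈ a, x ≠ 0) → (∀ x ∈ f, x ∈ B) → ∃ G, P a f G)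
    {A : List E[X]} (hAB : ∀ q ∈ A, q ∈ polySub B) {D k : ℕ}
    (hA0 : ∃ x ∈ A.map (fun q => (k.factorial : E) * q.coeff D), x ≠ 0) (J : ℕ)
    {Y : List (ℕ × E)} (hY : ∀ y ∈ Y, y.1 < J ∧ y.2 ∈ B) :
    ∃ C : List E, (∀ c ∈ C, c ∈ B) ∧ LinearIndepOn (constants σ) id {c | c ∈ C} ∧
      LevelCover σ β P A D k (Y ++ C.map fun c => (J, c)) J := by
  obtain ⟨Z, hZ⟩ : ∃ Z, Z = Y.flatMap fun y => (List.range
      ((symbol σ β A D k J y).natDegree + 1)).map (symbol σ β A D k J y).coeff := ⟨_, rfl⟩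
  obtain ⟨G, hG⟩ := hPt (A.map fun q => (k.factorial : E) * q.coeff D) Z (fun x hx => by
      obtain ⟨q, hq, rfl⟩ := List.mem_map.1 hx
      exact mul_mem (natCast_mem _ _) (mem_polySub.1 (hAB q hq) _)) hA0 (fun x hx => by
      rw [hZ, List.mem_flatMap] at hx
      obtain ⟨y, hy, hx⟩ := hx
      obtain ⟨i, -, rfl⟩ := List.mem_map.1 hx
      exact mem_polySub.1 (symbol_mem hB hβB hAB D k J (hY y hy).2) _)
  obtain ⟨C, hCG, hGC, hind⟩ := exists_independent_sublist hinv G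
  refine ⟨C, fun c hc => (hP _ _ _ hG).1 c (hCG c hc), hind, Z, G, C, fun y hy => ?_, hG, hGC,
    fun c hc => List.mem_append_right _ (List.mem_map_of_mem hc)⟩
  rcases List.mem_append.1 hy with hy | hy
  · refine Or.inr fun m => ?_
    by_cases hm : m ≤ (symbol σ β A D k J y).natDegree
    · refine mem_listSpan_of_mem ?_
      rw [hZ, List.mem_flatMap]
      exact ⟨y, hy, List.mem_map_of_mem (List.mem_range.2 (by omega))⟩
    · rw [coeff_eq_zero_of_natDegree_lt (by omega)]
      exact zero_mem _
  · obtain ⟨c, -, rfl⟩ := List.mem_map.1 hy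
    exact Or.inl le_rfl

/-- Candidates for the highest coefficients on all levels up to `J`, independent on level `0`. -/
theorem exists_levels [IsDomain E]
    (hinv : ∀ c ∈ constants σ, c ≠ 0 → ∃ c' ∈ constants σ, c' * c = 1)
    (hB : ∀ x ∈ B, σ x ∈ B) (hβB : β ∈ B) {P : List E → List E → List E → Prop}
    (hP : ∀ a f G, P a f G → (∀ g ∈ G, g ∈ B) ∧ Covers σ B a f G)
    (hPt : ∀ a f, (∀ x ∈ a, x ∈ B) → (∃ x ∈ a, x ≠ 0) → (∀ x ∈ f, x ∈ B) → ∃ G, P a f G)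
    {A : List E[X]} (hAB : ∀ q ∈ A, q ∈ polySub B) {D k : ℕ}
    (hA0 : ∃ x ∈ A.map (fun q => (k.factorial : E) * q.coeff D), x ≠ 0) (J : ℕ) :
    ∃ Y : List (ℕ × E), (∀ y ∈ Y, y.1 < J + 1 ∧ y.2 ∈ B) ∧
      (∀ i < J + 1, LevelCover σ β P A D k Y i) ∧
      LinearIndepOn (constants σ) Prod.snd {y | y ∈ Y ∧ y.1 = 0} := by
  induction J with
  | zero =>
    obtain ⟨C, hC, hind, hcov⟩ := exists_next_level (Y := []) hinv hB hβB hP hPt hAB hA0 0 (by simp)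
    refine ⟨C.map fun c => (0, c), ?_, ?_, ?_⟩
    · intro y hy
      obtain ⟨c, hc, rfl⟩ := List.mem_map.1 hy
      exact ⟨Nat.zero_lt_one, hC c hc⟩
    · intro i hi
      obtain rfl : i = 0 := by omega
      exact hcov
    · have h1 : ∀ y : ℕ × E, (y ∈ C.map (fun c => (0, c)) ∧ y.1 = 0) ↔ y.1 = 0 ∧ y.2 ∈ C := by
        rintro ⟨i, c⟩
        simp only [List.mem_map, Prod.mk.injEq]
        constructor
        · rintro ⟨⟨c', hc', rfl, rfl⟩, -⟩
          exact ⟨rfl, hc'⟩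
        · rintro ⟨rfl, hc⟩
          exact ⟨⟨c, hc, rfl, rfl⟩, rfl⟩
      have h2 : Prod.snd '' {y : ℕ × E | y ∈ C.map (fun c => (0, c)) ∧ y.1 = 0} = {c | c ∈ C} := by
        ext c
        constructor
        · rintro ⟨y, hy, rfl⟩
          exact ((h1 y).1 hy).2
        · exact fun hc => ⟨(0, c), (h1 _).2 ⟨rfl, hc⟩, rfl⟩
      rw [linearIndepOn_iff_image, h2]
      · exact hind
      · intro y hy y' hy' h
        exact Prod.ext (hy.2.trans hy'.2.symm) h
  | succ J ih =>
    obtain ⟨Y, hY, hcov, hind⟩ := ih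
    obtain ⟨C, hC, -, hcov'⟩ := exists_next_level hinv hB hβB hP hPt hAB hA0 (J + 1) hY
    have hlev : ∀ y ∈ C.map fun c => (J + 1, c), y.1 = J + 1 := by
      intro y hy
      obtain ⟨c, -, rfl⟩ := List.mem_map.1 hy
      rfl
    refine ⟨Y ++ C.map fun c => (J + 1, c), ?_, ?_, ?_⟩
    · intro y hy
      rcases List.mem_append.1 hy with hy | hy
      · exact ⟨(hY y hy).1.trans (Nat.lt_succ_self _), (hY y hy).2⟩
      · obtain ⟨c, hc, rfl⟩ := List.mem_map.1 hy
        exact ⟨Nat.lt_succ_self _, hC c hc⟩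
    · intro i hi
      rcases Nat.lt_succ_iff_lt_or_eq.1 hi with hi | rfl
      · exact (hcov i hi).append hlev hi.le
      · exact hcov'
    · convert hind using 1
      ext y
      simp only [List.mem_append, Set.mem_ofPred_eq]
      constructor
      · rintro ⟨hy | hy, h0⟩
        · exact ⟨hy, h0⟩
        · have := hlev y hy
          omega
      · rintro ⟨hy, h0⟩
        exact ⟨Or.inl hy, h0⟩

/-- Bounds for the integer roots of polynomials with constant coefficients can be found. -/
def RootBound (σ : E ≃+* E) (Q : E[X] → ℕ → Prop) : Prop :=
  (∀ κ N, Q κ N → ∀ n : ℕ, κ.eval (n : E) = 0 → n ≤ N) ∧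
    ∀ κ : E[X], κ ≠ 0 → (∀ i, κ.coeff i ∈ constants σ) → ∃ N, Q κ N

/-- The elements of level `0` can be separated. There is a separating functional, since the
alternative would be a relation with constant polynomials as weights, which `no_symbol_relation`
excludes. The values at `y₀` of the functionals that kill the other symbol vectors form an ideal
that is closed under the coefficientwise automorphism, and so it contains some `b κ` with constant
coefficients of `κ`. -/
theorem exists_symbolSeparated [IsDomain E] [CharZero E] (hσ : ConstQuotients σ)
    (hinv : ∀ c ∈ constants σ, c ≠ 0 → ∃ c' ∈ constants σ, c' * c = 1)
    (hβ : ∀ u ∈ B, ∀ v ∈ B, v ≠ 0 → σ u * v - u * σ v ≠ β * (v * σ v))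
    (hK : ∀ x ∈ constants σ, x ∈ B) (hB : ∀ x ∈ B, σ x ∈ B) (hβB : β ∈ B)
    {Q : E[X] → ℕ → Prop} (hQ : RootBound σ Q)
    {A : List E[X]} (hAB : ∀ q ∈ A, q ∈ polySub B) (hA0 : ∃ q ∈ A, q ≠ 0) {D k : ℕ}
    (hA : ∀ q ∈ A, q.natDegree ≤ D) (hk : D + A.length + 2 * (A.length * A.length) ≤ k)
    {Y : List (ℕ × E)} (hY : ∀ y ∈ Y, y.1 ≤ k ∧ y.2 ∈ B)
    (hind : LinearIndepOn (constants σ) Prod.snd {y | y ∈ Y ∧ y.1 = 0}) {y₀ : ℕ × E}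
    (hy₀ : y₀ ∈ Y) (hy₀' : y₀.1 = 0) : ∃ N, SymbolSeparated σ β Q A D k Y y₀ N := by
  classical
  rcases exists_functional_or_relation (coeffAut σ) hσ.polynomial
    ((Y.filter (· ≠ y₀)).map (symbolVec σ β A D k)) (symbolVec σ β A D k y₀) with
    ⟨φ, hφ, hφY⟩ | ⟨d, hd, hdy⟩
  · -- the values at `y₀` of the functionals that kill the other symbol vectors
    let I : Ideal E[X] :=
      { carrier := {p | ∃ φ, (∀ y ∈ Y, y ≠ y₀ →
            functional (coeffAut σ) φ (symbolVec σ β A D k y) = 0) ∧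
          functional (coeffAut σ) φ (symbolVec σ β A D k y₀) = p}
        zero_mem' := ⟨[], by simp [functional_nil], by simp [functional_nil]⟩
        add_mem' := by
          rintro _ _ ⟨φ, h1, rfl⟩ ⟨ψ, h2, rfl⟩
          refine ⟨φ ++ ψ, fun y hy hne => ?_, functional_append _ _ _ _⟩
          rw [functional_append, h1 y hy hne, h2 y hy hne, add_zero]
        smul_mem' := by
          rintro u _ ⟨φ, h1, rfl⟩
          obtain ⟨ψ, hψ⟩ := exists_functional_mul (coeffAut σ) u φ
          exact ⟨ψ, fun y hy hne => by rw [hψ, h1 y hy hne, mul_zero], hψ _⟩ }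
    have hI : ∀ p ∈ I, coeffAut σ p ∈ I := by
      rintro _ ⟨φ, h1, rfl⟩
      obtain ⟨ψ, hψ⟩ := exists_functional_map (coeffAut σ) φ
      exact ⟨ψ, fun y hy hne => by rw [hψ, h1 y hy hne, map_zero], hψ _⟩
    obtain ⟨b, κ, hb, hκ0, hκ, ψ, hψ, hψy⟩ := exists_C_mul_mem hσ hinv hI _ _
      ⟨φ, fun y hy hne => hφY _ (List.mem_map_of_mem (List.mem_filter.2 ⟨hy, by simpa using hne⟩)),
        rfl⟩ hφ le_rfl
    obtain ⟨N, hN⟩ := hQ.2 κ hκ0 hκ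
    refine ⟨N + 1, ψ, κ, b, N, fun y hy => ?_, ⟨hψy, hb⟩, hN, Nat.lt_succ_self _⟩
    by_cases hyy : y = y₀
    · exact Or.inl ⟨congrArg _ hyy, congrArg _ hyy⟩
    · exact Or.inr (hψ y hy hyy)
  · exfalso
    have hset : {q | q ∈ (Y.filter (· ≠ y₀)).map (symbolVec σ β A D k)} =
        symbolVec σ β A D k '' ((Y.toFinset.erase y₀ : Finset (ℕ × E)) : Set (ℕ × E)) := by
      ext q
      simp only [List.mem_map, List.mem_filter, Set.mem_ofPred_eq, Set.mem_image, Finset.mem_coe,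
        Finset.mem_erase, List.mem_toFinset, and_comm, ne_eq, decide_not,
        Bool.not_eq_true', decide_eq_false_iff_not]
    rw [hset] at hdy
    obtain ⟨w, hw⟩ := exists_weights hdy
    obtain ⟨W, hW⟩ : ∃ W : ℕ × E → E[X], W = fun y =>
      if y = y₀ then (d : E[X]) else -(w y : E[X]) := ⟨_, rfl⟩
    have h0 := no_symbol_relation hσ hinv hβ hK hB hβB hAB hA0 hA hk (Y := Y.toFinset) (W := W)
      (fun y hy => hY y (List.mem_toFinset.1 hy)) (by simpa using hind) (fun y i => ?_)
      (fun i hi => ?_) (List.mem_toFinset.2 hy₀) hy₀'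
    · rw [hW] at h0
      simp only [if_true] at h0
      exact hd (Subtype.ext h0)
    · rw [hW]
      dsimp only
      split_ifs
      · exact (mem_constants_coeffAut σ).1 d.2 i
      · rw [coeff_neg]
        exact neg_mem ((mem_constants_coeffAut σ).1 (w y).2 i)
    · rw [← Finset.add_sum_erase _ _ (List.mem_toFinset.2 hy₀)]
      have h1 := congrFun hw i
      simp only [Finset.sum_apply, Pi.smul_apply, Subring.smul_def, smul_eq_mul, symbolVec] at h1
      rw [show i - (i - k) = i by omega] at h1
      rw [hW]
      simp only [if_true]
      rw [← h1, ← Finset.sum_add_distrib]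
      refine Finset.sum_eq_zero fun y hy => ?_
      rw [if_neg (Finset.ne_of_mem_erase hy)]
      ring

/-- Every equation has a certified degree bound. -/
theorem exists_sigmaBound [IsDomain E] [CharZero E] (hσ : ConstQuotients σ)
    (hinv : ∀ c ∈ constants σ, c ≠ 0 → ∃ c' ∈ constants σ, c' * c = 1)
    (hβ : ∀ u ∈ B, ∀ v ∈ B, v ≠ 0 → σ u * v - u * σ v ≠ β * (v * σ v))
    (hK : ∀ x ∈ constants σ, x ∈ B) (hB : ∀ x ∈ B, σ x ∈ B) (hβB : β ∈ B)
    {Q : E[X] → ℕ → Prop} (hQ : RootBound σ Q) {P : List E → List E → List E → Prop}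
    (hP : ∀ a f G, P a f G → (∀ g ∈ G, g ∈ B) ∧ Covers σ B a f G)
    (hPt : ∀ a f, (∀ x ∈ a, x ∈ B) → (∃ x ∈ a, x ≠ 0) → (∀ x ∈ f, x ∈ B) → ∃ G, P a f G)
    {a f : List E} (ha : ∀ x ∈ a, x ∈ polyAdjoin B t) (ha0 : ∃ x ∈ a, x ≠ 0)
    (hf : ∀ x ∈ f, x ∈ polyAdjoin B t) : ∃ N, SigmaBound σ β P Q B t a f N := by
  obtain ⟨A, hAl⟩ := exists_lifts ha
  obtain ⟨Fp, hFl⟩ := exists_lifts hf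
  have hA0 : ∃ q ∈ A, q ≠ 0 := by
    obtain ⟨x, hx, hx0⟩ := ha0
    rw [← hAl.2] at hx
    obtain ⟨q, hq, rfl⟩ := List.mem_map.1 hx
    exact ⟨q, hq, by rintro rfl; simp at hx0⟩
  obtain ⟨D, hD, hD0⟩ := exists_degree hA0
  obtain ⟨DF, hDF⟩ := exists_natDegree_le Fp
  obtain ⟨k, hk⟩ : ∃ k, k = D + A.length + 2 * (A.length * A.length) := ⟨_, rfl⟩
  have hk0 : ∃ x ∈ A.map (fun q => (k.factorial : E) * q.coeff D), x ≠ 0 := by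
    obtain ⟨x, hx, hx0⟩ := hD0
    obtain ⟨q, hq, rfl⟩ := List.mem_map.1 hx
    exact ⟨_, List.mem_map_of_mem hq,
      mul_ne_zero (Nat.cast_ne_zero.2 k.factorial_ne_zero) hx0⟩
  obtain ⟨Y, hY, hcov, hind⟩ := exists_levels hinv hB hβB hP hPt hAl.1 hk0 k
  have hY' : ∀ y ∈ Y, y.1 ≤ k ∧ y.2 ∈ B := fun y hy =>
    ⟨Nat.lt_succ_iff.1 (hY y hy).1, (hY y hy).2⟩
  have hmono : ∀ (y : ℕ × E) N M, N ≤ M →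
      (y.1 ≠ 0 ∨ SymbolSeparated σ β Q A D k Y y N) →
      (y.1 ≠ 0 ∨ SymbolSeparated σ β Q A D k Y y M) := by
    rintro y N M hNM (h | ⟨φ, κ, b, N', h1, h2, h3, h4⟩)
    · exact Or.inl h
    · exact Or.inr ⟨φ, κ, b, N', h1, h2, h3, h4.trans_le hNM⟩
  obtain ⟨N, hN⟩ := exists_bound_forall_mem (l := Y) hmono fun y hy => by
    by_cases hy0 : y.1 = 0
    · obtain ⟨N, hN⟩ := exists_symbolSeparated hσ hinv hβ hK hB hβB hQ hAl.1 hA0 hD hk.ge hY' hind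
        hy hy0
      exact ⟨N, Or.inr hN⟩
    · exact ⟨0, Or.inl hy0⟩
  exact ⟨N + (DF + k + 1), A, Fp, Y, D, k, DF, ⟨hAl, hFl⟩, ⟨hD, hDF⟩, hcov,
    fun y hy => ⟨(hY' y hy).1, hmono y N _ (by omega) (hN y hy)⟩, by omega⟩

/-- Covers can be found in `B[t]`, for a `Σ`-monomial `t`, if they can be found in `B` and the
integer roots of polynomials over the constants can be bounded. -/
theorem CanCover.polyAdjoin_sigma [Coded E] [CodedRing E] [IsDomain E] [CharZero E]
    (hσe : Eff fun x : E => σ x) (hσ : ConstQuotients σ)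
    (hinv : ∀ c ∈ constants σ, c ≠ 0 → ∃ c' ∈ constants σ, c' * c = 1)
    (hβ : ∀ u ∈ B, ∀ v ∈ B, v ≠ 0 → σ u * v - u * σ v ≠ β * (v * σ v))
    (hK : ∀ x ∈ constants σ, x ∈ B) (hB : ∀ x ∈ B, σ x ∈ B) (hβB : β ∈ B)
    (htr : TransOver B t) (ht : σ t = t + β) (hmem : Semi fun x : E => x ∈ B)
    {Q : E[X] → ℕ → Prop} (hQs : Semi fun x : E[X] × ℕ => Q x.1 x.2) (hQ : RootBound σ Q)
    (hcov : CanCover σ B) : CanCover σ (_root_.polyAdjoin B t) := by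
  obtain ⟨P, hPs, hP, hPt⟩ := id hcov
  exact CanCover.polyAdjoin hσe htr hB (one_mem B) one_ne_zero hβB (by rw [ht, one_mul]) hK hmem
    hcov ⟨SigmaBound σ β P Q B t, semi_sigmaBound hσe hmem hPs hQs, fun a f N h g hg hgf =>
      h.mem_boundedDegree htr hB hβB ht hK (fun a f G h => (hP a f G h).2) hQ.1 hg hgf,
      fun a f ha ha0 hf => exists_sigmaBound hσ hinv hβ hK hB hβB hQ hP hPt ha ha0 hf⟩

end sigmatotal

/-! ### Covers of the solutions in the whole extension -/

namespace PiSigmaExtension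

open Polynomial

variable {F E : Type*} [Field F] [CommRing E] [Algebra F E] {σF : F ≃+* F} {σE : E ≃+* E} {e : ℕ}
  (T : PiSigmaExtension σF σE e)

include T in
/-- Polynomials over the constants of `E` are polynomials over the constants of `F`, for which the
integer roots can be computed. -/
theorem exists_rootBound [Coded E] [CodedRing E] (hσ : Eff fun x : E => σE x) {νF : ℕ → F}
    (hν : Function.Surjective νF) (hemb : Eff fun n : ℕ => codeMap E νF n)
    (hroots : CanComputeIntegerRoots νF σF) :
    ∃ Q : E[X] → ℕ → Prop, (Semi fun x : E[X] × ℕ => Q x.1 x.2) ∧ RootBound σE Q := by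
  obtain ⟨alg, halg, hspec⟩ := hroots
  have halg' : Eff fun p : List ℕ => alg p := by
    refine ⟨alg, halg, fun c => ?_⟩
    change List.map id (alg c) = alg (c.map id)
    simp
  refine ⟨fun κ N => ∃ c : List ℕ, ofCoeffs (c.map (codeMap E νF)) = κ ∧
    AllMem c (fun n => σE (codeMap E νF n) = codeMap E νF n) ∧
    (∃ n, n ∈ c ∧ codeMap E νF n ≠ 0) ∧ AllMem (alg c) (fun z => z.natAbs ≤ N), ?_, ?_, ?_⟩
  · have hmap : Eff fun l : List ℕ => ofCoeffs (l.map (codeMap E νF)) :=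
      Eff.ofCoeffs (Eff.map Eff.id (hemb.comp (Eff.snd Eff.id)))
    have hfix : Semi fun c : List ℕ =>
        AllMem c (fun n => σE (codeMap E νF n) = codeMap E νF n) := by fun_prop
    have hne : Semi fun c : List ℕ => ∃ n, n ∈ c ∧ codeMap E νF n ≠ 0 := by fun_prop
    have hN : Semi fun x : List ℕ × ℕ => AllMem (alg x.1) (fun z => z.natAbs ≤ x.2) :=
      Semi.allMem (halg'.comp (Eff.fst Eff.id)) (Semi.natLe (by fun_prop) (by fun_prop))
    refine Semi.exists (Semi.and ?_ (Semi.and ?_ (Semi.and ?_ ?_)))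
    · exact Semi.eq (hmap.comp (Eff.snd Eff.id)) (by fun_prop)
    · exact hfix.comp (Eff.snd Eff.id)
    · exact hne.comp (Eff.snd Eff.id)
    · exact hN.comp (f := fun x : (E[X] × ℕ) × List ℕ => (x.2, x.1.2)) (by fun_prop)
  · rintro _ N ⟨c, rfl, hfix, hne, hN⟩ n hn
    obtain ⟨m, a, rfl, i, hi⟩ := exists_ofFn_codes hne
    have h1 := (hspec m a (fun i => ?_) ⟨i, fun h => hi (by rw [codeMap, h, map_zero])⟩ n).2 ?_
    · simpa using hN _ h1
    · refine T.injective ?_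
      rw [← T.commutes]
      exact hfix (a i) ((List.mem_ofFn' _ _).2 ⟨i, rfl⟩)
    · refine T.injective ?_
      rw [ofCoeffs, eval_finsetSum, List.length_map, List.length_ofFn, Finset.sum_range] at hn
      rw [map_sum, map_zero, ← hn]
      refine Finset.sum_congr rfl fun i _ => ?_
      simp [-List.ofFn_succ, List.getD_eq_getElem?_getD, codeMap, Nat.lt_succ_iff.1 i.2]
  · intro κ hκ hc
    obtain ⟨c, hcκ⟩ := exists_codes (E := E) hν (l := (List.range (κ.natDegree + 1)).map κ.coeff)
      fun x hx => by
        obtain ⟨i, -, rfl⟩ := List.mem_map.1 hx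
        exact T.const_mem_range (hc i)
    obtain ⟨N, hN⟩ : ∃ N, ∀ z ∈ alg c, z.natAbs ≤ N :=
      exists_bound_forall_mem (fun z N M h h1 => h1.trans h) fun z _ => ⟨_, le_rfl⟩
    have hmem : ∀ n ∈ c, ∃ i, κ.coeff i = codeMap E νF n := by
      intro n hn
      have h1 := List.mem_map_of_mem (f := codeMap E νF) hn
      rw [hcκ] at h1
      obtain ⟨i, -, hi⟩ := List.mem_map.1 h1
      exact ⟨i, hi⟩
    refine ⟨N, c, ?_, fun n hn => ?_, ?_, hN⟩
    · rw [hcκ]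
      ext n
      rw [coeff_map_range_ofCoeffs]
      split_ifs with h
      · rfl
      · exact (coeff_eq_zero_of_natDegree_lt (by omega)).symm
    · obtain ⟨i, hi⟩ := hmem n hn
      rw [← hi]
      exact hc i
    · have h1 : κ.leadingCoeff ∈ c.map (codeMap E νF) := by
        rw [hcκ]
        exact List.mem_map.2 ⟨κ.natDegree, by simp, rfl⟩
      obtain ⟨n, hn, hn'⟩ := List.mem_map.1 h1
      exact ⟨n, hn, by rw [hn']; exact leadingCoeff_ne_zero.2 hκ⟩

theorem semi_mem_sigmaRing [Coded E] [CodedRing E] {νF : ℕ → F}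
    (hν : Function.Surjective νF) (hemb : Eff fun n : ℕ => codeMap E νF n) (k : ℕ) :
    Semi fun x : E => x ∈ T.sigmaRing k := by
  induction k with
  | zero => exact T.semi_mem_piRing hν hemb e
  | succ k ih =>
    change Semi fun x : E => x ∈ T.adjoinSigma k _
    by_cases h : ∃ hk : k < e, T.kind ⟨k, hk⟩ = .sigma
    · obtain ⟨hk, h⟩ := h
      rw [show T.adjoinSigma k _ = _ from T.adjoinSigma_of_sigma h _]
      exact semi_mem_polyAdjoin _ ih
    · rwa [T.adjoinSigma_of_not h]

/-- Covers can be found in `E`: the `Σ`-monomials are adjoined one by one to the ring generated by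
the `Π`-monomials. -/
theorem canCover_top (hPi : ∀ i, T.kind i = MonomialKind.pi →
      ∃ α : F, α ≠ 0 ∧ σE (T.t i) = algebraMap F E α * T.t i) [Coded E] [CodedRing E]
    (hσ : Eff fun x : E => σE x) {νF : ℕ → F} (hν : Function.Surjective νF)
    (hemb : Eff fun n : ℕ => codeMap E νF n) (hPLDE : CanSolvePLDEs νF σF)
    (hOrbit : CanSolvePseudoOrbit νF σF)
    (hHyp : CanComputeHypergeometricCandidates νF σF)
    (hSigma : (∃ i, T.kind i = MonomialKind.sigma) →
      CharZero F ∧ CanComputeIntegerRoots νF σF) : CanCover σE (⊤ : Subring E) := by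
  have hdom := T.isDomain
  rw [← T.sigmaRing_top]
  have key : ∀ k, CanCover σE (T.sigmaRing k) := by
    intro k
    induction k with
    | zero => exact T.canCover_piRing hPi hσ hν hemb hPLDE hOrbit hHyp e
    | succ k ih =>
      change CanCover σE (T.adjoinSigma k _)
      by_cases h : ∃ hk : k < e, T.kind ⟨k, hk⟩ = .sigma
      swap
      · rwa [T.adjoinSigma_of_not h]
      obtain ⟨hk, h⟩ := h
      rw [show T.adjoinSigma k _ = _ from T.adjoinSigma_of_sigma h _]
      obtain ⟨hchar, hroots⟩ := hSigma ⟨_, h⟩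
      have : CharZero E := charZero_of_injective_algebraMap T.injective
      obtain ⟨Q, hQs, hQ⟩ := T.exists_rootBound hσ hν hemb hroots
      have hmem := T.semi_mem_sigmaRing hν hemb k
      have hB := T.sigmaRing_stable hPi k
      have htr := T.transOver_sigmaRing h
      have hβB := T.sigma_sub_mem h
      have hF := T.range_le_sigmaRing k
      obtain ⟨t, rfl⟩ : ∃ t, T.t ⟨k, hk⟩ = t := ⟨_, rfl⟩
      obtain ⟨β, hβ⟩ : ∃ β, σE (T.t ⟨k, hk⟩) - T.t ⟨k, hk⟩ = β := ⟨_, rfl⟩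
      have ht := (sub_eq_iff_eq_add'.1 hβ)
      rw [hβ] at hβB
      refine CanCover.polyAdjoin_sigma (β := β) hσ T.constQuotients (fun c hc h0 => ?_)
        (fun u hu v hv hv0 => ?_) (fun x hx => hF (T.const_mem_range hx)) hB hβB htr ht hmem hQs
        hQ ih
      · obtain ⟨c', hc', -, h1⟩ := T.exists_const_inv hc h0
        exact ⟨c', hc', h1⟩
      · exact T.not_telescoping hF htr ht hu hv hv0
  exact key e

end PiSigmaExtension

/-! ### From covers to bases of the solution spaces -/

section basis

variable {E : Type*} [CommRing E] {σ : E ≃+* E}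

/-- Operator functionals that separate the vectors from each other certify their independence. -/
theorem linearIndependent_of_separated [IsDomain E] {n : ℕ} {v : Fin n → ℕ → E}
    (h : ∀ i, ∃ φ, functional σ φ (v i) ≠ 0 ∧ ∀ j, j ≠ i → functional σ φ (v j) = 0) :
    LinearIndependent (constants σ) v := by
  rw [Fintype.linearIndependent_iff]
  intro c hc i
  obtain ⟨φ, hφ, hφ0⟩ := h i
  have h1 := congrArg (functional σ φ) hc
  rw [map_sum, map_zero, Finset.sum_eq_single_of_mem i (Finset.mem_univ i), map_smul,
    Subring.smul_def, smul_eq_mul] at h1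
  · exact Subtype.ext ((mul_eq_zero.1 h1).resolve_right hφ)
  · intro j _ hj
    rw [map_smul, hφ0 j hj, smul_zero]

/-- Independence over the constants always has a certificate by operator functionals. -/
theorem exists_separated [IsDomain E] (hσ : ConstQuotients σ) {n : ℕ} {v : Fin n → ℕ → E}
    (hv : LinearIndependent (constants σ) v) (i : Fin n) :
    ∃ φ, functional σ φ (v i) ≠ 0 ∧ ∀ j, j ≠ i → functional σ φ (v j) = 0 := by
  rcases exists_functional_or_relation σ hσ (((List.finRange n).filter (· ≠ i)).map v) (v i) with
    ⟨φ, h1, h2⟩ | ⟨d, hd, h⟩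
  · exact ⟨φ, h1, fun j hj => h2 _ (List.mem_map_of_mem (by simpa using hj))⟩
  · refine absurd (linearIndependent_iff_eq_zero_of_smul_mem_span.1 hv i d ?_) hd
    have hset : v '' (Set.univ \ {i}) =
        {q | q ∈ ((List.finRange n).filter (· ≠ i)).map v} := by
      ext q
      simp
    rw [hset]
    exact h

/-- The vector `(g, c₁, …, c_d)` of a solution that is given as a pair of `(c₁, …, c_d)` and `g`. -/
def solVec (q : List E × E) (i : ℕ) : E := (q.2 :: q.1).getD i 0

/-- The defect of a pair in the equation with the operator `a` and the right hand sides `f`. -/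
def defect (σ : E ≃+* E) (a f : List E) (q : List E × E) : E :=
  opApply σ a q.2 - ∑ j ∈ Finset.range f.length, q.1.getD j 0 * f.getD j 0

/-- The members of the list `l` are mapped by `v` to vectors that can be separated from each other
by operator functionals. -/
def Separated (σ : E ≃+* E) (v : List E × E → ℕ → E) (l : List (List E × E)) : Prop :=
  AllLt l.length fun i => ∃ φ, functional σ φ (v (l.getD i ([], 0))) ≠ 0 ∧
    AllLt l.length fun j => j = i ∨ functional σ φ (v (l.getD j ([], 0))) = 0

/-- The first `d + 1` coordinates of `w` are those of a combination of the members of `l`. -/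
def VecMem (σ : E ≃+* E) (d : ℕ) (l : List (List E × E)) (w : List E × E) : Prop :=
  ∃ k : List E, AllMem k (fun c => σ c = c) ∧ AllLt (d + 1) fun i =>
    solVec w i = ∑ j ∈ Finset.range l.length, k.getD j 0 * solVec (l.getD j ([], 0)) i

/-- A certificate for `S` being a basis of the solution space: its members are independent
solutions, and together with a list `Y` of elements with linearly independent defects they span a
space that contains all solutions. -/
def IsSolutionBasis (σ : E ≃+* E) (P : List E → List E → List E → Prop) (a f : List E)
    (S : List (List E × E)) : Prop :=
  ∃ (G : List E) (Y : List (List E × E)), P a f G ∧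
    AllMem (S ++ Y) (fun q => q.1.length = f.length ∧ AllMem q.1 fun c => σ c = c) ∧
    AllMem S (fun q => defect σ a f q = 0) ∧
    (Separated σ solVec S ∧ Separated σ (fun q _ => defect σ a f q) Y) ∧
    AllMem G (fun g => VecMem σ f.length (S ++ Y) ([], g)) ∧
    AllLt f.length fun j => VecMem σ f.length (S ++ Y) ((List.range j).map (fun _ => 0) ++ [1], 0)

section semi

variable [Coded E] [CodedRing E] {T : Type*} [Coded T]

omit [CodedRing E] in
@[fun_prop]
theorem Eff.solVec {q : T → List E × E} {i : T → ℕ} (hq : Eff q) (hi : Eff i) :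
    Eff fun x => solVec (q x) (i x) := by
  unfold _root_.solVec
  fun_prop

theorem Eff.defect (hσ : Eff fun x : E => σ x) :
    Eff fun x : (List E × List E) × (List E × E) => defect σ x.1.1 x.1.2 x.2 := by
  unfold _root_.defect
  fun_prop

theorem semi_separated (hσ : Eff fun x : E => σ x) {Z : Type*} [Coded Z]
    {v : Z → List E × E → ℕ → E} (hv : Eff fun x : (Z × (List E × E)) × ℕ => v x.1.1 x.1.2 x.2) :
    Semi fun x : Z × List (List E × E) => Separated σ (v x.1) x.2 := by
  have h1 : Eff fun x : (Z × (List E × E)) × List (List E × ℕ) =>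
      functional σ x.2 (v x.1.1 x.1.2) :=
    Eff.functional hσ (by fun_prop) (hv.comp (g := fun p : ((Z × (List E × E)) ×
      List (List E × ℕ)) × ℕ => (p.1.1, p.2)) (by fun_prop))
  have h2 : Eff fun x : ((Z × List (List E × E)) × ℕ) × List (List E × ℕ) =>
      functional σ x.2 (v x.1.1.1 (x.1.1.2.getD x.1.2 ([], 0))) :=
    h1.comp (g := fun x : ((Z × List (List E × E)) × ℕ) × List (List E × ℕ) =>
      ((x.1.1.1, x.1.1.2.getD x.1.2 ([], 0)), x.2)) (by fun_prop)
  refine Semi.allLt (by fun_prop) (Semi.exists (Semi.and (Semi.ne h2 (Eff.const _)) (Semi.allLt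
    (by fun_prop) (Semi.or (Semi.eq (by fun_prop) (by fun_prop)) (Semi.eq ?_ (Eff.const _))))))
  exact h2.comp (g := fun x : (((Z × List (List E × E)) × ℕ) × List (List E × ℕ)) × ℕ =>
    ((x.1.1.1, x.2), x.1.2)) (by fun_prop)

theorem semi_vecMem (hσ : Eff fun x : E => σ x) :
    Semi fun x : (ℕ × List (List E × E)) × (List E × E) => VecMem σ x.1.1 x.1.2 x.2 := by
  unfold VecMem
  fun_prop

theorem semi_isSolutionBasis (hσ : Eff fun x : E => σ x) {P : List E → List E → List E → Prop}
    (hP : Semi fun x : List E × List E × List E => P x.1 x.2.1 x.2.2) :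
    Semi fun x : (List E × List E) × List (List E × E) =>
      IsSolutionBasis σ P x.1.1 x.1.2 x.2 := by
  have h1 : Semi fun x : List (List E × E) × ℕ =>
      AllMem x.1 (fun q => q.1.length = x.2 ∧ AllMem q.1 fun c => σ c = c) := by fun_prop
  have h2 : Semi fun x : (List E × List E) × List (List E × E) =>
      AllMem x.2 (fun q => defect σ x.1.1 x.1.2 q = 0) :=
    Semi.allMem (by fun_prop) (Semi.eq ((Eff.defect hσ).comp
      (g := fun x : ((List E × List E) × List (List E × E)) × (List E × E) => (x.1.1, x.2))
      (by fun_prop)) (Eff.const _))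
  have h3 : Semi fun x : List (List E × E) => Separated σ solVec x :=
    (semi_separated hσ (Z := ℕ) (v := fun _ => solVec) (by fun_prop)).comp
      (f := fun x : List (List E × E) => (0, x)) (by fun_prop)
  have h4 : Semi fun x : (List E × List E) × List (List E × E) =>
      Separated σ (fun q _ => defect σ x.1.1 x.1.2 q) x.2 :=
    semi_separated hσ (v := fun (z : List E × List E) q _ => defect σ z.1 z.2 q)
      ((Eff.defect hσ).comp (Eff.fst Eff.id))
  have h5 : Semi fun x : (ℕ × List (List E × E)) × List E =>
      AllMem x.2 (fun g => VecMem σ x.1.1 x.1.2 ([], g)) :=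
    Semi.allMem (by fun_prop) ((semi_vecMem hσ).comp
      (f := fun x : ((ℕ × List (List E × E)) × List E) × E => (x.1.1, ([], x.2))) (by fun_prop))
  have h6 : Semi fun x : ℕ × List (List E × E) =>
      AllLt x.1 fun j => VecMem σ x.1 x.2 ((List.range j).map (fun _ => 0) ++ [1], 0) :=
    Semi.allLt (by fun_prop) ((semi_vecMem hσ).comp
      (f := fun x : (ℕ × List (List E × E)) × ℕ =>
        (x.1, ((List.range x.2).map (fun _ => (0 : E)) ++ [1], 0))) (by fun_prop))
  refine Semi.exists (Semi.exists (Semi.and ?_ (Semi.and ?_ (Semi.and ?_ (Semi.and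
    (Semi.and ?_ ?_) (Semi.and ?_ ?_))))))
  · exact hP.comp (f := fun x : (((List E × List E) × List (List E × E)) × List E) ×
      List (List E × E) => (x.1.1.1.1, x.1.1.1.2, x.1.2)) (by fun_prop)
  · exact h1.comp (f := fun x : (((List E × List E) × List (List E × E)) × List E) ×
      List (List E × E) => (x.1.1.2 ++ x.2, x.1.1.1.2.length)) (by fun_prop)
  · exact h2.comp (f := fun x : (((List E × List E) × List (List E × E)) × List E) ×
      List (List E × E) => x.1.1) (by fun_prop)
  · exact h3.comp (f := fun x : (((List E × List E) × List (List E × E)) × List E) ×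
      List (List E × E) => x.1.1.2) (by fun_prop)
  · exact h4.comp (f := fun x : (((List E × List E) × List (List E × E)) × List E) ×
      List (List E × E) => (x.1.1.1, x.2)) (by fun_prop)
  · exact h5.comp (f := fun x : (((List E × List E) × List (List E × E)) × List E) ×
      List (List E × E) => ((x.1.1.1.2.length, x.1.1.2 ++ x.2), x.1.2)) (by fun_prop)
  · exact h6.comp (f := fun x : (((List E × List E) × List (List E × E)) × List E) ×
      List (List E × E) => (x.1.1.1.2.length, x.1.1.2 ++ x.2)) (by fun_prop)

end semi

/-- An element of `Kᵈ × E` as a pair of a list and an element of `E`. -/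
def solPair {d : ℕ} (x : (Fin d → constants σ) × E) : List E × E :=
  (List.ofFn fun j => (x.1 j : E), x.2)

/-- The vector of an element of `Kᵈ × E`. -/
def solLin (σ : E ≃+* E) (d : ℕ) : ((Fin d → constants σ) × E) →ₗ[constants σ] (ℕ → E) where
  toFun x := solVec (solPair x)
  map_add' x y := by
    funext i
    cases i with
    | zero => rfl
    | succ i => by_cases h : i < d <;> simp [solVec, solPair, List.getD_eq_getElem?_getD, h]
  map_smul' c x := by
    funext i
    cases i with
    | zero => rfl
    | succ i =>
      by_cases h : i < d <;>
        simp [solVec, solPair, List.getD_eq_getElem?_getD, h, Subring.smul_def]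

theorem solLin_succ {d : ℕ} (x : (Fin d → constants σ) × E) (i : ℕ) :
    solLin σ d x (i + 1) = if h : i < d then (x.1 ⟨i, h⟩ : E) else 0 := by
  by_cases h : i < d <;> simp [solLin, solVec, solPair, List.getD_eq_getElem?_getD, h]

theorem solLin_ext {d : ℕ} {x y : (Fin d → constants σ) × E}
    (h : ∀ i < d + 1, solLin σ d x i = solLin σ d y i) : x = y := by
  refine Prod.ext (funext fun j => Subtype.ext ?_) (h 0 (Nat.succ_pos d))
  have h1 := h (j + 1) (by omega)
  simpa [solLin_succ] using h1

theorem ker_solLin (d : ℕ) : LinearMap.ker (solLin σ d) = ⊥ :=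
  LinearMap.ker_eq_bot.2 fun _ _ h => solLin_ext fun i _ => congrFun h i

/-- The defect of an element of `Kᵈ × E`. -/
def defectLin (σ : E ≃+* E) {d : ℕ} (a : List E) (f : Fin d → E) :
    ((Fin d → constants σ) × E) →ₗ[constants σ] E :=
  opLin σ a ∘ₗ LinearMap.snd _ _ _ -
    (∑ j, LinearMap.toSpanSingleton (constants σ) E (f j) ∘ₗ LinearMap.proj j) ∘ₗ
      LinearMap.fst _ _ _

theorem defectLin_apply {d : ℕ} (a : List E) (f : Fin d → E) (x : (Fin d → constants σ) × E) :
    defectLin σ a f x = opApply σ a x.2 - ∑ j, (x.1 j : E) * f j := by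
  simp [defectLin, Subring.smul_def]

theorem defect_solPair {d : ℕ} (a : List E) (f : Fin d → E) (x : (Fin d → constants σ) × E) :
    defect σ a (List.ofFn f) (solPair x) = defectLin σ a f x := by
  rw [defect, defectLin_apply, List.length_ofFn, Finset.sum_range]
  congr 1
  exact Finset.sum_congr rfl fun j _ => by simp [solPair, List.getD_eq_getElem?_getD]

theorem mem_pldeSolutions_iff {m d : ℕ} {a : Fin (m + 1) → E} {f : Fin d → E}
    {x : (Fin d → constants σ) × E} :
    x ∈ pldeSolutions σ a f ↔ defectLin σ (List.ofFn a) f x = 0 := by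
  rw [defectLin_apply, opApply_ofFn, sub_eq_zero]
  rfl

theorem getD_ofFn {X : Type*} {n : ℕ} (v : Fin n → X) (i : Fin n) (x : X) :
    (List.ofFn v).getD i x = v i := by simp [List.getD_eq_getElem?_getD]

/-- `VecMem` expresses membership in the span of a family of elements of `Kᵈ × E`. -/
theorem vecMem_ofFn_iff {d n : ℕ} {z : Fin n → (Fin d → constants σ) × E}
    {x : (Fin d → constants σ) × E} {w : List E × E} (hw : ∀ i, solVec w i = solLin σ d x i) :
    VecMem σ d (List.ofFn fun j => solPair (z j)) w ↔
      x ∈ Submodule.span (constants σ) (Set.range z) := by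
  rw [Submodule.mem_span_range_iff_exists_fun]
  constructor
  · rintro ⟨k, hk, h⟩
    refine ⟨fun j => ⟨k.getD j 0, getD_mem (M := constants σ) hk j⟩, solLin_ext fun i hi => ?_⟩
    rw [← hw, h i hi, map_sum, List.length_ofFn, Finset.sum_range, Finset.sum_apply]
    refine Finset.sum_congr rfl fun j _ => ?_
    rw [map_smul, getD_ofFn]
    rfl
  · rintro ⟨k, rfl⟩
    refine ⟨List.ofFn fun j => (k j : E), fun c hc => ?_, fun i _ => ?_⟩
    · obtain ⟨j, rfl⟩ := (List.mem_ofFn' _ _).1 hc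
      exact (k j).2
    · dsimp only
      rw [hw, map_sum, List.length_ofFn, Finset.sum_range, Finset.sum_apply]
      refine Finset.sum_congr rfl fun j _ => ?_
      rw [map_smul, getD_ofFn, getD_ofFn]
      rfl

theorem separated_ofFn_iff {n : ℕ} {v : List E × E → ℕ → E} {w : Fin n → List E × E} :
    Separated σ v (List.ofFn w) ↔ ∀ i, ∃ φ, functional σ φ (v (w i)) ≠ 0 ∧
      ∀ j, j ≠ i → functional σ φ (v (w j)) = 0 := by
  simp only [Separated, AllLt, List.length_ofFn]
  constructor
  · intro h i
    obtain ⟨φ, h1, h2⟩ := h i i.2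
    rw [getD_ofFn] at h1
    refine ⟨φ, h1, fun j hj => ?_⟩
    have := (h2 j j.2).resolve_left fun h => hj (Fin.ext h)
    rwa [getD_ofFn] at this
  · intro h i hi
    obtain ⟨φ, h1, h2⟩ := h ⟨i, hi⟩
    refine ⟨φ, by rwa [getD_ofFn w ⟨i, hi⟩], fun j hj => or_iff_not_imp_left.2 fun hji => ?_⟩
    rw [getD_ofFn w ⟨j, hj⟩]
    exact h2 _ fun h => hji (congrArg Fin.val h)

/-- The constant vectors. They make the functionals on vectors applicable to single elements. -/
def constVec (σ : E ≃+* E) : E →ₗ[constants σ] (ℕ → E) := LinearMap.pi fun _ => LinearMap.id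

/-- A submodule that contains the unit vectors of `Kᵈ` and the members of `G` contains all elements
of `Kᵈ × E` whose last component lies in the span of `G`. -/
theorem mem_of_cover {d : ℕ} {N : Submodule (constants σ) ((Fin d → constants σ) × E)}
    {G : List E} (hG : ∀ g ∈ G, ((0, g) : (Fin d → constants σ) × E) ∈ N)
    (hd : ∀ j, ((Pi.single j 1, 0) : (Fin d → constants σ) × E) ∈ N)
    {x : (Fin d → constants σ) × E} (hx : x.2 ∈ listSpan σ G) : x ∈ N := by
  have h1 : ((0, x.2) : (Fin d → constants σ) × E) ∈ N :=
    (listSpan_le (M := N.comap (LinearMap.inr _ _ _))).2 hG hx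
  have h2 : ((x.1, 0) : (Fin d → constants σ) × E) =
      ∑ j, x.1 j • ((Pi.single j 1, 0) : (Fin d → constants σ) × E) := by
    refine Prod.ext (funext fun j => ?_) ?_
    · simp [Prod.fst_sum, Pi.single_apply]
    · simp [Prod.snd_sum]
  have h3 : x = (x.1, 0) + (0, x.2) := by simp
  rw [h3, h2]
  exact add_mem (sum_mem fun j _ => N.smul_mem _ (hd j)) h1

theorem solVec_nil (g : E) (d : ℕ) (i : ℕ) :
    solVec ([], g) i = solLin σ d (0, g) i := by
  cases i with
  | zero => rfl
  | succ i => simp [solLin_succ, solVec]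

theorem solVec_single {d : ℕ} (j : Fin d) (i : ℕ) :
    solVec ((List.range j).map (fun _ => (0 : E)) ++ [1], 0) i =
      solLin σ d (Pi.single j 1, 0) i := by
  cases i with
  | zero => rfl
  | succ i =>
    rw [solLin_succ]
    simp only [solVec, List.getElem?_cons_succ, List.getD_eq_getElem?_getD]
    rcases lt_trichotomy i j with h | h | h
    · have h1 : (⟨i, h.trans j.2⟩ : Fin d) ≠ j := fun h' => h.ne (congrArg Fin.val h')
      rw [dif_pos (h.trans j.2), Pi.single_eq_of_ne h1,
        List.getElem?_append_left (by simpa using h)]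
      simp [h]
    · subst h
      rw [dif_pos j.2, List.getElem?_append_right (by simp)]
      simp
    · rw [List.getElem?_eq_none (by simp; omega)]
      split_ifs with h2
      · have h1 : (⟨i, h2⟩ : Fin d) ≠ j := fun h' => h.ne' (congrArg Fin.val h')
        rw [Pi.single_eq_of_ne h1]
        rfl
      · rfl

end basis

section solve

variable {E : Type*} [CommRing E] {σ : E ≃+* E}

theorem ofFn_solPair_append {d r n : ℕ} (s : Fin r → (Fin d → constants σ) × E)
    (y : Fin n → (Fin d → constants σ) × E) :
    (List.ofFn fun k => solPair (s k)) ++ (List.ofFn fun l => solPair (y l)) =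
      List.ofFn fun j => solPair (Fin.append s y j) := by
  have h1 : ∀ {k : ℕ} (z : Fin k → (Fin d → constants σ) × E),
      (List.ofFn fun j => solPair (z j)) = (List.ofFn z).map solPair := fun z => by
    rw [List.map_ofFn]
    rfl
  rw [h1, h1, h1, List.ofFn_fin_append, List.map_append]

theorem exists_ofFn_solPair {d : ℕ} {l : List (List E × E)}
    (h : AllMem l fun q => q.1.length = d ∧ AllMem q.1 fun c => σ c = c) :
    ∃ (n : ℕ) (y : Fin n → (Fin d → constants σ) × E), l = List.ofFn fun j => solPair (y j) := by
  have h1 : ∀ q ∈ l, ∃ x : (Fin d → constants σ) × E, solPair x = q := by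
    rintro ⟨c, g⟩ hq
    obtain ⟨rfl, hc⟩ := h _ hq
    exact ⟨(fun j => ⟨c.get j, hc _ (List.get_mem c j)⟩, g), by simp [solPair]⟩
  choose! y hy using h1
  refine ⟨l.length, fun j => y (l.get j), ?_⟩
  simp only [hy _ (List.get_mem l _)]
  exact (List.ofFn_get l).symm

/-- The certificates are sound. A solution is the sum of a combination of `s` and a combination of
the `y`; the latter has defect zero and therefore vanishes, as the defects of the `y` are
independent. -/
theorem exists_basis_of_isSolutionBasis [IsDomain E] {P : List E → List E → List E → Prop}
    (hP : ∀ a f G, P a f G → Covers σ Set.univ a f G) {m d r : ℕ} {a : Fin (m + 1) → E}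
    {f : Fin d → E} {s : Fin r → (Fin d → constants σ) × E}
    (h : IsSolutionBasis σ P (List.ofFn a) (List.ofFn f) (List.ofFn fun k => solPair (s k))) :
    ∃ b : Module.Basis (Fin r) (constants σ) (pldeSolutions σ a f), ∀ k, (b k).1 = s k := by
  obtain ⟨G, Y, hG, hSY, hS, ⟨hsep, hsep'⟩, hcov, hcov'⟩ := h
  rw [List.length_ofFn] at hSY hcov hcov'
  obtain ⟨n, y, rfl⟩ := exists_ofFn_solPair fun q hq => hSY q (List.mem_append_right _ hq)
  have happ := ofFn_solPair_append s y
  rw [happ] at hcov hcov'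
  have hs : LinearIndependent (constants σ) s := LinearIndependent.of_comp (solLin σ d)
    (linearIndependent_of_separated (separated_ofFn_iff.1 hsep))
  have hy : LinearIndependent (constants σ) fun l => defectLin σ (List.ofFn a) f (y l) := by
    refine LinearIndependent.of_comp (constVec σ)
      (linearIndependent_of_separated fun i => ?_)
    have h1 := separated_ofFn_iff.1 hsep' i
    simp only [defect_solPair] at h1
    exact h1
  have hs0 : ∀ k, defectLin σ (List.ofFn a) f (s k) = 0 := fun k => by
    rw [← defect_solPair]
    exact hS _ ((List.mem_ofFn' _ _).2 ⟨k, rfl⟩)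
  have hrange : Set.range (Fin.append s y) ⊆
      ((Submodule.span (constants σ) (Set.range s) ⊔
        Submodule.span (constants σ) (Set.range y) : Submodule _ _) : Set _) := by
    rintro _ ⟨j, rfl⟩
    induction j using Fin.addCases with
    | left k =>
      rw [Fin.append_left]
      exact Submodule.mem_sup_left (Submodule.subset_span ⟨k, rfl⟩)
    | right l =>
      rw [Fin.append_right]
      exact Submodule.mem_sup_right (Submodule.subset_span ⟨l, rfl⟩)
  have hV : Submodule.span (constants σ) (Set.range s) = pldeSolutions σ a f := by
    refine le_antisymm (Submodule.span_le.2 ?_) fun x hx => ?_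
    · rintro _ ⟨k, rfl⟩
      exact mem_pldeSolutions_iff.2 (hs0 k)
    have hx0 := mem_pldeSolutions_iff.1 hx
    have hxG : x.2 ∈ listSpan σ G := by
      refine hP _ _ _ hG x.2 trivial ?_
      rw [defectLin_apply, sub_eq_zero] at hx0
      exact mem_listSpan_ofFn.2 ⟨x.1, hx0.symm⟩
    obtain ⟨x1, hx1, x2, hx2, rfl⟩ := Submodule.mem_sup.1 (Submodule.span_le.2 hrange
      (mem_of_cover (fun g hg => (vecMem_ofFn_iff (solVec_nil g d)).1 (hcov g hg))
        (fun j => (vecMem_ofFn_iff (solVec_single j)).1 (hcov' j j.2)) hxG))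
    have hx1' : defectLin σ (List.ofFn a) f x1 = 0 :=
      (Submodule.span_le (p := LinearMap.ker (defectLin σ (List.ofFn a) f))).2
        (by rintro _ ⟨k, rfl⟩; exact hs0 k) hx1
    rw [map_add, hx1', zero_add] at hx0
    obtain ⟨q, rfl⟩ := (Submodule.mem_span_range_iff_exists_fun _).1 hx2
    rw [map_sum] at hx0
    simp only [map_smul] at hx0
    have hq := Fintype.linearIndependent_iff.1 hy q hx0
    simpa [hq] using hx1
  refine ⟨(Module.Basis.span hs).map (LinearEquiv.ofEq _ _ hV), fun k => ?_⟩
  rw [Module.Basis.map_apply, LinearEquiv.coe_ofEq_apply, Module.Basis.span_apply]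

/-- A basis `s` of the kernel of `D`, and preimages `y` of a basis of the image of `U ⊇ ker D`. -/
theorem exists_kernel_and_preimages {K M W : Type*} [Field K] [AddCommGroup M] [Module K M]
    [AddCommGroup W] [Module K W] (D : M →ₗ[K] W) {U : Submodule K M} (hU : U.FG)
    (hD : LinearMap.ker D ≤ U) :
    ∃ (r n : ℕ) (s : Fin r → M) (y : Fin n → M), LinearIndependent K s ∧ (∀ k, D (s k) = 0) ∧
      (LinearIndependent K fun l => D (y l)) ∧
      U ≤ Submodule.span K (Set.range s) ⊔ Submodule.span K (Set.range y) := by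
  have : Module.Finite K U := Module.Finite.iff_fg.2 hU
  have : Module.Finite K (LinearMap.ker D) :=
    Module.Finite.of_injective _ (Submodule.inclusion_injective hD)
  have : Module.Finite K (U.map D) := Module.Finite.iff_fg.2 (hU.map D)
  let b := Module.finBasis K (LinearMap.ker D)
  let b' := Module.finBasis K (U.map D)
  choose y hyU hy using fun l => (b' l).2
  have hb' : LinearIndependent K fun l => ((b' l : U.map D) : W) :=
    b'.linearIndependent.map' (U.map D).subtype (Submodule.ker_subtype _)
  refine ⟨_, _, fun k => b k, y, b.linearIndependent.map' _ (Submodule.ker_subtype _),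
    fun k => (b k).2, by simpa only [hy] using hb', fun x hx => ?_⟩
  have h1 := congrArg Subtype.val (b'.sum_repr ⟨D x, Submodule.mem_map_of_mem hx⟩)
  set q := b'.repr ⟨D x, Submodule.mem_map_of_mem hx⟩
  have h2 : x - ∑ l, q l • y l ∈ LinearMap.ker D := by
    rw [LinearMap.mem_ker, map_sub, map_sum, sub_eq_zero]
    refine h1.symm.trans ?_
    rw [Submodule.coe_sum]
    exact Finset.sum_congr rfl fun l _ => by rw [map_smul, hy, Submodule.coe_smul]
  have h3 := congrArg Subtype.val (b.sum_repr ⟨_, h2⟩)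
  rw [Submodule.coe_sum] at h3
  rw [← sub_add_cancel x (∑ l, q l • y l)]
  refine add_mem (Submodule.mem_sup_left ?_) (Submodule.mem_sup_right ?_)
  · refine (congrArg (· ∈ _) h3).mp (sum_mem fun k _ => ?_)
    rw [Submodule.coe_smul]
    exact Submodule.smul_mem _ _ (Submodule.subset_span ⟨k, rfl⟩)
  · exact sum_mem fun l _ => Submodule.smul_mem _ _ (Submodule.subset_span ⟨l, rfl⟩)

/-- Every cover yields a certified basis. -/
theorem exists_isSolutionBasis [IsDomain E] (hσ : ConstQuotients σ)
    (hinv : ∀ c ∈ constants σ, c ≠ 0 → ∃ c' ∈ constants σ, c' * c = 1)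
    {P : List E → List E → List E → Prop}
    (hP : ∀ a f G, P a f G → Covers σ Set.univ a f G) {m d : ℕ} {a : Fin (m + 1) → E}
    {f : Fin d → E} {G : List E} (hG : P (List.ofFn a) (List.ofFn f) G) :
    ∃ S, IsSolutionBasis σ P (List.ofFn a) (List.ofFn f) S := by
  let _ : Field (constants σ) := (isField_constants hinv).toField
  have hU : ((⊤ : Submodule (constants σ) (Fin d → constants σ)).prod (listSpan σ G)).FG :=
    Submodule.FG.prod Module.Finite.fg_top (Submodule.fg_span (List.finite_toSet G))
  obtain ⟨r, n, s, y, hs, hs0, hy, hle⟩ := exists_kernel_and_preimages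
    (defectLin σ (List.ofFn a) f) hU fun x hx => ⟨trivial, hP _ _ _ hG x.2 trivial (by
      rw [LinearMap.mem_ker, defectLin_apply, sub_eq_zero] at hx
      exact mem_listSpan_ofFn.2 ⟨x.1, hx.symm⟩)⟩
  have hle' : ∀ {x}, x ∈ (⊤ : Submodule (constants σ) (Fin d → constants σ)).prod (listSpan σ G) →
      x ∈ Submodule.span (constants σ) (Set.range (Fin.append s y)) := fun {x} hx => by
    suffices h1 : Submodule.span (constants σ) (Set.range s) ⊔
        Submodule.span (constants σ) (Set.range y) ≤
          Submodule.span (constants σ) (Set.range (Fin.append s y)) from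
      h1 (hle hx)
    refine sup_le (Submodule.span_mono ?_) (Submodule.span_mono ?_)
    · rintro _ ⟨k, rfl⟩
      exact ⟨_, Fin.append_left s y k⟩
    · rintro _ ⟨l, rfl⟩
      exact ⟨_, Fin.append_right s y l⟩
  have happ := ofFn_solPair_append s y
  refine ⟨List.ofFn fun k => solPair (s k), G, List.ofFn fun l => solPair (y l), hG, ?_, ?_,
    ⟨separated_ofFn_iff.2 ?_, separated_ofFn_iff.2 ?_⟩, ?_, ?_⟩
  · rw [happ]
    intro q hq
    obtain ⟨j, rfl⟩ := (List.mem_ofFn' _ _).1 hq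
    refine ⟨by simp [solPair], fun c hc => ?_⟩
    obtain ⟨i, rfl⟩ := (List.mem_ofFn' _ _).1 hc
    exact ((Fin.append s y j).1 i).2
  · intro q hq
    obtain ⟨k, rfl⟩ := (List.mem_ofFn' _ _).1 hq
    rw [defect_solPair]
    exact hs0 k
  · exact exists_separated hσ (hs.map' (solLin σ d) (ker_solLin d))
  · simp only [defect_solPair]
    exact exists_separated hσ (v := fun l => constVec σ (defectLin σ (List.ofFn a) f (y l)))
      (hy.map' (constVec σ) (LinearMap.ker_eq_bot.2 fun _ _ h => congrFun h 0))
  · rw [happ, List.length_ofFn]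
    exact fun g hg => (vecMem_ofFn_iff (solVec_nil g d)).2
      (hle' ⟨trivial, mem_listSpan_of_mem hg⟩)
  · rw [happ, List.length_ofFn]
    exact fun j hj => (vecMem_ofFn_iff (solVec_single ⟨j, hj⟩)).2 (hle' ⟨trivial, zero_mem _⟩)

/-- The computable choice function for certified bases solves PLDEs. In order to make the relation
total, every output is accepted for an operator with vanishing coefficients. -/
theorem canSolvePLDEs_of_canCover [IsDomain E] (hσ : ConstQuotients σ)
    (hinv : ∀ c ∈ constants σ, c ≠ 0 → ∃ c' ∈ constants σ, c' * c = 1) {ν : ℕ → E}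
    (hν : IsComputableDifferenceRing ν σ)
    (h : @CanCover E _ (Coded.ofSurjective ν hν.surjective) σ ⊤) : CanSolvePLDEs ν σ := by
  let _ : Coded E := Coded.ofSurjective ν hν.surjective
  have : CodedRing E := hν.codedRing
  obtain ⟨P, hP, hsound, htot⟩ := h
  have hsound' : ∀ a f G, P a f G → Covers σ Set.univ a f G := fun a f G hG =>
    (hsound a f G hG).2
  have hsemi : Semi fun p : (List E × List E) × List (List E × E) =>
      (AllMem p.1.1 fun x => x = 0) ∨ IsSolutionBasis σ P p.1.1 p.1.2 p.2 :=
    Semi.or (by fun_prop) (semi_isSolutionBasis hν.eff_aut hP)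
  obtain ⟨alg, halg, hspec⟩ := Semi.exists_choice
    (P := fun (p : List E × List E) q => (AllMem p.1 fun x => x = 0) ∨
      IsSolutionBasis σ P p.1 p.2 q) hsemi (by
    rintro ⟨a, f⟩
    by_cases ha : AllMem a fun x => x = 0
    · exact ⟨[], Or.inl ha⟩
    · simp only [AllMem, not_forall] at ha
      obtain ⟨x, hx, hx0⟩ := ha
      obtain ⟨G, hG⟩ := htot a f (fun _ _ => trivial) ⟨x, hx, hx0⟩ fun _ _ => trivial
      obtain ⟨k, a, rfl⟩ : ∃ (k : ℕ) (b : Fin k → E), a = List.ofFn b :=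
        ⟨_, a.get, (List.ofFn_get a).symm⟩
      obtain ⟨d, f, rfl⟩ : ∃ (k : ℕ) (b : Fin k → E), f = List.ofFn b :=
        ⟨_, f.get, (List.ofFn_get f).symm⟩
      cases k with
      | zero => simp at hx
      | succ m =>
        obtain ⟨S, hS⟩ := exists_isSolutionBasis hσ hinv hsound' hG
        exact ⟨S, Or.inr hS⟩)
  refine ⟨alg, halg, fun m d a f ⟨i, hi⟩ => ?_⟩
  have h1 := hspec (List.ofFn a, List.ofFn f)
  have h2 : Coded.val (List.ofFn a, List.ofFn f) =
      ((List.ofFn fun i => ν (a i), List.ofFn fun j => ν (f j)) : List E × List E) := by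
    change ((List.ofFn a).map ν, (List.ofFn f).map ν) = _
    simp [List.map_ofFn, Function.comp_def]
  rw [h2] at h1
  have h3 := h1.resolve_left fun h => hi (h _ ((List.mem_ofFn' _ _).2 ⟨i, rfl⟩))
  obtain ⟨out, hout⟩ : ∃ out : List (List ℕ × ℕ), alg (List.ofFn a, List.ofFn f) = out := ⟨_, rfl⟩
  rw [hout] at h3 ⊢
  change IsSolutionBasis σ P _ _ (out.map fun q => (q.1.map ν, ν q.2)) at h3
  -- the members of the output are codes of elements of `Kᵈ × E`
  have h5 : ∀ q ∈ out, q.1.length = d ∧ ∀ n ∈ q.1, ν n ∈ constants σ := by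
    intro q hq
    obtain ⟨G, Y, -, hSY, -⟩ := h3
    obtain ⟨hl, hc⟩ := hSY _ (List.mem_append_left _ (List.mem_map_of_mem hq))
    exact ⟨by simpa using hl, fun n hn => hc _ (List.mem_map_of_mem hn)⟩
  have h6 : ∀ k : Fin out.length, (out.get k).1.length = d := fun k => (h5 _ (List.get_mem _ k)).1
  let c : Fin out.length → Fin d → ℕ := fun k j => (out.get k).1.get (j.cast (h6 k).symm)
  let s : Fin out.length → (Fin d → constants σ) × E := fun k =>
    (fun j => ⟨ν (c k j), (h5 _ (List.get_mem _ k)).2 _ (List.get_mem _ _)⟩, ν (out.get k).2)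
  have h7 : out = List.ofFn fun k => (List.ofFn (c k), (out.get k).2) := by
    refine (List.ofFn_get out).symm.trans (congrArg _ (funext fun k => Prod.ext ?_ rfl))
    refine List.ext_get (by simpa using h6 k) fun i _ _ => ?_
    simp [c]
  have h8 : (out.map fun q => (q.1.map ν, ν q.2)) = List.ofFn fun k => solPair (s k) := by
    conv_lhs => rw [h7]
    rw [List.map_ofFn]
    refine congrArg _ (funext fun k => Prod.ext ?_ rfl)
    simp [solPair, s, List.map_ofFn, Function.comp_def]
  rw [h8] at h3
  obtain ⟨b, hb⟩ := exists_basis_of_isSolutionBasis hsound' h3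
  exact ⟨_, c, fun k => (out.get k).2, h7, b, fun k => by rw [hb]; exact ⟨fun _ => rfl, rfl⟩⟩

end solve

/-! ### Codings of `ΠΣ`-extensions -/

section laurent

open Polynomial

variable {R : Type*} [CommRing R]

/-- The Laurent polynomial `p · T⁻ⁿ`. -/
def divT (p : R[X] × ℕ) : R[T;T⁻¹] := toLaurent p.1 * LaurentPolynomial.T (-p.2)

theorem divT_mul_T (p : R[X] × ℕ) (n : ℕ) :
    divT p * LaurentPolynomial.T (p.2 + n : ℕ) = toLaurent (p.1 * X ^ n) := by
  rw [divT, mul_assoc, ← LaurentPolynomial.T_add, map_mul, toLaurent_X_pow]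
  congr 2
  push_cast
  ring

/-- Equality with `p · T⁻ᵏ` after multiplication by `Tᵏ⁺ⁿ`. -/
theorem divT_eq_iff {p : R[X] × ℕ} {f : R[T;T⁻¹]} (n : ℕ) :
    divT p = f ↔ f * LaurentPolynomial.T (p.2 + n : ℕ) = toLaurent (p.1 * X ^ n) := by
  rw [← divT_mul_T]
  exact ⟨fun h => by rw [h], fun h =>
    ((LaurentPolynomial.isUnit_T (R := R) (p.2 + n : ℕ)).mul_left_injective h).symm⟩

theorem divT_surjective : Function.Surjective (divT (R := R)) := fun f => by
  obtain ⟨n, p, hp⟩ := LaurentPolynomial.exists_T_pow f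
  exact ⟨(p, n), (divT_eq_iff 0).2 (by simpa using hp.symm)⟩

theorem divT_eq_divT_iff {p q : R[X] × ℕ} :
    divT p = divT q ↔ p.1 * X ^ q.2 = q.1 * X ^ p.2 := by
  rw [divT_eq_iff q.2, add_comm p.2, divT_mul_T, toLaurent_inj, eq_comm]

theorem laurent_ringHom_ext {S : Type*} [CommRing S] {f g : R[T;T⁻¹] →+* S}
    (hC : ∀ a, f (LaurentPolynomial.C a) = g (LaurentPolynomial.C a))
    (hT : f (LaurentPolynomial.T 1) = g (LaurentPolynomial.T 1)) : f = g := by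
  have h1 : f.comp toLaurent = g.comp toLaurent :=
    Polynomial.ringHom_ext (fun a => by simpa using hC a) (by simpa using hT)
  refine RingHom.ext fun p => ?_
  obtain ⟨n, q, hq⟩ := LaurentPolynomial.exists_T_pow p
  have h2 : ∀ k : ℕ, f (LaurentPolynomial.T k) = g (LaurentPolynomial.T k) := fun k => by
    simpa using RingHom.congr_fun h1 (X ^ k)
  have h3 := RingHom.congr_fun h1 q
  rw [RingHom.comp_apply, RingHom.comp_apply, hq, map_mul, map_mul, h2] at h3
  exact ((LaurentPolynomial.isUnit_T (R := R) n).map g).mul_left_injective h3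

variable [Coded R]

/-- Laurent polynomials are coded by a polynomial and the exponent of the denominator; fractions
need not be reduced. -/
instance : Coded R[T;T⁻¹] where
  Code := Coded.Code (R[X] × ℕ)
  val c := divT (Coded.val c)
  surj := divT_surjective.comp Coded.surj

theorem Eff.divT {T : Type*} [Coded T] {f : T → R[X] × ℕ} (hf : Eff f) :
    Eff fun x => divT (f x) := by
  obtain ⟨g, hg, h⟩ := hf
  exact ⟨g, hg, fun c => congrArg _root_.divT (h c)⟩

theorem Eff.laurent_divT {Z : Type*} [Coded Z] {f : R[T;T⁻¹] → Z}
    (h : Eff fun p : R[X] × ℕ => f (_root_.divT p)) : Eff f := h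

theorem Eff.laurent_divT₂ {Z : Type*} [Coded Z] {f : R[T;T⁻¹] × R[T;T⁻¹] → Z}
    (h : Eff fun p : (R[X] × ℕ) × (R[X] × ℕ) => f (_root_.divT p.1, _root_.divT p.2)) : Eff f := h

variable [CodedRing R]

instance : CodedRing R[T;T⁻¹] where
  eq := by
    have h : Semi fun p : (R[X] × ℕ) × (R[X] × ℕ) => p.1.1 * X ^ p.2.2 = p.2.1 * X ^ p.1.2 := by
      fun_prop
    exact h.of_iff (Q := fun p : (R[X] × ℕ) × (R[X] × ℕ) => divT p.1 = divT p.2) fun p =>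
      divT_eq_divT_iff
  ne := by
    have h : Semi fun p : (R[X] × ℕ) × (R[X] × ℕ) => p.1.1 * X ^ p.2.2 ≠ p.2.1 * X ^ p.1.2 := by
      fun_prop
    exact h.of_iff (Q := fun p : (R[X] × ℕ) × (R[X] × ℕ) => divT p.1 ≠ divT p.2) fun p =>
      divT_eq_divT_iff.not
  add := by
    have h : Eff fun p : (R[X] × ℕ) × (R[X] × ℕ) =>
        divT (p.1.1 * X ^ p.2.2 + p.2.1 * X ^ p.1.2, p.1.2 + p.2.2) := Eff.divT (by fun_prop)
    refine Eff.laurent_divT₂ ?_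
    convert h using 2 with p
    rw [eq_comm, divT_eq_iff 0, add_mul, add_zero, divT_mul_T, add_comm p.1.2, divT_mul_T]
    simp
  neg := by
    have h : Eff fun p : R[X] × ℕ => divT (-p.1, p.2) := Eff.divT (by fun_prop)
    refine Eff.laurent_divT ?_
    convert h using 2 with p
    simp [divT]
  mul := by
    have h : Eff fun p : (R[X] × ℕ) × (R[X] × ℕ) => divT (p.1.1 * p.2.1, p.1.2 + p.2.2) :=
      Eff.divT (by fun_prop)
    refine Eff.laurent_divT₂ ?_
    convert h using 2 with p
    simp only [divT, map_mul, Nat.cast_add, neg_add, LaurentPolynomial.T_add]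
    ring

omit [CodedRing R] in
theorem Eff.laurentC : Eff fun r : R => (LaurentPolynomial.C r : R[T;T⁻¹]) := by
  have h : Eff fun r : R => _root_.divT (Polynomial.C r, 0) := Eff.divT (by fun_prop)
  convert h using 2 with r
  simp [_root_.divT]

omit [CodedRing R] in
theorem Eff.laurent_eval₂ {S : Type*} [CommRing S] [Coded S] [CodedRing S] {φ : R →+* S}
    (hφ : Eff fun r => φ r) (u : Sˣ) : Eff fun f : R[T;T⁻¹] => LaurentPolynomial.eval₂ φ u f := by
  have h : Eff fun p : R[X] × ℕ => p.1.eval₂ φ (u : S) * ((u⁻¹ : Sˣ) : S) ^ p.2 := by fun_prop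
  refine Eff.laurent_divT ?_
  convert h using 2 with p
  rw [_root_.divT, map_mul, LaurentPolynomial.eval₂_toLaurent, LaurentPolynomial.eval₂_T_neg_n]

end laurent

section transport

variable {R S : Type*} [CommRing R] [CommRing S]

/-- The coding of the values of a bijection that is induced by a coding of the arguments. -/
@[reducible] def Coded.ofEquiv [Coded R] (f : R ≃+* S) : Coded S where
  Code := Coded.Code R
  val c := f (Coded.val c)
  surj := f.surjective.comp Coded.surj

theorem CodedRing.ofEquiv [Coded R] [CodedRing R] (f : R ≃+* S) :
    @CodedRing S _ (Coded.ofEquiv f) := by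
  let _ := Coded.ofEquiv f
  have hf : Eff fun x : R => f x := ⟨fun c => c, Computable.id, fun _ => rfl⟩
  have h1 : Semi fun p : R × R => p.1 = p.2 := by fun_prop
  have h2 : Semi fun p : R × R => p.1 ≠ p.2 := by fun_prop
  have h3 : Eff fun p : R × R => f (p.1 + p.2) := hf.comp (by fun_prop)
  have h4 : Eff fun p : R => f (-p) := hf.comp (by fun_prop)
  have h5 : Eff fun p : R × R => f (p.1 * p.2) := hf.comp (by fun_prop)
  refine { eq := ?_, ne := ?_, add := ?_, neg := ?_, mul := ?_ }
  · exact h1.of_iff (Q := fun p : R × R => f p.1 = f p.2) fun p => f.injective.eq_iff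
  · exact h2.of_iff (Q := fun p : R × R => f p.1 ≠ f p.2) fun p => f.injective.ne_iff
  · obtain ⟨g, hg, h⟩ := h3
    exact ⟨g, hg, fun c => (h c).trans (map_add f _ _)⟩
  · obtain ⟨g, hg, h⟩ := h4
    exact ⟨g, hg, fun c => (h c).trans (map_neg f _)⟩
  · obtain ⟨g, hg, h⟩ := h5
    exact ⟨g, hg, fun c => (h c).trans (map_mul f _ _)⟩

/-- The elements of a coded ring can be coded by natural numbers. -/
theorem exists_natCoding [Coded R] [CodedRing R] {σ : R ≃+* R} (hσ : Eff fun x => σ x)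
    {k : ℕ → R} (hk : Eff k) :
    ∃ ν : ℕ → R, IsComputableDifferenceRing ν σ ∧
      ∃ h : ℕ → ℕ, Computable h ∧ ∀ n, ν (h n) = k n := by
  obtain ⟨c0, -⟩ := Coded.surj (0 : R)
  let code : ℕ → Coded.Code R := fun n => (Encodable.decode n).getD c0
  have hcode : Computable code := Computable.option_getD Computable.decode (Computable.const c0)
  have hval : ∀ c, code (Encodable.encode c) = c := fun c => by simp [code]
  have henc : Computable (Encodable.encode : Coded.Code R → ℕ) := Computable.encode
  have hcode2 : Computable fun p : ℕ × ℕ => (code p.1, code p.2) :=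
    (hcode.comp Computable.fst).pair (hcode.comp Computable.snd)
  have heq : Semi fun p : R × R => p.1 = p.2 := by fun_prop
  have hne : Semi fun p : R × R => p.1 ≠ p.2 := by fun_prop
  obtain ⟨add, hadd, hadd'⟩ := CodedRing.add (R := R)
  obtain ⟨neg, hneg, hneg'⟩ := CodedRing.neg (R := R)
  obtain ⟨mul, hmul, hmul'⟩ := CodedRing.mul (R := R)
  obtain ⟨s, hs, hs'⟩ := hσ
  obtain ⟨m, hm, hm'⟩ := hk
  refine ⟨fun n => Coded.val (code n), ⟨fun x => ?_, ?_, ?_, ?_, ?_, ?_⟩,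
    fun n => Encodable.encode (m n), henc.comp hm, fun n => by
      simp only [hval]
      exact hm' n⟩
  · obtain ⟨c, rfl⟩ := Coded.surj x
    exact ⟨Encodable.encode c, by simp only [hval]⟩
  · exact ComputablePred.computable_iff_re_compl_re'.2
      ⟨Partrec.comp heq hcode2, Partrec.comp hne hcode2⟩
  · exact ⟨fun x y => Encodable.encode (add (code x, code y)),
      henc.comp (hadd.comp hcode2), fun x y => by simp only [hval]; exact hadd' _⟩
  · exact ⟨fun x => Encodable.encode (neg (code x)),
      henc.comp (hneg.comp hcode), fun x => by simp only [hval]; exact hneg' _⟩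
  · exact ⟨fun x y => Encodable.encode (mul (code x, code y)),
      henc.comp (hmul.comp hcode2), fun x y => by simp only [hval]; exact hmul' _⟩
  · exact ⟨fun x => Encodable.encode (s (code x)),
      henc.comp (hs.comp hcode), fun x => by simp only [hval]; exact hs' _⟩

end transport

namespace PiSigmaExtension

variable {F E : Type*} [Field F] [CommRing E] [Algebra F E] {σF : F ≃+* F} {σE : E ≃+* E} {e : ℕ}
  (T : PiSigmaExtension σF σE e)

/-- The difference ring `(B, σE)` has a coding for which the embedding of `F` is computable. -/
def HasCoding (ν : ℕ → F) (σE : E ≃+* E) (B : Subring E) : Prop :=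
  ∃ (_ : Coded B) (h : ∀ x ∈ B, (σE : E →+* E) x ∈ B) (hk : ∀ n, codeMap E ν n ∈ B),
    CodedRing B ∧ (Eff fun x : B => (σE : E →+* E).restrict B B h x) ∧
      Eff fun n => (⟨codeMap E ν n, hk n⟩ : B)

/-- Codings are transported along an injective ring homomorphism onto `B`. -/
theorem hasCoding_of_range_eq {νF : ℕ → F} {S : Type*} [CommRing S] [Coded S] [CodedRing S]
    {B : Subring E} {φ : S →+* E} (hφ : Function.Injective φ) (hB : φ.range = B) {s : S → S}
    (hs : Eff s) (hs' : ∀ x, φ (s x) = σE (φ x)) {k : ℕ → S} (hk : Eff k)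
    (hk' : ∀ n, φ (k n) = codeMap E νF n) : HasCoding νF σE B := by
  subst hB
  let f : S ≃+* φ.range := RingEquiv.ofBijective φ.rangeRestrict
    ⟨fun x y h => hφ (congrArg Subtype.val h), φ.rangeRestrict_surjective⟩
  refine ⟨Coded.ofEquiv f, ?_, fun n => ⟨k n, hk' n⟩, CodedRing.ofEquiv f, ?_, ?_⟩
  · rintro _ ⟨x, rfl⟩
    exact ⟨s x, hs' x⟩
  · obtain ⟨g, hg, h⟩ := hs
    exact ⟨g, hg, fun c => Subtype.ext ((congrArg φ (h c)).trans (hs' _))⟩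
  · obtain ⟨g, hg, h⟩ := hk
    exact ⟨g, hg, fun c => Subtype.ext ((congrArg φ (h c)).trans (hk' _))⟩

theorem HasCoding.sigma {νF : ℕ → F} {A B : Subring E} {t : E} (hA : HasCoding νF σE A)
    (h : IsSigmaMonomial σE A B t) : HasCoding νF σE B := by
  obtain ⟨_, hAσ, hAk, _, hσ, hk⟩ := hA
  obtain ⟨⟨φ, hφ, hC, hX, hB⟩, hu⟩ := h
  have hCσ : Eff fun x : A => (Polynomial.C.comp ((σE : E →+* E).restrict A A hAσ)) x :=
    Eff.C hσ
  refine hasCoding_of_range_eq (s := fun p => p.eval₂ (Polynomial.C.comp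
    ((σE : E →+* E).restrict A A hAσ)) (Polynomial.X + Polynomial.C ⟨_, hu⟩)) hφ hB
    (Eff.eval₂ hCσ (Eff.const _) Eff.id) (fun p => ?_)
    (k := fun n => Polynomial.C ⟨codeMap E νF n, hAk n⟩) (Eff.C hk) fun n => hC _
  refine RingHom.congr_fun (f := φ.comp (Polynomial.eval₂RingHom (Polynomial.C.comp
    ((σE : E →+* E).restrict A A hAσ)) (Polynomial.X + Polynomial.C ⟨_, hu⟩)))
    (g := (σE : E →+* E).comp φ) (Polynomial.ringHom_ext (fun a => ?_) ?_) p
  · simp [hC]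
  · simp [hC, hX]

theorem HasCoding.pi {νF : ℕ → F} {A B : Subring E} {t : E} (hA : HasCoding νF σE A)
    (h : IsPiMonomial σE A B t) : HasCoding νF σE B := by
  obtain ⟨_, hAσ, hAk, _, hσ, hk⟩ := hA
  obtain ⟨⟨φ, hφ, hC, hT, hB⟩, α, hα⟩ := h
  let u : (A[T;T⁻¹])ˣ := Units.map (LaurentPolynomial.C : A →+* A[T;T⁻¹]).toMonoidHom α *
    (LaurentPolynomial.isUnit_T (R := A) 1).unit
  have hu : φ u = σE t := by
    simp [u, hC, hT, hα]
  have hCσ : Eff fun x : A =>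
      (LaurentPolynomial.C.comp ((σE : E →+* E).restrict A A hAσ)) x :=
    Eff.laurentC.comp hσ
  refine hasCoding_of_range_eq (s := fun p => LaurentPolynomial.eval₂ (LaurentPolynomial.C.comp
    ((σE : E →+* E).restrict A A hAσ)) u p) hφ hB
    (Eff.laurent_eval₂ hCσ u) (fun p => ?_)
    (k := fun n => LaurentPolynomial.C ⟨codeMap E νF n, hAk n⟩) (Eff.laurentC.comp hk) fun n => hC _
  refine RingHom.congr_fun (f := φ.comp (LaurentPolynomial.eval₂ (LaurentPolynomial.C.comp
    ((σE : E →+* E).restrict A A hAσ)) u)) (g := (σE : E →+* E).comp φ)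
    (laurent_ringHom_ext (fun a => ?_) ?_) p
  · simp [hC]
  · simp [hu, hT]

include T in
theorem hasCoding_ring {νF : ℕ → F} (hF : IsComputableDifferenceRing νF σF) (i : Fin (e + 1)) :
    HasCoding νF σE (T.ring i) := by
  induction i using Fin.induction with
  | zero =>
    let _ : Coded F := Coded.ofSurjective νF hF.surjective
    have : CodedRing F := hF.codedRing
    exact hasCoding_of_range_eq (φ := algebraMap F E) T.injective T.base.symm hF.eff_aut
      (fun x => (T.commutes x).symm) (k := νF) ⟨fun n => n, Computable.id, fun _ => rfl⟩
      fun n => rfl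
  | succ i ih =>
    cases h : T.kind i with
    | pi => exact ih.pi (T.pi_step i h)
    | sigma => exact ih.sigma (T.sigma_step i h)

include T in
theorem exists_isComputableExtension {νF : ℕ → F} (hF : IsComputableDifferenceRing νF σF) :
    ∃ νE : ℕ → E, IsComputableExtension νF νE σE := by
  obtain ⟨_, h, hk, _, hσ, hk'⟩ := T.top ▸ T.hasCoding_ring hF (Fin.last e)
  let _ : Coded E := Coded.ofEquiv (Subring.topEquiv (R := E))
  have : CodedRing E := CodedRing.ofEquiv (Subring.topEquiv (R := E))
  have hσ' : Eff fun x : E => σE x := by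
    obtain ⟨g, hg, hg'⟩ := hσ
    exact ⟨g, hg, fun c => congrArg Subtype.val (hg' c)⟩
  have hk'' : Eff fun n => codeMap E νF n := by
    obtain ⟨g, hg, hg'⟩ := hk'
    exact ⟨g, hg, fun c => congrArg Subtype.val (hg' c)⟩
  obtain ⟨ν, hν, hemb⟩ := exists_natCoding hσ' hk''
  exact ⟨ν, hν, hemb⟩

end PiSigmaExtension

end

theorem mainTheorem5 {F E : Type*} [Field F] [CommRing E] [Algebra F E]
    (σF : F ≃+* F) (σE : E ≃+* E) (e : ℕ) (T : PiSigmaExtension σF σE e)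
    (hPi : ∀ i, T.kind i = MonomialKind.pi →
      ∃ α : F, α ≠ 0 ∧ σE (T.t i) = algebraMap F E α * T.t i)
    (νF : ℕ → F) (hF : IsComputableDifferenceRing νF σF)
    (hPLDE : CanSolvePLDEs νF σF)
    (hOrbit : CanSolvePseudoOrbit νF σF)
    (hHyp : CanComputeHypergeometricCandidates νF σF)
    (hSigma : (∃ i, T.kind i = MonomialKind.sigma) →
      CharZero F ∧ CanComputeIntegerRoots νF σF) :
    (∃ νE : ℕ → E, IsComputableExtension νF νE σE) ∧
      ∀ νE : ℕ → E, IsComputableExtension νF νE σE → CanSolvePLDEs νE σE := by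
  refine ⟨T.exists_isComputableExtension hF, fun νE hE => ?_⟩
  have hdom := T.isDomain
  let _ : Coded E := Coded.ofSurjective νE hE.computable.surjective
  have : CodedRing E := hE.computable.codedRing
  have hemb : Eff fun n : ℕ => PiSigmaExtension.codeMap E νF n := hE.embedding
  exact canSolvePLDEs_of_canCover T.constQuotients
    (fun c hc h0 => by
      obtain ⟨c', hc', -, h⟩ := T.exists_const_inv hc h0
      exact ⟨c', hc', h⟩)
    hE.computable
    (T.canCover_top hPi hE.computable.eff_aut hF.surjective hemb hPLDE hOrbit hHyp hSigma)
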